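/- A \emph{generalized polygon} $P$ is the piecewise Euclidean complex obtained from a pure, finite, connected simplicial 2-complex in which the link of every vertex is a path, by assigning lengths to the edges such that the strict triangle inequality holds in every triangle. A \emph{boundary edge} is an edge that lies in exactly one triangle; distinct boundary edges carry distinct labels, and $\mathcal A$ denotes the finite set of labels with the discrete topology. The billiard flow on $P$ moves points at unit speed along straight lines, with optical reflection in the boundary edges. A forward trajectory is nonsingular if it never meets a vertex, and its forward bounce sequence is the sequence of boundary edges that it meets after its base point, in order. Let ${\sf B}_+(P)\subset\mathcal A^{\mathbb N}$ be the set of all (infinite) forward bounce sequences of nonsingular forward trajectories, and $\overline{{\sf B}_+(P)}$ its closure in the product topology. A sequence is \emph{realizable} if it belongs to ${\sf B}_+(P)$. An edge $A$ is a \emph{prefix} for a sequence $(F_1,F_2,\dots)$ if $(A,F_1,F_2,\dots)\in\overline{{\sf B}_+(P)}$. \textbf{Theorem.} Let $P$ be a generalized polygon that is either a planar polygon, possibly with holes (that is, its interior embeds isometrically into the plane), or simply connected. Let $(E_i)_{i\ge1}\in\overline{{\sf B}_+(P)}$, and consider the condition $$(\ast)\qquad\text{for every } n\ge1 \text{ the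 only prefix for } (E_i)_{i\ge n+1} \text{ is } E_n .$$ If $(\ast)$ holds, then $(E_i)$ is realizable. If $(E_i)$ is aperiodic (there is no $k\ge1$ with $E_{i+k}=E_i$ for all $i\ge 1$), then $(E_i)$ is realizable if and only if $(\ast)$ holds. -/

import Mathlib

namespace Billiard

/-- The link of the vertex `v` in the simplicial 2-complex with set of 2-simplices `faces`: its
vertices are the vertices joined to `v`, and `a`, `b` are joined when `{v, a, b}` is a face. -/
def linkGraph {V : Type*} [DecidableEq V] (faces : Finset (Finset V)) (v : V) :
    SimpleGraph {a : V // a ≠ v ∧ ∃ t ∈ faces, v ∈ t ∧ a ∈ t} where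
  Adj a b := a ≠ b ∧ ({v, a.1, b.1} : Finset V) ∈ faces
  symm := ⟨fun a b h => ⟨h.1.symm, by
    have h2 := h.2
    rwa [Finset.pair_comm a.1 b.1] at h2⟩⟩
  loopless := ⟨fun _ h => h.1 rfl⟩

/-- The 1-skeleton of the complex. -/
def oneSkeleton {V : Type*} (faces : Finset (Finset V)) : SimpleGraph V where
  Adj a b := a ≠ b ∧ ∃ t ∈ faces, a ∈ t ∧ b ∈ t
  symm := ⟨fun _ _ h => ⟨h.1.symm, h.2.imp fun _ ht => ⟨ht.1, ht.2.2, ht.2.1⟩⟩⟩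
  loopless := ⟨fun _ h => h.1 rfl⟩

/-- A generalized polygon: a pure, finite, connected simplicial 2-complex in which the link of
every vertex is a path, together with edge lengths that satisfy the strict triangle inequality in
every 2-simplex. Only the values `len a b` with `a`, `b` in a common face matter. -/
structure GeneralizedPolygon (V : Type*) [Fintype V] [DecidableEq V] where
  faces : Finset (Finset V)
  card_face : ∀ t ∈ faces, t.card = 3
  pure : ∀ v : V, ∃ t ∈ faces, v ∈ t
  connected : (oneSkeleton faces).Connected
  link_path : ∀ v : V, ∃ n : ℕ,
    Nonempty (linkGraph faces v ≃g SimpleGraph.pathGraph (n + 2))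
  len : V → V → ℝ
  len_self : ∀ a, len a a = 0
  len_symm : ∀ a b, len a b = len b a
  triangle : ∀ t ∈ faces, ∀ a ∈ t, ∀ b ∈ t, ∀ c ∈ t, a ≠ b → b ≠ c → a ≠ c →
    len a c < len a b + len b c

namespace GeneralizedPolygon

variable {V : Type*} [Fintype V] [DecidableEq V]

/-- `P` is a polygon in the usual sense, possibly with holes: its interior embeds isometrically
into the plane. Concretely, all triangles can be placed in the plane, compatibly along common
edges, with pairwise disjoint interiors. -/
def IsPlanar (P : GeneralizedPolygon V) : Prop :=
  ∃ f : V → EuclideanSpace ℝ (Fin 2),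
    (∀ t ∈ P.faces, ∀ a ∈ t, ∀ b ∈ t, dist (f a) (f b) = P.len a b) ∧
    ∀ t ∈ P.faces, ∀ t' ∈ P.faces, t ≠ t' →
      Disjoint (interior (convexHull ℝ (f '' (t : Set V))))
        (interior (convexHull ℝ (f '' (t' : Set V))))

/-- The dual graph: its vertices are the triangles, joined when they share an edge. -/
def dualGraph (P : GeneralizedPolygon V) : SimpleGraph {t : Finset V // t ∈ P.faces} where
  Adj t t' := t ≠ t' ∧ (t.1 ∩ t'.1).card = 2
  symm := ⟨fun t t' h => ⟨h.1.symm, by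
    have h2 := h.2
    rwa [Finset.inter_comm] at h2⟩⟩
  loopless := ⟨fun _ h => h.1 rfl⟩

/-- `P` is simply connected. As the link of every vertex is a path, every vertex lies on the
boundary of the surface and `P` deformation retracts onto its (connected) dual graph, so that `P`
is simply connected if and only if this graph is a tree. -/
def IsSimplyConnected (P : GeneralizedPolygon V) : Prop :=
  P.dualGraph.IsAcyclic

/-- The boundary edges: edges that lie in exactly one face. They are the letters of the alphabet. -/
def IsBoundaryEdge (P : GeneralizedPolygon V) (e : Finset V) : Prop :=
  e.card = 2 ∧ ∃! t, t ∈ P.faces ∧ e ⊆ t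

/-- The alphabet of (labels of) boundary edges. -/
def BoundaryEdge (P : GeneralizedPolygon V) : Type _ :=
  {e : Finset V // P.IsBoundaryEdge e}

/-- The alphabet carries the discrete topology. -/
instance (P : GeneralizedPolygon V) : TopologicalSpace P.BoundaryEdge := ⊥

instance (P : GeneralizedPolygon V) : DiscreteTopology P.BoundaryEdge := ⟨rfl⟩

/-- Points of `P` are given by barycentric coordinates `x : V → ℝ`. For `s` a face, an edge or a
vertex, this says that `x` lies in the open simplex with vertex set `s`. -/
def InOpenSimplex (s : Finset V) (x : V → ℝ) : Prop :=
  (∀ v ∈ s, 0 < x v) ∧ (∀ v, v ∉ s → x v = 0) ∧ ∑ v, x v = 1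

/-- The Euclidean inner product of two vectors tangent to a common triangle, in barycentric
coordinates (each of the two coordinate vectors is supported on the triangle and has sum zero).
If the triangle is placed in the plane, with vertices `f v` at the given mutual distances, this is
the inner product of `∑ v, u v • f v` and `∑ v, w v • f v`. -/
noncomputable def tangentInner (P : GeneralizedPolygon V) (u w : V → ℝ) : ℝ :=
  -(1 / 2) * ∑ a, ∑ b, P.len a b ^ 2 * u a * w b

/-- A nonsingular (infinite, never meeting a vertex) forward trajectory of the billiard flow with
unit speed, cut at the edges of the triangulation: in the `k`-th step it starts at the point
`pos k` with unit velocity `vel k` and runs for the time `time k > 0` along a straight line through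
the open triangle `face k`, until it reaches an interior point of the edge `edge k`. If that edge
is interior to `P` it continues straight into the other triangle at the edge, and if it is a
boundary edge it is reflected back into the same triangle. In either case the speed and the
component of the velocity along the edge are preserved, and the new velocity points into the
new triangle. The pair `(pos 0, vel 0)` is the base point and the direction of the trajectory. -/
structure ForwardTrajectory (P : GeneralizedPolygon V) where
  face : ℕ → Finset V
  edge : ℕ → Finset V
  pos : ℕ → V → ℝ
  vel : ℕ → V → ℝ
  time : ℕ → ℝ
  face_mem : ∀ k, face k ∈ P.faces
  base_not_vertex : ∀ v, ¬ InOpenSimplex {v} (pos 0)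
  time_pos : ∀ k, 0 < time k
  unit_speed : ∀ k, P.tangentInner (vel k) (vel k) = 1
  straight : ∀ k, ∀ s, 0 < s → s < time k → InOpenSimplex (face k) (pos k + s • vel k)
  pos_succ : ∀ k, pos (k + 1) = pos k + time k • vel k
  edge_card : ∀ k, (edge k).card = 2
  edge_subset : ∀ k, edge k ⊆ face k
  edge_hit : ∀ k, InOpenSimplex (edge k) (pos (k + 1))
  edge_subset_succ : ∀ k, edge k ⊆ face (k + 1)
  face_succ : ∀ k, face (k + 1) = face k ↔ P.IsBoundaryEdge (edge k)
  tangential : ∀ k, ∀ a ∈ edge k, ∀ b ∈ edge k,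
    P.tangentInner (vel (k + 1)) (Pi.single a 1 - Pi.single b 1) =
      P.tangentInner (vel k) (Pi.single a 1 - Pi.single b 1)

/-- `E` is the forward bounce sequence of `τ`: the sequence of all boundary edges met by `τ`, in
order. (A base point on the boundary does not contribute a letter.) -/
def ForwardTrajectory.HasBounceSequence {P : GeneralizedPolygon V} (τ : P.ForwardTrajectory)
    (E : ℕ → P.BoundaryEdge) : Prop :=
  ∃ κ : ℕ → ℕ, StrictMono κ ∧ Set.range κ = {k | P.IsBoundaryEdge (τ.edge k)} ∧
    ∀ i, (E i).1 = τ.edge (κ i)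

/-- The forward bounce spectrum: the set of realizable one-sided sequences. -/
def forwardBounceSpectrum (P : GeneralizedPolygon V) : Set (ℕ → P.BoundaryEdge) :=
  {E | ∃ τ : P.ForwardTrajectory, τ.HasBounceSequence E}

/-- The sequence `(A, F 0, F 1, …)`. -/
def prepend {α : Type*} (A : α) (F : ℕ → α) : ℕ → α
  | 0 => A
  | i + 1 => F i

/-- `A` is a prefix for the sequence `F`: the sequence `(A, F 0, F 1, …)` lies in the closure of
the forward bounce spectrum (for the product of the discrete topologies). -/
def IsPrefix (P : GeneralizedPolygon V) (A : P.BoundaryEdge) (F : ℕ → P.BoundaryEdge) : Prop :=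
  prepend A F ∈ closure P.forwardBounceSpectrum

/-- For every index `n`, the only prefix for the tail of `E` after its `n`-th letter is that
letter. -/
def HasUniquePrefixes (P : GeneralizedPolygon V) (E : ℕ → P.BoundaryEdge) : Prop :=
  ∀ n : ℕ, ∀ A : P.BoundaryEdge, P.IsPrefix A (fun i => E (n + 1 + i)) ↔ A = E n

end GeneralizedPolygon

end Billiard

namespace Billiard
open Finset

/-! ### Plane geometry in coordinates -/

/-! The triangles of `P` are placed in the plane once, compatibly along common edges and with
neighbours on opposite sides (`Dev`). An oriented line becomes an affine functional with unit
gradient. It does not change when the line crosses an interior edge, and it is composed with a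
reflection at a bounce. An orbit (`IsOrbit`) is a sequence of triangles with exit edges whose ends
are strictly separated by the functional; orbits and nonsingular trajectories have the same bounce
sequences (`mem_spectrum_iff`). The basic estimate is `Dev.exists_drift`: the crossing points
advance at least linearly in the number of crossed edges.

Sufficiency (`realizable_of_unique`). A sequence in the closure is the code of a limit line that
separates the edges weakly (`exists_limit_code`). If it separates strictly, it is an orbit.
Otherwise it runs through vertices. These cannot lie on its left, right and left again in this
order, so beyond some singular vertex `v`, say on the left, all singular vertices are on the left
(`IsLim.select`, `IsLim.exists_pivot`). A small rotation about `v` clears the vertices ahead, and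
translations to the two sides give lines that follow the code beyond `v` but pass `v` on different
sides. Traced backward, they come from different boundary edges (`NoFold`). As there are finitely
many edges, some tail has two prefixes.

Necessity (`isPrefix_eq`). Let `E` be realized and let `A` be a prefix of a tail `F` of `E`. A limit
line for `(A, F)` and the realizing line have the same future after the first bounce, and by linear
drift they are parallel (`R.parallel`). If they coincide, running backward gives the same edge.
Otherwise `F` is the code of a strip of positive width. Among the sequences in the orbit closure of
`F`, consider strips of almost maximal width. Returns of such a strip are close to each other, and
at two positions with the same long future but different preceding letters the returns have to
coincide (`R.exists_special`). This leads to a sequence without long left special words, hence to a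
periodic sequence in the orbit closure (`exists_periodic_in_hull`). When `F` follows it for one
period, the line returns with a small shift, and the strip forces the repetition to go on for ever
(`eventually_periodic`). Backward determinism then makes `E` periodic.

The shape of `P` enters only through the existence of a development and through `NoFold` and `Stag`,
the latter saying that chords from one edge to two different edges do not interlace. For simply
connected `P` the dual graph is a tree, so a straight path between boundary edges is determined by
its ends. For planar `P` a chord cannot meet a boundary edge between its ends. -/

abbrev Pt := ℝ × ℝ

/-- Twice the signed area of the triangle `a b c`. -/
def cr (a b c : Pt) : ℝ := (b.1 - a.1) * (c.2 - a.2) - (b.2 - a.2) * (c.1 - a.1)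

def sqd (a b : Pt) : ℝ := (a.1 - b.1) ^ 2 + (a.2 - b.2) ^ 2

/-- Affine functionals `x ↦ ψ.1 x.1 + ψ.2.1 x.2 + ψ.2.2` on the plane. -/
abbrev Fn := ℝ × ℝ × ℝ

def ev (ψ : Fn) (z : Pt) : ℝ := ψ.1 * z.1 + ψ.2.1 * z.2 + ψ.2.2

def gsq (ψ : Fn) : ℝ := ψ.1 ^ 2 + ψ.2.1 ^ 2

/-- Reflection in the line through `a` and `b`. -/
noncomputable def mirror (a b z : Pt) : Pt :=
  (2 * a.1 - z.1 + 2 * ((z.1 - a.1) * (b.1 - a.1) + (z.2 - a.2) * (b.2 - a.2)) / sqd a b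
      * (b.1 - a.1),
   2 * a.2 - z.2 + 2 * ((z.1 - a.1) * (b.1 - a.1) + (z.2 - a.2) * (b.2 - a.2)) / sqd a b
      * (b.2 - a.2))

/-- The functional `ψ ∘ mirror a b`. -/
noncomputable def pull (a b : Pt) (ψ : Fn) : Fn :=
  (2 * (ψ.1 * (b.1 - a.1) + ψ.2.1 * (b.2 - a.2)) / sqd a b * (b.1 - a.1) - ψ.1,
   2 * (ψ.1 * (b.1 - a.1) + ψ.2.1 * (b.2 - a.2)) / sqd a b * (b.2 - a.2) - ψ.2.1,
   2 * (ψ.1 * a.1 + ψ.2.1 * a.2) + ψ.2.2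
    - 2 * (ψ.1 * (b.1 - a.1) + ψ.2.1 * (b.2 - a.2)) / sqd a b
      * ((b.1 - a.1) * a.1 + (b.2 - a.2) * a.2))

lemma ev_pull (a b : Pt) (ψ : Fn) (z : Pt) : ev (pull a b ψ) z = ev ψ (mirror a b z) := by
  simp only [ev, pull, mirror]; ring

lemma sqd_ne {a b : Pt} (h : a ≠ b) : sqd a b ≠ 0 := by
  intro h0
  apply h
  unfold sqd at h0
  have h1 := sq_nonneg (a.1 - b.1)
  have h2 := sq_nonneg (a.2 - b.2)
  ext
  · nlinarith
  · nlinarith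

lemma sqd_comm (a b : Pt) : sqd a b = sqd b a := by unfold sqd; ring

lemma mirror_mirror {a b : Pt} (h : a ≠ b) (z : Pt) : mirror a b (mirror a b z) = z := by
  have h0 := sqd_ne h
  have h1 : sqd a b = (b.1 - a.1) ^ 2 + (b.2 - a.2) ^ 2 := by unfold sqd; ring
  ext
  · simp only [mirror]
    field_simp
    rw [h1]; ring
  · simp only [mirror]
    field_simp
    rw [h1]; ring

lemma mirror_eq_self {a b z : Pt} (h : a ≠ b) (hz : cr a b z = 0) : mirror a b z = z := by
  have h0 := sqd_ne h
  have h1 : sqd a b = (b.1 - a.1) ^ 2 + (b.2 - a.2) ^ 2 := by unfold sqd; ring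
  unfold cr at hz
  ext
  · simp only [mirror]
    field_simp
    rw [h1]; linear_combination 2 * (b.2 - a.2) * hz
  · simp only [mirror]
    field_simp
    rw [h1]; linear_combination -2 * (b.1 - a.1) * hz

lemma mirror_left (a b : Pt) : mirror a b a = a := by
  ext <;> simp only [mirror, sub_self, zero_mul, add_zero, mul_zero, zero_div] <;> ring

lemma mirror_right {a b : Pt} (h : a ≠ b) : mirror a b b = b :=
  mirror_eq_self h (by unfold cr; ring)

lemma mirror_comm (a b z : Pt) : mirror a b z = mirror b a z := by
  by_cases h : a = b
  · rw [h]
  have h0 := sqd_ne h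
  have h1 : sqd a b = (b.1 - a.1) ^ 2 + (b.2 - a.2) ^ 2 := by unfold sqd; ring
  ext
  · simp only [mirror, sqd_comm b a]
    field_simp
    rw [h1]; ring
  · simp only [mirror, sqd_comm b a]
    field_simp
    rw [h1]; ring

lemma Fn.ext_ev {ψ φ : Fn} (h : ∀ z, ev ψ z = ev φ z) : ψ = φ := by
  have h0 := h (0, 0)
  have h1 := h (1, 0)
  have h2 := h (0, 1)
  simp only [ev] at h0 h1 h2
  refine Prod.ext ?_ (Prod.ext ?_ ?_) <;> linarith

lemma pull_comm (a b : Pt) (ψ : Fn) : pull a b ψ = pull b a ψ :=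
  Fn.ext_ev fun z => by rw [ev_pull, ev_pull, mirror_comm]

lemma pull_pull {a b : Pt} (h : a ≠ b) (ψ : Fn) : pull a b (pull a b ψ) = ψ :=
  Fn.ext_ev fun z => by rw [ev_pull, ev_pull, mirror_mirror h]

lemma gsq_pull {a b : Pt} (h : a ≠ b) (ψ : Fn) : gsq (pull a b ψ) = gsq ψ := by
  have h0 := sqd_ne h
  have h1 : sqd a b = (b.1 - a.1) ^ 2 + (b.2 - a.2) ^ 2 := by unfold sqd; ring
  simp only [gsq, pull]
  field_simp
  rw [h1]; ring

lemma cr_mirror {a b : Pt} (h : a ≠ b) (p q r : Pt) :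
    cr (mirror a b p) (mirror a b q) (mirror a b r) = - cr p q r := by
  have h0 := sqd_ne h
  have h1 : sqd a b = (b.1 - a.1) ^ 2 + (b.2 - a.2) ^ 2 := by unfold sqd; ring
  simp only [cr, mirror]
  field_simp
  rw [h1]; ring

lemma pull_add (a b : Pt) (ψ φ : Fn) : pull a b (ψ + φ) = pull a b ψ + pull a b φ :=
  Fn.ext_ev fun z => by
    have : ∀ (ψ φ : Fn) z, ev (ψ + φ) z = ev ψ z + ev φ z := fun ψ φ z => by simp [ev]; ring
    rw [ev_pull, this, this, ev_pull, ev_pull]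

lemma ev_add (ψ φ : Fn) (z : Pt) : ev (ψ + φ) z = ev ψ z + ev φ z := by simp [ev]; ring

lemma ev_sub (ψ φ : Fn) (z : Pt) : ev (ψ - φ) z = ev ψ z - ev φ z := by simp [ev]; ring

lemma ev_smul (t : ℝ) (ψ : Fn) (z : Pt) : ev (t • ψ) z = t * ev ψ z := by simp [ev]; ring

lemma ev_neg (ψ : Fn) (z : Pt) : ev (-ψ) z = - ev ψ z := by simp [ev]; ring

lemma pull_smul (a b : Pt) (t : ℝ) (ψ : Fn) : pull a b (t • ψ) = t • pull a b ψ :=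
  Fn.ext_ev fun z => by rw [ev_pull, ev_smul, ev_smul, ev_pull]

lemma ev_combo (ψ : Fn) (s t : ℝ) (h : s + t = 1) (x y : Pt) :
    ev ψ (s • x + t • y) = s * ev ψ x + t * ev ψ y := by
  have : t = 1 - s := by linarith
  subst this
  simp [ev]; ring

lemma continuous_ev (z : Pt) : Continuous fun ψ : Fn => ev ψ z := by
  unfold ev; fun_prop

/-! ### Developments -/

open GeneralizedPolygon

variable {V : Type*} [Fintype V] [DecidableEq V]

/-- A development of `P`: the triangles are placed in the plane, compatibly along common edges
and such that neighbours lie on different sides of their common edge. -/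
structure Dev (P : GeneralizedPolygon V) where
  D : Finset V → V → Pt
  iso : ∀ t ∈ P.faces, ∀ a ∈ t, ∀ b ∈ t, sqd (D t a) (D t b) = P.len a b ^ 2
  agree : ∀ t ∈ P.faces, ∀ t' ∈ P.faces, ∀ a b, a ≠ b → a ∈ t → b ∈ t → a ∈ t' → b ∈ t' →
    D t a = D t' a
  opp : ∀ t ∈ P.faces, ∀ t' ∈ P.faces, ∀ a b c c', a ≠ b → a ∈ t → b ∈ t → a ∈ t' → b ∈ t' →
    t ≠ t' → c ∈ t → c ≠ a → c ≠ b → c' ∈ t' → c' ≠ a → c' ≠ b →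
    cr (D t a) (D t b) (D t c) * cr (D t' a) (D t' b) (D t' c') < 0

variable {P : GeneralizedPolygon V} (𝔇 : Dev P)

lemma len_pos {t : Finset V} (ht : t ∈ P.faces) {a b c : V} (ha : a ∈ t) (hb : b ∈ t) (hc : c ∈ t)
    (hab : a ≠ b) (hbc : b ≠ c) (hac : a ≠ c) : 0 < P.len a b := by
  have h1 := P.triangle t ht a ha b hb c hc hab hbc hac
  have h2 := P.triangle t ht b hb a ha c hc hab.symm hac hbc
  have h3 := P.len_symm a b
  linarith

lemma Dev.nondeg {t : Finset V} (ht : t ∈ P.faces) {a b c : V} (ha : a ∈ t) (hb : b ∈ t)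
    (hc : c ∈ t) (hab : a ≠ b) (hbc : b ≠ c) (hac : a ≠ c) :
    cr (𝔇.D t a) (𝔇.D t b) (𝔇.D t c) ≠ 0 := by
  intro h0
  have h1 := P.triangle t ht a ha b hb c hc hab hbc hac
  have h2 := P.triangle t ht b hb a ha c hc hab.symm hac hbc
  have h3 := P.triangle t ht a ha c hc b hb hac hbc.symm hab
  have p1 := len_pos ht ha hb hc hab hbc hac
  have p2 := len_pos ht hb hc ha hbc hac.symm hab.symm
  have p3 := len_pos ht ha hc hb hac hbc.symm hab
  have e1 := 𝔇.iso t ht a ha b hb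
  have e2 := 𝔇.iso t ht b hb c hc
  have e3 := 𝔇.iso t ht a ha c hc
  rw [P.len_symm b a] at h2
  rw [P.len_symm c b] at h3
  set x := P.len a b
  set y := P.len b c
  set z := P.len a c
  -- Heron's formula; the factors on the right are positive by the strict triangle inequalities.
  have key : 4 * cr (𝔇.D t a) (𝔇.D t b) (𝔇.D t c) ^ 2
      = (x + y + z) * (x + y - z) * (y + z - x) * (x + z - y) := by
    have : (x + y + z) * (x + y - z) * (y + z - x) * (x + z - y)
      = 2 * x^2 * y^2 + 2 * y^2*z^2 + 2*z^2*x^2 - (x^2)^2 - (y^2)^2 - (z^2)^2 := by ring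
    rw [this, ← e1, ← e2, ← e3]
    unfold cr sqd; ring
  rw [h0] at key
  have : 0 < (x + y + z) * (x + y - z) * (y + z - x) * (x + z - y) := by
    apply mul_pos (mul_pos (mul_pos _ _) _) <;> linarith
  linarith

lemma Dev.D_ne {t : Finset V} (ht : t ∈ P.faces) {a b : V} (ha : a ∈ t) (hb : b ∈ t)
    (hab : a ≠ b) : 𝔇.D t a ≠ 𝔇.D t b := by
  intro h
  obtain ⟨c, hc, hc'⟩ : ∃ c ∈ t, c ∉ ({a, b} : Finset V) :=
    Finset.exists_mem_notMem_of_card_lt_card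
      (by rw [P.card_face t ht]; exact lt_of_le_of_lt Finset.card_le_two (by norm_num))
  simp only [Finset.mem_insert, Finset.mem_singleton, not_or] at hc'
  apply 𝔇.nondeg ht ha hb hc hab (Ne.symm hc'.2) (Ne.symm hc'.1)
  rw [h]; unfold cr; ring

end Billiard

namespace Billiard
open Finset
open GeneralizedPolygon
variable {V : Type*} [Fintype V] [DecidableEq V]

/-! ### Combinatorial states and orbits -/

/-- A line that leaves the triangle `face` through its edge `{l, r}`; `ε` is the orientation of the
unfolded triangle. -/
structure CState (V : Type*) where
  face : Finset V
  l : V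
  r : V
  ε : Bool

def CState.edge (s : CState V) : Finset V := {s.l, s.r}

def sg (b : Bool) : ℝ := if b then 1 else -1

lemma sg_not (b : Bool) : sg (!b) = - sg b := by cases b <;> simp [sg]

lemma sg_mul_self (b : Bool) : sg b * sg b = 1 := by cases b <;> simp [sg]

lemma sg_sq (b : Bool) : sg b ^ 2 = 1 := by cases b <;> simp [sg]

lemma sg_ne (b : Bool) : sg b ≠ 0 := by cases b <;> simp [sg]

variable {P : GeneralizedPolygon V} (𝔇 : Dev P)

/-- The field `behind` puts the apex behind the exit edge once the triangle has been turned over as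
`ε` tells, so that a line leaving through the edge has `l` on its left and `r` on its right. -/
structure VInv (s : CState V) : Prop where
  face_mem : s.face ∈ P.faces
  l_mem : s.l ∈ s.face
  r_mem : s.r ∈ s.face
  ne : s.l ≠ s.r
  behind : ∀ c ∈ s.face, c ≠ s.l → c ≠ s.r →
    sg s.ε * cr (𝔇.D s.face s.l) (𝔇.D s.face s.r) (𝔇.D s.face c) < 0

/-- The next exit edge shares exactly one end with the old one. Flipping `ε` at a bounce, instead of
exchanging `l` and `r`, keeps the sign convention of `Sep` along the whole orbit. -/
structure CStep (P : GeneralizedPolygon V) (s s' : CState V) : Prop where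
  bd : P.IsBoundaryEdge s.edge → s'.face = s.face ∧ s'.ε = !s.ε
  int : ¬ P.IsBoundaryEdge s.edge → s'.face ≠ s.face ∧ s'.ε = s.ε
  l_mem : s.l ∈ s'.face
  r_mem : s.r ∈ s'.face
  turn : (s'.l = s.l ∧ s'.r ≠ s.r) ∨ (s'.r = s.r ∧ s'.l ≠ s.l)

def Sep (ψ : Fn) (s : CState V) : Prop :=
  0 < ev ψ (𝔇.D s.face s.l) ∧ ev ψ (𝔇.D s.face s.r) < 0

open Classical in
/-- The change of the functional at the edge of `s`. -/
noncomputable def refr (s : CState V) (ψ : Fn) : Fn :=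
  if P.IsBoundaryEdge s.edge then pull (𝔇.D s.face s.l) (𝔇.D s.face s.r) ψ else ψ

/-- The line is always described in the plane of the development. Equivalently, the initial
functional is composed with the unfolding of the path, see `ev_transp`. -/
noncomputable def transp (c : ℕ → CState V) (ψ : Fn) : ℕ → Fn
  | 0 => ψ
  | k + 1 => refr 𝔇 (c k) (transp c ψ k)

structure IsOrbit (c : ℕ → CState V) (ψ : Fn) : Prop where
  inv : ∀ k, VInv 𝔇 (c k)
  step : ∀ k, CStep P (c k) (c (k + 1))
  unit : gsq ψ = 1
  sep : ∀ k, Sep 𝔇 (transp 𝔇 c ψ k) (c k)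

variable {𝔇}

lemma exists_apex {t : Finset V} (ht : t ∈ P.faces) {a b : V} (ha : a ∈ t) (hb : b ∈ t)
    (hab : a ≠ b) : ∃ c, c ≠ a ∧ c ≠ b ∧ t = {a, b, c} := by
  obtain ⟨c, hc, hc'⟩ : ∃ c ∈ t, c ∉ ({a, b} : Finset V) :=
    Finset.exists_mem_notMem_of_card_lt_card
      (by rw [P.card_face t ht]; exact lt_of_le_of_lt Finset.card_le_two (by norm_num))
  simp only [Finset.mem_insert, Finset.mem_singleton, not_or] at hc'
  refine ⟨c, hc'.1, hc'.2, (Finset.eq_of_subset_of_card_le ?_ ?_).symm⟩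
  · intro x hx
    simp only [Finset.mem_insert, Finset.mem_singleton] at hx
    rcases hx with rfl | rfl | rfl <;> assumption
  · rw [P.card_face t ht, Finset.card_eq_three.2 ⟨a, b, c, hab, Ne.symm hc'.1, Ne.symm hc'.2, rfl⟩]

lemma VInv.exists_apex {s : CState V} (h : VInv 𝔇 s) :
    ∃ c, c ≠ s.l ∧ c ≠ s.r ∧ s.face = {s.l, s.r, c} :=
  Billiard.exists_apex h.face_mem h.l_mem h.r_mem h.ne

lemma VInv.D_ne {s : CState V} (h : VInv 𝔇 s) : 𝔇.D s.face s.l ≠ 𝔇.D s.face s.r :=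
  𝔇.D_ne h.face_mem h.l_mem h.r_mem h.ne

lemma VInv.edge_subset {s : CState V} (h : VInv 𝔇 s) : s.edge ⊆ s.face := by
  intro x hx
  simp only [CState.edge, Finset.mem_insert, Finset.mem_singleton] at hx
  rcases hx with rfl | rfl
  exacts [h.l_mem, h.r_mem]

lemma VInv.edge_card {s : CState V} (h : VInv 𝔇 s) : s.edge.card = 2 :=
  Finset.card_pair h.ne

/-- Positions of the end points of the common edge agree in consecutive triangles. -/
lemma CStep.D_l {s s' : CState V} (h : CStep P s s') (hs : VInv 𝔇 s) (hs' : VInv 𝔇 s') :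
    𝔇.D s'.face s.l = 𝔇.D s.face s.l :=
  (𝔇.agree _ hs.face_mem _ hs'.face_mem _ _ hs.ne hs.l_mem hs.r_mem h.l_mem h.r_mem).symm

lemma CStep.D_r {s s' : CState V} (h : CStep P s s') (hs : VInv 𝔇 s) (hs' : VInv 𝔇 s') :
    𝔇.D s'.face s.r = 𝔇.D s.face s.r :=
  (𝔇.agree _ hs.face_mem _ hs'.face_mem _ _ hs.ne.symm hs.r_mem hs.l_mem h.r_mem h.l_mem).symm

lemma ev_refr_l {s : CState V} (ψ : Fn) :
    ev (refr 𝔇 s ψ) (𝔇.D s.face s.l) = ev ψ (𝔇.D s.face s.l) := by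
  unfold refr
  split_ifs
  · rw [ev_pull, mirror_left]
  · rfl

lemma ev_refr_r {s : CState V} (hs : VInv 𝔇 s) (ψ : Fn) :
    ev (refr 𝔇 s ψ) (𝔇.D s.face s.r) = ev ψ (𝔇.D s.face s.r) := by
  unfold refr
  split_ifs
  · rw [ev_pull, mirror_right hs.D_ne]
  · rfl

lemma gsq_refr {s : CState V} (hs : VInv 𝔇 s) (ψ : Fn) : gsq (refr 𝔇 s ψ) = gsq ψ := by
  unfold refr
  split_ifs
  · rw [gsq_pull hs.D_ne]
  · rfl

lemma gsq_transp {c : ℕ → CState V} (hc : ∀ k, VInv 𝔇 (c k)) (ψ : Fn) (k : ℕ) :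
    gsq (transp 𝔇 c ψ k) = gsq ψ := by
  induction k with
  | zero => rfl
  | succ k ih => rw [transp, gsq_refr (hc k), ih]

lemma transp_add (c : ℕ → CState V) (ψ : Fn) (i j : ℕ) :
    transp 𝔇 c ψ (i + j) = transp 𝔇 (fun k => c (i + k)) (transp 𝔇 c ψ i) j := by
  induction j with
  | zero => rfl
  | succ j ih => rw [← add_assoc, transp, ih]; rfl

lemma IsOrbit.drop {c : ℕ → CState V} {ψ : Fn} (h : IsOrbit 𝔇 c ψ) (i : ℕ) :
    IsOrbit 𝔇 (fun k => c (i + k)) (transp 𝔇 c ψ i) where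
  inv k := h.inv _
  step k := h.step _
  unit := by rw [gsq_transp h.inv, h.unit]
  sep k := by rw [← transp_add]; exact h.sep _

/-- In the next triangle the common edge is in front of the line's exit edge. -/
lemma CStep.ahead {s s' : CState V} (h : CStep P s s') (hs : VInv 𝔇 s) (hs' : VInv 𝔇 s')
    {c : V} (hc : c ∈ s'.face) (hl : c ≠ s.l) (hr : c ≠ s.r) :
    0 < sg s'.ε * cr (𝔇.D s'.face s.l) (𝔇.D s'.face s.r) (𝔇.D s'.face c) := by
  by_cases hb : P.IsBoundaryEdge s.edge
  · obtain ⟨h1, h2⟩ := h.bd hb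
    rw [h1] at hc ⊢
    rw [h2, sg_not]
    have := hs.behind c hc hl hr
    linarith
  · obtain ⟨h1, h2⟩ := h.int hb
    rw [h2]
    obtain ⟨d, hd1, hd2, hd3⟩ := hs.exists_apex
    have hd : d ∈ s.face := by rw [hd3]; simp
    have h3 := hs.behind d hd hd1 hd2
    have h4 := 𝔇.opp s.face hs.face_mem s'.face hs'.face_mem s.l s.r d c hs.ne hs.l_mem hs.r_mem
      h.l_mem h.r_mem (Ne.symm h1) hd hd1 hd2 hc hl hr
    have h5 := sg_mul_self s.ε
    by_contra hcon
    have h6 := mul_nonneg_of_nonpos_of_nonpos h3.le (not_lt.1 hcon)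
    have : sg s.ε * cr (𝔇.D s.face s.l) (𝔇.D s.face s.r) (𝔇.D s.face d) *
       (sg s.ε * cr (𝔇.D s'.face s.l) (𝔇.D s'.face s.r) (𝔇.D s'.face c)) =
       cr (𝔇.D s.face s.l) (𝔇.D s.face s.r) (𝔇.D s.face d) *
        cr (𝔇.D s'.face s.l) (𝔇.D s'.face s.r) (𝔇.D s'.face c) := by
      linear_combination (cr (𝔇.D s.face s.l) (𝔇.D s.face s.r) (𝔇.D s.face d) *
        cr (𝔇.D s'.face s.l) (𝔇.D s'.face s.r) (𝔇.D s'.face c)) * h5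
    linarith

/-- Conversely this position of the apex makes the exit edge of the next state correctly oriented. -/
lemma VInv.of_ahead {s' : CState V} {l r : V} (hf : s'.face ∈ P.faces) (hl : l ∈ s'.face)
    (hr : r ∈ s'.face) (hl' : s'.l ∈ s'.face) (hr' : s'.r ∈ s'.face) (hlr : l ≠ r)
    (hne : s'.l ≠ s'.r)
    (turn : (s'.l = l ∧ s'.r ≠ r) ∨ (s'.r = r ∧ s'.l ≠ l))
    (ha : ∀ c ∈ s'.face, c ≠ l → c ≠ r →
      0 < sg s'.ε * cr (𝔇.D s'.face l) (𝔇.D s'.face r) (𝔇.D s'.face c)) : VInv 𝔇 s' := by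
  refine ⟨hf, hl', hr', hne, fun c hc h1 h2 => ?_⟩
  obtain ⟨d, hd1, hd2, hd3⟩ := Billiard.exists_apex hf hl hr hlr
  have hd : d ∈ s'.face := by rw [hd3]; simp
  have h3 := ha d hd hd1 hd2
  rcases turn with ⟨t1, t2⟩ | ⟨t1, t2⟩
  · have e1 : s'.r = d := by
      rw [hd3] at hr'
      simp only [Finset.mem_insert, Finset.mem_singleton] at hr'
      rcases hr' with h | h | h
      · exact absurd (h.trans t1.symm) hne.symm
      · exact absurd h t2
      · exact h
    have e2 : c = r := by
      rw [hd3] at hc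
      simp only [Finset.mem_insert, Finset.mem_singleton] at hc
      rcases hc with h | h | h
      · exact absurd (h.trans t1.symm) h1
      · exact h
      · exact absurd (h.trans e1.symm) h2
    rw [t1, e1, e2]
    have : cr (𝔇.D s'.face l) (𝔇.D s'.face d) (𝔇.D s'.face r)
      = - cr (𝔇.D s'.face l) (𝔇.D s'.face r) (𝔇.D s'.face d) := by unfold cr; ring
    rw [this]; linarith
  · have e1 : s'.l = d := by
      rw [hd3] at hl'
      simp only [Finset.mem_insert, Finset.mem_singleton] at hl'
      rcases hl' with h | h | h
      · exact absurd h t2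
      · exact absurd (h.trans t1.symm) hne
      · exact h
    have e2 : c = l := by
      rw [hd3] at hc
      simp only [Finset.mem_insert, Finset.mem_singleton] at hc
      rcases hc with h | h | h
      · exact h
      · exact absurd (h.trans t1.symm) h2
      · exact absurd (h.trans e1.symm) h1
    rw [t1, e1, e2]
    have : cr (𝔇.D s'.face d) (𝔇.D s'.face r) (𝔇.D s'.face l)
      = - cr (𝔇.D s'.face l) (𝔇.D s'.face r) (𝔇.D s'.face d) := by unfold cr; ring
    rw [this]; linarith

end Billiard

namespace Billiard
open Finset
open GeneralizedPolygon
variable {V : Type*} [Fintype V] [DecidableEq V]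

/-! ### From trajectories to orbits -/

variable {P : GeneralizedPolygon V} (𝔇 : Dev P)

/-- The point (or vector) with barycentric coordinates `x` in the placed triangle `t`. -/
def bary (t : Finset V) (x : V → ℝ) : Pt :=
  (∑ v, x v * (𝔇.D t v).1, ∑ v, x v * (𝔇.D t v).2)

lemma bary_add_smul (t : Finset V) (x y : V → ℝ) (s : ℝ) :
    bary 𝔇 t (x + s • y) = bary 𝔇 t x + s • bary 𝔇 t y := by
  ext
  · simp only [bary, Pi.add_apply, Pi.smul_apply, smul_eq_mul, Prod.fst_add, Prod.smul_fst,
      Finset.mul_sum, ← Finset.sum_add_distrib]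
    exact Finset.sum_congr rfl fun v _ => by ring
  · simp only [bary, Pi.add_apply, Pi.smul_apply, smul_eq_mul, Prod.snd_add, Prod.smul_snd,
      Finset.mul_sum, ← Finset.sum_add_distrib]
    exact Finset.sum_congr rfl fun v _ => by ring

lemma sum_three {a b c : V} (hab : a ≠ b) (hac : a ≠ c) (hbc : b ≠ c) {x : V → ℝ}
    (hx : ∀ v, v ∉ ({a, b, c} : Finset V) → x v = 0) : ∑ v, x v = x a + x b + x c := by
  rw [← Finset.sum_subset (Finset.subset_univ ({a, b, c} : Finset V)) (fun v _ hv => hx v hv),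
    Finset.sum_insert (by simp [hab, hac]), Finset.sum_pair hbc, add_assoc]

lemma sum_two {a b : V} (hab : a ≠ b) {x : V → ℝ}
    (hx : ∀ v, v ∉ ({a, b} : Finset V) → x v = 0) : ∑ v, x v = x a + x b := by
  rw [← Finset.sum_subset (Finset.subset_univ ({a, b} : Finset V)) (fun v _ hv => hx v hv),
    Finset.sum_pair hab]

/-- In the expansion of the squared distances the terms that depend on one vertex only are killed by
the vanishing coordinate sums; the mixed term is the inner product. -/
lemma tangentInner_eq {t : Finset V} (ht : t ∈ P.faces) {u w : V → ℝ} (hu : ∀ v ∉ t, u v = 0)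
    (hw : ∀ v ∉ t, w v = 0) (hu0 : ∑ v, u v = 0) (hw0 : ∑ v, w v = 0) :
    P.tangentInner u w = (bary 𝔇 t u).1 * (bary 𝔇 t w).1 + (bary 𝔇 t u).2 * (bary 𝔇 t w).2 := by
  have h1 : ∑ a, ∑ b, P.len a b ^ 2 * u a * w b
      = ∑ a, ∑ b, sqd (𝔇.D t a) (𝔇.D t b) * u a * w b := by
    refine Finset.sum_congr rfl fun a _ => Finset.sum_congr rfl fun b _ => ?_
    by_cases ha : a ∈ t
    · by_cases hb : b ∈ t
      · rw [𝔇.iso t ht a ha b hb]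
      · rw [hw b hb]; ring
    · rw [hu a ha]; ring
  have h2 : ∑ a, ∑ b, sqd (𝔇.D t a) (𝔇.D t b) * u a * w b =
      (∑ a, ((𝔇.D t a).1 ^ 2 + (𝔇.D t a).2 ^ 2) * u a) * ∑ b, w b
      + (∑ a, u a) * (∑ b, ((𝔇.D t b).1 ^ 2 + (𝔇.D t b).2 ^ 2) * w b)
      - 2 * ((∑ a, u a * (𝔇.D t a).1) * (∑ b, w b * (𝔇.D t b).1)
       + (∑ a, u a * (𝔇.D t a).2) * (∑ b, w b * (𝔇.D t b).2)) := by
    simp only [Finset.sum_mul_sum]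
    simp only [Finset.mul_sum, ← Finset.sum_add_distrib, ← Finset.sum_sub_distrib]
    refine Finset.sum_congr rfl fun a _ => Finset.sum_congr rfl fun b _ => ?_
    unfold sqd; ring
  rw [tangentInner, h1, h2, hu0, hw0]
  simp only [bary]; ring

/-- The functional that vanishes on the line through `z` in the direction `u`, positive on the
left. -/
def lineFn (u z : Pt) : Fn := (-u.2, u.1, u.2 * z.1 - u.1 * z.2)

lemma ev_lineFn (u z w : Pt) : ev (lineFn u z) w = u.1 * (w.2 - z.2) - u.2 * (w.1 - z.1) := by
  simp only [ev, lineFn]; ring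

lemma gsq_lineFn (u z : Pt) : gsq (lineFn u z) = u.1 * u.1 + u.2 * u.2 := by
  simp only [gsq, lineFn]; ring

section
variable {𝔇} (τ : P.ForwardTrajectory)

/-- Two interior times of the step determine an affine function of time, so position and velocity
vanish separately. -/
lemma traj_zero (k : ℕ) {v : V} (hv : v ∉ τ.face k) : τ.pos k v = 0 ∧ τ.vel k v = 0 := by
  have hT := τ.time_pos k
  have h1 := (τ.straight k (τ.time k / 2) (by linarith) (by linarith)).2.1 v hv
  have h2 := (τ.straight k (τ.time k / 3) (by linarith) (by linarith)).2.1 v hv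
  simp only [Pi.add_apply, Pi.smul_apply, smul_eq_mul] at h1 h2
  have h3 : τ.vel k v = 0 := by
    have : τ.time k * τ.vel k v = 0 := by linarith
    exact (mul_eq_zero.1 this).resolve_left hT.ne'
  rw [h3] at h1
  exact ⟨by linarith, h3⟩

lemma traj_sum (k : ℕ) : ∑ v, τ.pos k v = 1 ∧ ∑ v, τ.vel k v = 0 := by
  have hT := τ.time_pos k
  have h1 := (τ.straight k (τ.time k / 2) (by linarith) (by linarith)).2.2
  have h2 := (τ.straight k (τ.time k / 3) (by linarith) (by linarith)).2.2
  simp only [Pi.add_apply, Pi.smul_apply, smul_eq_mul, Finset.sum_add_distrib,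
    ← Finset.mul_sum] at h1 h2
  have h3 : ∑ v, τ.vel k v = 0 := by
    have : τ.time k * ∑ v, τ.vel k v = 0 := by linarith
    exact (mul_eq_zero.1 this).resolve_left hT.ne'
  rw [h3] at h1
  exact ⟨by linarith, h3⟩

variable (𝔇)

lemma traj_unit (k : ℕ) : (bary 𝔇 (τ.face k) (τ.vel k)).1 * (bary 𝔇 (τ.face k) (τ.vel k)).1
    + (bary 𝔇 (τ.face k) (τ.vel k)).2 * (bary 𝔇 (τ.face k) (τ.vel k)).2 = 1 := by
  rw [← tangentInner_eq 𝔇 (τ.face_mem k) (fun v hv => (traj_zero τ k hv).2)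
    (fun v hv => (traj_zero τ k hv).2) (traj_sum τ k).2 (traj_sum τ k).2]
  exact τ.unit_speed k

lemma bary_edge {t : Finset V} {a b : V} (hab : a ≠ b) {x : V → ℝ}
    (hx : ∀ v, v ∉ ({a, b} : Finset V) → x v = 0) :
    bary 𝔇 t x = (x a * (𝔇.D t a).1 + x b * (𝔇.D t b).1, x a * (𝔇.D t a).2 + x b * (𝔇.D t b).2) := by
  simp only [bary]
  rw [sum_two hab (fun v hv => by rw [hx v hv, zero_mul]),
    sum_two hab (fun v hv => by rw [hx v hv, zero_mul])]

lemma bary_tri {t : Finset V} {a b c : V} (hab : a ≠ b) (hac : a ≠ c) (hbc : b ≠ c) {x : V → ℝ}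
    (hx : ∀ v, v ∉ ({a, b, c} : Finset V) → x v = 0) :
    bary 𝔇 t x = (x a * (𝔇.D t a).1 + x b * (𝔇.D t b).1 + x c * (𝔇.D t c).1,
      x a * (𝔇.D t a).2 + x b * (𝔇.D t b).2 + x c * (𝔇.D t c).2) := by
  simp only [bary]
  rw [sum_three hab hac hbc (fun v hv => by rw [hx v hv, zero_mul]),
    sum_three hab hac hbc (fun v hv => by rw [hx v hv, zero_mul])]

/-- The side of the edge `{a, b}` on which a point of the open triangle lies. -/
lemma cr_bary_tri {t : Finset V} {a b c : V} (hab : a ≠ b) (hac : a ≠ c) (hbc : b ≠ c) {x : V → ℝ}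
    (hx : ∀ v, v ∉ ({a, b, c} : Finset V) → x v = 0) (h1 : ∑ v, x v = 1) :
    cr (𝔇.D t a) (𝔇.D t b) (bary 𝔇 t x) = x c * cr (𝔇.D t a) (𝔇.D t b) (𝔇.D t c) := by
  rw [bary_tri 𝔇 hab hac hbc hx]
  rw [sum_three hab hac hbc hx] at h1
  have : x a = 1 - x b - x c := by linarith
  simp only [cr, this]; ring

lemma traj_pos_succ_face (k : ℕ) :
    bary 𝔇 (τ.face k) (τ.pos (k + 1)) = bary 𝔇 (τ.face k) (τ.pos k)
      + τ.time k • bary 𝔇 (τ.face k) (τ.vel k) := by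
  rw [τ.pos_succ, bary_add_smul]

lemma traj_bary_succ (k : ℕ) :
    bary 𝔇 (τ.face (k + 1)) (τ.pos (k + 1)) = bary 𝔇 (τ.face k) (τ.pos (k + 1)) := by
  obtain ⟨a, b, hab, he⟩ := Finset.card_eq_two.1 (τ.edge_card k)
  have hz := (τ.edge_hit k).2.1
  have h1 := τ.edge_subset k
  have h2 := τ.edge_subset_succ k
  rw [he] at hz h1 h2
  have a1 : a ∈ τ.face k := h1 (by simp)
  have b1 : b ∈ τ.face k := h1 (by simp)
  have a2 : a ∈ τ.face (k + 1) := h2 (by simp)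
  have b2 : b ∈ τ.face (k + 1) := h2 (by simp)
  rw [bary_edge 𝔇 hab hz, bary_edge 𝔇 hab hz,
    𝔇.agree _ (τ.face_mem k) _ (τ.face_mem (k + 1)) a b hab a1 b1 a2 b2,
    𝔇.agree _ (τ.face_mem k) _ (τ.face_mem (k + 1)) b a hab.symm b1 a1 b2 a2]

/-- Leaving a triangle through the edge `{a, b}`. -/
lemma traj_exit (k : ℕ) {a b c : V} (hab : a ≠ b) (hac : a ≠ c) (hbc : b ≠ c)
    (hf : τ.face k = {a, b, c}) (he : τ.edge k = {a, b}) :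
    ∃ s > 0, s * cr (𝔇.D (τ.face k) a) (𝔇.D (τ.face k) b) (𝔇.D (τ.face k) c) =
      (bary 𝔇 (τ.face k) (τ.vel k)).1 * ((𝔇.D (τ.face k) b).2 - (𝔇.D (τ.face k) a).2)
      - (bary 𝔇 (τ.face k) (τ.vel k)).2 * ((𝔇.D (τ.face k) b).1 - (𝔇.D (τ.face k) a).1) := by
  have hT := τ.time_pos k
  have hs := τ.straight k (τ.time k / 2) (by linarith) (by linarith)
  have hz : ∀ v, v ∉ ({a, b, c} : Finset V) → (τ.pos k + (τ.time k / 2) • τ.vel k) v = 0 := by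
    intro v hv
    exact hs.2.1 v (by rw [hf]; exact hv)
  have h1 := cr_bary_tri 𝔇 (t := τ.face k) hab hac hbc hz hs.2.2
  have hc : 0 < (τ.pos k + (τ.time k / 2) • τ.vel k) c := hs.1 c (by rw [hf]; simp)
  set x := (τ.pos k + (τ.time k / 2) • τ.vel k) c with hx
  -- The point at half time has apex weight `x`, and the edge is reached after the other half of the
  -- time.
  refine ⟨x * (2 / τ.time k), by positivity, ?_⟩
  have hh := (τ.edge_hit k)
  rw [he] at hh
  have h2 := bary_edge 𝔇 (t := τ.face k) hab hh.2.1
  rw [traj_pos_succ_face] at h2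
  have h3 : τ.pos (k + 1) a + τ.pos (k + 1) b = 1 := by rw [← sum_two hab hh.2.1, hh.2.2]
  rw [bary_add_smul] at h1
  have e1 := congrArg Prod.fst h2
  have e2 := congrArg Prod.snd h2
  simp only [Prod.fst_add, Prod.snd_add, Prod.smul_fst, Prod.smul_snd, smul_eq_mul] at e1 e2
  have h4 : τ.pos (k + 1) a = 1 - τ.pos (k + 1) b := by linarith
  rw [h4] at e1 e2
  have key : x * cr (𝔇.D (τ.face k) a) (𝔇.D (τ.face k) b) (𝔇.D (τ.face k) c) = (τ.time k / 2) *
      ((bary 𝔇 (τ.face k) (τ.vel k)).1 * ((𝔇.D (τ.face k) b).2 - (𝔇.D (τ.face k) a).2)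
      - (bary 𝔇 (τ.face k) (τ.vel k)).2 * ((𝔇.D (τ.face k) b).1 - (𝔇.D (τ.face k) a).1)) := by
    rw [← h1]
    simp only [cr, Prod.fst_add, Prod.snd_add, Prod.smul_fst, Prod.smul_snd, smul_eq_mul]
    linear_combination ((𝔇.D (τ.face k) b).1 - (𝔇.D (τ.face k) a).1) * e2
      - ((𝔇.D (τ.face k) b).2 - (𝔇.D (τ.face k) a).2) * e1
  have hT' := hT.ne'
  field_simp
  linear_combination 2 * key

/-- Entering a triangle through the edge `{a, b}`. -/
lemma traj_entry (k : ℕ) {a b c : V} (hab : a ≠ b) (hac : a ≠ c) (hbc : b ≠ c)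
    (hf : τ.face (k + 1) = {a, b, c}) (he : τ.edge k = {a, b}) :
    ∃ s > 0, s * cr (𝔇.D (τ.face (k + 1)) a) (𝔇.D (τ.face (k + 1)) b) (𝔇.D (τ.face (k + 1)) c) =
      - ((bary 𝔇 (τ.face (k + 1)) (τ.vel (k + 1))).1
        * ((𝔇.D (τ.face (k + 1)) b).2 - (𝔇.D (τ.face (k + 1)) a).2)
      - (bary 𝔇 (τ.face (k + 1)) (τ.vel (k + 1))).2
        * ((𝔇.D (τ.face (k + 1)) b).1 - (𝔇.D (τ.face (k + 1)) a).1)) := by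
  have hT := τ.time_pos (k + 1)
  set T := τ.time (k + 1)
  have hs := τ.straight (k + 1) (T / 2) (by linarith) (by linarith)
  have hz : ∀ v, v ∉ ({a, b, c} : Finset V) → (τ.pos (k + 1) + (T / 2) • τ.vel (k + 1)) v = 0 := by
    intro v hv
    exact hs.2.1 v (by rw [hf]; exact hv)
  have h1 := cr_bary_tri 𝔇 (t := τ.face (k + 1)) hab hac hbc hz hs.2.2
  have hc : 0 < (τ.pos (k + 1) + (T / 2) • τ.vel (k + 1)) c := hs.1 c (by rw [hf]; simp)
  set x := (τ.pos (k + 1) + (T / 2) • τ.vel (k + 1)) c with hx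
  refine ⟨x * (2 / T), by positivity, ?_⟩
  have hh := (τ.edge_hit k)
  rw [he] at hh
  have h2 := bary_edge 𝔇 (t := τ.face (k + 1)) hab hh.2.1
  have h3 : τ.pos (k + 1) a + τ.pos (k + 1) b = 1 := by rw [← sum_two hab hh.2.1, hh.2.2]
  rw [bary_add_smul] at h1
  have e1 := congrArg Prod.fst h2
  have e2 := congrArg Prod.snd h2
  have h4 : τ.pos (k + 1) a = 1 - τ.pos (k + 1) b := by linarith
  rw [h4] at e1 e2
  simp only at e1 e2
  set t := τ.face (k + 1)
  have key : x * cr (𝔇.D t a) (𝔇.D t b) (𝔇.D t c) = (T / 2) *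
      - ((bary 𝔇 t (τ.vel (k + 1))).1 * ((𝔇.D t b).2 - (𝔇.D t a).2)
      - (bary 𝔇 t (τ.vel (k + 1))).2 * ((𝔇.D t b).1 - (𝔇.D t a).1)) := by
    rw [← h1]
    simp only [cr, Prod.fst_add, Prod.snd_add, Prod.smul_fst, Prod.smul_snd, smul_eq_mul]
    linear_combination ((𝔇.D t b).1 - (𝔇.D t a).1) * e2
      - ((𝔇.D t b).2 - (𝔇.D t a).2) * e1
  have hT' := hT.ne'
  field_simp
  linear_combination 2 * key

/-- The functional of the line of the `k`-th step. -/
noncomputable def trajFn (k : ℕ) : Fn :=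
  lineFn (bary 𝔇 (τ.face k) (τ.vel k)) (bary 𝔇 (τ.face k) (τ.pos k))

lemma traj_tangential (k : ℕ) {a b : V} (hab : a ≠ b) (he : τ.edge k = {a, b}) :
    (bary 𝔇 (τ.face (k + 1)) (τ.vel (k + 1))).1 * ((𝔇.D (τ.face k) a).1 - (𝔇.D (τ.face k) b).1)
    + (bary 𝔇 (τ.face (k + 1)) (τ.vel (k + 1))).2 * ((𝔇.D (τ.face k) a).2 - (𝔇.D (τ.face k) b).2)
    = (bary 𝔇 (τ.face k) (τ.vel k)).1 * ((𝔇.D (τ.face k) a).1 - (𝔇.D (τ.face k) b).1)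
    + (bary 𝔇 (τ.face k) (τ.vel k)).2 * ((𝔇.D (τ.face k) a).2 - (𝔇.D (τ.face k) b).2) := by
  have h1 := τ.edge_subset k
  have h2 := τ.edge_subset_succ k
  rw [he] at h1 h2
  have a1 : a ∈ τ.face k := h1 (by simp)
  have b1 : b ∈ τ.face k := h1 (by simp)
  have a2 : a ∈ τ.face (k + 1) := h2 (by simp)
  have b2 : b ∈ τ.face (k + 1) := h2 (by simp)
  have ht := τ.tangential k a (by rw [he]; simp) b (by rw [he]; simp)
  have hx : ∀ v, v ∉ ({a, b} : Finset V) →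
      (Pi.single a 1 - Pi.single b 1 : V → ℝ) v = 0 := by
    intro v hv
    simp only [Finset.mem_insert, Finset.mem_singleton, not_or] at hv
    simp [hv.1, hv.2]
  have hsum : ∑ v, (Pi.single a 1 - Pi.single b 1 : V → ℝ) v = 0 := by
    simp
  have sub : ∀ {t : Finset V}, a ∈ t → b ∈ t → ∀ v ∉ t,
      (Pi.single a 1 - Pi.single b 1 : V → ℝ) v = 0 := by
    intro t ha hb v hv
    apply hx
    simp only [Finset.mem_insert, Finset.mem_singleton, not_or]
    exact ⟨fun h => hv (h ▸ ha), fun h => hv (h ▸ hb)⟩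
  rw [tangentInner_eq 𝔇 (τ.face_mem (k + 1)) (fun v hv => (traj_zero τ (k + 1) hv).2)
    (sub a2 b2) (traj_sum τ (k + 1)).2 hsum,
    tangentInner_eq 𝔇 (τ.face_mem k) (fun v hv => (traj_zero τ k hv).2)
    (sub a1 b1) (traj_sum τ k).2 hsum, bary_edge 𝔇 hab hx, bary_edge 𝔇 hab hx] at ht
  have va : (Pi.single a 1 - Pi.single b 1 : V → ℝ) a = 1 := by simp [hab]
  have vb : (Pi.single a 1 - Pi.single b 1 : V → ℝ) b = -1 := by simp [hab.symm]
  rw [va, vb, ← 𝔇.agree _ (τ.face_mem k) _ (τ.face_mem (k + 1)) a b hab a1 b1 a2 b2,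
    ← 𝔇.agree _ (τ.face_mem k) _ (τ.face_mem (k + 1)) b a hab.symm b1 a1 b2 a2] at ht
  simp only at ht
  linarith

end

lemma vec_solve {d u w : Pt} (hd : d.1 ^ 2 + d.2 ^ 2 ≠ 0)
    (h1 : u.1 * d.1 + u.2 * d.2 = w.1 * d.1 + w.2 * d.2)
    (h2 : u.1 * d.2 - u.2 * d.1 = w.1 * d.2 - w.2 * d.1) : u = w := by
  ext
  · apply mul_left_cancel₀ hd
    linear_combination d.1 * h1 + d.2 * h2
  · apply mul_left_cancel₀ hd
    linear_combination d.2 * h1 - d.1 * h2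

/-- At an edge the normal velocity is known only up to sign. The sign comes from the sides on which
the old and the new triangle lie. -/
lemma sq_eq_of_sign {x y s t : ℝ} (hs : 0 < s) (ht : 0 < t) {p q : ℝ} (hp : s * p = x)
    (hq : t * q = y) (hpq : 0 < p * q) (h : x ^ 2 = y ^ 2) : x = y := by
  rcases sq_eq_sq_iff_eq_or_eq_neg.1 h with h | h
  · exact h
  · exfalso
    have : x * y > 0 := by
      rw [← hp, ← hq]
      have := mul_pos (mul_pos hs ht) hpq
      linarith [this, (by ring : s * p * (t * q) = s * t * (p * q))]
    rw [h] at this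
    nlinarith [sq_nonneg y]

end Billiard

namespace Billiard
open Finset
open GeneralizedPolygon
variable {V : Type*} [Fintype V] [DecidableEq V]
variable {P : GeneralizedPolygon V} (𝔇 : Dev P) (τ : P.ForwardTrajectory)

/-! ### The functional of a trajectory at an edge -/

lemma lineFn_add_smul (u z : Pt) (t : ℝ) : lineFn u (z + t • u) = lineFn u z := by
  refine Prod.ext rfl (Prod.ext rfl ?_)
  simp [lineFn]; ring

lemma trajFn_eq (k : ℕ) : trajFn 𝔇 τ k =
    lineFn (bary 𝔇 (τ.face k) (τ.vel k)) (bary 𝔇 (τ.face k) (τ.pos (k + 1))) := by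
  rw [trajFn, traj_pos_succ_face, lineFn_add_smul]

lemma traj_face_eq (k : ℕ) {a b : V} (hab : a ≠ b) (he : τ.edge k = {a, b}) :
    ∃ c, a ≠ c ∧ b ≠ c ∧ τ.face k = {a, b, c} := by
  have h1 := τ.edge_subset k
  rw [he] at h1
  obtain ⟨c, h2, h3, h4⟩ := exists_apex (τ.face_mem k) (h1 (by simp : a ∈ _)) (h1 (by simp : b ∈ _))
    hab
  exact ⟨c, Ne.symm h2, Ne.symm h3, h4⟩

lemma traj_face_succ_eq (k : ℕ) {a b : V} (hab : a ≠ b) (he : τ.edge k = {a, b}) :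
    ∃ c, a ≠ c ∧ b ≠ c ∧ τ.face (k + 1) = {a, b, c} := by
  have h1 := τ.edge_subset_succ k
  rw [he] at h1
  obtain ⟨c, h2, h3, h4⟩ := exists_apex (τ.face_mem (k + 1)) (h1 (by simp : a ∈ _))
    (h1 (by simp : b ∈ _)) hab
  exact ⟨c, Ne.symm h2, Ne.symm h3, h4⟩

/-- Unit speed together with the preserved tangential component leaves only the square of the normal
component. -/
lemma traj_normal_sq (k : ℕ) {a b : V} (hab : a ≠ b) (he : τ.edge k = {a, b}) :
    ((bary 𝔇 (τ.face (k + 1)) (τ.vel (k + 1))).1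
        * ((𝔇.D (τ.face k) b).2 - (𝔇.D (τ.face k) a).2)
      - (bary 𝔇 (τ.face (k + 1)) (τ.vel (k + 1))).2
        * ((𝔇.D (τ.face k) b).1 - (𝔇.D (τ.face k) a).1)) ^ 2
    = ((bary 𝔇 (τ.face k) (τ.vel k)).1 * ((𝔇.D (τ.face k) b).2 - (𝔇.D (τ.face k) a).2)
      - (bary 𝔇 (τ.face k) (τ.vel k)).2 * ((𝔇.D (τ.face k) b).1 - (𝔇.D (τ.face k) a).1)) ^ 2 := by
  have h1 := traj_tangential 𝔇 τ k hab he
  have h2 := traj_unit 𝔇 τ k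
  have h3 := traj_unit 𝔇 τ (k + 1)
  set u := bary 𝔇 (τ.face (k + 1)) (τ.vel (k + 1))
  set w := bary 𝔇 (τ.face k) (τ.vel k)
  set p := 𝔇.D (τ.face k) a
  set q := 𝔇.D (τ.face k) b
  have e : ∀ x : Pt, (x.1 * (q.2 - p.2) - x.2 * (q.1 - p.1)) ^ 2 =
    (x.1 * x.1 + x.2 * x.2) * ((q.1 - p.1) ^ 2 + (q.2 - p.2) ^ 2)
     - (x.1 * (p.1 - q.1) + x.2 * (p.2 - q.2)) ^ 2 := by intro x; ring
  rw [e u, e w, h1, h2, h3]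

lemma dsq_ne {p q : Pt} (h : p ≠ q) : (q.1 - p.1) ^ 2 + (q.2 - p.2) ^ 2 ≠ 0 := by
  have := sqd_ne h
  unfold sqd at this
  intro h'
  apply this
  linarith [(by ring : (p.1 - q.1) ^ 2 + (p.2 - q.2) ^ 2 = (q.1 - p.1) ^ 2 + (q.2 - p.2) ^ 2)]

/-- The two triangles are on opposite sides of the edge, so leaving the one and entering the other
give the normal component the same sign, and the velocity does not change. -/
lemma trajFn_interior (k : ℕ) (hb : ¬ P.IsBoundaryEdge (τ.edge k)) :
    trajFn 𝔇 τ (k + 1) = trajFn 𝔇 τ k := by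
  obtain ⟨a, b, hab, he⟩ := Finset.card_eq_two.1 (τ.edge_card k)
  obtain ⟨c, hac, hbc, hf⟩ := traj_face_eq τ k hab he
  obtain ⟨c', hac', hbc', hf'⟩ := traj_face_succ_eq τ k hab he
  obtain ⟨s, hs, h1⟩ := traj_exit 𝔇 τ k hab hac hbc hf he
  obtain ⟨t, ht, h2⟩ := traj_entry 𝔇 τ k hab hac' hbc' hf' he
  have hne : τ.face (k + 1) ≠ τ.face k := fun h => hb ((τ.face_succ k).1 h)
  have a1 : a ∈ τ.face k := by rw [hf]; simp
  have b1 : b ∈ τ.face k := by rw [hf]; simp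
  have a2 : a ∈ τ.face (k + 1) := by rw [hf']; simp
  have b2 : b ∈ τ.face (k + 1) := by rw [hf']; simp
  have hopp := 𝔇.opp _ (τ.face_mem k) _ (τ.face_mem (k + 1)) a b c c' hab a1 b1 a2 b2 hne.symm
    (by rw [hf]; simp) hac.symm hbc.symm (by rw [hf']; simp) hac'.symm hbc'.symm
  have ea := 𝔇.agree _ (τ.face_mem k) _ (τ.face_mem (k + 1)) a b hab a1 b1 a2 b2
  have eb := 𝔇.agree _ (τ.face_mem k) _ (τ.face_mem (k + 1)) b a hab.symm b1 a1 b2 a2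
  have hn := traj_normal_sq 𝔇 τ k hab he
  have htan := traj_tangential 𝔇 τ k hab he
  rw [← ea, ← eb] at h2 hopp
  have hu : bary 𝔇 (τ.face (k + 1)) (τ.vel (k + 1)) = bary 𝔇 (τ.face k) (τ.vel k) := by
    refine vec_solve (d := 𝔇.D (τ.face k) b - 𝔇.D (τ.face k) a)
      (dsq_ne (𝔇.D_ne (τ.face_mem k) a1 b1 hab)) ?_ ?_
    · simp only [Prod.fst_sub, Prod.snd_sub]; linarith
    · refine sq_eq_of_sign ht hs (p := - cr (𝔇.D (τ.face k) a) (𝔇.D (τ.face k) b)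
        (𝔇.D (τ.face (k + 1)) c')) ?_ h1 ?_ hn
      · rw [mul_neg, h2]; simp
      · linarith [mul_comm (cr (𝔇.D (τ.face k) a) (𝔇.D (τ.face k) b)
          (𝔇.D (τ.face (k + 1)) c')) (cr (𝔇.D (τ.face k) a) (𝔇.D (τ.face k) b)
          (𝔇.D (τ.face k) c))]
  rw [trajFn_eq 𝔇 τ k, trajFn, hu, traj_bary_succ]

/-- Leaving and entering the same triangle reverses the normal component. The minus sign appears
because a reflection exchanges the left and the right of an oriented line; it is absorbed by
`trajOr`. -/
lemma trajFn_boundary (k : ℕ) (hb : P.IsBoundaryEdge (τ.edge k)) {a b : V} (hab : a ≠ b)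
    (he : τ.edge k = {a, b}) :
    trajFn 𝔇 τ (k + 1) = - pull (𝔇.D (τ.face k) a) (𝔇.D (τ.face k) b) (trajFn 𝔇 τ k) := by
  obtain ⟨c, hac, hbc, hf⟩ := traj_face_eq τ k hab he
  have hff := (τ.face_succ k).2 hb
  obtain ⟨s, hs, h1⟩ := traj_exit 𝔇 τ k hab hac hbc hf he
  obtain ⟨t, ht, h2⟩ := traj_entry 𝔇 τ k hab hac hbc (hff.trans hf) he
  have a1 : a ∈ τ.face k := by rw [hf]; simp
  have b1 : b ∈ τ.face k := by rw [hf]; simp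
  have hn := traj_normal_sq 𝔇 τ k hab he
  have htan := traj_tangential 𝔇 τ k hab he
  have hz := traj_bary_succ 𝔇 τ k
  have hnd := 𝔇.nondeg (τ.face_mem k) a1 b1 (by rw [hf]; simp : c ∈ _) hab hbc hac
  have hd := dsq_ne (𝔇.D_ne (τ.face_mem k) a1 b1 hab)
  have hh := (τ.edge_hit k)
  rw [he] at hh
  have hzz := bary_edge 𝔇 (t := τ.face k) hab hh.2.1
  have h3 : τ.pos (k + 1) a + τ.pos (k + 1) b = 1 := by rw [← sum_two hab hh.2.1, hh.2.2]
  have h4 : τ.pos (k + 1) a = 1 - τ.pos (k + 1) b := by linarith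
  rw [h4] at hzz
  rw [trajFn_eq 𝔇 τ k, trajFn, hz]
  rw [hff] at h2 hn htan ⊢
  set u := bary 𝔇 (τ.face k) (τ.vel (k + 1))
  set w := bary 𝔇 (τ.face k) (τ.vel k)
  set p := 𝔇.D (τ.face k) a
  set q := 𝔇.D (τ.face k) b
  set z := bary 𝔇 (τ.face k) (τ.pos (k + 1))
  have hnor : u.1 * (q.2 - p.2) - u.2 * (q.1 - p.1) = - (w.1 * (q.2 - p.2) - w.2 * (q.1 - p.1)) := by
    refine sq_eq_of_sign ht hs (p := - cr p q (𝔇.D (τ.face k) c))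
      (q := - cr p q (𝔇.D (τ.face k) c)) ?_ ?_ ?_ ?_
    · rw [mul_neg, h2]; ring
    · rw [mul_neg, h1]
    · rw [neg_mul_neg]; exact mul_self_pos.2 hnd
    · rw [hn]; ring
  have hsq : sqd p q = (q.1 - p.1) ^ 2 + (q.2 - p.2) ^ 2 := by unfold sqd; ring
  have hu1 : u.1 = 2 * (w.1 * (q.1 - p.1) + w.2 * (q.2 - p.2)) / sqd p q * (q.1 - p.1) - w.1 := by
    rw [hsq]; field_simp
    linear_combination (q.2 - p.2) * hnor - (q.1 - p.1) * htan
  have hu2 : u.2 = 2 * (w.1 * (q.1 - p.1) + w.2 * (q.2 - p.2)) / sqd p q * (q.2 - p.2) - w.2 := by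
    rw [hsq]; field_simp
    linear_combination -(q.1 - p.1) * hnor - (q.2 - p.2) * htan
  rw [hsq] at hu1 hu2
  have hz1 : z.1 = p.1 + τ.pos (k + 1) b * (q.1 - p.1) := by rw [hzz]; ring
  have hz2 : z.2 = p.2 + τ.pos (k + 1) b * (q.2 - p.2) := by rw [hzz]; ring
  refine Prod.ext ?_ (Prod.ext ?_ ?_)
  · simp only [lineFn, pull, Prod.fst_neg, hsq, hu2]
    field_simp
    ring
  · simp only [lineFn, pull, Prod.fst_neg, Prod.snd_neg, hsq, hu1]
    field_simp
    ring
  · simp only [lineFn, pull, Prod.snd_neg, hsq, hu1, hu2, hz1, hz2]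
    field_simp
    ring

open Classical in
/-- The orientation of the unfolded triangle at the `k`-th step. -/
noncomputable def trajOr : ℕ → Bool
  | 0 => true
  | k + 1 => if P.IsBoundaryEdge (τ.edge k) then !trajOr k else trajOr k

/-- For either order of the two ends the signs follow from the sign of the normal velocity, and
exchanging the ends reverses that sign, so one of the two orders is correct. -/
lemma traj_state (k : ℕ) : ∃ l r, l ≠ r ∧ τ.edge k = {l, r} ∧
    0 < sg (trajOr τ k) * ev (trajFn 𝔇 τ k) (𝔇.D (τ.face k) l) ∧
    sg (trajOr τ k) * ev (trajFn 𝔇 τ k) (𝔇.D (τ.face k) r) < 0 ∧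
    VInv 𝔇 ⟨τ.face k, l, r, trajOr τ k⟩ := by
  have main : ∀ a b, a ≠ b → τ.edge k = {a, b} → (bary 𝔇 (τ.face k) (τ.vel k)).1
      * ((𝔇.D (τ.face k) b).2 - (𝔇.D (τ.face k) a).2)
      - (bary 𝔇 (τ.face k) (τ.vel k)).2 * ((𝔇.D (τ.face k) b).1 - (𝔇.D (τ.face k) a).1) ≠ 0 ∧
      (sg (trajOr τ k) * ((bary 𝔇 (τ.face k) (τ.vel k)).1
      * ((𝔇.D (τ.face k) b).2 - (𝔇.D (τ.face k) a).2)
      - (bary 𝔇 (τ.face k) (τ.vel k)).2 * ((𝔇.D (τ.face k) b).1 - (𝔇.D (τ.face k) a).1)) < 0 →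
    0 < sg (trajOr τ k) * ev (trajFn 𝔇 τ k) (𝔇.D (τ.face k) a) ∧
    sg (trajOr τ k) * ev (trajFn 𝔇 τ k) (𝔇.D (τ.face k) b) < 0 ∧
    VInv 𝔇 ⟨τ.face k, a, b, trajOr τ k⟩) := by
    intro a b hab he
    obtain ⟨c, hac, hbc, hf⟩ := traj_face_eq τ k hab he
    obtain ⟨s, hs, h1⟩ := traj_exit 𝔇 τ k hab hac hbc hf he
    have a1 : a ∈ τ.face k := by rw [hf]; simp
    have b1 : b ∈ τ.face k := by rw [hf]; simp
    have hnd := 𝔇.nondeg (τ.face_mem k) a1 b1 (by rw [hf]; simp : c ∈ _) hab hbc hac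
    have hh := (τ.edge_hit k)
    rw [he] at hh
    have hzz := bary_edge 𝔇 (t := τ.face k) hab hh.2.1
    have h3 : τ.pos (k + 1) a + τ.pos (k + 1) b = 1 := by rw [← sum_two hab hh.2.1, hh.2.2]
    have pa := hh.1 a (by simp)
    have pb := hh.1 b (by simp)
    have h4 : τ.pos (k + 1) a = 1 - τ.pos (k + 1) b := by linarith
    rw [h4] at hzz pa
    refine ⟨by rw [← h1]; exact mul_ne_zero hs.ne' hnd, fun hneg => ?_⟩
    rw [trajFn_eq, ev_lineFn, ev_lineFn, hzz]
    set w := bary 𝔇 (τ.face k) (τ.vel k)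
    set p := 𝔇.D (τ.face k) a
    set q := 𝔇.D (τ.face k) b
    set x := τ.pos (k + 1) b
    refine ⟨?_, ?_, τ.face_mem k, a1, b1, hab, ?_⟩
    · have := mul_pos_of_neg_of_neg hneg (neg_lt_zero.2 pb)
      linarith [this, (by ring : sg (trajOr τ k) * (w.1 * (q.2 - p.2) - w.2 * (q.1 - p.1)) * -x =
        sg (trajOr τ k) * (w.1 * (p.2 - ((1 - x) * p.2 + x * q.2)) -
          w.2 * (p.1 - ((1 - x) * p.1 + x * q.1))))]
    · have := mul_neg_of_neg_of_pos hneg pa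
      linarith [this, (by ring : sg (trajOr τ k) * (w.1 * (q.2 - p.2) - w.2 * (q.1 - p.1)) * (1 - x) =
        sg (trajOr τ k) * (w.1 * (q.2 - ((1 - x) * p.2 + x * q.2)) -
          w.2 * (q.1 - ((1 - x) * p.1 + x * q.1))))]
    · intro d hd h5 h6
      simp only at hd h5 h6 ⊢
      have : d = c := by
        rw [hf] at hd
        simp only [Finset.mem_insert, Finset.mem_singleton] at hd
        tauto
      rw [this]
      by_contra hcon
      rw [← h1] at hneg
      have := mul_nonneg hs.le (not_lt.1 hcon)
      linarith [(by ring : s * (sg (trajOr τ k) * cr p q (𝔇.D (τ.face k) c)) =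
        sg (trajOr τ k) * (s * cr p q (𝔇.D (τ.face k) c)))]
  obtain ⟨a, b, hab, he⟩ := Finset.card_eq_two.1 (τ.edge_card k)
  have h1 := main a b hab he
  rcases lt_or_gt_of_ne (mul_ne_zero (sg_ne (trajOr τ k)) h1.1) with h | h
  · exact ⟨a, b, hab, he, h1.2 h⟩
  · have he' : τ.edge k = {b, a} := he.trans (Finset.pair_comm a b)
    refine ⟨b, a, hab.symm, he', (main b a hab.symm he').2 ?_⟩
    linarith [(by ring : sg (trajOr τ k) * ((bary 𝔇 (τ.face k) (τ.vel k)).1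
      * ((𝔇.D (τ.face k) b).2 - (𝔇.D (τ.face k) a).2)
      - (bary 𝔇 (τ.face k) (τ.vel k)).2 * ((𝔇.D (τ.face k) b).1 - (𝔇.D (τ.face k) a).1)) =
      - (sg (trajOr τ k) * ((bary 𝔇 (τ.face k) (τ.vel k)).1
      * ((𝔇.D (τ.face k) a).2 - (𝔇.D (τ.face k) b).2)
      - (bary 𝔇 (τ.face k) (τ.vel k)).2 * ((𝔇.D (τ.face k) a).1 - (𝔇.D (τ.face k) b).1))))]

/-- Otherwise the apex coordinate vanishes at both ends of the step, hence throughout, although the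
path runs in the open triangle. -/
lemma traj_edge_ne (k : ℕ) : τ.edge (k + 1) ≠ τ.edge k := by
  intro h
  obtain ⟨a, b, hab, he⟩ := Finset.card_eq_two.1 (τ.edge_card k)
  obtain ⟨c, hac, hbc, hf⟩ := traj_face_succ_eq τ k hab he
  have h1 := (τ.edge_hit k).2.1 c (by rw [he]; simp [hac.symm, hbc.symm])
  have h2 := (τ.edge_hit (k + 1)).2.1 c (by rw [h, he]; simp [hac.symm, hbc.symm])
  have hT := τ.time_pos (k + 1)
  have h3 := (τ.straight (k + 1) (τ.time (k + 1) / 2) (by linarith) (by linarith)).1 c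
    (by rw [hf]; simp)
  rw [τ.pos_succ] at h2
  simp only [Pi.add_apply, Pi.smul_apply, smul_eq_mul, h1, zero_add] at h2 h3
  rcases mul_eq_zero.1 h2 with h | h
  · linarith
  · rw [h] at h3; linarith

/-- A trajectory gives an orbit that crosses the same edges. -/
theorem exists_orbit_of_trajectory : ∃ c ψ, IsOrbit 𝔇 c ψ ∧ ∀ k, (c k).face = τ.face k ∧
    (c k).edge = τ.edge k := by
  choose l r hlr he hl hr hv using traj_state 𝔇 τ
  set c : ℕ → CState V := fun k => ⟨τ.face k, l k, r k, trajOr τ k⟩ with hc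
  have hedge : ∀ k, (c k).edge = τ.edge k := fun k => (he k).symm
  have htr : ∀ k, transp 𝔇 c (trajFn 𝔇 τ 0) k = sg (trajOr τ k) • trajFn 𝔇 τ k := by
    intro k
    induction k with
    | zero => simp [transp, trajOr, sg]
    | succ k ih =>
      rw [transp, ih, refr, hedge]
      by_cases hb : P.IsBoundaryEdge (τ.edge k)
      · rw [if_pos hb, trajFn_boundary 𝔇 τ k hb (hlr k) (he k), pull_smul, trajOr, if_pos hb, sg_not]
        simp [hc]
      · rw [if_neg hb, trajFn_interior 𝔇 τ k hb, trajOr, if_neg hb]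
  have hsep : ∀ k, Sep 𝔇 (transp 𝔇 c (trajFn 𝔇 τ 0) k) (c k) := by
    intro k
    rw [htr, Sep, ev_smul, ev_smul]
    exact ⟨hl k, hr k⟩
  refine ⟨c, trajFn 𝔇 τ 0, ⟨hv, fun k => ?_, ?_, hsep⟩, fun k => ⟨rfl, hedge k⟩⟩
  · have h1 := τ.edge_subset_succ k
    rw [he k] at h1
    have l2 : l k ∈ τ.face (k + 1) := h1 (by simp)
    have r2 : r k ∈ τ.face (k + 1) := h1 (by simp)
    refine ⟨fun hb => ?_, fun hb => ?_, l2, r2, ?_⟩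
    · rw [hedge] at hb
      exact ⟨(τ.face_succ k).2 hb, by simp [hc, trajOr, hb]⟩
    · rw [hedge] at hb
      exact ⟨fun h => hb ((τ.face_succ k).1 h), by simp [hc, trajOr, hb]⟩
    · have ea := 𝔇.agree _ (τ.face_mem k) _ (τ.face_mem (k + 1)) (l k) (r k) (hlr k)
        (hv k).l_mem (hv k).r_mem l2 r2
      have eb := 𝔇.agree _ (τ.face_mem k) _ (τ.face_mem (k + 1)) (r k) (l k) (hlr k).symm
        (hv k).r_mem (hv k).l_mem r2 l2
      have sl : 0 < ev (transp 𝔇 c (trajFn 𝔇 τ 0) (k + 1)) (𝔇.D (τ.face (k + 1)) (l k)) := by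
        rw [← ea, transp]
        have := ev_refr_l (𝔇 := 𝔇) (s := c k) (transp 𝔇 c (trajFn 𝔇 τ 0) k)
        simp only [hc] at this
        rw [this]; exact (hsep k).1
      have sr : ev (transp 𝔇 c (trajFn 𝔇 τ 0) (k + 1)) (𝔇.D (τ.face (k + 1)) (r k)) < 0 := by
        rw [← eb, transp]
        have := ev_refr_r (hv k) (transp 𝔇 c (trajFn 𝔇 τ 0) k)
        simp only at this
        rw [this]; exact (hsep k).2
      have s1 := hsep (k + 1)
      simp only [Sep, hc] at s1
      obtain ⟨d, hd1, hd2, hd3⟩ := exists_apex (τ.face_mem (k + 1)) l2 r2 (hlr k)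
      have m1 := (hv (k + 1)).l_mem
      have m2 := (hv (k + 1)).r_mem
      simp only [hd3, Finset.mem_insert, Finset.mem_singleton] at m1 m2
      -- The signs at the old ends survive the change of the functional, so a left end cannot become
      -- a right end. As the two exit edges differ, exactly one end is kept.
      have n1 : l (k + 1) ≠ r k := fun h => by
        have := s1.1; rw [h] at this; linarith
      have n2 : r (k + 1) ≠ l k := fun h => by
        have := s1.2; rw [h] at this; linarith
      have n3 := hlr (k + 1)
      have n4 : ¬ (l (k + 1) = l k ∧ r (k + 1) = r k) := by
        rintro ⟨h1, h2⟩
        apply traj_edge_ne τ k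
        rw [he, he, h1, h2]
      simp only [hc]
      rcases m1 with m1 | m1 | m1
      · left; exact ⟨m1, fun h => n4 ⟨m1, h⟩⟩
      · exact absurd m1 n1
      · right
        rcases m2 with m2 | m2 | m2
        · exact absurd m2 n2
        · exact ⟨m2, fun h => n4 ⟨h, m2⟩⟩
        · exact absurd (m1.trans m2.symm) n3
  · rw [trajFn, gsq_lineFn, traj_unit]

end Billiard

namespace Billiard
open Finset
open GeneralizedPolygon
variable {V : Type*} [Fintype V] [DecidableEq V]
variable {P : GeneralizedPolygon V} {𝔇 : Dev P}

/-! ### Crossing points -/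

/-- The zero of `φ` on the line through `A` and `B`. -/
noncomputable def cpt (φ : Fn) (A B : Pt) : Pt :=
  ((ev φ A * B.1 - ev φ B * A.1) / (ev φ A - ev φ B),
   (ev φ A * B.2 - ev φ B * A.2) / (ev φ A - ev φ B))

/-- The unit direction of travel along the zero set of `φ`. -/
def dir (b : Bool) (φ : Fn) : Pt := (sg b * φ.2.1, - (sg b * φ.1))

lemma dir_unit (b : Bool) {φ : Fn} (h : gsq φ = 1) :
    (dir b φ).1 ^ 2 + (dir b φ).2 ^ 2 = 1 := by
  have := sg_sq b
  unfold gsq at h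
  simp only [dir]
  linear_combination (φ.1 ^ 2 + φ.2.1 ^ 2) * this + h

lemma cpt_combo {φ : Fn} {A B : Pt} (h : ev φ A - ev φ B ≠ 0) :
    cpt φ A B = (-ev φ B / (ev φ A - ev φ B)) • A + (ev φ A / (ev φ A - ev φ B)) • B := by
  ext <;> simp only [cpt, Prod.fst_add, Prod.snd_add, Prod.smul_fst, Prod.smul_snd, smul_eq_mul]
    <;> field_simp <;> ring

lemma ev_cpt {φ : Fn} {A B : Pt} (h : ev φ A - ev φ B ≠ 0) : ev φ (cpt φ A B) = 0 := by
  rw [cpt_combo h, ev_combo _ _ _ (by field_simp; ring)]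
  field_simp; ring

/-- Two zeros of a unit functional differ by a multiple of the direction. -/
lemma zero_diff (b : Bool) {φ : Fn} (h : gsq φ = 1) {X Y : Pt} (hX : ev φ X = 0)
    (hY : ev φ Y = 0) :
    Y = X + ((dir b φ).1 * (Y.1 - X.1) + (dir b φ).2 * (Y.2 - X.2)) • dir b φ := by
  have h1 := sg_sq b
  unfold gsq at h
  unfold ev at hX hY
  have hd : φ.1 * (Y.1 - X.1) + φ.2.1 * (Y.2 - X.2) = 0 := by linarith
  ext
  · simp only [dir, Prod.fst_add, Prod.smul_fst, smul_eq_mul]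
    linear_combination -(φ.2.1 * (φ.2.1 * (Y.1 - X.1) - φ.1 * (Y.2 - X.2))) * h1
      - (Y.1 - X.1) * h + φ.1 * hd
  · simp only [dir, Prod.snd_add, Prod.smul_snd, smul_eq_mul]
    linear_combination (φ.1 * (φ.2.1 * (Y.1 - X.1) - φ.1 * (Y.2 - X.2))) * h1
      - (Y.2 - X.2) * h + φ.2.1 * hd

/-- Since `dir` is the gradient turned by a right angle, its component across `AB` is the difference
of the values of `φ`. -/
lemma cr_add_smul_dir (b : Bool) (φ : Fn) (A B X : Pt) (T : ℝ) :
    sg b * cr A B (X + T • dir b φ) = sg b * cr A B X + T * (ev φ A - ev φ B) := by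
  have h1 := sg_sq b
  simp only [cr, ev, dir, Prod.fst_add, Prod.snd_add, Prod.smul_fst, Prod.smul_snd, smul_eq_mul]
  linear_combination (-(T * ((B.1 - A.1) * φ.1 + (B.2 - A.2) * φ.2.1))) * h1

lemma cr_cpt {φ : Fn} {A B : Pt} (h : ev φ A - ev φ B ≠ 0) : cr A B (cpt φ A B) = 0 := by
  simp only [cr, cpt]
  field_simp
  ring

lemma cr_combo (A B X Y : Pt) (s t : ℝ) (h : s + t = 1) :
    cr A B (s • X + t • Y) = s * cr A B X + t * cr A B Y := by
  have : s = 1 - t := by linarith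
  subst this
  simp [cr]; ring

/-- The apex of the next triangle. -/
lemma CStep.mem_cases {s s' : CState V} (h : CStep P s s') (hs : VInv 𝔇 s) (hs' : VInv 𝔇 s') :
    (s'.l = s.l ∧ s'.r ≠ s.r ∧ s'.r ≠ s.l ∧ s'.face = {s.l, s.r, s'.r}) ∨
    (s'.r = s.r ∧ s'.l ≠ s.l ∧ s'.l ≠ s.r ∧ s'.face = {s.l, s.r, s'.l}) := by
  obtain ⟨d, h1, h2, h3⟩ := Billiard.exists_apex hs'.face_mem h.l_mem h.r_mem hs.ne
  rcases h.turn with ⟨t1, t2⟩ | ⟨t1, t2⟩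
  · left
    have n : s'.r ≠ s.l := fun h => hs'.ne (t1.trans h.symm)
    refine ⟨t1, t2, n, ?_⟩
    have hm := hs'.r_mem
    simp only [h3, Finset.mem_insert, Finset.mem_singleton] at hm
    rcases hm with hm | hm | hm
    · exact absurd hm n
    · exact absurd hm t2
    · rw [h3, hm]
  · right
    have n : s'.l ≠ s.r := fun h => hs'.ne (h.trans t1.symm)
    refine ⟨t1, t2, n, ?_⟩
    have hm := hs'.l_mem
    simp only [h3, Finset.mem_insert, Finset.mem_singleton] at hm
    rcases hm with hm | hm | hm
    · exact absurd hm t2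
    · exact absurd hm n
    · rw [h3, hm]

/-- The crossing point advances. -/
lemma advance {s s' : CState V} (h : CStep P s s') (hs : VInv 𝔇 s) (hs' : VInv 𝔇 s') {φ : Fn}
    (hφ : gsq φ = 1) (hl : 0 < ev φ (𝔇.D s'.face s.l)) (hr : ev φ (𝔇.D s'.face s.r) < 0)
    (hS : Sep 𝔇 φ s') :
    ∃ T : ℝ, 0 < T ∧ cpt φ (𝔇.D s'.face s'.l) (𝔇.D s'.face s'.r)
        = cpt φ (𝔇.D s'.face s.l) (𝔇.D s'.face s.r) + T • dir s'.ε φ ∧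
      T * (ev φ (𝔇.D s'.face s.l) - ev φ (𝔇.D s'.face s.r)) =
        sg s'.ε * cr (𝔇.D s'.face s.l) (𝔇.D s'.face s.r)
          (cpt φ (𝔇.D s'.face s'.l) (𝔇.D s'.face s'.r)) := by
  have hd : ev φ (𝔇.D s'.face s.l) - ev φ (𝔇.D s'.face s.r) ≠ 0 := by linarith
  have hd' : ev φ (𝔇.D s'.face s'.l) - ev φ (𝔇.D s'.face s'.r) ≠ 0 := by linarith [hS.1, hS.2]
  have e1 := zero_diff s'.ε hφ (ev_cpt hd) (ev_cpt hd')
  set T := (dir s'.ε φ).1 * ((cpt φ (𝔇.D s'.face s'.l) (𝔇.D s'.face s'.r)).1 -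
    (cpt φ (𝔇.D s'.face s.l) (𝔇.D s'.face s.r)).1) + (dir s'.ε φ).2 *
    ((cpt φ (𝔇.D s'.face s'.l) (𝔇.D s'.face s'.r)).2 -
    (cpt φ (𝔇.D s'.face s.l) (𝔇.D s'.face s.r)).2) with hT
  have e2 : T * (ev φ (𝔇.D s'.face s.l) - ev φ (𝔇.D s'.face s.r)) =
        sg s'.ε * cr (𝔇.D s'.face s.l) (𝔇.D s'.face s.r)
          (cpt φ (𝔇.D s'.face s'.l) (𝔇.D s'.face s'.r)) := by
    rw [e1, cr_add_smul_dir, cr_cpt hd]; ring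
  refine ⟨T, ?_, e1, e2⟩
  -- The new crossing point has positive weight at the apex, and the apex is ahead of the old edge.
  have hpos : 0 < sg s'.ε * cr (𝔇.D s'.face s.l) (𝔇.D s'.face s.r)
          (cpt φ (𝔇.D s'.face s'.l) (𝔇.D s'.face s'.r)) := by
    have hdp : 0 < ev φ (𝔇.D s'.face s'.l) - ev φ (𝔇.D s'.face s'.r) := by linarith [hS.1, hS.2]
    rw [cpt_combo hd', cr_combo _ _ _ _ _ _ (by field_simp; ring)]
    rcases h.mem_cases hs hs' with ⟨t1, t2, t3, t4⟩ | ⟨t1, t2, t3, t4⟩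
    · have hc := h.ahead hs hs' hs'.r_mem t3 t2
      rw [t1]
      have : cr (𝔇.D s'.face s.l) (𝔇.D s'.face s.r) (𝔇.D s'.face s.l) = 0 := by unfold cr; ring
      rw [this, mul_zero, zero_add, mul_left_comm]
      rw [t1] at hdp
      exact mul_pos (div_pos hl hdp) hc
    · have hc := h.ahead hs hs' hs'.l_mem t2 t3
      rw [t1]
      have : cr (𝔇.D s'.face s.l) (𝔇.D s'.face s.r) (𝔇.D s'.face s.r) = 0 := by unfold cr; ring
      rw [this, mul_zero, add_zero, mul_left_comm]
      rw [t1] at hdp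
      exact mul_pos (div_pos (by linarith) hdp) hc
  rw [← e2] at hpos
  exact pos_of_mul_pos_left hpos (by linarith)

/-! ### From orbits to trajectories -/

/-- Barycentric coordinates of the crossing point. -/
noncomputable def crossW (𝔇 : Dev P) (φ : Fn) (s : CState V) (v : V) : ℝ :=
  if v = s.l then
    -ev φ (𝔇.D s.face s.r) / (ev φ (𝔇.D s.face s.l) - ev φ (𝔇.D s.face s.r))
  else if v = s.r then
    ev φ (𝔇.D s.face s.l) / (ev φ (𝔇.D s.face s.l) - ev φ (𝔇.D s.face s.r))
  else 0

lemma crossW_inOpen {φ : Fn} {s : CState V} (hs : VInv 𝔇 s) (hS : Sep 𝔇 φ s) :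
    InOpenSimplex s.edge (crossW 𝔇 φ s) := by
  have h1 := hS.1
  have h2 := hS.2
  have hd : 0 < ev φ (𝔇.D s.face s.l) - ev φ (𝔇.D s.face s.r) := by linarith
  have hz : ∀ v, v ∉ ({s.l, s.r} : Finset V) → crossW 𝔇 φ s v = 0 := by
    intro v hv
    simp only [Finset.mem_insert, Finset.mem_singleton, not_or] at hv
    simp [crossW, hv.1, hv.2]
  refine ⟨fun v hv => ?_, hz, ?_⟩
  · simp only [CState.edge, Finset.mem_insert, Finset.mem_singleton] at hv
    rcases hv with rfl | rfl
    · simp only [crossW, if_true]; exact div_pos (by linarith) hd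
    · simp only [crossW, if_true, if_neg hs.ne.symm]; exact div_pos (by linarith) hd
  · rw [sum_two hs.ne hz]
    simp only [crossW, if_true, if_neg hs.ne.symm]
    field_simp; ring

lemma bary_crossW {φ : Fn} {s : CState V} (hs : VInv 𝔇 s) (hS : Sep 𝔇 φ s) {t : Finset V}
    (hl : 𝔇.D t s.l = 𝔇.D s.face s.l) (hr : 𝔇.D t s.r = 𝔇.D s.face s.r) :
    bary 𝔇 t (crossW 𝔇 φ s) = cpt φ (𝔇.D s.face s.l) (𝔇.D s.face s.r) := by
  have hd : ev φ (𝔇.D s.face s.l) - ev φ (𝔇.D s.face s.r) ≠ 0 := by linarith [hS.1, hS.2]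
  rw [bary_edge 𝔇 hs.ne (crossW_inOpen hs hS).2.1, cpt_combo hd, hl, hr]
  ext <;> simp [crossW, hs.ne.symm]

/-- Barycentric coordinates of a vector. -/
noncomputable def vecW (p : V → Pt) (a b c : V) (u : Pt) (v : V) : ℝ :=
  if v = a then ((p c).1 - (p b).1) * u.2 / cr (p a) (p b) (p c)
      - ((p c).2 - (p b).2) * u.1 / cr (p a) (p b) (p c)
  else if v = b then ((p a).1 - (p c).1) * u.2 / cr (p a) (p b) (p c)
      - ((p a).2 - (p c).2) * u.1 / cr (p a) (p b) (p c)
  else if v = c then ((p b).1 - (p a).1) * u.2 / cr (p a) (p b) (p c)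
      - ((p b).2 - (p a).2) * u.1 / cr (p a) (p b) (p c)
  else 0

lemma bary_vecW {t : Finset V} {a b c : V} (hab : a ≠ b) (hac : a ≠ c) (hbc : b ≠ c) (u : Pt)
    (hnd : cr (𝔇.D t a) (𝔇.D t b) (𝔇.D t c) ≠ 0) :
    bary 𝔇 t (vecW (𝔇.D t) a b c u) = u ∧ ∑ v, vecW (𝔇.D t) a b c u v = 0 ∧
      ∀ v, v ∉ ({a, b, c} : Finset V) → vecW (𝔇.D t) a b c u v = 0 := by
  have hz : ∀ v, v ∉ ({a, b, c} : Finset V) → vecW (𝔇.D t) a b c u v = 0 := by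
    intro v hv
    simp only [Finset.mem_insert, Finset.mem_singleton, not_or] at hv
    simp [vecW, hv.1, hv.2.1, hv.2.2]
  refine ⟨?_, ?_, hz⟩
  · rw [bary_tri 𝔇 hab hac hbc hz]
    simp only [vecW, if_true, if_neg hab.symm, if_neg hac.symm, if_neg hbc.symm]
    ext
    · simp only
      field_simp
      unfold cr; ring
    · simp only
      field_simp
      unfold cr; ring
  · rw [sum_three hab hac hbc hz]
    simp only [vecW, if_true, if_neg hab.symm, if_neg hac.symm, if_neg hbc.symm]
    field_simp
    ring

lemma dir_refr {s s' : CState V} (h : CStep P s s') (hs : VInv 𝔇 s) (φ : Fn) :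
    (dir s'.ε (refr 𝔇 s φ)).1 * ((𝔇.D s.face s.l).1 - (𝔇.D s.face s.r).1)
      + (dir s'.ε (refr 𝔇 s φ)).2 * ((𝔇.D s.face s.l).2 - (𝔇.D s.face s.r).2)
    = (dir s.ε φ).1 * ((𝔇.D s.face s.l).1 - (𝔇.D s.face s.r).1)
      + (dir s.ε φ).2 * ((𝔇.D s.face s.l).2 - (𝔇.D s.face s.r).2) := by
  unfold refr
  split_ifs with hb
  · rw [(h.bd hb).2]
    have h0 := sqd_ne hs.D_ne
    simp only [dir, sg_not, pull]
    field_simp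
    ring
  · rw [(h.int hb).2]

lemma inner_single {t : Finset V} (ht : t ∈ P.faces) {u : V → ℝ} (hu : ∀ v ∉ t, u v = 0)
    (hu0 : ∑ v, u v = 0) {a b : V} (ha : a ∈ t) (hb : b ∈ t) :
    P.tangentInner u (Pi.single a 1 - Pi.single b 1) =
      (bary 𝔇 t u).1 * ((𝔇.D t a).1 - (𝔇.D t b).1)
      + (bary 𝔇 t u).2 * ((𝔇.D t a).2 - (𝔇.D t b).2) := by
  rw [tangentInner_eq 𝔇 ht hu _ hu0 (by simp)]
  · have : bary 𝔇 t (Pi.single a 1 - Pi.single b 1) = 𝔇.D t a - 𝔇.D t b := by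
      ext <;> simp [bary, sub_mul, Finset.sum_sub_distrib, Pi.single_apply]
    rw [this]; rfl
  · intro v hv
    have h1 : v ≠ a := fun h => hv (h ▸ ha)
    have h2 : v ≠ b := fun h => hv (h ▸ hb)
    simp [h1, h2]

/-- An orbit gives a trajectory that crosses the same edges. -/
theorem exists_trajectory_of_orbit {c : ℕ → CState V} {ψ : Fn} (h : IsOrbit 𝔇 c ψ) :
    ∃ τ : P.ForwardTrajectory, ∀ k, τ.edge k = (c k).edge := by
  set φ : ℕ → Fn := transp 𝔇 c ψ with hφ
  have hu : ∀ k, gsq (φ k) = 1 := fun k => by rw [hφ, gsq_transp h.inv, h.unit]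
  set X : ℕ → V → ℝ := fun k => crossW 𝔇 (φ k) (c k) with hX
  have hXo : ∀ k, InOpenSimplex (c k).edge (X k) := fun k => crossW_inOpen (h.inv k) (h.sep k)
  have hXb : ∀ k, bary 𝔇 (c k).face (X k)
      = cpt (φ k) (𝔇.D (c k).face (c k).l) (𝔇.D (c k).face (c k).r) :=
    fun k => bary_crossW (h.inv k) (h.sep k) rfl rfl
  have hDl := fun k => (h.step k).D_l (h.inv k) (h.inv (k + 1))
  have hDr := fun k => (h.step k).D_r (h.inv k) (h.inv (k + 1))
  have hel : ∀ k, ev (φ (k + 1)) (𝔇.D (c k).face (c k).l) = ev (φ k) (𝔇.D (c k).face (c k).l) :=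
    fun k => ev_refr_l _
  have her : ∀ k, ev (φ (k + 1)) (𝔇.D (c k).face (c k).r) = ev (φ k) (𝔇.D (c k).face (c k).r) :=
    fun k => ev_refr_r (h.inv k) _
  have hXb' : ∀ k, bary 𝔇 (c (k + 1)).face (X k)
      = cpt (φ (k + 1)) (𝔇.D (c (k + 1)).face (c k).l) (𝔇.D (c (k + 1)).face (c k).r) := by
    intro k
    rw [bary_crossW (h.inv k) (h.sep k) (hDl k) (hDr k), hDl, hDr]
    simp only [cpt, hel, her]
    rfl
  have hadv : ∀ k, ∃ T : ℝ, 0 < T ∧ bary 𝔇 (c (k + 1)).face (X (k + 1)) =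
      bary 𝔇 (c (k + 1)).face (X k) + T • dir (c (k + 1)).ε (φ (k + 1)) := by
    intro k
    obtain ⟨T, hT, h1, -⟩ := advance (h.step k) (h.inv k) (h.inv (k + 1)) (hu (k + 1))
      (by rw [hDl, hel]; exact (h.sep k).1) (by rw [hDr, her]; exact (h.sep k).2) (h.sep (k + 1))
    exact ⟨T, hT, by rw [hXb, hXb']; exact h1⟩
  choose T hT hTX using hadv
  have h0 := h.inv 0
  obtain ⟨a, ha1, ha2, ha3⟩ := h0.exists_apex
  have ham : a ∈ (c 0).face := by rw [ha3]; simp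
  have hnd := 𝔇.nondeg h0.face_mem h0.l_mem h0.r_mem ham h0.ne (Ne.symm ha2) (Ne.symm ha1)
  set W := vecW (𝔇.D (c 0).face) (c 0).l (c 0).r a (dir (c 0).ε (φ 0)) with hW
  obtain ⟨hW1, hW2, hW3⟩ := bary_vecW (𝔇 := 𝔇) h0.ne (Ne.symm ha1) (Ne.symm ha2)
    (dir (c 0).ε (φ 0)) hnd
  rw [← ha3] at hW3
  have hW2' : ∑ v, W v = 0 := hW2
  have hW3' : ∀ v ∉ (c 0).face, W v = 0 := hW3
  have hWa : W a < 0 := by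
    have e : W a * cr (𝔇.D (c 0).face (c 0).l) (𝔇.D (c 0).face (c 0).r) (𝔇.D (c 0).face a)
      = sg (c 0).ε * (ev (φ 0) (𝔇.D (c 0).face (c 0).l) - ev (φ 0) (𝔇.D (c 0).face (c 0).r)) := by
      simp only [hW, vecW, if_neg ha1, if_neg ha2, if_true]
      field_simp
      simp only [dir, ev]; ring
    have h1 := h0.behind a ham ha1 ha2
    have h2 : 0 < ev (φ 0) (𝔇.D (c 0).face (c 0).l) - ev (φ 0) (𝔇.D (c 0).face (c 0).r) := by
      have := (h.sep 0).1
      have := (h.sep 0).2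
      simp only [hφ, transp] at *
      linarith
    by_contra hcon
    have h3 := mul_nonpos_of_nonneg_of_nonpos (not_lt.1 hcon) h1.le
    have h4 := sg_mul_self (c 0).ε
    have h5 : W a * (sg (c 0).ε * cr (𝔇.D (c 0).face (c 0).l) (𝔇.D (c 0).face (c 0).r)
        (𝔇.D (c 0).face a))
      = ev (φ 0) (𝔇.D (c 0).face (c 0).l) - ev (φ 0) (𝔇.D (c 0).face (c 0).r) := by
      linear_combination sg (c 0).ε * e + (ev (φ 0) (𝔇.D (c 0).face (c 0).l)
        - ev (φ 0) (𝔇.D (c 0).face (c 0).r)) * h4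
    linarith
  -- An orbit has no base point, so the path is prolonged backward from the first crossing point.
  -- The apex weight becomes positive because of `hWa`, and a small `t0` keeps the other two weights
  -- positive.
  obtain ⟨t0, ht0, htl, htr⟩ : ∃ t0 > 0, t0 * |W (c 0).l| < X 0 (c 0).l ∧
      t0 * |W (c 0).r| < X 0 (c 0).r := by
    have h1 : 0 < X 0 (c 0).l := (hXo 0).1 _ (by simp [CState.edge])
    have h2 : 0 < X 0 (c 0).r := (hXo 0).1 _ (by simp [CState.edge])
    set m := min (X 0 (c 0).l) (X 0 (c 0).r)
    have hm : 0 < m := lt_min h1 h2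
    have hpos : 0 < |W (c 0).l| + |W (c 0).r| + 1 := by positivity
    refine ⟨m / (|W (c 0).l| + |W (c 0).r| + 1), by positivity, ?_, ?_⟩
    · refine lt_of_lt_of_le ?_ (min_le_left (X 0 (c 0).l) (X 0 (c 0).r))
      rw [div_mul_eq_mul_div, div_lt_iff₀ hpos]
      exact mul_lt_mul_of_pos_left (by linarith [abs_nonneg (W (c 0).r)]) hm
    · refine lt_of_lt_of_le ?_ (min_le_right (X 0 (c 0).l) (X 0 (c 0).r))
      rw [div_mul_eq_mul_div, div_lt_iff₀ hpos]
      exact mul_lt_mul_of_pos_left (by linarith [abs_nonneg (W (c 0).l)]) hm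
  have hopen0 : ∀ s, 0 < s → s ≤ t0 → InOpenSimplex (c 0).face (X 0 - s • W) := by
    intro s hs hst
    refine ⟨fun v hv => ?_, fun v hv => ?_, ?_⟩
    · have aux : ∀ x w : ℝ, t0 * |w| < x → 0 < x - s * w := by
        intro x w hw
        have h1 : s * w ≤ s * |w| := mul_le_mul_of_nonneg_left (le_abs_self w) hs.le
        have h2 : s * |w| ≤ t0 * |w| := mul_le_mul_of_nonneg_right hst (abs_nonneg w)
        linarith
      rw [ha3] at hv
      simp only [Finset.mem_insert, Finset.mem_singleton] at hv
      simp only [Pi.sub_apply, Pi.smul_apply, smul_eq_mul]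
      rcases hv with rfl | rfl | rfl
      · exact aux _ _ htl
      · exact aux _ _ htr
      · have : X 0 v = 0 := (hXo 0).2.1 v (by simp [CState.edge, ha1, ha2])
        rw [this]
        have := mul_neg_of_pos_of_neg hs hWa
        linarith
    · simp only [Pi.sub_apply, Pi.smul_apply, smul_eq_mul]
      rw [(hXo 0).2.1 v (fun hv' => hv (h0.edge_subset hv')), hW3' v hv]; ring
    · simp only [Pi.sub_apply, Pi.smul_apply, smul_eq_mul, Finset.sum_sub_distrib,
        ← Finset.mul_sum]
      rw [(hXo 0).2.2, hW2']; ring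
  -- Index `0` is the base point; the crossing point `X k` ends step `k` and is the position with
  -- index `k + 1`.
  set pos : ℕ → V → ℝ := fun k => Nat.casesOn k (X 0 - t0 • W) X with hpos
  set vel : ℕ → V → ℝ := fun k => Nat.casesOn k W (fun k => (T k)⁻¹ • (X (k + 1) - X k)) with hvel
  set time : ℕ → ℝ := fun k => Nat.casesOn k t0 T with htime
  have hXz : ∀ k v, v ∉ (c (k + 1)).face → X k v = 0 := by
    intro k v hv
    apply (hXo k).2.1
    simp only [CState.edge, Finset.mem_insert, Finset.mem_singleton, not_or]
    exact ⟨fun e => hv (e ▸ (h.step k).l_mem), fun e => hv (e ▸ (h.step k).r_mem)⟩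
  have hXz' : ∀ k v, v ∉ (c k).face → X k v = 0 := fun k v hv =>
    (hXo k).2.1 v fun hv' => hv ((h.inv k).edge_subset hv')
  have hvz : ∀ k v, v ∉ (c k).face → vel k v = 0 := by
    rintro (_ | k) v hv
    · exact hW3 v hv
    · simp only [hvel, Pi.smul_apply, Pi.sub_apply, smul_eq_mul]
      rw [hXz k v hv, hXz' (k + 1) v hv]; ring
  have hvs : ∀ k, ∑ v, vel k v = 0 := by
    rintro (_ | k)
    · exact hW2
    · simp only [hvel, Pi.smul_apply, Pi.sub_apply, smul_eq_mul, ← Finset.mul_sum,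
        Finset.sum_sub_distrib]
      rw [(hXo k).2.2, (hXo (k + 1)).2.2]; ring
  have hvb : ∀ k, bary 𝔇 (c k).face (vel k) = dir (c k).ε (φ k) := by
    rintro (_ | k)
    · exact hW1
    · have e : X (k + 1) = X k + T k • vel (k + 1) := by
        simp only [hvel]
        rw [smul_smul, mul_inv_cancel₀ (hT k).ne', one_smul]; simp
      have e1 := hTX k
      rw [e, bary_add_smul] at e1
      have e2 := add_left_cancel e1
      exact smul_right_injective _ (hT k).ne' e2
  refine ⟨⟨fun k => (c k).face, fun k => (c k).edge, pos, vel, time,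
    fun k => (h.inv k).face_mem, ?_, ?_, ?_, ?_, ?_, fun k => (h.inv k).edge_card,
    fun k => (h.inv k).edge_subset, ?_, ?_, ?_, ?_⟩, fun k => rfl⟩
  · intro v hv
    have h1 := hopen0 t0 ht0 le_rfl
    have h2 : ∀ w ∈ (c 0).face, w = v := by
      intro w hw
      by_contra hne
      have h3 := hv.2.1 w (by simpa using hne)
      have h4 := h1.1 w hw
      have h5 : pos 0 w = (X 0 - t0 • W) w := rfl
      linarith
    exact h0.ne ((h2 _ h0.l_mem).trans (h2 _ h0.r_mem).symm)
  · rintro (_ | k)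
    exacts [ht0, hT k]
  · intro k
    rw [tangentInner_eq 𝔇 (h.inv k).face_mem (hvz k) (hvz k) (hvs k) (hvs k), hvb]
    have := dir_unit (c k).ε (hu k)
    linarith
  · rintro (_ | k) s hs0 hs1
    · have : pos 0 + s • vel 0 = X 0 - (t0 - s) • W := by
        simp only [hpos, hvel]
        ext v; simp; ring
      rw [this]
      have h5 : time 0 = t0 := rfl
      rw [h5] at hs1
      exact hopen0 _ (by linarith) (by linarith)
    · have h5 : time (k + 1) = T k := rfl
      rw [h5] at hs1
      have hTk := hT k
      set x := s / T k with hx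
      have hx0 : 0 < x := div_pos hs0 hTk
      have hx1 : x < 1 := (div_lt_one hTk).2 hs1
      have e : pos (k + 1) + s • vel (k + 1) = fun v => (1 - x) * X k v + x * X (k + 1) v := by
        simp only [hpos, hvel]
        ext v
        simp only [Pi.add_apply, Pi.smul_apply, Pi.sub_apply, smul_eq_mul, hx]
        field_simp; ring
      rw [e]
      have nn : ∀ k v, 0 ≤ X k v := fun k v => by
        by_cases hv : v ∈ (c k).edge
        · exact ((hXo k).1 v hv).le
        · rw [(hXo k).2.1 v hv]
      refine ⟨fun v hv => ?_, fun v hv => ?_, ?_⟩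
      · have hor : v ∈ (c k).edge ∨ v ∈ (c (k + 1)).edge := by
          rcases (h.step k).mem_cases (h.inv k) (h.inv (k + 1)) with
            ⟨-, -, -, h4⟩ | ⟨-, -, -, h4⟩ <;>
          · simp only [h4, Finset.mem_insert, Finset.mem_singleton] at hv
            simp only [CState.edge, Finset.mem_insert, Finset.mem_singleton]
            tauto
        rcases hor with hv | hv
        · have := mul_pos (by linarith : 0 < 1 - x) ((hXo k).1 v hv)
          have := mul_nonneg hx0.le (nn (k + 1) v)
          linarith
        · have := mul_nonneg (by linarith : 0 ≤ 1 - x) (nn k v)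
          have := mul_pos hx0 ((hXo (k + 1)).1 v hv)
          linarith
      · simp only [hXz k v hv, hXz' (k + 1) v hv]; ring
      · rw [Finset.sum_add_distrib, ← Finset.mul_sum, ← Finset.mul_sum, (hXo k).2.2,
          (hXo (k + 1)).2.2]; ring
  · rintro (_ | k)
    · simp [hpos, hvel, htime]
    · simp only [hpos, hvel, htime]
      rw [smul_smul, mul_inv_cancel₀ (hT k).ne', one_smul]; simp
  · intro k; exact hXo k
  · intro k v hv
    simp only [CState.edge, Finset.mem_insert, Finset.mem_singleton] at hv
    rcases hv with rfl | rfl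
    exacts [(h.step k).l_mem, (h.step k).r_mem]
  · intro k
    constructor
    · intro e
      by_contra hb
      exact ((h.step k).int hb).1 e
    · intro hb; exact ((h.step k).bd hb).1
  · intro k a' ha' b' hb'
    have key : P.tangentInner (vel (k + 1)) (Pi.single (c k).l 1 - Pi.single (c k).r 1) =
        P.tangentInner (vel k) (Pi.single (c k).l 1 - Pi.single (c k).r 1) := by
      rw [inner_single (𝔇 := 𝔇) (h.inv (k + 1)).face_mem (hvz (k + 1)) (hvs (k + 1))
        (h.step k).l_mem (h.step k).r_mem, inner_single (𝔇 := 𝔇) (h.inv k).face_mem (hvz k)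
        (hvs k) (h.inv k).l_mem (h.inv k).r_mem, hvb, hvb, hDl, hDr]
      exact dir_refr (h.step k) (h.inv k) (φ k)
    have neg : ∀ u w : V → ℝ, P.tangentInner u (-w) = - P.tangentInner u w := by
      intro u w
      simp [tangentInner, Finset.sum_neg_distrib]
    simp only [CState.edge, Finset.mem_insert, Finset.mem_singleton] at ha' hb'
    rcases ha' with rfl | rfl <;> rcases hb' with rfl | rfl
    · simp [tangentInner]
    · exact key
    · rw [← neg_sub, neg, neg, key]
    · simp [tangentInner]

/-! ### Uniform bounds -/

lemma Dev.exists_bound (𝔇 : Dev P) : ∃ ρ : ℝ, 1 ≤ ρ ∧ ∀ t ∈ P.faces, ∀ v ∈ t,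
    |(𝔇.D t v).1| ≤ ρ ∧ |(𝔇.D t v).2| ≤ ρ := by
  obtain ⟨M, hM⟩ := (Set.toFinite (Set.range fun x : Finset V × V =>
    max |(𝔇.D x.1 x.2).1| |(𝔇.D x.1 x.2).2|)).bddAbove
  refine ⟨max 1 M, le_max_left _ _, fun t _ v _ => ?_⟩
  have h := hM ⟨(t, v), rfl⟩
  simp only at h
  exact ⟨(le_max_left _ _).trans (h.trans (le_max_right _ _)),
    (le_max_right _ _).trans (h.trans (le_max_right _ _))⟩

lemma Dev.exists_area (𝔇 : Dev P) : ∃ κ : ℝ, 0 < κ ∧ ∀ t ∈ P.faces, ∀ a ∈ t, ∀ b ∈ t, ∀ c ∈ t,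
    a ≠ b → b ≠ c → a ≠ c → κ ≤ |cr (𝔇.D t a) (𝔇.D t b) (𝔇.D t c)| := by
  classical
  set S : Finset (Finset V × V × V × V) := Finset.univ.filter fun x =>
    cr (𝔇.D x.1 x.2.1) (𝔇.D x.1 x.2.2.1) (𝔇.D x.1 x.2.2.2) ≠ 0
  by_cases hS : S.Nonempty
  · obtain ⟨x, hx, hmin⟩ := S.exists_min_image
      (fun x => |cr (𝔇.D x.1 x.2.1) (𝔇.D x.1 x.2.2.1) (𝔇.D x.1 x.2.2.2)|) hS
    refine ⟨_, abs_pos.2 (Finset.mem_filter.1 hx).2, fun t ht a ha b hb c hc h1 h2 h3 => ?_⟩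
    exact hmin (t, a, b, c) (Finset.mem_filter.2 ⟨Finset.mem_univ _,
      𝔇.nondeg ht ha hb hc h1 h2 h3⟩)
  · refine ⟨1, one_pos, fun t ht a ha b hb c hc h1 h2 h3 => absurd ?_ hS⟩
    exact ⟨(t, a, b, c), Finset.mem_filter.2 ⟨Finset.mem_univ _, 𝔇.nondeg ht ha hb hc h1 h2 h3⟩⟩

/-! ### Steps of a line -/

noncomputable def aa (𝔇 : Dev P) (φ : Fn) (s : CState V) : ℝ :=
  ev φ (𝔇.D s.face s.l) - ev φ (𝔇.D s.face s.r)

noncomputable def bb (𝔇 : Dev P) (φ : Fn) (s : CState V) : ℝ :=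
  (dir s.ε φ).1 * ((𝔇.D s.face s.r).1 - (𝔇.D s.face s.l).1)
    + (dir s.ε φ).2 * ((𝔇.D s.face s.r).2 - (𝔇.D s.face s.l).2)

/-- The weight of the right end in the crossing point. -/
noncomputable def wr (𝔇 : Dev P) (φ : Fn) (s : CState V) : ℝ :=
  ev φ (𝔇.D s.face s.l) / aa 𝔇 φ s

/-- The point where the line crosses the exit edge. -/
noncomputable def Yc (𝔇 : Dev P) (φ : Fn) (s : CState V) : Pt :=
  cpt φ (𝔇.D s.face s.l) (𝔇.D s.face s.r)

/-- A monotone function of the slope of the exit edge against the line. -/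
noncomputable def slope (𝔇 : Dev P) (φ : Fn) (s : CState V) : ℝ :=
  bb 𝔇 φ s / (aa 𝔇 φ s + |bb 𝔇 φ s|)

lemma Sep.aa_pos {φ : Fn} {s : CState V} (h : Sep 𝔇 φ s) : 0 < aa 𝔇 φ s := by
  unfold aa; linarith [h.1, h.2]

lemma Sep.wr_pos {φ : Fn} {s : CState V} (h : Sep 𝔇 φ s) : 0 < wr 𝔇 φ s :=
  div_pos h.1 h.aa_pos

lemma Sep.wr_lt {φ : Fn} {s : CState V} (h : Sep 𝔇 φ s) : wr 𝔇 φ s < 1 := by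
  rw [wr, div_lt_one h.aa_pos]; unfold aa; linarith [h.2]

lemma Sep.Yc_eq {φ : Fn} {s : CState V} (h : Sep 𝔇 φ s) :
    Yc 𝔇 φ s = (1 - wr 𝔇 φ s) • 𝔇.D s.face s.l + wr 𝔇 φ s • 𝔇.D s.face s.r := by
  have h1 : ev φ (𝔇.D s.face s.l) - ev φ (𝔇.D s.face s.r) ≠ 0 := h.aa_pos.ne'
  rw [Yc, cpt_combo h1, wr, aa]
  congr 2
  field_simp; ring

lemma Sep.ev_Yc {φ : Fn} {s : CState V} (h : Sep 𝔇 φ s) : ev φ (Yc 𝔇 φ s) = 0 :=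
  ev_cpt h.aa_pos.ne'

lemma Sep.slope_le {φ : Fn} {s : CState V} (h : Sep 𝔇 φ s) : |slope 𝔇 φ s| ≤ 1 := by
  have := h.aa_pos
  rw [slope, abs_div, abs_of_pos (by positivity : 0 < aa 𝔇 φ s + |bb 𝔇 φ s|)]
  rw [div_le_one (by positivity)]
  linarith

/-- With `x = b / a` the quotient is `x / (1 + |x|)`, a bounded increasing function. After clearing
denominators the increase is at least `a * b' - a' * b`; the combination `0 ≤ b`, `b' ≤ 0`, where
this could fail, contradicts `h`. -/
lemma frac_step {a b a' b' κ M : ℝ} (ha : 0 < a) (ha' : 0 < a') (hκ : 0 < κ)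
    (h : κ ≤ a * b' - a' * b) (hM : a + |b| ≤ M) (hM' : a' + |b'| ≤ M) :
    b / (a + |b|) + κ / M ^ 2 ≤ b' / (a' + |b'|) := by
  have h1 : 0 < a + |b| := by positivity
  have h2 : 0 < a' + |b'| := by positivity
  have h3 : κ ≤ b' * (a + |b|) - b * (a' + |b'|) := by
    rcases le_total 0 b with hb | hb <;> rcases le_total 0 b' with hb' | hb' <;>
      simp only [abs_of_nonneg, abs_of_nonpos, hb, hb']
    · linarith
    · have := mul_nonneg ha'.le hb
      have := mul_nonpos_of_nonneg_of_nonpos ha.le hb'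
      linarith
    · have := mul_nonneg hb' (neg_nonneg.2 hb)
      linarith
    · linarith
  have h4 : b' / (a' + |b'|) - b / (a + |b|)
      = (b' * (a + |b|) - b * (a' + |b'|)) / ((a' + |b'|) * (a + |b|)) := by
    field_simp
  have hMp : 0 < M := by linarith
  have h5 : κ / M ^ 2 ≤ (b' * (a + |b|) - b * (a' + |b'|)) / ((a' + |b'|) * (a + |b|)) := by
    apply div_le_div₀ (hκ.le.trans h3) h3 (by positivity)
    rw [sq]
    exact mul_le_mul hM' hM h1.le hMp.le
  linarith

/-- Differences of `φ` and components along `dir` are coordinates in an orthonormal frame, so their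
determinant is an oriented area. -/
lemma cross_left (b : Bool) {φ : Fn} (h : gsq φ = 1) (A B N : Pt) :
    (ev φ A - ev φ B) * ((dir b φ).1 * (N.1 - A.1) + (dir b φ).2 * (N.2 - A.2))
      - (ev φ A - ev φ N) * ((dir b φ).1 * (B.1 - A.1) + (dir b φ).2 * (B.2 - A.2))
      = sg b * cr A B N := by
  unfold gsq at h
  simp only [ev, dir, cr]
  linear_combination sg b * ((B.1 - A.1) * (N.2 - A.2) - (B.2 - A.2) * (N.1 - A.1)) * h

lemma cross_right (b : Bool) {φ : Fn} (h : gsq φ = 1) (A B N : Pt) :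
    (ev φ A - ev φ B) * ((dir b φ).1 * (B.1 - N.1) + (dir b φ).2 * (B.2 - N.2))
      - (ev φ N - ev φ B) * ((dir b φ).1 * (B.1 - A.1) + (dir b φ).2 * (B.2 - A.2))
      = - (sg b * cr A B N) := by
  unfold gsq at h
  simp only [ev, dir, cr]
  linear_combination -sg b * ((B.1 - A.1) * (N.2 - A.2) - (B.2 - A.2) * (N.1 - A.1)) * h

/-- The constants: a bound for coordinates and for areas. -/
structure Dev.Const (𝔇 : Dev P) (ρ κ : ℝ) : Prop where
  one_le : 1 ≤ ρ
  pos : 0 < κ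
  bound : ∀ t ∈ P.faces, ∀ v ∈ t, |(𝔇.D t v).1| ≤ ρ ∧ |(𝔇.D t v).2| ≤ ρ
  area : ∀ t ∈ P.faces, ∀ a ∈ t, ∀ b ∈ t, ∀ c ∈ t,
    a ≠ b → b ≠ c → a ≠ c → κ ≤ |cr (𝔇.D t a) (𝔇.D t b) (𝔇.D t c)|

lemma Dev.exists_const (𝔇 : Dev P) : ∃ ρ κ : ℝ, 𝔇.Const ρ κ := by
  obtain ⟨ρ, h1, h2⟩ := 𝔇.exists_bound
  obtain ⟨κ, h3, h4⟩ := 𝔇.exists_area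
  exact ⟨ρ, κ, h1, h3, h2, h4⟩

lemma abs_le_of_gsq {φ : Fn} (h : gsq φ = 1) : |φ.1| ≤ 1 ∧ |φ.2.1| ≤ 1 := by
  unfold gsq at h
  constructor <;> rw [abs_le] <;> constructor <;> nlinarith [sq_nonneg φ.1, sq_nonneg φ.2.1]

lemma dot_le {x y u w ρ : ℝ} (hx : |x| ≤ 1) (hy : |y| ≤ 1) (hu : |u| ≤ ρ)
    (hw : |w| ≤ ρ) : |x * u + y * w| ≤ 2 * ρ := by
  have h1 : |x * u| ≤ 1 * ρ := by rw [abs_mul]; exact mul_le_mul hx hu (abs_nonneg _) one_pos.le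
  have h2 : |y * w| ≤ 1 * ρ := by rw [abs_mul]; exact mul_le_mul hy hw (abs_nonneg _) one_pos.le
  have := abs_add_le (x * u) (y * w)
  linarith

lemma Dev.Const.aa_le {ρ κ : ℝ} (hc : 𝔇.Const ρ κ) {φ : Fn} (h : gsq φ = 1) {s : CState V}
    (hs : VInv 𝔇 s) : |aa 𝔇 φ s| ≤ 4 * ρ := by
  have h1 := hc.bound _ hs.face_mem _ hs.l_mem
  have h2 := hc.bound _ hs.face_mem _ hs.r_mem
  have h3 := abs_le_of_gsq h
  have e : aa 𝔇 φ s = φ.1 * ((𝔇.D s.face s.l).1 - (𝔇.D s.face s.r).1)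
    + φ.2.1 * ((𝔇.D s.face s.l).2 - (𝔇.D s.face s.r).2) := by unfold aa ev; ring
  rw [e]
  have := dot_le (ρ := 2 * ρ) h3.1 h3.2
    ((abs_sub (𝔇.D s.face s.l).1 (𝔇.D s.face s.r).1).trans (by linarith [h1.1, h2.1]))
    ((abs_sub (𝔇.D s.face s.l).2 (𝔇.D s.face s.r).2).trans (by linarith [h1.2, h2.2]))
  linarith

lemma Dev.Const.bb_le {ρ κ : ℝ} (hc : 𝔇.Const ρ κ) {φ : Fn} (h : gsq φ = 1) {s : CState V}
    (hs : VInv 𝔇 s) : |bb 𝔇 φ s| ≤ 4 * ρ := by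
  have h1 := hc.bound _ hs.face_mem _ hs.l_mem
  have h2 := hc.bound _ hs.face_mem _ hs.r_mem
  have h3 := abs_le_of_gsq h
  have hs1 : |sg s.ε| = 1 := by cases s.ε <;> simp [sg]
  have := dot_le (ρ := 2 * ρ) (x := (dir s.ε φ).1) (y := (dir s.ε φ).2)
    (by simp only [dir, abs_mul, hs1]; linarith [h3.2])
    (by simp only [dir, abs_neg, abs_mul, hs1]; linarith [h3.1])
    ((abs_sub (𝔇.D s.face s.r).1 (𝔇.D s.face s.l).1).trans (by linarith [h1.1, h2.1]))
    ((abs_sub (𝔇.D s.face s.r).2 (𝔇.D s.face s.l).2).trans (by linarith [h1.2, h2.2]))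
  unfold bb
  linarith

lemma aa_refr {s s' : CState V} (h : CStep P s s') (hs : VInv 𝔇 s) (hs' : VInv 𝔇 s') (φ : Fn) :
    ev (refr 𝔇 s φ) (𝔇.D s'.face s.l) - ev (refr 𝔇 s φ) (𝔇.D s'.face s.r) = aa 𝔇 φ s := by
  rw [h.D_l hs hs', h.D_r hs hs', ev_refr_l, ev_refr_r hs, aa]

lemma bb_refr {s s' : CState V} (h : CStep P s s') (hs : VInv 𝔇 s) (hs' : VInv 𝔇 s') (φ : Fn) :
    (dir s'.ε (refr 𝔇 s φ)).1 * ((𝔇.D s'.face s.r).1 - (𝔇.D s'.face s.l).1)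
      + (dir s'.ε (refr 𝔇 s φ)).2 * ((𝔇.D s'.face s.r).2 - (𝔇.D s'.face s.l).2)
      = bb 𝔇 φ s := by
  rw [h.D_l hs hs', h.D_r hs hs', bb]
  linarith [dir_refr (𝔇 := 𝔇) h hs φ]

lemma Yc_refr {s s' : CState V} (h : CStep P s s') (hs : VInv 𝔇 s) (hs' : VInv 𝔇 s') (φ : Fn) :
    cpt (refr 𝔇 s φ) (𝔇.D s'.face s.l) (𝔇.D s'.face s.r) = Yc 𝔇 φ s := by
  rw [h.D_l hs hs', h.D_r hs hs', Yc]
  simp only [cpt, ev_refr_l, ev_refr_r hs]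

/-- One step: the crossing point advances, at least in proportion to the weight of the vertex that
changes, and the slope moves in the direction given by the turn. -/
lemma step_data {ρ κ : ℝ} (hc : 𝔇.Const ρ κ) {s s' : CState V} (h : CStep P s s')
    (hs : VInv 𝔇 s) (hs' : VInv 𝔇 s') {φ : Fn} (hφ : gsq φ = 1) (hS : Sep 𝔇 φ s)
    (hS' : Sep 𝔇 (refr 𝔇 s φ) s') :
    ∃ T : ℝ, 0 < T ∧ Yc 𝔇 (refr 𝔇 s φ) s' = Yc 𝔇 φ s + T • dir s'.ε (refr 𝔇 s φ) ∧
      ((slope 𝔇 φ s + κ / (8 * ρ) ^ 2 ≤ slope 𝔇 (refr 𝔇 s φ) s' ∧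
        κ / (4 * ρ) * wr 𝔇 (refr 𝔇 s φ) s' ≤ T ∧ κ / (4 * ρ) * wr 𝔇 φ s ≤ T) ∨
      (slope 𝔇 (refr 𝔇 s φ) s' + κ / (8 * ρ) ^ 2 ≤ slope 𝔇 φ s ∧
        κ / (4 * ρ) * (1 - wr 𝔇 (refr 𝔇 s φ) s') ≤ T ∧ κ / (4 * ρ) * (1 - wr 𝔇 φ s) ≤ T)) := by
  set φ' := refr 𝔇 s φ with hφ'
  have hu : gsq φ' = 1 := by rw [hφ', gsq_refr hs, hφ]
  have ha := aa_refr h hs hs' φ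
  have hb := bb_refr h hs hs' φ
  have hY := Yc_refr h hs hs' φ
  rw [← hφ'] at ha hb hY
  have hρ := hc.one_le
  have hκ := hc.pos
  have hl : 0 < ev φ' (𝔇.D s'.face s.l) := by
    rw [h.D_l hs hs', hφ', ev_refr_l]; exact hS.1
  have hr : ev φ' (𝔇.D s'.face s.r) < 0 := by
    rw [h.D_r hs hs', hφ', ev_refr_r hs]; exact hS.2
  obtain ⟨T, hT, e1, e2⟩ := advance h hs hs' hu hl hr hS'
  rw [hY] at e1
  rw [ha] at e2
  -- The same advance seen from the new edge. This bounds it by the weight of the old crossing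
  -- point, while `e2` gives the bound by the new weight.
  have e3 : T * aa 𝔇 φ' s' = - (sg s'.ε * cr (𝔇.D s'.face s'.l) (𝔇.D s'.face s'.r)
      (Yc 𝔇 φ s)) := by
    have := cr_add_smul_dir s'.ε φ' (𝔇.D s'.face s'.l) (𝔇.D s'.face s'.r) (Yc 𝔇 φ s) T
    rw [← e1, cr_cpt hS'.aa_pos.ne'] at this
    unfold aa
    linarith
  have hYs : Yc 𝔇 φ s = (1 - wr 𝔇 φ s) • 𝔇.D s'.face s.l + wr 𝔇 φ s • 𝔇.D s'.face s.r := by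
    rw [h.D_l hs hs', h.D_r hs hs', hS.Yc_eq]
  have hYs' := hS'.Yc_eq
  have hap := hS.aa_pos
  have hap' := hS'.aa_pos
  have hal := (abs_le.1 (hc.aa_le hφ hs)).2
  have hal' := (abs_le.1 (hc.aa_le hu hs')).2
  have hbl := hc.bb_le hφ hs
  have hbl' := hc.bb_le hu hs'
  -- The constant is the smallest area divided by the largest extent of an edge across a line.
  have key : ∀ K w a : ℝ, κ ≤ K → 0 < w → 0 < a → a ≤ 4 * ρ → T * a = w * K →
      κ / (4 * ρ) * w ≤ T := by
    intro K w a hK hw ha0 ha1 e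
    rw [div_mul_eq_mul_div, div_le_iff₀ (by linarith)]
    calc κ * w ≤ w * K := by rw [mul_comm]; exact mul_le_mul_of_nonneg_left hK hw.le
      _ = T * a := e.symm
      _ ≤ T * (4 * ρ) := mul_le_mul_of_nonneg_left ha1 hT.le
  refine ⟨T, hT, e1, ?_⟩
  rcases h.mem_cases hs hs' with ⟨t1, t2, t3, t4⟩ | ⟨t1, t2, t3, t4⟩
  · left
    have hpos := h.ahead hs hs' hs'.r_mem t3 t2
    have hK : κ ≤ sg s'.ε * cr (𝔇.D s'.face s.l) (𝔇.D s'.face s.r) (𝔇.D s'.face s'.r) := by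
      have := hc.area _ hs'.face_mem _ h.l_mem _ h.r_mem _ hs'.r_mem hs.ne t2.symm t3.symm
      rwa [← abs_of_pos hpos, abs_mul, show |sg s'.ε| = 1 by cases s'.ε <;> simp [sg], one_mul]
    refine ⟨?_, key _ _ _ hK hS'.wr_pos hap hal ?_, key _ _ _ hK hS.wr_pos hap' hal' ?_⟩
    · refine frac_step hap hap' hκ ?_ (by linarith) (by linarith)
      rw [← hb, ← ha]
      have := cross_left s'.ε hu (𝔇.D s'.face s.l) (𝔇.D s'.face s.r) (𝔇.D s'.face s'.r)
      simp only [aa, bb, t1]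
      linarith
    · rw [e2, ← Yc, hYs', cr_combo _ _ _ _ _ _ (by ring), t1]
      have : cr (𝔇.D s'.face s.l) (𝔇.D s'.face s.r) (𝔇.D s'.face s.l) = 0 := by unfold cr; ring
      rw [this]; ring
    · rw [e3, hYs, cr_combo _ _ _ _ _ _ (by ring), t1]
      unfold cr; ring
  · right
    have hpos := h.ahead hs hs' hs'.l_mem t2 t3
    have hK : κ ≤ sg s'.ε * cr (𝔇.D s'.face s.l) (𝔇.D s'.face s.r) (𝔇.D s'.face s'.l) := by
      have := hc.area _ hs'.face_mem _ h.l_mem _ h.r_mem _ hs'.l_mem hs.ne t3.symm t2.symm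
      rwa [← abs_of_pos hpos, abs_mul, show |sg s'.ε| = 1 by cases s'.ε <;> simp [sg], one_mul]
    refine ⟨?_, key _ _ _ hK (by linarith [hS'.wr_lt]) hap hal ?_,
      key _ _ _ hK (by linarith [hS.wr_lt]) hap' hal' ?_⟩
    · have := frac_step (b := - bb 𝔇 φ s) (b' := - bb 𝔇 φ' s') (M := 8 * ρ) hap hap' hκ ?_
        (by rw [abs_neg]; linarith) (by rw [abs_neg]; linarith)
      · rw [abs_neg, abs_neg, neg_div, neg_div] at this
        unfold slope
        linarith
      · rw [← hb, ← ha]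
        have := cross_right s'.ε hu (𝔇.D s'.face s.l) (𝔇.D s'.face s.r) (𝔇.D s'.face s'.l)
        simp only [aa, bb, t1]
        linarith
    · rw [e2, ← Yc, hYs', cr_combo _ _ _ _ _ _ (by ring), t1]
      have : cr (𝔇.D s'.face s.l) (𝔇.D s'.face s.r) (𝔇.D s'.face s.r) = 0 := by unfold cr; ring
      rw [this]; ring
    · rw [e3, hYs, cr_combo _ _ _ _ _ _ (by ring), t1]
      unfold cr; ring

/-! ### Lengths of chains -/

structure Chain (𝔇 : Dev P) (c : ℕ → CState V) (n : ℕ) : Prop where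
  inv : ∀ k ≤ n, VInv 𝔇 (c k)
  step : ∀ k < n, CStep P (c k) (c (k + 1))

def FSep (𝔇 : Dev P) (c : ℕ → CState V) (ψ : Fn) (n : ℕ) : Prop :=
  ∀ k ≤ n, Sep 𝔇 (transp 𝔇 c ψ k) (c k)

lemma Chain.gsq_transp {c : ℕ → CState V} {n : ℕ} (hc : Chain 𝔇 c n) (ψ : Fn) {k : ℕ}
    (hk : k ≤ n) : gsq (transp 𝔇 c ψ k) = gsq ψ := by
  induction k with
  | zero => rfl
  | succ k ih => rw [transp, gsq_refr (hc.inv k (by omega)), ih (by omega)]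

lemma ev_Yc_refr {s : CState V} (hs : VInv 𝔇 s) {φ : Fn} (hS : Sep 𝔇 φ s) (η : Fn) :
    ev (refr 𝔇 s η) (Yc 𝔇 φ s) = ev η (Yc 𝔇 φ s) := by
  rw [hS.Yc_eq, ev_combo _ _ _ (by ring), ev_combo _ _ _ (by ring), ev_refr_l, ev_refr_r hs]

def dt (η φ : Fn) : ℝ := η.1 * φ.2.1 - η.2.1 * φ.1

lemma dt_pull {a b : Pt} (h : a ≠ b) (η φ : Fn) : dt (pull a b η) (pull a b φ) = - dt η φ := by
  have h0 := sqd_ne h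
  have h1 : sqd a b = (b.1 - a.1) ^ 2 + (b.2 - a.2) ^ 2 := by unfold sqd; ring
  simp only [dt, pull]
  field_simp
  rw [h1]; ring

lemma CStep.dt_refr {s s' : CState V} (h : CStep P s s') (hs : VInv 𝔇 s) (η φ : Fn) :
    sg s'.ε * dt (refr 𝔇 s η) (refr 𝔇 s φ) = sg s.ε * dt η φ := by
  unfold refr
  split_ifs with hb
  · rw [dt_pull hs.D_ne, (h.bd hb).2, sg_not]; ring
  · rw [(h.int hb).2]

lemma ev_add_dir (η φ : Fn) (Y : Pt) (T : ℝ) (b : Bool) :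
    ev η (Y + T • dir b φ) = ev η Y + T * (sg b * dt η φ) := by
  simp only [ev, dir, dt, Prod.fst_add, Prod.snd_add, Prod.smul_fst, Prod.smul_snd, smul_eq_mul]
  ring

/-- Here `f` is the slope, `w` the weight and `T` the advance. Since `|f| ≤ 1`, the slope cannot
move in the same direction for more than `2 / δ` steps. When the direction changes, the two bounds
at the common crossing point, `μ * w` and `μ * (1 - w)`, add up to `μ`. -/
lemma sum_ge_of_turns {δ μ : ℝ} (hδ : 0 < δ) :
    ∃ K : ℕ, 0 < K ∧ ∀ (n : ℕ) (f w T : ℕ → ℝ), (∀ k ≤ n, |f k| ≤ 1) →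
      (∀ k < n, 0 < T k) → (∀ k < n,
        (f k + δ ≤ f (k + 1) ∧ μ * w (k + 1) ≤ T k ∧ μ * w k ≤ T k) ∨
        (f (k + 1) + δ ≤ f k ∧ μ * (1 - w (k + 1)) ≤ T k ∧ μ * (1 - w k) ≤ T k)) →
      ∀ m, m + K ≤ n → ∑ k ∈ range m, T k + μ ≤ ∑ k ∈ range (m + K), T k := by
  obtain ⟨J, hJ⟩ := exists_nat_gt (2 / δ)
  have hJ' : 2 < J * δ := by rwa [div_lt_iff₀ hδ] at hJ
  refine ⟨J + 1, by omega, fun n f w T hf hT hturn m hm => ?_⟩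
  obtain ⟨k, hk1, hk2, hk3⟩ : ∃ k, m ≤ k ∧ k + 2 ≤ m + (J + 1) ∧ μ ≤ T k + T (k + 1) := by
    by_contra hcon
    push Not at hcon
    have hfm := abs_le.1 (hf m (by omega))
    have hfJ := abs_le.1 (hf (m + J) (by omega))
    rcases hturn m (by omega) with h0 | h0
    · have : ∀ j ≤ J, f m + j * δ ≤ f (m + j) ∧ f (m + j) + δ ≤ f (m + j + 1) ∧
          μ * w (m + j + 1) ≤ T (m + j) := by
        intro j
        induction j with
        | zero => intro _; simpa using ⟨h0.1, h0.2.1⟩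
        | succ j ih =>
          intro hj
          obtain ⟨i1, i2, i3⟩ := ih (by omega)
          refine ⟨by push_cast; rw [← add_assoc]; linarith, ?_⟩
          rcases hturn (m + j + 1) (by omega) with h1 | h1
          · exact ⟨h1.1, h1.2.1⟩
          · have := hcon (m + j) (by omega) (by omega)
            linarith [h1.2.2]
      linarith [(this J le_rfl).1]
    · have : ∀ j ≤ J, f (m + j) + j * δ ≤ f m ∧ f (m + j + 1) + δ ≤ f (m + j) ∧
          μ * (1 - w (m + j + 1)) ≤ T (m + j) := by
        intro j
        induction j with
        | zero => intro _; simpa using ⟨h0.1, h0.2.1⟩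
        | succ j ih =>
          intro hj
          obtain ⟨i1, i2, i3⟩ := ih (by omega)
          refine ⟨by push_cast; rw [← add_assoc]; linarith, ?_⟩
          rcases hturn (m + j + 1) (by omega) with h1 | h1
          · have := hcon (m + j) (by omega) (by omega)
            linarith [h1.2.2]
          · exact ⟨h1.1, h1.2.1⟩
      linarith [(this J le_rfl).1]
  have hmono : ∀ a b, a ≤ b → b ≤ n → ∑ i ∈ range a, T i ≤ ∑ i ∈ range b, T i := by
    intro a b hab hb
    refine sum_le_sum_of_subset_of_nonneg (range_subset_range.2 hab) fun i hi _ => ?_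
    exact (hT i (by have := mem_range.1 hi; omega)).le
  have h1 := hmono m k hk1 (by omega)
  have h2 := hmono (k + 2) (m + (J + 1)) hk2 hm
  rw [sum_range_succ, sum_range_succ] at h2
  linarith

/-- Along a chain the crossing points move along the line, with at least linear speed. -/
theorem Dev.exists_drift (𝔇 : Dev P) : ∃ d C : ℝ, 0 < d ∧ 0 < C ∧
    ∀ (c : ℕ → CState V) (n : ℕ) (ψ : Fn), Chain 𝔇 c n → gsq ψ = 1 → FSep 𝔇 c ψ n →
    ∃ t : ℕ → ℝ, ∀ m ≤ n, d * m - C ≤ t m ∧ ∀ η : Fn,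
      ev (transp 𝔇 c η m) (Yc 𝔇 (transp 𝔇 c ψ m) (c m))
        = ev η (Yc 𝔇 ψ (c 0)) + t m * (sg (c 0).ε * dt η ψ) := by
  obtain ⟨ρ, κ, hc⟩ := 𝔇.exists_const
  have hρ := hc.one_le
  have hκ := hc.pos
  have hδ : 0 < κ / (8 * ρ) ^ 2 := by positivity
  have hμ : 0 < κ / (4 * ρ) := by positivity
  obtain ⟨K, hK, hsum⟩ := sum_ge_of_turns (μ := κ / (4 * ρ)) hδ
  have hK' : (0 : ℝ) < K := by exact_mod_cast hK
  refine ⟨κ / (4 * ρ) / K, κ / (4 * ρ), by positivity, hμ, fun c n ψ hch hψ hS => ?_⟩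
  have hstep := fun (k : ℕ) (hk : k < n) => step_data hc (hch.step k hk) (hch.inv k hk.le)
    (hch.inv (k + 1) hk) ((hch.gsq_transp ψ hk.le).trans hψ) (hS k hk.le) (hS (k + 1) hk)
  choose! T hT using hstep
  have hbig := hsum n (fun k => slope 𝔇 (transp 𝔇 c ψ k) (c k))
    (fun k => wr 𝔇 (transp 𝔇 c ψ k) (c k)) T (fun k hk => (hS k hk).slope_le)
    (fun k hk => (hT k hk).1) (fun k hk => (hT k hk).2.2)
  -- `t m` is the length of the path up to edge `m`. The unfolded path is straight, so every
  -- transported functional is affine in `t m` along it.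
  refine ⟨fun m => ∑ k ∈ range m, T k, fun m hm => ⟨?_, fun η => ?_⟩⟩
  · induction m using Nat.strong_induction_on with
    | _ m ih =>
      rcases lt_or_ge m K with h | h
      · have h1 : (m : ℝ) ≤ K := by exact_mod_cast h.le
        have h2 : 0 ≤ ∑ k ∈ range m, T k :=
          sum_nonneg fun k hk => (hT k (by have := mem_range.1 hk; omega)).1.le
        have h3 : κ / (4 * ρ) / K * m ≤ κ / (4 * ρ) / K * K :=
          mul_le_mul_of_nonneg_left h1 (by positivity)
        rw [div_mul_cancel₀ _ hK'.ne'] at h3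
        linarith
      · have h1 := ih (m - K) (by omega) (by omega)
        have h2 := hbig (m - K) (by omega)
        rw [Nat.sub_add_cancel h] at h2
        rw [Nat.cast_sub h, mul_sub, div_mul_cancel₀ _ hK'.ne'] at h1
        linarith
  · induction m with
    | zero => simp [transp]
    | succ m ih =>
      have h1 := ih (by omega)
      have hd : ∀ k ≤ n, sg (c k).ε * dt (transp 𝔇 c η k) (transp 𝔇 c ψ k)
          = sg (c 0).ε * dt η ψ := by
        intro k
        induction k with
        | zero => intro _; rfl
        | succ k ih2 =>
          intro hk
          rw [transp, transp, (hch.step k hk).dt_refr (hch.inv k (by omega)), ih2 (by omega)]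
      have h3 : Yc 𝔇 (transp 𝔇 c ψ (m + 1)) (c (m + 1)) = Yc 𝔇 (transp 𝔇 c ψ m) (c m)
        + T m • dir (c (m + 1)).ε (transp 𝔇 c ψ (m + 1)) := (hT m hm).2.1
      simp only at h1 ⊢
      rw [h3, ev_add_dir, hd (m + 1) hm, transp,
        ev_Yc_refr (hch.inv m (by omega)) (hS m (by omega)), h1, sum_range_succ]
      ring

/-- The functional as long as no boundary edge is met. -/
lemma transp_eq_of_interior {c : ℕ → CState V} {n : ℕ}
    (h : ∀ k < n, ¬ P.IsBoundaryEdge (c k).edge) (η : Fn) : ∀ k ≤ n, transp 𝔇 c η k = η := by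
  intro k
  induction k with
  | zero => intro _; rfl
  | succ k ih => intro hk; rw [transp, ih (by omega), refr, if_neg (h k hk)]

lemma Dev.Const.Yc_le {ρ κ : ℝ} (hc : 𝔇.Const ρ κ) {φ : Fn} {s : CState V} (hs : VInv 𝔇 s)
    (hS : Sep 𝔇 φ s) : |(Yc 𝔇 φ s).1| ≤ ρ ∧ |(Yc 𝔇 φ s).2| ≤ ρ := by
  have h1 := hc.bound _ hs.face_mem _ hs.l_mem
  have h2 := hc.bound _ hs.face_mem _ hs.r_mem
  have w1 := hS.wr_pos
  have w2 := hS.wr_lt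
  rw [hS.Yc_eq]
  simp only [Prod.fst_add, Prod.snd_add, Prod.smul_fst, Prod.smul_snd, smul_eq_mul]
  have aux : ∀ x y : ℝ, |x| ≤ ρ → |y| ≤ ρ → |(1 - wr 𝔇 φ s) * x + wr 𝔇 φ s * y| ≤ ρ := by
    intro x y hx hy
    rw [abs_le] at *
    constructor <;> nlinarith
  exact ⟨aux _ _ h1.1 h2.1, aux _ _ h1.2 h2.2⟩

/-- Chains without bounces have bounded length. -/
theorem Dev.exists_chain_bound (𝔇 : Dev P) : ∃ N : ℕ, ∀ (c : ℕ → CState V) (n : ℕ) (ψ : Fn),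
    Chain 𝔇 c n → gsq ψ = 1 → FSep 𝔇 c ψ n → (∀ k < n, ¬ P.IsBoundaryEdge (c k).edge) →
    n < N := by
  obtain ⟨d, C, hd, hC, h⟩ := 𝔇.exists_drift
  obtain ⟨ρ, κ, hc⟩ := 𝔇.exists_const
  obtain ⟨N, hN⟩ := exists_nat_gt ((4 * ρ + C) / d)
  refine ⟨N, fun c n ψ hch hψ hS hint => ?_⟩
  obtain ⟨t, ht⟩ := h c n ψ hch hψ hS
  obtain ⟨h1, h2⟩ := ht n le_rfl
  have hρ := hc.one_le
  -- This functional measures length along the line. Without bounces it is never changed, and it is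
  -- bounded on the polygon.
  have h3 := h2 (sg (c 0).ε * ψ.2.1, - (sg (c 0).ε * ψ.1), 0)
  rw [transp_eq_of_interior hint _ n le_rfl, transp_eq_of_interior hint _ n le_rfl] at h3
  have e : sg (c 0).ε * dt (sg (c 0).ε * ψ.2.1, - (sg (c 0).ε * ψ.1), 0) ψ = 1 := by
    have := sg_sq (c 0).ε
    unfold gsq at hψ
    simp only [dt]
    linear_combination (ψ.1 ^ 2 + ψ.2.1 ^ 2) * this + hψ
  rw [e, mul_one] at h3
  have hSn : Sep 𝔇 ψ (c n) := by
    have := hS n le_rfl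
    rwa [transp_eq_of_interior hint _ n le_rfl] at this
  have b1 := hc.Yc_le (hch.inv n le_rfl) hSn
  have b2 := hc.Yc_le (hch.inv 0 (by omega)) (hS 0 (by omega))
  simp only [transp] at b2
  have hu := abs_le_of_gsq hψ
  have hs1 : |sg (c 0).ε| = 1 := by cases (c 0).ε <;> simp [sg]
  have hx : |sg (c 0).ε * ψ.2.1| ≤ 1 := by rw [abs_mul, hs1]; linarith [hu.2]
  have hy : |-(sg (c 0).ε * ψ.1)| ≤ 1 := by rw [abs_neg, abs_mul, hs1]; linarith [hu.1]
  have c1 := abs_le.1 (dot_le hx hy b1.1 b1.2)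
  have c2 := abs_le.1 (dot_le hx hy b2.1 b2.2)
  simp only [ev, add_zero] at h3
  have h4 : d * n ≤ 4 * ρ + C := by linarith
  rw [div_lt_iff₀ hd] at hN
  have h5 : d * n < d * N := by linarith
  exact_mod_cast lt_of_mul_lt_mul_left h5 hd.le

/-! ### Faces at an edge and edges at a vertex -/

/-- In the link of `a`, which is a path, the vertex `b` has at most two neighbours. -/
lemma faces_le_two {t t₁ t₂ : Finset V} (ht : t ∈ P.faces) (ht₁ : t₁ ∈ P.faces)
    (ht₂ : t₂ ∈ P.faces) {a b : V} (hab : a ≠ b) (h : a ∈ t ∧ b ∈ t) (h₁ : a ∈ t₁ ∧ b ∈ t₁)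
    (h₂ : a ∈ t₂ ∧ b ∈ t₂) (n₁ : t ≠ t₁) (n₂ : t ≠ t₂) : t₁ = t₂ := by
  obtain ⟨n, ⟨e⟩⟩ := P.link_path a
  obtain ⟨c, c1, c2, rfl⟩ := exists_apex ht h.1 h.2 hab
  obtain ⟨d, d1, d2, rfl⟩ := exists_apex ht₁ h₁.1 h₁.2 hab
  obtain ⟨f, f1, f2, rfl⟩ := exists_apex ht₂ h₂.1 h₂.2 hab
  set B : {x : V // x ≠ a ∧ ∃ t ∈ P.faces, a ∈ t ∧ x ∈ t} := ⟨b, hab.symm, _, ht, by simp⟩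
  have aux : ∀ x : {x : V // x ≠ a ∧ ∃ t ∈ P.faces, a ∈ t ∧ x ∈ t}, x.1 ≠ b →
      {a, b, x.1} ∈ P.faces → (e B).val + 1 = (e x).val ∨ (e x).val + 1 = (e B).val := by
    intro x hx hf
    have : (SimpleGraph.pathGraph (n + 2)).Adj (e B) (e x) :=
      e.map_rel_iff.2 ⟨fun h => hx (congrArg Subtype.val h).symm, hf⟩
    rwa [SimpleGraph.pathGraph_adj] at this
  have i1 := aux ⟨c, c1, _, ht, by simp⟩ c2 ht
  have i2 := aux ⟨d, d1, _, ht₁, by simp⟩ d2 ht₁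
  have i3 := aux ⟨f, f1, _, ht₂, by simp⟩ f2 ht₂
  have inj : ∀ x y : {x : V // x ≠ a ∧ ∃ t ∈ P.faces, a ∈ t ∧ x ∈ t},
      (e x).val = (e y).val → x.1 = y.1 := fun x y h =>
    congrArg Subtype.val (e.injective (Fin.ext h))
  by_contra hne
  have k1 : (e ⟨c, c1, _, ht, by simp⟩).val ≠ (e ⟨d, d1, _, ht₁, by simp⟩).val :=
    fun h => n₁ (by have := inj _ _ h; simp only at this; rw [this])
  have k2 : (e ⟨c, c1, _, ht, by simp⟩).val ≠ (e ⟨f, f1, _, ht₂, by simp⟩).val :=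
    fun h => n₂ (by have := inj _ _ h; simp only at this; rw [this])
  have k3 : (e ⟨d, d1, _, ht₁, by simp⟩).val ≠ (e ⟨f, f1, _, ht₂, by simp⟩).val :=
    fun h => hne (by have := inj _ _ h; simp only at this; rw [this])
  omega

/-- Every vertex lies on a boundary edge. -/
lemma exists_boundaryEdge_at (P : GeneralizedPolygon V) (v : V) :
    ∃ w, w ≠ v ∧ P.IsBoundaryEdge {v, w} := by
  obtain ⟨n, ⟨e⟩⟩ := P.link_path v
  -- An end of the link has a single neighbour, so the edge to it lies in a single face.
  set B := e.symm 0 with hB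
  obtain ⟨t, ht, hv, hBt⟩ := B.2.2
  refine ⟨B.1, B.2.1, Finset.card_pair B.2.1.symm, t, ⟨ht, ?_⟩, fun t' ⟨ht', hs⟩ => ?_⟩
  · intro x hx
    simp only [Finset.mem_insert, Finset.mem_singleton] at hx
    rcases hx with rfl | rfl <;> assumption
  · have hv' : v ∈ t' := hs (by simp)
    have hB' : B.1 ∈ t' := hs (by simp)
    obtain ⟨c, c1, c2, rfl⟩ := exists_apex ht hv hBt B.2.1.symm
    obtain ⟨d, d1, d2, rfl⟩ := exists_apex ht' hv' hB' B.2.1.symm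
    have aux : ∀ x : {x : V // x ≠ v ∧ ∃ t ∈ P.faces, v ∈ t ∧ x ∈ t}, x.1 ≠ B.1 →
        {v, B.1, x.1} ∈ P.faces → (e x).val = 1 := by
      intro x hx hf
      have h1 : (SimpleGraph.pathGraph (n + 2)).Adj (e B) (e x) :=
        e.map_rel_iff.2 ⟨fun h => hx (congrArg Subtype.val h).symm, hf⟩
      rw [SimpleGraph.pathGraph_adj, hB, e.apply_symm_apply] at h1
      simp at h1
      omega
    have i1 := aux ⟨c, c1, _, ht, by simp⟩ c2 ht
    have i2 := aux ⟨d, d1, _, ht', by simp⟩ d2 ht'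
    have := congrArg Subtype.val (e.injective (Fin.ext (i1.trans i2.symm)))
    simp only at this
    rw [this]

lemma exists_other_face {t : Finset V} (ht : t ∈ P.faces) {a b : V} (hab : a ≠ b) (ha : a ∈ t)
    (hb : b ∈ t) (h : ¬ P.IsBoundaryEdge {a, b}) : ∃ t' ∈ P.faces, t' ≠ t ∧ a ∈ t' ∧ b ∈ t' := by
  by_contra hcon
  push Not at hcon
  refine h ⟨Finset.card_pair hab, t, ⟨ht, ?_⟩, fun t' ⟨ht', hs⟩ => ?_⟩
  · intro x hx
    simp only [Finset.mem_insert, Finset.mem_singleton] at hx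
    rcases hx with rfl | rfl <;> assumption
  · by_contra hne
    exact hcon t' ht' hne (hs (by simp)) (hs (by simp))

/-! ### Extension of orbits -/

lemma sg_mul_pos {b : Bool} {x y : ℝ} (h : sg b * x < 0) (h' : x * y < 0) : 0 < sg b * y := by
  by_contra hcon
  have h1 := mul_nonneg_of_nonpos_of_nonpos h.le (not_lt.1 hcon)
  have h2 : sg b * x * (sg b * y) = x * y := by linear_combination x * y * sg_sq b
  linarith

lemma sg_mul_neg {b : Bool} {x y : ℝ} (h : 0 < sg b * x) (h' : x * y < 0) : sg b * y < 0 := by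
  by_contra hcon
  have h1 := mul_nonneg h.le (not_lt.1 hcon)
  have h2 : sg b * x * (sg b * y) = x * y := by linear_combination x * y * sg_sq b
  linarith

omit [Fintype V] [DecidableEq V] in
lemma CState.ext' {s s' : CState V} (h1 : s.face = s'.face) (h2 : s.l = s'.l) (h3 : s.r = s'.r)
    (h4 : s.ε = s'.ε) : s = s' := by
  cases s; cases s'; simp_all

/-- The next triangle, with its orientation. -/
lemma VInv.exists_next {s : CState V} (hs : VInv 𝔇 s) : ∃ (t : Finset V) (b : Bool),
    t ∈ P.faces ∧ s.l ∈ t ∧ s.r ∈ t ∧ (P.IsBoundaryEdge s.edge → t = s.face ∧ b = !s.ε) ∧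
    (¬ P.IsBoundaryEdge s.edge → t ≠ s.face ∧ b = s.ε) := by
  by_cases hb : P.IsBoundaryEdge s.edge
  · exact ⟨s.face, !s.ε, hs.face_mem, hs.l_mem, hs.r_mem, fun _ => ⟨rfl, rfl⟩,
      fun h => absurd hb h⟩
  · obtain ⟨t, ht, hne, h1, h2⟩ := exists_other_face hs.face_mem hs.ne hs.l_mem hs.r_mem hb
    exact ⟨t, s.ε, ht, h1, h2, fun h => absurd h hb, fun _ => ⟨hne, rfl⟩⟩

/-- The apex of the next triangle is in front. -/
lemma VInv.next_ahead {s : CState V} (hs : VInv 𝔇 s) {t : Finset V} {b : Bool}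
    (ht : t ∈ P.faces) (hl : s.l ∈ t) (hr : s.r ∈ t)
    (h1 : P.IsBoundaryEdge s.edge → t = s.face ∧ b = !s.ε)
    (h2 : ¬ P.IsBoundaryEdge s.edge → t ≠ s.face ∧ b = s.ε) {c : V} (hc : c ∈ t) (hcl : c ≠ s.l)
    (hcr : c ≠ s.r) : 0 < sg b * cr (𝔇.D t s.l) (𝔇.D t s.r) (𝔇.D t c) := by
  by_cases hb : P.IsBoundaryEdge s.edge
  · obtain ⟨rfl, rfl⟩ := h1 hb
    rw [sg_not]
    have := hs.behind c hc hcl hcr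
    linarith
  · obtain ⟨h3, rfl⟩ := h2 hb
    obtain ⟨d, hd1, hd2, hd3⟩ := hs.exists_apex
    have hd : d ∈ s.face := by rw [hd3]; simp
    have h4 := hs.behind d hd hd1 hd2
    have h5 := 𝔇.opp s.face hs.face_mem t ht s.l s.r d c hs.ne hs.l_mem hs.r_mem
      hl hr (Ne.symm h3) hd hd1 hd2 hc hcl hcr
    exact sg_mul_pos h4 h5

/-- The sign of the functional at the apex of the next triangle decides between its two other edges.
-/
lemma VInv.exists_step {s : CState V} (hs : VInv 𝔇 s) {φ : Fn} (hS : Sep 𝔇 φ s)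
    (hg : ∀ t v, ev (refr 𝔇 s φ) (𝔇.D t v) ≠ 0) :
    ∃ s', CStep P s s' ∧ VInv 𝔇 s' ∧ Sep 𝔇 (refr 𝔇 s φ) s' := by
  obtain ⟨t, b, ht, hl, hr, h1, h2⟩ := hs.exists_next
  obtain ⟨c, hc1, hc2, hc3⟩ := Billiard.exists_apex ht hl hr hs.ne
  have hc : c ∈ t := by rw [hc3]; simp
  have el : 𝔇.D t s.l = 𝔇.D s.face s.l :=
    (𝔇.agree _ hs.face_mem _ ht _ _ hs.ne hs.l_mem hs.r_mem hl hr).symm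
  have er : 𝔇.D t s.r = 𝔇.D s.face s.r :=
    (𝔇.agree _ hs.face_mem _ ht _ _ hs.ne.symm hs.r_mem hs.l_mem hr hl).symm
  have sl : 0 < ev (refr 𝔇 s φ) (𝔇.D t s.l) := by rw [el, ev_refr_l]; exact hS.1
  have sr : ev (refr 𝔇 s φ) (𝔇.D t s.r) < 0 := by rw [er, ev_refr_r hs]; exact hS.2
  rcases lt_or_gt_of_ne (hg t c) with h | h
  · refine ⟨⟨t, s.l, c, b⟩, ⟨h1, h2, hl, hr, Or.inl ⟨rfl, hc2⟩⟩, ?_, sl, h⟩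
    exact VInv.of_ahead (s' := ⟨t, s.l, c, b⟩) ht hl hr hl hc hs.ne hc1.symm (Or.inl ⟨rfl, hc2⟩)
      fun c hc hcl hcr => hs.next_ahead ht hl hr h1 h2 hc hcl hcr
  · refine ⟨⟨t, c, s.r, b⟩, ⟨h1, h2, hl, hr, Or.inr ⟨rfl, hc1⟩⟩, ?_, h, sr⟩
    exact VInv.of_ahead (s' := ⟨t, c, s.r, b⟩) ht hl hr hc hr hs.ne hc2 (Or.inr ⟨rfl, hc1⟩)
      fun c hc hcl hcr => hs.next_ahead ht hl hr h1 h2 hc hcl hcr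

lemma CStep.face_eq {s s' s'' : CState V} (h : CStep P s s') (h' : CStep P s s'') (hs : VInv 𝔇 s)
    (hs' : VInv 𝔇 s') (hs'' : VInv 𝔇 s'') : s'.face = s''.face ∧ s'.ε = s''.ε := by
  by_cases hb : P.IsBoundaryEdge s.edge
  · exact ⟨(h.bd hb).1.trans (h'.bd hb).1.symm, (h.bd hb).2.trans (h'.bd hb).2.symm⟩
  · exact ⟨faces_le_two hs.face_mem hs'.face_mem hs''.face_mem hs.ne ⟨hs.l_mem, hs.r_mem⟩
      ⟨h.l_mem, h.r_mem⟩ ⟨h'.l_mem, h'.r_mem⟩ (h.int hb).1.symm (h'.int hb).1.symm,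
      (h.int hb).2.trans (h'.int hb).2.symm⟩

/-- The next state is determined by the signs of the functional. -/
lemma CStep.unique {s s' s'' : CState V} (h : CStep P s s') (h' : CStep P s s'') (hs : VInv 𝔇 s)
    (hs' : VInv 𝔇 s') (hs'' : VInv 𝔇 s'') {φ : Fn} (hS' : Sep 𝔇 φ s') (hS'' : Sep 𝔇 φ s'') :
    s' = s'' := by
  obtain ⟨hf, he⟩ := h.face_eq h' hs hs' hs''
  have key : ∀ {s' s'' : CState V}, VInv 𝔇 s' → s'.face = s''.face → Sep 𝔇 φ s' →
      Sep 𝔇 φ s'' → s'.face = {s.l, s.r, s'.r} → s''.face = {s.l, s.r, s''.l} → s'.r ≠ s.l →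
      s'.r ≠ s.r → False := by
    intro s' s'' hs' hf hS' hS'' h1 h2 n1 n2
    have : s'.r ∈ s''.face := hf ▸ hs'.r_mem
    rw [h2] at this
    simp only [Finset.mem_insert, Finset.mem_singleton, n1, n2, false_or] at this
    have a := hS'.2
    rw [this, hf] at a
    linarith [hS''.1]
  rcases h.mem_cases hs hs' with ⟨t1, t2, t3, t4⟩ | ⟨t1, t2, t3, t4⟩ <;>
    rcases h'.mem_cases hs hs'' with ⟨u1, u2, u3, u4⟩ | ⟨u1, u2, u3, u4⟩
  · refine CState.ext' hf (t1.trans u1.symm) ?_ he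
    have : s'.r ∈ s''.face := hf ▸ hs'.r_mem
    rw [u4] at this
    simpa only [Finset.mem_insert, Finset.mem_singleton, t2, t3, false_or] using this
  · exact (key hs' hf hS' hS'' t4 u4 t3 t2).elim
  · exact (key hs'' hf.symm hS'' hS' u4 t4 u3 u2).elim
  · refine CState.ext' hf ?_ (t1.trans u1.symm) he
    have : s'.l ∈ s''.face := hf ▸ hs'.l_mem
    rw [u4] at this
    simpa only [Finset.mem_insert, Finset.mem_singleton, t2, t3, false_or] using this

/-- The previous state through a given edge of the triangle. -/
lemma VInv.exists_prev_edge {s : CState V} (hs : VInv 𝔇 s) {φ : Fn} {a b : V}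
    (ha : a ∈ s.face) (hb : b ∈ s.face) (hab : a ≠ b)
    (turn : (s.l = a ∧ s.r ≠ b) ∨ (s.r = b ∧ s.l ≠ a))
    (hpos : 0 < ev φ (𝔇.D s.face a)) (hneg : ev φ (𝔇.D s.face b) < 0) :
    ∃ s₀ φ₀, CStep P s₀ s ∧ VInv 𝔇 s₀ ∧ Sep 𝔇 φ₀ s₀ ∧ refr 𝔇 s₀ φ₀ = φ ∧ s₀.l = a ∧ s₀.r = b ∧
      (φ₀ = φ ∨ φ₀ = pull (𝔇.D s.face a) (𝔇.D s.face b) φ) := by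
  have front : ∀ c ∈ s.face, c ≠ a → c ≠ b →
      0 < sg s.ε * cr (𝔇.D s.face a) (𝔇.D s.face b) (𝔇.D s.face c) := by
    intro c hc h1 h2
    rcases turn with ⟨t1, t2⟩ | ⟨t1, t2⟩
    · have hr : s.r = c := by
        obtain ⟨d, d1, d2, d3⟩ := Billiard.exists_apex hs.face_mem ha hb hab
        have m1 := hs.r_mem
        rw [d3] at m1 hc
        simp only [Finset.mem_insert, Finset.mem_singleton, h1, h2, false_or] at hc
        simp only [Finset.mem_insert, Finset.mem_singleton, t2, false_or,
          show s.r ≠ a from fun h => hs.ne (t1.trans h.symm)] at m1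
        rw [m1, hc]
      have := hs.behind b hb (by rw [t1]; exact hab.symm) (by rw [hr]; exact h2.symm)
      rw [t1, hr] at this
      have e : cr (𝔇.D s.face a) (𝔇.D s.face b) (𝔇.D s.face c) =
        - cr (𝔇.D s.face a) (𝔇.D s.face c) (𝔇.D s.face b) := by unfold cr; ring
      rw [e]; linarith
    · have hl : s.l = c := by
        obtain ⟨d, d1, d2, d3⟩ := Billiard.exists_apex hs.face_mem ha hb hab
        have m1 := hs.l_mem
        rw [d3] at m1 hc
        simp only [Finset.mem_insert, Finset.mem_singleton, h1, h2, false_or] at hc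
        simp only [Finset.mem_insert, Finset.mem_singleton, t2, false_or,
          show s.l ≠ b from fun h => hs.ne (h.trans t1.symm)] at m1
        rw [m1, hc]
      have := hs.behind a ha (by rw [hl]; exact h1.symm) (by rw [t1]; exact hab)
      rw [t1, hl] at this
      have e : cr (𝔇.D s.face a) (𝔇.D s.face b) (𝔇.D s.face c) =
        - cr (𝔇.D s.face c) (𝔇.D s.face b) (𝔇.D s.face a) := by unfold cr; ring
      rw [e]; linarith
  by_cases hbd : P.IsBoundaryEdge {a, b}
  · set s₀ : CState V := ⟨s.face, a, b, !s.ε⟩ with hs₀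
    have hbd' : P.IsBoundaryEdge s₀.edge := hbd
    refine ⟨s₀, pull (𝔇.D s.face a) (𝔇.D s.face b) φ, ⟨fun _ => ⟨rfl, by simp [hs₀]⟩,
      fun h => absurd hbd' h, ha, hb, turn⟩, ⟨hs.face_mem, ha, hb, hab, fun c hc h1 h2 => ?_⟩,
      ⟨?_, ?_⟩, ?_, rfl, rfl, Or.inr rfl⟩
    · have := front c hc h1 h2
      simp only [hs₀, sg_not]
      linarith
    · simpa only [hs₀, ev_pull, mirror_left] using hpos
    · simpa only [hs₀, ev_pull, mirror_right (𝔇.D_ne hs.face_mem ha hb hab)] using hneg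
    · rw [refr, if_pos hbd', pull_pull (𝔇.D_ne hs.face_mem ha hb hab)]
  · obtain ⟨t, ht, hne, hat, hbt⟩ := exists_other_face hs.face_mem hab ha hb hbd
    set s₀ : CState V := ⟨t, a, b, s.ε⟩ with hs₀
    have hbd' : ¬ P.IsBoundaryEdge s₀.edge := hbd
    have ea : 𝔇.D t a = 𝔇.D s.face a := (𝔇.agree _ hs.face_mem _ ht _ _ hab ha hb hat hbt).symm
    have eb : 𝔇.D t b = 𝔇.D s.face b :=
      (𝔇.agree _ hs.face_mem _ ht _ _ hab.symm hb ha hbt hat).symm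
    refine ⟨s₀, φ, ⟨fun h => absurd h hbd', fun _ => ⟨hne.symm, rfl⟩, ha, hb, turn⟩,
      ⟨ht, hat, hbt, hab, fun c hc h1 h2 => ?_⟩, ⟨?_, ?_⟩, ?_, rfl, rfl, Or.inl rfl⟩
    · obtain ⟨d, hd1, hd2, hd3⟩ := Billiard.exists_apex hs.face_mem ha hb hab
      have hd : d ∈ s.face := by rw [hd3]; simp
      have h4 := front d hd hd1 hd2
      have h5 := 𝔇.opp s.face hs.face_mem t ht a b d c hab ha hb hat hbt hne.symm hd hd1 hd2
        hc h1 h2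
      exact sg_mul_neg h4 h5
    · simpa only [hs₀, ea] using hpos
    · simpa only [hs₀, eb] using hneg
    · rw [refr, if_neg hbd']

lemma transp_prepend {o : ℕ → CState V} {s₀ : CState V} {φ φ₀ : Fn} (hφ : refr 𝔇 s₀ φ₀ = φ)
    (k : ℕ) : transp 𝔇 (GeneralizedPolygon.prepend s₀ o) φ₀ (k + 1) = transp 𝔇 o φ k := by
  induction k with
  | zero => exact hφ
  | succ k ih => rw [transp, ih]; rfl

lemma IsOrbit.prepend {o : ℕ → CState V} {φ φ₀ : Fn} (h : IsOrbit 𝔇 o φ) {s₀ : CState V}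
    (hst : CStep P s₀ (o 0)) (hv : VInv 𝔇 s₀) (hS : Sep 𝔇 φ₀ s₀) (hφ : refr 𝔇 s₀ φ₀ = φ) :
    IsOrbit 𝔇 (prepend s₀ o) φ₀ := by
  refine ⟨?_, ?_, ?_, ?_⟩
  · rintro (_ | k)
    exacts [hv, h.inv k]
  · rintro (_ | k)
    exacts [hst, h.step k]
  · rw [← h.unit, ← hφ, gsq_refr hv]
  · rintro (_ | k)
    · exact hS
    · rw [transp_prepend hφ]; exact h.sep k

/-! ### Generic functionals -/

/-- All formal words of reflections are admitted, whether or not a path realizes them. There are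
countably many, and the conditions in `Gen` are stable under every step, forward or backward. -/
noncomputable def pulls (𝔇 : Dev P) : List (Finset V × V × V) → Fn → Fn
  | [], φ => φ
  | x :: w, φ => pulls 𝔇 w (pull (𝔇.D x.1 x.2.1) (𝔇.D x.1 x.2.2) φ)

/-- No vertex of the unfolding lies on the line. -/
def Gen (𝔇 : Dev P) (φ : Fn) : Prop := ∀ w t v, ev (pulls 𝔇 w φ) (𝔇.D t v) ≠ 0

lemma Gen.pull {φ : Fn} (h : Gen 𝔇 φ) (t : Finset V) (a b : V) :
    Gen 𝔇 (pull (𝔇.D t a) (𝔇.D t b) φ) := fun w => h ((t, a, b) :: w)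

lemma Gen.refr {φ : Fn} (h : Gen 𝔇 φ) (s : CState V) : Gen 𝔇 (refr 𝔇 s φ) := by
  unfold Billiard.refr
  split_ifs
  exacts [h.pull _ _ _, h]

lemma Gen.ne {φ : Fn} (h : Gen 𝔇 φ) (t : Finset V) (v : V) : ev φ (𝔇.D t v) ≠ 0 := h [] t v

lemma pull_const (a b : Pt) (η : ℝ) : pull a b (0, 0, η) = (0, 0, η) := by
  simp [Billiard.pull]

lemma pulls_add_const (w : List (Finset V × V × V)) (φ : Fn) (η : ℝ) :
    pulls 𝔇 w (φ + (0, 0, η)) = pulls 𝔇 w φ + (0, 0, η) := by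
  induction w generalizing φ with
  | nil => rfl
  | cons x w ih => simp only [pulls, pull_add, pull_const, ih]

lemma pulls_smul (w : List (Finset V × V × V)) (φ : Fn) (r : ℝ) :
    pulls 𝔇 w (r • φ) = r • pulls 𝔇 w φ := by
  induction w generalizing φ with
  | nil => rfl
  | cons x w ih => simp only [pulls, pull_smul, ih]

lemma Gen.smul {φ : Fn} (h : Gen 𝔇 φ) {r : ℝ} (hr : r ≠ 0) : Gen 𝔇 (r • φ) := fun w t v => by
  rw [pulls_smul, ev_smul]
  exact mul_ne_zero hr (h w t v)

lemma ev_const (η : ℝ) (z : Pt) : ev (0, 0, η) z = η := by simp [ev]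

/-- Constants are invariant under reflections, so each word and each vertex exclude a single
translation `η`. -/
lemma exists_gen (𝔇 : Dev P) (φ : Fn) {x y : ℝ} (h : x < y) :
    ∃ η, x < η ∧ η < y ∧ Gen 𝔇 (φ + (0, 0, η)) := by
  have hc : (Set.range fun i : List (Finset V × V × V) × Finset V × V =>
      - ev (pulls 𝔇 i.1 φ) (𝔇.D i.2.1 i.2.2)).Countable := Set.countable_range _
  obtain ⟨η, h1, h2, h3⟩ := (hc.dense_compl ℝ).exists_between h
  refine ⟨η, h2, h3, fun w t v h0 => h1 ⟨(w, t, v), ?_⟩⟩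
  rw [pulls_add_const, ev_add, ev_const] at h0
  simp only
  linarith

/-- A generic line has an infinite forward orbit. -/
lemma exists_orbit {s : CState V} (hs : VInv 𝔇 s) {φ : Fn} (hS : Sep 𝔇 φ s) (hg : Gen 𝔇 φ)
    (hu : gsq φ = 1) : ∃ c, c 0 = s ∧ IsOrbit 𝔇 c φ := by
  have hnext : ∀ x : {x : CState V × Fn // VInv 𝔇 x.1 ∧ Sep 𝔇 x.2 x.1 ∧ Gen 𝔇 x.2},
      ∃ y : {x : CState V × Fn // VInv 𝔇 x.1 ∧ Sep 𝔇 x.2 x.1 ∧ Gen 𝔇 x.2},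
        CStep P x.1.1 y.1.1 ∧ y.1.2 = refr 𝔇 x.1.1 x.1.2 := by
    rintro ⟨⟨s, φ⟩, hs, hS, hg⟩
    obtain ⟨s', h1, h2, h3⟩ := hs.exists_step hS (hg.refr s).ne
    exact ⟨⟨⟨s', refr 𝔇 s φ⟩, h2, h3, hg.refr s⟩, h1, rfl⟩
  choose f hf1 hf2 using hnext
  set x₀ : {x : CState V × Fn // VInv 𝔇 x.1 ∧ Sep 𝔇 x.2 x.1 ∧ Gen 𝔇 x.2} := ⟨⟨s, φ⟩, hs, hS, hg⟩
  have ht : ∀ k, transp 𝔇 (fun k => (f^[k] x₀).1.1) φ k = (f^[k] x₀).1.2 := by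
    intro k
    induction k with
    | zero => rfl
    | succ k ih => rw [transp, ih, Function.iterate_succ_apply', hf2]
  refine ⟨fun k => (f^[k] x₀).1.1, rfl, fun k => (f^[k] x₀).2.1, fun k => ?_, hu, fun k => ?_⟩
  · simp only [Function.iterate_succ_apply']
    exact hf1 _
  · rw [ht]
    exact (f^[k] x₀).2.2.1

/-- The sign at the apex of the first triangle decides through which edge the line came in. The last
clause records this; it tells on which side a line passes a vertex. -/
lemma IsOrbit.exists_prev {o : ℕ → CState V} {φ : Fn} (h : IsOrbit 𝔇 o φ) (hg : Gen 𝔇 φ) :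
    ∃ s₀ φ₀, IsOrbit 𝔇 (GeneralizedPolygon.prepend s₀ o) φ₀ ∧ Gen 𝔇 φ₀ ∧ refr 𝔇 s₀ φ₀ = φ ∧
      ∀ c ∈ (o 0).face, c ≠ (o 0).l → c ≠ (o 0).r →
        (0 < ev φ (𝔇.D (o 0).face c) → s₀.l = c ∧ s₀.r = (o 0).r) ∧
        (ev φ (𝔇.D (o 0).face c) < 0 → s₀.l = (o 0).l ∧ s₀.r = c) := by
  have hs := h.inv 0
  obtain ⟨a, a1, a2, a3⟩ := hs.exists_apex
  have ha : a ∈ (o 0).face := by rw [a3]; simp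
  have huniq : ∀ c ∈ (o 0).face, c ≠ (o 0).l → c ≠ (o 0).r → c = a := by
    intro c hc h1 h2
    rw [a3] at hc
    simpa only [Finset.mem_insert, Finset.mem_singleton, h1, h2, false_or] using hc
  have hS : Sep 𝔇 φ (o 0) := h.sep 0
  have fin : ∀ s₀ φ₀, Sep 𝔇 φ₀ s₀ → (φ₀ = φ ∨ ∃ t a b, φ₀ = pull (𝔇.D t a) (𝔇.D t b) φ) →
      Gen 𝔇 φ₀ := by
    rintro s₀ φ₀ - (rfl | ⟨t, a, b, rfl⟩)
    exacts [hg, hg.pull _ _ _]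
  rcases lt_or_gt_of_ne (hg.ne (o 0).face a) with hlt | hgt
  · obtain ⟨s₀, φ₀, h1, h2, h3, h4, h5, h6, h7⟩ := hs.exists_prev_edge hs.l_mem ha a1.symm
      (Or.inl ⟨rfl, a2.symm⟩) hS.1 hlt
    refine ⟨s₀, φ₀, h.prepend h1 h2 h3 h4, fin s₀ φ₀ h3 ?_, h4, fun c hc c1 c2 => ?_⟩
    · rcases h7 with h7 | h7
      exacts [Or.inl h7, Or.inr ⟨_, _, _, h7⟩]
    · obtain rfl := huniq c hc c1 c2
      exact ⟨fun h => absurd h hlt.not_gt, fun _ => ⟨h5, h6⟩⟩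
  · obtain ⟨s₀, φ₀, h1, h2, h3, h4, h5, h6, h7⟩ := hs.exists_prev_edge ha hs.r_mem a2
      (Or.inr ⟨rfl, a1.symm⟩) hgt hS.2
    refine ⟨s₀, φ₀, h.prepend h1 h2 h3 h4, fin s₀ φ₀ h3 ?_, h4, fun c hc c1 c2 => ?_⟩
    · rcases h7 with h7 | h7
      exacts [Or.inl h7, Or.inr ⟨_, _, _, h7⟩]
    · obtain rfl := huniq c hc c1 c2
      exact ⟨fun _ => ⟨h5, h6⟩, fun h => absurd h hgt.not_gt⟩

lemma IsOrbit.chain {c : ℕ → CState V} {ψ : Fn} (h : IsOrbit 𝔇 c ψ) (n : ℕ) : Chain 𝔇 c n :=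
  ⟨fun k _ => h.inv k, fun k _ => h.step k⟩

lemma IsOrbit.fsep {c : ℕ → CState V} {ψ : Fn} (h : IsOrbit 𝔇 c ψ) (n : ℕ) : FSep 𝔇 c ψ n :=
  fun k _ => h.sep k

/-- A generic orbit extends backward to a bounce. -/
lemma IsOrbit.exists_back {o : ℕ → CState V} {φ : Fn} (h : IsOrbit 𝔇 o φ) (hg : Gen 𝔇 φ) :
    ∃ c ψ n, IsOrbit 𝔇 c ψ ∧ (∀ k, c (n + k) = o k) ∧ transp 𝔇 c ψ n = φ ∧
      P.IsBoundaryEdge (c 0).edge ∧ (∀ k, 0 < k → k ≤ n → ¬ P.IsBoundaryEdge (c k).edge) := by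
  by_contra hcon
  obtain ⟨N, hN⟩ := 𝔇.exists_chain_bound
  -- If no bounce is ever met, the backward extension yields chains without bounces of any length,
  -- against `hN`.
  have key : ∀ n, ∃ c ψ, IsOrbit 𝔇 c ψ ∧ Gen 𝔇 ψ ∧ (∀ k, c (n + k) = o k) ∧
      transp 𝔇 c ψ n = φ ∧ ∀ k ≤ n, ¬ P.IsBoundaryEdge (c k).edge := by
    intro n
    induction n with
    | zero =>
      refine ⟨o, φ, h, hg, fun k => by rw [zero_add], rfl, fun k hk hb => hcon ?_⟩
      obtain rfl : k = 0 := by omega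
      exact ⟨o, φ, 0, h, fun k => by rw [zero_add], rfl, hb, fun k h1 h2 => by omega⟩
    | succ n ih =>
      obtain ⟨c, ψ, h1, h2, h3, h8, h4⟩ := ih
      obtain ⟨s₀, φ₀, h5, h6, h9, -⟩ := h1.exists_prev h2
      have h10 : transp 𝔇 (GeneralizedPolygon.prepend s₀ c) φ₀ (n + 1) = φ := by
        rw [transp_prepend h9, h8]
      have h7 : ∀ k, GeneralizedPolygon.prepend s₀ c (n + 1 + k) = o k := by
        intro k
        rw [show n + 1 + k = n + k + 1 by ring]
        exact h3 k
      refine ⟨_, φ₀, h5, h6, h7, h10, ?_⟩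
      rintro (_ | k) hk
      · intro hb
        refine hcon ⟨_, φ₀, n + 1, h5, h7, h10, hb, ?_⟩
        rintro (_ | k) hk0 hk1
        · omega
        · exact h4 k (by omega)
      · exact h4 k (by omega)
  obtain ⟨c, ψ, h1, -, -, -, h4⟩ := key N
  exact lt_irrefl _ (hN c N ψ (h1.chain N) h1.unit (h1.fsep N) fun k hk => h4 k hk.le)

/-! ### Bounce sequences -/

/-- `κ` enumerates the bounces. -/
structure Bounces (P : GeneralizedPolygon V) (c : ℕ → CState V) (κ : ℕ → ℕ)
    (E : ℕ → P.BoundaryEdge) : Prop where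
  mono : StrictMono κ
  range : Set.range κ = {k | P.IsBoundaryEdge (c k).edge}
  edge : ∀ i, (E i).1 = (c (κ i)).edge

lemma exists_bounces_of_infinite {c : ℕ → CState V}
    (h : ∀ m, ∃ k ≥ m, P.IsBoundaryEdge (c k).edge) : ∃ κ E, Bounces P c κ E := by
  classical
  have hinf : {k | P.IsBoundaryEdge (c k).edge}.Infinite := by
    rw [Set.infinite_iff_exists_gt]
    intro m
    obtain ⟨k, hk, hb⟩ := h (m + 1)
    exact ⟨k, hb, by omega⟩
  refine ⟨Nat.nth fun k => P.IsBoundaryEdge (c k).edge,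
    fun i => ⟨(c (Nat.nth (fun k => P.IsBoundaryEdge (c k).edge) i)).edge,
      Nat.nth_mem_of_infinite hinf i⟩, Nat.nth_strictMono hinf, Nat.range_nth_of_infinite hinf,
    fun i => rfl⟩

/-- A tail without bounces would contain arbitrarily long chains without bounces. -/
lemma IsOrbit.exists_bounces {c : ℕ → CState V} {ψ : Fn} (h : IsOrbit 𝔇 c ψ) :
    ∃ κ E, Bounces P c κ E := by
  apply exists_bounces_of_infinite
  intro m
  by_contra hcon
  push Not at hcon
  obtain ⟨N, hN⟩ := 𝔇.exists_chain_bound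
  have h' := h.drop m
  exact lt_irrefl _ (hN _ N _ (h'.chain N) h'.unit (h'.fsep N) fun k _ => hcon _ (by omega))

/-- From here on trajectories are replaced by orbits of the development. -/
lemma mem_spectrum_iff (𝔇 : Dev P) (E : ℕ → P.BoundaryEdge) :
    E ∈ P.forwardBounceSpectrum ↔ ∃ c ψ κ, IsOrbit 𝔇 c ψ ∧ Bounces P c κ E := by
  constructor
  · rintro ⟨τ, κ, h1, h2, h3⟩
    obtain ⟨c, ψ, h, hc⟩ := exists_orbit_of_trajectory 𝔇 τ
    refine ⟨c, ψ, κ, h, h1, ?_, fun i => ?_⟩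
    · rw [h2]; simp only [(hc _).2]
    · rw [(hc _).2, h3]
  · rintro ⟨c, ψ, κ, h, hb⟩
    obtain ⟨τ, hτ⟩ := exists_trajectory_of_orbit h
    refine ⟨τ, κ, hb.mono, ?_, fun i => ?_⟩
    · rw [hb.range]; simp only [hτ]
    · rw [hτ, hb.edge]

/-- Enumerations of sets that agree on an interval agree there, up to a shift. -/
lemma enum_local {p p' : ℕ → Prop} {κ κ' : ℕ → ℕ} (hm : StrictMono κ) (hm' : StrictMono κ')
    (hr : Set.range κ = {k | p k}) (hr' : Set.range κ' = {k | p' k}) {a a' i₀ i₀' L : ℕ}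
    (h : ∀ i, a ≤ κ i ↔ i₀ ≤ i) (h' : ∀ i, a' ≤ κ' i ↔ i₀' ≤ i)
    (hp : ∀ j ≤ L, p (a + j) ↔ p' (a' + j)) (i : ℕ) (hi : κ (i₀ + i) ≤ a + L) :
    κ' (i₀' + i) + a = κ (i₀ + i) + a' := by
  induction i using Nat.strong_induction_on with
  | _ i ih =>
    obtain ⟨j, hj⟩ := Nat.exists_eq_add_of_le ((h (i₀ + i)).2 (by omega))
    have h1 : p (a + j) := by
      have : κ (i₀ + i) ∈ {k | p k} := hr ▸ Set.mem_range_self _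
      rwa [hj] at this
    have h2 : a' + j ∈ Set.range κ' := by rw [hr']; exact (hp j (by omega)).1 h1
    obtain ⟨y, hy⟩ := h2
    obtain ⟨i', rfl⟩ := Nat.exists_eq_add_of_le ((h' y).1 (by omega))
    rcases lt_trichotomy i' i with hlt | rfl | hgt
    · have h3 := ih i' hlt ((hm (by omega : i₀ + i' < i₀ + i)).le.trans hi)
      have h4 := hm (by omega : i₀ + i' < i₀ + i)
      omega
    · omega
    · have h3 := hm' (by omega : i₀' + i < i₀' + i')
      obtain ⟨j₂, hj₂⟩ := Nat.exists_eq_add_of_le ((h' (i₀' + i)).2 (by omega))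
      have h4 : p' (a' + j₂) := by
        have : κ' (i₀' + i) ∈ {k | p' k} := hr' ▸ Set.mem_range_self _
        rwa [hj₂] at this
      have h5 : a + j₂ ∈ Set.range κ := by rw [hr]; exact (hp j₂ (by omega)).2 h4
      obtain ⟨z, hz⟩ := h5
      obtain ⟨i₂, rfl⟩ := Nat.exists_eq_add_of_le ((h z).1 (by omega))
      have h6 : i₂ < i := by
        have := hm.lt_iff_lt.1 (by omega : κ (i₀ + i₂) < κ (i₀ + i))
        omega
      have h7 := ih i₂ h6 ((hm (by omega : i₀ + i₂ < i₀ + i)).le.trans hi)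
      have h8 : κ' (i₀' + i₂) = κ' (i₀' + i) := by omega
      have := hm'.injective h8
      omega

end Billiard

namespace Billiard
open Finset Filter Topology
open GeneralizedPolygon
variable {V : Type*} [Fintype V] [DecidableEq V]
variable {P : GeneralizedPolygon V} {𝔇 : Dev P}

/-! ### Limits -/

lemma mem_closure_seq_iff {α : Type*} [TopologicalSpace α] [DiscreteTopology α]
    {S : Set (ℕ → α)} {E : ℕ → α} :
    E ∈ closure S ↔ ∀ n, ∃ E' ∈ S, ∀ i < n, E' i = E i := by
  rw [(PiNat.isTopologicalBasis_cylinders fun _ : ℕ => α).mem_closure_iff]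
  constructor
  · intro h n
    obtain ⟨E', h1, h2⟩ := h (PiNat.cylinder E n) ⟨E, n, rfl⟩ (PiNat.self_mem_cylinder E n)
    exact ⟨E', h2, h1⟩
  · rintro h _ ⟨x, n, rfl⟩ hE
    obtain ⟨E', h1, h2⟩ := h n
    exact ⟨E', fun i hi => (h2 i hi).trans (hE i hi), h1⟩

lemma Ultrafilter.exists_eventually_eq {ι α : Type*} [Finite α] (U : Ultrafilter ι) (f : ι → α) :
    ∃ a, ∀ᶠ i in U, f i = a := by
  obtain ⟨a, -, ha⟩ := (U.map f).eq_pure_of_finite_mem Set.finite_univ Filter.univ_mem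
  refine ⟨a, ?_⟩
  have h : {x | x = a} ∈ U.map f := by rw [ha]; exact rfl
  exact h

lemma Ultrafilter.exists_tendsto {ι : Type*} (U : Ultrafilter ι) {f : ι → Fn} {R : ℝ}
    (h : ∀ i, f i ∈ Metric.closedBall (0 : Fn) R) : ∃ T, Tendsto f U (𝓝 T) := by
  obtain ⟨T, -, hT⟩ := (isCompact_closedBall (0 : Fn) R).ultrafilter_le_nhds' (U.map f)
    (Filter.Eventually.of_forall (f := (U : Filter ι)) h)
  exact ⟨T, hT⟩

instance : Finite (CState V) :=
  Finite.of_injective (fun s : CState V => (s.face, s.l, s.r, s.ε)) fun s s' h => by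
    simp only [Prod.mk.injEq] at h
    exact CState.ext' h.1 h.2.1 h.2.2.1 h.2.2.2

lemma transp_congr {c c' : ℕ → CState V} {n : ℕ} (h : ∀ k < n, c k = c' k) (ψ : Fn) :
    ∀ k ≤ n, transp 𝔇 c ψ k = transp 𝔇 c' ψ k := by
  intro k
  induction k with
  | zero => intro _; rfl
  | succ k ih => intro hk; rw [transp, transp, ih (by omega), h k hk]

lemma continuous_refr (s : CState V) : Continuous (refr 𝔇 s) := by
  unfold refr
  split_ifs
  · unfold pull; fun_prop
  · exact continuous_id

lemma continuous_transp (c : ℕ → CState V) (k : ℕ) : Continuous fun ψ => transp 𝔇 c ψ k := by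
  induction k with
  | zero => exact continuous_id
  | succ k ih => exact (continuous_refr (c k)).comp ih

lemma continuous_gsq : Continuous gsq := by unfold gsq; fun_prop

lemma continuous_ev_fst {f : Fn → Fn} (hf : Continuous f) (z : Pt) :
    Continuous fun ψ => ev (f ψ) z := (continuous_ev z).comp hf

lemma Dev.Const.mem_ball {ρ κ : ℝ} (hc : 𝔇.Const ρ κ) {φ : Fn} (hu : gsq φ = 1) {s : CState V}
    (hs : VInv 𝔇 s) (hS : Sep 𝔇 φ s) : φ ∈ Metric.closedBall (0 : Fn) (2 * ρ) := by
  have h1 := abs_le_of_gsq hu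
  have h2 := hc.Yc_le hs hS
  have h3 := hS.ev_Yc
  have hρ := hc.one_le
  have h4 := dot_le h1.1 h1.2 h2.1 h2.2
  have h5 : φ.2.2 = -(φ.1 * (Yc 𝔇 φ s).1 + φ.2.1 * (Yc 𝔇 φ s).2) := by
    unfold ev at h3; linarith
  rw [mem_closedBall_zero_iff, Prod.norm_def, Prod.norm_def, Real.norm_eq_abs, Real.norm_eq_abs,
    Real.norm_eq_abs, h5, abs_neg]
  refine max_le (by linarith [h1.1]) (max_le (by linarith [h1.2]) h4)

lemma Bounces.drop {c : ℕ → CState V} {κ : ℕ → ℕ} {E : ℕ → P.BoundaryEdge}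
    (h : Bounces P c κ E) (m : ℕ) :
    Bounces P (fun k => c (κ m + k)) (fun i => κ (m + i) - κ m) (fun i => E (m + i)) := by
  have hle : ∀ i, κ m ≤ κ (m + i) := fun i => h.mono.monotone (by omega)
  refine ⟨fun i j hij => ?_, ?_, fun i => ?_⟩
  · have := h.mono (show m + i < m + j by omega)
    have := hle i
    change κ (m + i) - κ m < κ (m + j) - κ m
    omega
  · ext k
    constructor
    · rintro ⟨i, rfl⟩
      have h1 : κ (m + i) ∈ {k | P.IsBoundaryEdge (c k).edge} := h.range ▸ Set.mem_range_self _
      have h2 : κ m + (κ (m + i) - κ m) = κ (m + i) := by have := hle i; omega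
      simp only [Set.mem_ofPred_eq, h2]
      exact h1
    · intro hk
      have h1 : κ m + k ∈ Set.range κ := by rw [h.range]; exact hk
      obtain ⟨j, hj⟩ := h1
      have h2 : m ≤ j := by
        have := h.mono.le_iff_le (a := m) (b := j)
        omega
      obtain ⟨i, rfl⟩ := Nat.exists_eq_add_of_le h2
      exact ⟨i, by simp only; omega⟩
  · have h2 : κ m + (κ (m + i) - κ m) = κ (m + i) := by have := hle i; omega
    simp only [h2]
    exact h.edge _

/-- A sequence in the closure of the spectrum is the bounce sequence of a code whose finite parts
are realized, and that is weakly separated by a limit functional. -/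
lemma exists_limit_code {E : ℕ → P.BoundaryEdge} (hE : E ∈ closure P.forwardBounceSpectrum) :
    ∃ (F : ℕ → CState V) (κ : ℕ → ℕ) (T : Fn), Bounces P F κ E ∧ κ 0 = 0 ∧ (∀ k, VInv 𝔇 (F k)) ∧
      (∀ k, CStep P (F k) (F (k + 1))) ∧ gsq T = 1 ∧
      (∀ k, 0 ≤ ev (transp 𝔇 F T k) (𝔇.D (F k).face (F k).l) ∧
        ev (transp 𝔇 F T k) (𝔇.D (F k).face (F k).r) ≤ 0) ∧
      ∀ n, ∃ c ψ, IsOrbit 𝔇 c ψ ∧ ∀ k ≤ n, c k = F k := by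
  rw [mem_closure_seq_iff] at hE
  have happ : ∀ N, ∃ c ψ κ E', IsOrbit 𝔇 c ψ ∧ Bounces P c κ E' ∧ κ 0 = 0 ∧
      ∀ i < N, E' i = E i := by
    intro N
    obtain ⟨E', h1, h2⟩ := hE N
    obtain ⟨c, ψ, κ, h3, h4⟩ := (mem_spectrum_iff 𝔇 E').1 h1
    -- The approximating orbits are cut at their first bounce, so that index `0` of every code is a
    -- bounce.
    refine ⟨_, _, _, _, h3.drop (κ 0), h4.drop 0, by simp, fun i hi => ?_⟩
    simp only [zero_add]
    exact h2 i hi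
  choose c ψ κ E' hO hB hκ hEE using happ
  obtain ⟨ρ, κ₀, hc⟩ := 𝔇.exists_const
  obtain ⟨N₀, hN₀⟩ := 𝔇.exists_chain_bound
  set U : Ultrafilter ℕ := hyperfilter ℕ with hU
  have hF : ∀ k, ∃ s, ∀ᶠ N in U, c N k = s := fun k =>
    Ultrafilter.exists_eventually_eq U fun N => c N k
  choose F hF using hF
  obtain ⟨T, hT⟩ := Ultrafilter.exists_tendsto U (f := ψ) (R := 2 * ρ) fun N =>
    hc.mem_ball (hO N).unit ((hO N).inv 0) ((hO N).sep 0)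
  have hFn : ∀ n, ∀ᶠ N in U, ∀ k ≤ n, c N k = F k := by
    intro n
    have : ∀ᶠ N in U, ∀ k ∈ Finset.range (n + 1), c N k = F k := by
      rw [Filter.eventually_all_finset]
      exact fun k _ => hF k
    exact this.mono fun N hN k hk => hN k (Finset.mem_range.2 (by omega))
  have hlarge : ∀ m, ∀ᶠ N in (U : Filter ℕ), m < N := fun m =>
    Nat.hyperfilter_le_atTop (Filter.eventually_gt_atTop m)
  have hin : ∀ k, VInv 𝔇 (F k) := by
    intro k
    obtain ⟨N, hN⟩ := (hF k).exists
    rw [← hN]; exact (hO N).inv k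
  have hst : ∀ k, CStep P (F k) (F (k + 1)) := by
    intro k
    obtain ⟨N, h1, h2⟩ := ((hF k).and (hF (k + 1))).exists
    rw [← h1, ← h2]; exact (hO N).step k
  -- Gaps between bounces are uniformly bounded, so bounces do not escape to infinity in the limit.
  have hinf : ∀ m, ∃ k ≥ m, P.IsBoundaryEdge (F k).edge := by
    intro m
    by_contra hcon
    push Not at hcon
    obtain ⟨N, hN⟩ := (hFn (m + N₀)).exists
    have h' := (hO N).drop m
    refine lt_irrefl _ (hN₀ _ N₀ _ (h'.chain N₀) h'.unit (h'.fsep N₀) fun k hk => ?_)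
    rw [hN _ (by omega)]
    exact hcon _ (by omega)
  obtain ⟨κF, EF, hBF⟩ := exists_bounces_of_infinite hinf
  have hloc : ∀ i, ∀ᶠ N in U, κ N i = κF i := by
    intro i
    refine (hFn (κF i)).mono fun N hN => ?_
    have := enum_local hBF.mono (hB N).mono hBF.range (hB N).range (a := 0) (a' := 0) (i₀ := 0)
      (i₀' := 0) (L := κF i) (by simp) (by simp)
      (fun j hj => by rw [zero_add, hN j hj]) i (by simp)
    simpa using this
  have hEF : EF = E := by
    funext i
    obtain ⟨N, h1, h2, h3⟩ := ((hloc i).and ((hFn (κF i)).and (hlarge i))).exists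
    rw [← hEE N i h3]
    apply Subtype.ext
    rw [hBF.edge, (hB N).edge, h1, h2 _ le_rfl]
  subst hEF
  have hlim : ∀ k v, Tendsto (fun N => ev (transp 𝔇 (c N) (ψ N) k) (𝔇.D (F k).face v)) U
      (𝓝 (ev (transp 𝔇 F T k) (𝔇.D (F k).face v))) := by
    intro k v
    have h1 : Tendsto (fun N => ev (transp 𝔇 F (ψ N) k) (𝔇.D (F k).face v)) U
      (𝓝 (ev (transp 𝔇 F T k) (𝔇.D (F k).face v))) :=
      ((continuous_ev_fst (continuous_transp F k) _).tendsto T).comp hT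
    refine h1.congr' ((hFn k).mono fun N hN => ?_)
    simp only
    rw [transp_congr (n := k) (fun j hj => hN j (by omega)) _ k le_rfl]
  refine ⟨F, κF, T, hBF, ?_, hin, hst, ?_, fun k => ⟨?_, ?_⟩, fun n => ?_⟩
  · obtain ⟨N, hN⟩ := (hloc 0).exists
    rw [← hN, hκ]
  · refine tendsto_nhds_unique ((continuous_gsq.tendsto T).comp hT) ?_
    refine tendsto_const_nhds.congr fun N => ?_
    exact (hO N).unit.symm
  · refine ge_of_tendsto (hlim k (F k).l) ((hF k).mono fun N hN => ?_)
    have := ((hO N).sep k).1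
    rw [hN] at this
    exact this.le
  · refine le_of_tendsto (hlim k (F k).r) ((hF k).mono fun N hN => ?_)
    have := ((hO N).sep k).2
    rw [hN] at this
    exact this.le
  · obtain ⟨N, hN⟩ := (hFn n).exists
    exact ⟨c N, ψ N, hO N, hN⟩

/-! ### Unfolding -/

open Classical in
noncomputable def rmir (𝔇 : Dev P) (s : CState V) (z : Pt) : Pt :=
  if P.IsBoundaryEdge s.edge then mirror (𝔇.D s.face s.l) (𝔇.D s.face s.r) z else z

/-- Carries the plane of state `k` back to the plane of state `0`, so that the whole path lies on
one line. -/
noncomputable def unf (𝔇 : Dev P) (c : ℕ → CState V) : ℕ → Pt → Pt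
  | 0, z => z
  | k + 1, z => unf 𝔇 c k (rmir 𝔇 (c k) z)

lemma ev_refr (s : CState V) (φ : Fn) (z : Pt) : ev (refr 𝔇 s φ) z = ev φ (rmir 𝔇 s z) := by
  unfold refr rmir
  split_ifs
  · rw [ev_pull]
  · rfl

lemma ev_transp (c : ℕ → CState V) (ψ : Fn) (k : ℕ) (z : Pt) :
    ev (transp 𝔇 c ψ k) z = ev ψ (unf 𝔇 c k z) := by
  induction k generalizing z with
  | zero => rfl
  | succ k ih => rw [transp, ev_refr, ih]; rfl

lemma CStep.cr_rmir {s s' : CState V} (h : CStep P s s') (hs : VInv 𝔇 s) (p q r : Pt) :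
    sg s.ε * cr (rmir 𝔇 s p) (rmir 𝔇 s q) (rmir 𝔇 s r) = sg s'.ε * cr p q r := by
  unfold rmir
  split_ifs with hb
  · rw [cr_mirror hs.D_ne, (h.bd hb).2, sg_not]; ring
  · rw [(h.int hb).2]

lemma cr_unf {c : ℕ → CState V} (hv : ∀ k, VInv 𝔇 (c k)) (hs : ∀ k, CStep P (c k) (c (k + 1)))
    (k : ℕ) (p q r : Pt) :
    sg (c 0).ε * cr (unf 𝔇 c k p) (unf 𝔇 c k q) (unf 𝔇 c k r) = sg (c k).ε * cr p q r := by
  induction k generalizing p q r with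
  | zero => rfl
  | succ k ih => rw [unf, unf, unf, ih, (hs k).cr_rmir (hv k)]

lemma unf_l {c : ℕ → CState V} (hv : ∀ k, VInv 𝔇 (c k)) (hs : ∀ k, CStep P (c k) (c (k + 1)))
    (k : ℕ) : unf 𝔇 c (k + 1) (𝔇.D (c (k + 1)).face (c k).l)
      = unf 𝔇 c k (𝔇.D (c k).face (c k).l) := by
  rw [unf, (hs k).D_l (hv k) (hv _)]
  congr 1
  unfold rmir
  split_ifs
  · exact mirror_left _ _
  · rfl

lemma unf_r {c : ℕ → CState V} (hv : ∀ k, VInv 𝔇 (c k)) (hs : ∀ k, CStep P (c k) (c (k + 1)))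
    (k : ℕ) : unf 𝔇 c (k + 1) (𝔇.D (c (k + 1)).face (c k).r)
      = unf 𝔇 c k (𝔇.D (c k).face (c k).r) := by
  rw [unf, (hs k).D_r (hv k) (hv _)]
  congr 1
  unfold rmir
  split_ifs
  · exact mirror_right (hv k).D_ne
  · rfl

/-- Coordinates along and across the line `T`. -/
def xy (b : Bool) (T : Fn) (z : Pt) : Pt := (sg b * T.2.1 * z.1 - sg b * T.1 * z.2, ev T z)

def alongFn (b : Bool) (T : Fn) : Fn := (sg b * T.2.1, -(sg b * T.1), 0)

lemma ev_alongFn (b : Bool) (T : Fn) (z : Pt) : ev (alongFn b T) z = (xy b T z).1 := by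
  simp only [ev, alongFn, xy]; ring

lemma cr_xy {b : Bool} {T : Fn} (h : gsq T = 1) (p q r : Pt) :
    cr (xy b T p) (xy b T q) (xy b T r) = sg b * cr p q r := by
  unfold gsq at h
  simp only [cr, xy, ev]
  linear_combination sg b * ((q.1 - p.1) * (r.2 - p.2) - (q.2 - p.2) * (r.1 - p.1)) * h

lemma xy_injective {b : Bool} {T : Fn} (h : gsq T = 1) : Function.Injective (xy b T) := by
  intro p q hpq
  have h1 := congrArg Prod.fst hpq
  have h2 := congrArg Prod.snd hpq
  simp only [xy, ev] at h1 h2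
  unfold gsq at h
  have e := sg_sq b
  have h1' : T.2.1 * (p.1 - q.1) - T.1 * (p.2 - q.2) = 0 := by
    linear_combination sg b * h1 - (T.2.1 * (p.1 - q.1) - T.1 * (p.2 - q.2)) * e
  have h2' : T.1 * (p.1 - q.1) + T.2.1 * (p.2 - q.2) = 0 := by linarith
  ext
  · linear_combination T.2.1 * h1' + T.1 * h2' - (p.1 - q.1) * h
  · linear_combination -T.1 * h1' + T.2.1 * h2' - (p.2 - q.2) * h

lemma xy_combo {b : Bool} {T : Fn} (s t : ℝ) (h : s + t = 1) (p q : Pt) :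
    xy b T (s • p + t • q) = s • xy b T p + t • xy b T q := by
  have := ev_combo T s t h p q
  ext
  · simp [xy]; ring
  · simpa [xy] using this

/-! ### Strips -/

/-- A zigzag strip of triangles, in coordinates where the travel is in the first direction. -/
def Strip (L R : ℕ → Pt) : Prop := ∀ k,
  (L (k + 1) = L k ∧ 0 < cr (L k) (R k) (R (k + 1))) ∨
  (R (k + 1) = R k ∧ 0 < cr (L k) (R k) (L (k + 1)))

/-- For `p` above and `q` below the axis the first alternative says that the segment crosses the
axis beyond `x`. The second covers segments contained in the axis, where the determinant vanishes.
-/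
def Beyond (x : ℝ) (p q : Pt) : Prop :=
  0 < cr (x, 0) q p ∨ (p.2 = 0 ∧ q.2 = 0 ∧ x < p.1 ∧ x < q.1)

/-- For `p` off the axis the identity `e` shows that the crossing moves forward. For `p` on the axis
the crossing is `p` itself, unless the segment lies on the axis. -/
lemma Beyond.left {x : ℝ} {p q n : Pt} (h : Beyond x p q) (hp : 0 ≤ p.2) (hq : q.2 ≤ 0)
    (hn : n.2 ≤ 0) (hc : 0 < cr p q n) : Beyond x p n := by
  unfold Beyond at *
  rcases h with h | ⟨h1, h2, h3, h4⟩
  · have e : cr (x, 0) n p * (p.2 - q.2) = cr (x, 0) q p * (p.2 - n.2) + p.2 * cr p q n := by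
      unfold cr; ring
    rcases hp.lt_or_eq with hp' | hp'
    · left
      have h5 : 0 < cr (x, 0) n p * (p.2 - q.2) := by
        rw [e]
        have := mul_pos h (by linarith : 0 < p.2 - n.2)
        have := mul_pos hp' hc
        linarith
      exact pos_of_mul_pos_left h5 (by linarith)
    · unfold cr at h hc ⊢
      simp only [← hp'] at h hc ⊢
      have hq' : q.2 < 0 := by
        rcases hq.lt_or_eq with h6 | h6
        · exact h6
        · rw [h6] at h; linarith
      have hx : x < p.1 := by nlinarith
      rcases hn.lt_or_eq with h7 | h7
      · left; nlinarith
      · right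
        rw [h7] at hc
        exact ⟨trivial, h7, hx, by nlinarith⟩
  · left
    unfold cr at hc ⊢
    simp only [h1, h2] at hc ⊢
    have : n.2 < 0 := by
      rcases hn.lt_or_eq with h6 | h6
      · exact h6
      · rw [h6] at hc; linarith
    nlinarith

lemma cr_flip (p q r : Pt) : cr (p.1, -p.2) (q.1, -q.2) (r.1, -r.2) = - cr p q r := by
  unfold cr; ring

lemma cr_swap (p q r : Pt) : cr q p r = - cr p q r := by unfold cr; ring

lemma Beyond.right {x : ℝ} {p q n : Pt} (h : Beyond x p q) (hp : 0 ≤ p.2) (hq : q.2 ≤ 0)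
    (hn : 0 ≤ n.2) (hc : 0 < cr p q n) : Beyond x n q := by
  have e : ∀ a b : Pt, cr (x, 0) (a.1, -a.2) (b.1, -b.2) = cr (x, 0) b a := by
    intro a b; unfold cr; ring
  have h' : Beyond x (q.1, -q.2) (p.1, -p.2) := by
    rcases h with h | ⟨h1, h2, h3, h4⟩
    · left; rw [e]; exact h
    · right; simp only [h1, h2, neg_zero]; exact ⟨trivial, trivial, h4, h3⟩
  have := h'.left (n := (n.1, -n.2)) (by simpa using hq) (by simpa using hp) (by simpa using hn)
    (by rw [cr_flip, cr_swap]; simpa using hc)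
  rcases this with h | ⟨h1, h2, h3, h4⟩
  · left; rwa [e] at h
  · right; exact ⟨by simpa using h2, by simpa using h1, h4, h3⟩

lemma Beyond.lt_left {x : ℝ} {p q : Pt} (h : Beyond x p q) (hq : q.2 ≤ 0) (h0 : p.2 = 0) :
    x < p.1 := by
  rcases h with h | ⟨-, -, h3, -⟩
  · unfold cr at h
    simp only [h0] at h
    nlinarith
  · exact h3

lemma Beyond.lt_right {x : ℝ} {p q : Pt} (h : Beyond x p q) (hp : 0 ≤ p.2) (h0 : q.2 = 0) :
    x < q.1 := by
  rcases h with h | ⟨-, -, -, h4⟩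
  · unfold cr at h
    simp only [h0] at h
    nlinarith
  · exact h4

lemma Strip.beyond {L R : ℕ → Pt} (h : Strip L R) (hL : ∀ k, 0 ≤ (L k).2) (hR : ∀ k, (R k).2 ≤ 0)
    {x : ℝ} {b : ℕ} (hb : Beyond x (L b) (R b)) : ∀ k, b ≤ k → Beyond x (L k) (R k) := by
  intro k hk
  induction k, hk using Nat.le_induction with
  | base => exact hb
  | succ k hk ih =>
    rcases h k with ⟨h1, h2⟩ | ⟨h1, h2⟩
    · rw [h1]; exact ih.left (hL k) (hR k) (hR _) h2
    · rw [h1]; exact ih.right (hL k) (hR k) (hL _) h2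

/-! ### Reversing the sign of the functional -/

/-- Exchanging left and right together with the orientation and the sign of the functional leaves
the path and its direction unchanged. This reduces singular vertices on the right to singular
vertices on the left. -/
def CState.neg (s : CState V) : CState V := ⟨s.face, s.r, s.l, !s.ε⟩

omit [Fintype V] in
lemma CState.neg_edge (s : CState V) : s.neg.edge = s.edge := Finset.pair_comm _ _

lemma VInv.neg {s : CState V} (h : VInv 𝔇 s) : VInv 𝔇 s.neg := by
  refine ⟨h.face_mem, h.r_mem, h.l_mem, h.ne.symm, fun c hc h1 h2 => ?_⟩
  have := h.behind c hc h2 h1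
  simp only [CState.neg, sg_not]
  rw [cr_swap]
  linarith

lemma CStep.neg {s s' : CState V} (h : CStep P s s') : CStep P s.neg s'.neg := by
  refine ⟨fun hb => ?_, fun hb => ?_, h.r_mem, h.l_mem, h.turn.symm⟩
  · rw [CState.neg_edge] at hb
    exact ⟨(h.bd hb).1, by simp [CState.neg, (h.bd hb).2]⟩
  · rw [CState.neg_edge] at hb
    exact ⟨(h.int hb).1, by simp [CState.neg, (h.int hb).2]⟩

lemma Sep.neg {φ : Fn} {s : CState V} (h : Sep 𝔇 φ s) : Sep 𝔇 (-φ) s.neg := by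
  constructor
  · rw [ev_neg]; exact neg_pos.2 h.2
  · rw [ev_neg]; exact neg_neg_iff_pos.2 h.1

lemma pull_neg (a b : Pt) (φ : Fn) : pull a b (-φ) = - pull a b φ :=
  Fn.ext_ev fun z => by rw [ev_pull, ev_neg, ev_neg, ev_pull]

lemma refr_neg (s : CState V) (φ : Fn) : refr 𝔇 s.neg (-φ) = - refr 𝔇 s φ := by
  unfold refr
  rw [CState.neg_edge]
  split_ifs
  · rw [← pull_neg, pull_comm]; rfl
  · rfl

lemma transp_neg (c : ℕ → CState V) (φ : Fn) (k : ℕ) :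
    transp 𝔇 (fun j => (c j).neg) (-φ) k = - transp 𝔇 c φ k := by
  induction k with
  | zero => rfl
  | succ k ih => rw [transp, ih, refr_neg]; rfl

lemma gsq_neg (φ : Fn) : gsq (-φ) = gsq φ := by simp [gsq]

lemma IsOrbit.neg {c : ℕ → CState V} {ψ : Fn} (h : IsOrbit 𝔇 c ψ) :
    IsOrbit 𝔇 (fun k => (c k).neg) (-ψ) :=
  ⟨fun k => (h.inv k).neg, fun k => (h.step k).neg, by rw [gsq_neg, h.unit], fun k => by
    rw [transp_neg]; exact (h.sep k).neg⟩

lemma Bounces.neg {c : ℕ → CState V} {κ : ℕ → ℕ} {E : ℕ → P.BoundaryEdge}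
    (h : Bounces P c κ E) : Bounces P (fun k => (c k).neg) κ E :=
  ⟨h.mono, by simp only [CState.neg_edge]; exact h.range, fun i => by
    rw [CState.neg_edge]; exact h.edge i⟩

/-! ### Fans -/

/-- A line passes the same vertex on its left only a bounded number of times in a row. -/
lemma Dev.exists_fan_bound (𝔇 : Dev P) : ∃ N : ℕ, ∀ (c : ℕ → CState V) (ψ : Fn),
    IsOrbit 𝔇 c ψ → ∀ n, (∀ k ≤ n, (c k).l = (c 0).l) → n < N := by
  obtain ⟨d, C, hd, hC, h⟩ := 𝔇.exists_drift
  obtain ⟨ρ, κ, hc⟩ := 𝔇.exists_const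
  obtain ⟨N, hN⟩ := exists_nat_gt ((8 * ρ + C) / d)
  refine ⟨N, fun c ψ ho n hl => ?_⟩
  obtain ⟨t, ht⟩ := h c n ψ (ho.chain n) ho.unit (ho.fsep n)
  obtain ⟨h1, h2⟩ := ht n le_rfl
  have hρ := hc.one_le
  set η : Fn := alongFn (c 0).ε ψ with hη
  have h3 := h2 η
  have e : sg (c 0).ε * dt η ψ = 1 := by
    have h4 := sg_sq (c 0).ε
    have h5 := ho.unit
    unfold gsq at h5
    simp only [dt, hη, alongFn]
    linear_combination (ψ.1 ^ 2 + ψ.2.1 ^ 2) * h4 + h5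
  rw [e, mul_one] at h3
  have hη1 : gsq η = 1 := by
    have h4 := sg_sq (c 0).ε
    have h5 := ho.unit
    unfold gsq at h5 ⊢
    simp only [hη, alongFn]
    linear_combination (ψ.1 ^ 2 + ψ.2.1 ^ 2) * h4 + h5
  -- Unfolded, the common left vertex does not move, while the crossing points drift linearly and
  -- yet stay within bounded distance of it.
  have hlk : ∀ k ≤ n, ev (transp 𝔇 c η k) (𝔇.D (c k).face (c k).l)
      = ev η (𝔇.D (c 0).face (c 0).l) := by
    intro k
    induction k with
    | zero => intro _; rfl
    | succ k ih =>
      intro hk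
      have e1 : (c (k + 1)).l = (c k).l := by rw [hl _ hk, hl k (by omega)]
      rw [← ih (by omega), ev_transp, ev_transp, e1, unf_l ho.inv ho.step]
  have hdiff : ∀ k ≤ n, |ev (transp 𝔇 c η k) (Yc 𝔇 (transp 𝔇 c ψ k) (c k))
      - ev (transp 𝔇 c η k) (𝔇.D (c k).face (c k).l)| ≤ 4 * ρ := by
    intro k hk
    have hu : gsq (transp 𝔇 c η k) = 1 := by rw [Billiard.gsq_transp ho.inv, hη1]
    have h5 := abs_le_of_gsq hu
    have h6 := hc.Yc_le (ho.inv k) (ho.sep k)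
    have h7 := hc.bound _ (ho.inv k).face_mem _ (ho.inv k).l_mem
    have h8 := dot_le h5.1 h5.2 h6.1 h6.2
    have h9 := dot_le h5.1 h5.2 h7.1 h7.2
    rw [abs_le] at *
    unfold ev
    constructor <;> linarith
  have d1 := abs_le.1 (hdiff n le_rfl)
  have d0 := abs_le.1 (hdiff 0 (by omega))
  rw [hlk n le_rfl] at d1
  simp only [transp] at d0
  have h4 : d * n ≤ 8 * ρ + C := by linarith
  rw [div_lt_iff₀ hd] at hN
  have h5 : d * n < d * N := by linarith
  exact_mod_cast lt_of_mul_lt_mul_left h5 hd.le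

/-! ### Straight chains between bounces -/

/-- `φ` is the functional after the bounce at `c 0`. It also separates the edge of `c 0`, because
the reflection fixes the ends of that edge. -/
structure SChain (𝔇 : Dev P) (φ : Fn) (c : ℕ → CState V) (n : ℕ) : Prop where
  chain : Chain 𝔇 c n
  sep : ∀ k ≤ n, Sep 𝔇 φ (c k)
  bd : P.IsBoundaryEdge (c 0).edge
  int : ∀ k, 0 < k → k < n → ¬ P.IsBoundaryEdge (c k).edge

lemma Sep.refr {φ : Fn} {s : CState V} (hs : VInv 𝔇 s) (h : Sep 𝔇 φ s) :
    Sep 𝔇 (refr 𝔇 s φ) s := ⟨by rw [ev_refr_l]; exact h.1, by rw [ev_refr_r hs]; exact h.2⟩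

lemma Sep.smul {φ : Fn} {s : CState V} (h : Sep 𝔇 φ s) {r : ℝ} (hr : 0 < r) :
    Sep 𝔇 (r • φ) s :=
  ⟨by rw [ev_smul]; exact mul_pos hr h.1, by rw [ev_smul]; exact mul_neg_of_pos_of_neg hr h.2⟩

lemma SChain.smul {φ : Fn} {c : ℕ → CState V} {n : ℕ} (h : SChain 𝔇 φ c n) {r : ℝ} (hr : 0 < r) :
    SChain 𝔇 (r • φ) c n := ⟨h.chain, fun k hk => (h.sep k hk).smul hr, h.bd, h.int⟩

lemma IsOrbit.schain {c : ℕ → CState V} {ψ : Fn} (h : IsOrbit 𝔇 c ψ)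
    (hb : P.IsBoundaryEdge (c 0).edge) {n : ℕ}
    (hi : ∀ k, 0 < k → k < n + 1 → ¬ P.IsBoundaryEdge (c k).edge) :
    SChain 𝔇 (transp 𝔇 c ψ (n + 1)) c (n + 1) := by
  have h1 : ∀ k ≤ n, transp 𝔇 c ψ (k + 1) = transp 𝔇 c ψ 1 := by
    intro k
    induction k with
    | zero => intro _; rfl
    | succ k ih =>
      intro hk
      rw [transp, refr, if_neg (hi (k + 1) (by omega) (by omega)), ih (by omega)]
  refine ⟨h.chain _, ?_, hb, hi⟩
  rintro (_ | k) hk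
  · rw [h1 n le_rfl]
    exact (h.sep 0).refr (h.inv 0)
  · rw [h1 n le_rfl, ← h1 k (by omega)]
    exact h.sep _

/-! ### Perturbation of singular limits -/

structure IsLim (𝔇 : Dev P) (F : ℕ → CState V) (T : Fn) : Prop where
  inv : ∀ k, VInv 𝔇 (F k)
  step : ∀ k, CStep P (F k) (F (k + 1))
  unit : gsq T = 1
  weak : ∀ k, 0 ≤ ev (transp 𝔇 F T k) (𝔇.D (F k).face (F k).l) ∧
    ev (transp 𝔇 F T k) (𝔇.D (F k).face (F k).r) ≤ 0
  real : ∀ n, ∃ c ψ, IsOrbit 𝔇 c ψ ∧ ∀ k ≤ n, c k = F k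

lemma IsLim.neg {F : ℕ → CState V} {T : Fn} (h : IsLim 𝔇 F T) :
    IsLim 𝔇 (fun k => (F k).neg) (-T) := by
  refine ⟨fun k => (h.inv k).neg, fun k => (h.step k).neg, by rw [gsq_neg, h.unit],
    fun k => ?_, fun n => ?_⟩
  · rw [transp_neg, ev_neg, ev_neg]
    exact ⟨neg_nonneg.2 (h.weak k).2, neg_nonpos.2 (h.weak k).1⟩
  · obtain ⟨c, ψ, h1, h2⟩ := h.real n
    exact ⟨_, _, h1.neg, fun k hk => by rw [h2 k hk]⟩

/-- Unfolded positions of the ends of the edges. -/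
noncomputable def Lp (𝔇 : Dev P) (F : ℕ → CState V) (T : Fn) (k : ℕ) : Pt :=
  xy (F 0).ε T (unf 𝔇 F k (𝔇.D (F k).face (F k).l))

noncomputable def Rp (𝔇 : Dev P) (F : ℕ → CState V) (T : Fn) (k : ℕ) : Pt :=
  xy (F 0).ε T (unf 𝔇 F k (𝔇.D (F k).face (F k).r))

lemma Lp_snd (F : ℕ → CState V) (T : Fn) (k : ℕ) :
    (Lp 𝔇 F T k).2 = ev (transp 𝔇 F T k) (𝔇.D (F k).face (F k).l) := (ev_transp _ _ _ _).symm

lemma Rp_snd (F : ℕ → CState V) (T : Fn) (k : ℕ) :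
    (Rp 𝔇 F T k).2 = ev (transp 𝔇 F T k) (𝔇.D (F k).face (F k).r) := (ev_transp _ _ _ _).symm

lemma rmir_neg (s : CState V) (z : Pt) : rmir 𝔇 s.neg z = rmir 𝔇 s z := by
  unfold rmir
  rw [CState.neg_edge]
  split_ifs
  · exact mirror_comm _ _ _
  · rfl

lemma unf_neg (F : ℕ → CState V) (k : ℕ) (z : Pt) :
    unf 𝔇 (fun j => (F j).neg) k z = unf 𝔇 F k z := by
  induction k generalizing z with
  | zero => rfl
  | succ k ih => rw [unf, unf, ih, rmir_neg]

lemma xy_neg (b : Bool) (T : Fn) (z : Pt) : xy (!b) (-T) z = ((xy b T z).1, -(xy b T z).2) := by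
  ext
  · simp only [xy, sg_not, Prod.fst_neg, Prod.snd_neg]; ring
  · simp only [xy, ev_neg]

lemma Lp_neg (F : ℕ → CState V) (T : Fn) (k : ℕ) :
    Lp 𝔇 (fun j => (F j).neg) (-T) k = ((Rp 𝔇 F T k).1, -(Rp 𝔇 F T k).2) := by
  unfold Lp Rp
  rw [unf_neg, ← xy_neg]; rfl

lemma Rp_neg (F : ℕ → CState V) (T : Fn) (k : ℕ) :
    Rp 𝔇 (fun j => (F j).neg) (-T) k = ((Lp 𝔇 F T k).1, -(Lp 𝔇 F T k).2) := by
  unfold Lp Rp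
  rw [unf_neg, ← xy_neg]; rfl

lemma IsLim.strip {F : ℕ → CState V} {T : Fn} (h : IsLim 𝔇 F T) :
    Strip (Lp 𝔇 F T) (Rp 𝔇 F T) := by
  intro k
  have hv := h.inv
  have hs := h.step
  rcases (hs k).mem_cases (hv k) (hv (k + 1)) with ⟨t1, t2, t3, t4⟩ | ⟨t1, t2, t3, t4⟩
  · left
    refine ⟨?_, ?_⟩
    · unfold Lp
      rw [t1, unf_l hv hs]
    · unfold Lp Rp
      rw [cr_xy h.unit, ← unf_l hv hs k, ← unf_r hv hs k, cr_unf hv hs]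
      exact (hs k).ahead (hv k) (hv _) (hv _).r_mem t3 t2
  · right
    refine ⟨?_, ?_⟩
    · unfold Rp
      rw [t1, unf_r hv hs]
    · unfold Lp Rp
      rw [cr_xy h.unit, ← unf_l hv hs k, ← unf_r hv hs k, cr_unf hv hs]
      exact (hs k).ahead (hv k) (hv _) (hv _).l_mem t2 t3

/-- A functional cannot have signs `+`, `-`, `+` at three successive points of a line. -/
lemma no_alternation {b : Bool} {T ψ : Fn} (h : gsq T = 1) {p q r : Pt} (hp : (xy b T p).2 = 0)
    (hq : (xy b T q).2 = 0) (hr : (xy b T r).2 = 0) (h1 : (xy b T p).1 < (xy b T q).1)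
    (h2 : (xy b T q).1 < (xy b T r).1) : ∃ s t : ℝ, 0 < s ∧ 0 < t ∧
      ev ψ q = s * ev ψ p + t * ev ψ r := by
  set x := (xy b T p).1
  set y := (xy b T q).1
  set z := (xy b T r).1
  have hd : 0 < z - x := by linarith
  have e : (z - y) / (z - x) + (y - x) / (z - x) = 1 := by field_simp; ring
  refine ⟨(z - y) / (z - x), (y - x) / (z - x), div_pos (by linarith) hd,
    div_pos (by linarith) hd, ?_⟩
  rw [← ev_combo _ _ _ e]
  congr 1
  apply xy_injective h (b := b)
  rw [xy_combo _ _ e]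
  ext
  · change y = (z - y) / (z - x) * x + (y - x) / (z - x) * z
    field_simp; ring
  · simp [hp, hq, hr]

/-- If both alternatives fail, beyond every left zero there is a right zero and vice versa. A left,
a right and a left zero in this order contradict the strict signs of a finite realization, by
`no_alternation`. So there is no zero at all, and the limit separates strictly. -/
lemma IsLim.select {F : ℕ → CState V} {T : Fn} (h : IsLim 𝔇 F T)
    (hs : ¬ ∀ k, Sep 𝔇 (transp 𝔇 F T k) (F k)) :
    (∃ k, (Lp 𝔇 F T k).2 = 0 ∧ ∀ j, (Rp 𝔇 F T j).2 = 0 → (Rp 𝔇 F T j).1 ≤ (Lp 𝔇 F T k).1) ∨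
    (∃ k, (Rp 𝔇 F T k).2 = 0 ∧ ∀ j, (Lp 𝔇 F T j).2 = 0 → (Lp 𝔇 F T j).1 ≤ (Rp 𝔇 F T k).1) := by
  by_contra hcon
  push Not at hcon
  obtain ⟨h1, h2⟩ := hcon
  have signs : ∀ n, ∃ ψ : Fn, ∀ k ≤ n, 0 < ev ψ (unf 𝔇 F k (𝔇.D (F k).face (F k).l)) ∧
      ev ψ (unf 𝔇 F k (𝔇.D (F k).face (F k).r)) < 0 := by
    intro n
    obtain ⟨c, ψ, ho, hc⟩ := h.real n
    refine ⟨ψ, fun k hk => ?_⟩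
    have := ho.sep k
    rw [hc k hk, transp_congr (n := n) (fun j hj => hc j hj.le) ψ k hk] at this
    rw [← ev_transp, ← ev_transp]
    exact this
  have caseL : ∀ k, (Lp 𝔇 F T k).2 ≠ 0 := by
    intro k hk
    obtain ⟨j, j1, j2⟩ := h1 k hk
    obtain ⟨i, i1, i2⟩ := h2 j j1
    obtain ⟨ψ, hψ⟩ := signs (max k (max j i))
    obtain ⟨s, t, hs, ht, e⟩ := no_alternation (ψ := ψ) h.unit hk j1 i1 j2 i2
    have a1 := (hψ k (le_max_left _ _)).1
    have a2 := (hψ j ((le_max_left _ _).trans (le_max_right _ _))).2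
    have a3 := (hψ i ((le_max_right _ _).trans (le_max_right _ _))).1
    have := mul_pos hs a1
    have := mul_pos ht a3
    linarith
  have caseR : ∀ k, (Rp 𝔇 F T k).2 ≠ 0 := by
    intro k hk
    obtain ⟨j, j1, j2⟩ := h2 k hk
    exact caseL j j1
  refine hs fun k => ⟨?_, ?_⟩
  · exact lt_of_le_of_ne (h.weak k).1 (by rw [← Lp_snd]; exact (caseL k).symm)
  · exact lt_of_le_of_ne (h.weak k).2 (by rw [← Rp_snd]; exact caseR k)

/-- Data at a singular vertex `v`, passed on the left, beyond which there are only singular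
vertices on the left. -/
structure Pivot (𝔇 : Dev P) (F : ℕ → CState V) (T χ : Fn) (b : ℕ) (v : V) : Prop where
  pos : 0 < b
  mem : v ∈ (F b).face
  ne_l : v ≠ (F b).l
  ne_r : v ≠ (F b).r
  unit : gsq χ = 1
  orth : T.1 * χ.1 + T.2.1 * χ.2.1 = 0
  zero : ev (transp 𝔇 F T b) (𝔇.D (F b).face v) = 0
  zero' : ev (transp 𝔇 F χ b) (𝔇.D (F b).face v) = 0
  only : ∀ z, ev (transp 𝔇 F T b) z = 0 → ev (transp 𝔇 F χ b) z = 0 → z = 𝔇.D (F b).face v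
  left : ∀ k, b ≤ k → ev (transp 𝔇 F T k) (𝔇.D (F k).face (F k).l) = 0 →
    0 < ev (transp 𝔇 F χ k) (𝔇.D (F k).face (F k).l)
  right : ∀ k, b ≤ k → ev (transp 𝔇 F T k) (𝔇.D (F k).face (F k).r) < 0

lemma unf_injective {c : ℕ → CState V} (hv : ∀ k, VInv 𝔇 (c k)) (k : ℕ) :
    Function.Injective (unf 𝔇 c k) := by
  induction k with
  | zero => exact fun _ _ h => h
  | succ k ih =>
    intro p q hpq
    have h1 := ih hpq
    unfold rmir at h1
    split_ifs at h1
    · have := congrArg (mirror (𝔇.D (c k).face (c k).l) (𝔇.D (c k).face (c k).r)) h1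
      rwa [mirror_mirror (hv k).D_ne, mirror_mirror (hv k).D_ne] at this
    · exact h1

/-- By the fan bound the left end changes some time after `k₀`. At the first such index `b` the old
left end `v` is the apex of the triangle, and `χ` is the coordinate along the line measured from
`v`. -/
lemma IsLim.exists_pivot {F : ℕ → CState V} {T : Fn} (h : IsLim 𝔇 F T) {k₀ : ℕ}
    (hk : (Lp 𝔇 F T k₀).2 = 0)
    (hgood : ∀ j, (Rp 𝔇 F T j).2 = 0 → (Rp 𝔇 F T j).1 ≤ (Lp 𝔇 F T k₀).1) :
    ∃ χ b v, Pivot 𝔇 F T χ b v := by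
  have hv := h.inv
  have hs := h.step
  obtain ⟨N, hN⟩ := 𝔇.exists_fan_bound
  have hex : ∃ j, (F (k₀ + j)).l ≠ (F k₀).l := by
    by_contra hcon
    push Not at hcon
    obtain ⟨c, ψ, ho, hc⟩ := h.real (k₀ + N)
    refine lt_irrefl _ (hN _ _ (ho.drop k₀) N fun k hk => ?_)
    rw [hc _ (by omega), hc _ (by omega), hcon]
    rfl
  classical
  set j := Nat.find hex with hj
  have hj1 : (F (k₀ + j)).l ≠ (F k₀).l := Nat.find_spec hex
  have hj2 : ∀ i < j, (F (k₀ + i)).l = (F k₀).l := fun i hi => not_not.1 (Nat.find_min hex hi)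
  have hj0 : j ≠ 0 := fun h0 => hj1 (by rw [h0]; rfl)
  obtain ⟨m, hm⟩ := Nat.exists_eq_succ_of_ne_zero hj0
  have hLm : ∀ i ≤ m, Lp 𝔇 F T (k₀ + i) = Lp 𝔇 F T k₀ := by
    intro i
    induction i with
    | zero => intro _; rfl
    | succ i ih =>
      intro hi
      have e1 : (F (k₀ + i + 1)).l = (F (k₀ + i)).l := by
        rw [hj2 i (by omega)]; exact hj2 (i + 1) (by omega)
      rw [← ih (by omega)]
      unfold Lp
      rw [← add_assoc, e1, unf_l hv hs]
  set k₁ := k₀ + m with hk₁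
  have hb : k₀ + j = k₁ + 1 := by omega
  have hl1 : (F (k₁ + 1)).l ≠ (F k₁).l := by
    rw [hj2 m (by omega), ← hb]; exact hj1
  have hLk := hLm m le_rfl
  rw [← hk₁] at hLk
  obtain ⟨t1, t2, t3, t4⟩ : (F (k₁ + 1)).r = (F k₁).r ∧ (F (k₁ + 1)).l ≠ (F k₁).l ∧
      (F (k₁ + 1)).l ≠ (F k₁).r ∧ (F (k₁ + 1)).face = {(F k₁).l, (F k₁).r, (F (k₁ + 1)).l} := by
    rcases (hs k₁).mem_cases (hv _) (hv _) with ⟨t1, -⟩ | t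
    · exact absurd t1 hl1
    · exact t
  set x := (Lp 𝔇 F T k₀).1 with hx
  have hcr : 0 < cr (Lp 𝔇 F T k₁) (Rp 𝔇 F T k₁) (Lp 𝔇 F T (k₁ + 1)) := by
    rcases h.strip k₁ with ⟨h1, h2⟩ | ⟨-, h2⟩
    · exfalso
      apply hl1
      unfold Lp at h1
      have h3 := xy_injective h.unit h1
      rw [← unf_l hv hs k₁] at h3
      have h4 := unf_injective hv _ h3
      by_contra hne
      exact 𝔇.D_ne (hv _).face_mem (hv _).l_mem (hs k₁).l_mem hne h4
    · exact h2
  have hLk' : Lp 𝔇 F T k₁ = (x, 0) := by rw [hLk]; exact Prod.ext rfl hk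
  have hRr : Rp 𝔇 F T (k₁ + 1) = Rp 𝔇 F T k₁ := by
    unfold Rp; rw [t1, unf_r hv hs]
  -- The exit edge at `b` is beyond `v`, and the strip only moves forward. Hence later zeros are
  -- strictly beyond `v`, and zeros on the right are then excluded by `hgood`.
  have hbey : Beyond x (Lp 𝔇 F T (k₁ + 1)) (Rp 𝔇 F T (k₁ + 1)) := by
    left; rw [hRr, ← hLk']; exact hcr
  have hL0 : ∀ k, 0 ≤ (Lp 𝔇 F T k).2 := fun k => by rw [Lp_snd]; exact (h.weak k).1
  have hR0 : ∀ k, (Rp 𝔇 F T k).2 ≤ 0 := fun k => by rw [Rp_snd]; exact (h.weak k).2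
  have hall := h.strip.beyond hL0 hR0 hbey
  set χ : Fn := alongFn (F 0).ε T + (0, 0, -x) with hχ
  have hevχ : ∀ k z, ev (transp 𝔇 F χ k) z = (xy (F 0).ε T (unf 𝔇 F k z)).1 - x := by
    intro k z
    rw [ev_transp, hχ, ev_add, ev_alongFn, ev_const]; ring
  have hvb : unf 𝔇 F (k₁ + 1) (𝔇.D (F (k₁ + 1)).face (F k₁).l)
      = unf 𝔇 F k₁ (𝔇.D (F k₁).face (F k₁).l) := unf_l hv hs k₁
  have hT0 := h.unit
  refine ⟨χ, k₁ + 1, (F k₁).l, Nat.succ_pos _, (hs k₁).l_mem, t2.symm, ?_, ?_, ?_, ?_, ?_, ?_,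
    fun k hk hz => ?_, fun k hk => ?_⟩
  · rw [t1]; exact (hv k₁).ne
  · have h4 := sg_sq (F 0).ε
    unfold gsq at hT0 ⊢
    simp only [hχ, alongFn, Prod.fst_add, Prod.snd_add]
    linear_combination (T.1 ^ 2 + T.2.1 ^ 2) * h4 + hT0
  · simp only [hχ, alongFn, Prod.fst_add, Prod.snd_add]; ring
  · rw [ev_transp, hvb, ← ev_transp, ← Lp_snd, hLk']
  · rw [hevχ, hvb]
    have : (Lp 𝔇 F T k₁).1 = x := by rw [hLk']
    exact sub_eq_zero.2 this
  · intro z hz1 hz2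
    apply unf_injective hv (k₁ + 1)
    apply xy_injective h.unit (b := (F 0).ε)
    rw [hvb]
    refine Eq.trans (Prod.ext ?_ ?_) hLk'.symm
    · rw [hevχ] at hz2; change _ = x; linarith
    · rw [ev_transp] at hz1; exact hz1
  · rw [hevχ]
    have := (hall k hk).lt_left (hR0 k) (by rw [Lp_snd]; exact hz)
    exact sub_pos.2 this
  · rw [← Rp_snd]
    refine lt_of_le_of_ne (hR0 k) fun h0 => ?_
    have h1 := (hall k hk).lt_right (hL0 k) h0
    linarith [hgood k h0]

/-! ### Sequences with unique prefixes are realizable -/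

/-- Straight chains that pass a vertex `v` on different sides come from different boundary edges,
if they are close to each other. -/
def NoFold (𝔇 : Dev P) : Prop := ∀ (s : CState V) (v : V) (φ : Fn), VInv 𝔇 s → v ∈ s.face →
  v ≠ s.l → v ≠ s.r → Sep 𝔇 φ s → ev φ (𝔇.D s.face v) = 0 →
  (∀ t ∈ P.faces, ∀ w ∈ t, ev φ (𝔇.D t w) = 0 → 𝔇.D t w = 𝔇.D s.face v) →
  ∃ η₀ : ℝ, 0 < η₀ ∧ ∀ η η' : ℝ, 0 < η → η < η₀ → -η₀ < η' → η' < 0 → ∀ c m c' m',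
    SChain 𝔇 (φ + (0, 0, η)) c (m + 1) → c (m + 1) = s → (c m).l = v → (c m).r = s.r →
    SChain 𝔇 (φ + (0, 0, η')) c' (m' + 1) → c' (m' + 1) = s → (c' m').l = s.l → (c' m').r = v →
    (c 0).edge ≠ (c' 0).edge

/-! ### Rotating and translating the limit line -/

lemma eventually_add_pos {x y : ℝ} (hy : 0 < y) : ∀ᶠ β in 𝓝[>] (0 : ℝ), 0 < y + β * x := by
  have : Tendsto (fun β : ℝ => y + β * x) (𝓝[>] 0) (𝓝 (y + 0 * x)) :=
    (Continuous.tendsto (by fun_prop) _).mono_left nhdsWithin_le_nhds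
  exact this.eventually (lt_mem_nhds (by simpa using hy))

lemma eventually_add_neg {x y : ℝ} (hy : y < 0) : ∀ᶠ β in 𝓝[>] (0 : ℝ), y + β * x < 0 := by
  filter_upwards [eventually_add_pos (x := -x) (neg_pos.2 hy)] with β h
  linarith

lemma ev_transp_add (c : ℕ → CState V) (φ ψ : Fn) (k : ℕ) (z : Pt) :
    ev (transp 𝔇 c (φ + ψ) k) z = ev (transp 𝔇 c φ k) z + ev (transp 𝔇 c ψ k) z := by
  rw [ev_transp, ev_transp, ev_transp, ev_add]

lemma ev_transp_smul (c : ℕ → CState V) (r : ℝ) (ψ : Fn) (k : ℕ) (z : Pt) :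
    ev (transp 𝔇 c (r • ψ) k) z = r * ev (transp 𝔇 c ψ k) z := by
  rw [ev_transp, ev_transp, ev_smul]

lemma transp_smul (c : ℕ → CState V) (r : ℝ) (ψ : Fn) (k : ℕ) :
    transp 𝔇 c (r • ψ) k = r • transp 𝔇 c ψ k :=
  Fn.ext_ev fun z => by rw [ev_transp_smul, ev_smul]

lemma transp_add_const (c : ℕ → CState V) (η : ℝ) (ψ : Fn) (k : ℕ) :
    transp 𝔇 c (ψ + (0, 0, η)) k = transp 𝔇 c ψ k + (0, 0, η) :=
  Fn.ext_ev fun z => by rw [ev_transp, ev_add, ev_add, ev_transp, ev_const, ev_const]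

/-- `T + β • χ` is the line rotated about `v` and rescaled. Zeros on the left from `b` on become
positive since `χ` is positive there, and strict signs survive for small `β`. Apart from the
position of `v` no placed vertex stays on the line, because `T` and `χ` have only one common zero.
-/
lemma Pivot.perturb {F : ℕ → CState V} {T χ : Fn} {b : ℕ} {v : V} (h : Pivot 𝔇 F T χ b v)
    (hF : IsLim 𝔇 F T) (n : ℕ) : ∃ ψ : Fn, 0 < gsq ψ ∧
      (∀ k, b ≤ k → k ≤ n → Sep 𝔇 (transp 𝔇 F ψ k) (F k)) ∧
      ev (transp 𝔇 F ψ b) (𝔇.D (F b).face v) = 0 ∧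
      ∀ t w, ev (transp 𝔇 F ψ b) (𝔇.D t w) = 0 → 𝔇.D t w = 𝔇.D (F b).face v := by
  have h1 : ∀ᶠ β in 𝓝[>] (0 : ℝ), ∀ k ∈ Finset.Icc b n,
      Sep 𝔇 (transp 𝔇 F (T + β • χ) k) (F k) := by
    rw [Filter.eventually_all_finset]
    intro k hk
    have hbk := (Finset.mem_Icc.1 hk).1
    have hl : ∀ᶠ β in 𝓝[>] (0 : ℝ), 0 < ev (transp 𝔇 F T k) (𝔇.D (F k).face (F k).l)
        + β * ev (transp 𝔇 F χ k) (𝔇.D (F k).face (F k).l) := by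
      rcases (hF.weak k).1.lt_or_eq with h0 | h0
      · exact eventually_add_pos h0
      · filter_upwards [self_mem_nhdsWithin] with β hβ
        rw [← h0, zero_add]
        exact mul_pos hβ (h.left k hbk h0.symm)
    filter_upwards [hl, eventually_add_neg (h.right k hbk)] with β b1 b2
    unfold Sep
    simp only [ev_transp_add, ev_transp_smul]
    exact ⟨b1, b2⟩
  have h2 : ∀ᶠ β in 𝓝[>] (0 : ℝ), ∀ x : Finset V × V,
      ev (transp 𝔇 F (T + β • χ) b) (𝔇.D x.1 x.2) = 0 → 𝔇.D x.1 x.2 = 𝔇.D (F b).face v := by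
    rw [Filter.eventually_all]
    intro x
    simp only [ev_transp_add, ev_transp_smul]
    rcases lt_trichotomy (ev (transp 𝔇 F T b) (𝔇.D x.1 x.2)) 0 with h0 | h0 | h0
    · filter_upwards [eventually_add_neg h0] with β hβ hz
      exact absurd hz hβ.ne
    · filter_upwards [self_mem_nhdsWithin] with β hβ hz
      rw [h0, zero_add] at hz
      exact h.only _ h0 ((mul_eq_zero.1 hz).resolve_left (ne_of_gt hβ))
    · filter_upwards [eventually_add_pos h0] with β hβ hz
      exact absurd hz hβ.ne'
  obtain ⟨β, hb1, hb2⟩ := (h1.and h2).exists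
  refine ⟨T + β • χ, ?_, fun k hk hkn => hb1 k (Finset.mem_Icc.2 ⟨hk, hkn⟩), ?_,
    fun t w => hb2 (t, w)⟩
  · have e : gsq (T + β • χ) = 1 + β ^ 2 := by
      have e1 := hF.unit
      have e2 := h.unit
      have e3 := h.orth
      unfold gsq at *
      simp only [Prod.fst_add, Prod.snd_add, Prod.smul_fst, Prod.smul_snd, smul_eq_mul]
      linear_combination e1 + β ^ 2 * e2 + 2 * β * e3
    rw [e]; positivity
  · rw [ev_transp_add, ev_transp_smul, h.zero, h.zero']; ring

/-- An orbit that starts with a bounce at `A` and then follows `F` from index `b` to `n`. -/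
def Precedes (𝔇 : Dev P) (F : ℕ → CState V) (b n : ℕ) (A : Finset V) : Prop :=
  ∃ c ψ m, IsOrbit 𝔇 c ψ ∧ P.IsBoundaryEdge (c 0).edge ∧ (c 0).edge = A ∧
    (∀ k, 0 < k → k ≤ m → ¬ P.IsBoundaryEdge (c k).edge) ∧
    ∀ j ≤ n - b, c (m + 1 + j) = F (b + j)

/-- The rescaled generic line is run forward from `F b`, where it has to follow `F` as long as `ψ`
separates, and backward to the preceding bounce. Its sign at `v` tells through which edge it entered
the triangle of `F b`. -/
lemma exists_extension {F : ℕ → CState V} (hv : ∀ k, VInv 𝔇 (F k))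
    (hst : ∀ k, CStep P (F k) (F (k + 1))) {ψ : Fn} (hψ : 0 < gsq ψ) {b n : ℕ} (hbn : b ≤ n)
    (hS : ∀ k, b ≤ k → k ≤ n → Sep 𝔇 (transp 𝔇 F ψ k) (F k))
    (hg : Gen 𝔇 (transp 𝔇 F ψ b)) {v : V} (hvm : v ∈ (F b).face) (hvl : v ≠ (F b).l)
    (hvr : v ≠ (F b).r) :
    ∃ c m, SChain 𝔇 (transp 𝔇 F ψ b) c (m + 1) ∧ c (m + 1) = F b ∧
      Precedes 𝔇 F b n (c 0).edge ∧
      (0 < ev (transp 𝔇 F ψ b) (𝔇.D (F b).face v) → (c m).l = v ∧ (c m).r = (F b).r) ∧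
      (ev (transp 𝔇 F ψ b) (𝔇.D (F b).face v) < 0 → (c m).l = (F b).l ∧ (c m).r = v) := by
  set r : ℝ := (Real.sqrt (gsq ψ))⁻¹ with hr
  have hr0 : 0 < r := inv_pos.2 (Real.sqrt_pos.2 hψ)
  have hgs : gsq (r • transp 𝔇 F ψ b) = 1 := by
    have e : gsq (r • transp 𝔇 F ψ b) = r ^ 2 * gsq (transp 𝔇 F ψ b) := by
      simp only [gsq, Prod.smul_fst, Prod.smul_snd, smul_eq_mul]; ring
    rw [e, gsq_transp hv, hr, inv_pow, Real.sq_sqrt hψ.le, inv_mul_cancel₀ hψ.ne']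
  obtain ⟨o, ho0, ho⟩ := exists_orbit (hv b) ((hS b le_rfl hbn).smul hr0) (hg.smul hr0.ne') hgs
  have hagree : ∀ j, b + j ≤ n → ∀ i ≤ j, o i = F (b + i) := by
    intro j
    induction j with
    | zero =>
      intro _ i hi
      obtain rfl : i = 0 := by omega
      exact ho0
    | succ j ih =>
      intro hj i hi
      have ih' := ih (by omega)
      rcases Nat.lt_or_ge i (j + 1) with h1 | h1
      · exact ih' i (by omega)
      · obtain rfl : i = j + 1 := by omega
        have e : transp 𝔇 o (r • transp 𝔇 F ψ b) (j + 1) = r • transp 𝔇 F ψ (b + (j + 1)) := by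
          rw [transp_add F ψ b (j + 1), ← transp_smul (fun k => F (b + k))]
          exact transp_congr (n := j + 1) (fun k hk => ih' k (by omega)) _ _ le_rfl
        have s1 := ho.sep (j + 1)
        rw [e] at s1
        have st := ho.step j
        rw [ih' j le_rfl] at st
        exact st.unique (hst (b + j)) (hv _) (ho.inv _) (hv (b + j + 1)) s1
          ((hS _ (by omega) hj).smul hr0)
  obtain ⟨s₀, φ₀, h1, h2, h3, h4⟩ := ho.exists_prev (hg.smul hr0.ne')
  obtain ⟨c, θ, m, h5, h6, h7, h8, h9⟩ := h1.exists_back h2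
  have hm : c m = s₀ := h6 0
  have hm1 : ∀ j, c (m + 1 + j) = o j := fun j => by
    rw [show m + 1 + j = m + (j + 1) by ring]; exact h6 (j + 1)
  have hθ : transp 𝔇 c θ (m + 1) = r • transp 𝔇 F ψ b := by rw [transp, h7, hm, h3]
  have hsc := h5.schain h8 (n := m) fun k hk hk' => h9 k hk (by omega)
  rw [hθ] at hsc
  have hsc' := hsc.smul (inv_pos.2 hr0)
  rw [smul_smul, inv_mul_cancel₀ hr0.ne', one_smul] at hsc'
  have h4' := h4 v (by rw [ho0]; exact hvm) (by rw [ho0]; exact hvl) (by rw [ho0]; exact hvr)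
  rw [ho0, ev_smul] at h4'
  refine ⟨c, m, hsc', (hm1 0).trans ho0, ⟨c, θ, m, h5, h8, rfl, h9, fun j hj => ?_⟩, ?_, ?_⟩
  · rw [hm1]
    exact hagree (n - b) (by omega) j hj
  · intro hp
    rw [hm]
    exact h4'.1 (mul_pos hr0 hp)
  · intro hp
    rw [hm]
    exact h4'.2 (mul_neg_of_pos_of_neg hr0 hp)

/-- The rotated line is translated a little to either side of `v`, by generic amounts. -/
lemma Pivot.exists_two (hNF : NoFold 𝔇) {F : ℕ → CState V} {T χ : Fn} {b : ℕ} {v : V}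
    (h : Pivot 𝔇 F T χ b v) (hF : IsLim 𝔇 F T) {n : ℕ} (hn : b ≤ n) :
    ∃ A B : Finset V, A ≠ B ∧ Precedes 𝔇 F b n A ∧ Precedes 𝔇 F b n B := by
  obtain ⟨ψ, hψ, hS, hz, honly⟩ := h.perturb hF n
  obtain ⟨η₀, hη₀, hno⟩ := hNF (F b) v (transp 𝔇 F ψ b) (hF.inv b) h.mem h.ne_l h.ne_r
    (hS b le_rfl hn) hz fun t _ w _ => honly t w
  have hev : ∀ᶠ η in 𝓝 (0 : ℝ), ∀ k ∈ Finset.Icc b n,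
      Sep 𝔇 (transp 𝔇 F (ψ + (0, 0, η)) k) (F k) := by
    rw [Filter.eventually_all_finset]
    intro k hk
    obtain ⟨h1, h2⟩ := Finset.mem_Icc.1 hk
    obtain ⟨s1, s2⟩ := hS k h1 h2
    unfold Sep
    simp only [transp_add_const, ev_add, ev_const]
    have t1 : ∀ᶠ η : ℝ in 𝓝 0, -ev (transp 𝔇 F ψ k) (𝔇.D (F k).face (F k).l) < η :=
      lt_mem_nhds (by linarith)
    have t2 : ∀ᶠ η : ℝ in 𝓝 0, η < -ev (transp 𝔇 F ψ k) (𝔇.D (F k).face (F k).r) :=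
      gt_mem_nhds (by linarith)
    filter_upwards [t1, t2] with η h3 h4
    constructor <;> linarith
  obtain ⟨δ, hδ, hball⟩ := Metric.eventually_nhds_iff.1 hev
  have hm : 0 < min δ η₀ := lt_min hδ hη₀
  have hgs : ∀ η, 0 < gsq (ψ + (0, 0, η)) := by
    intro η
    have : gsq (ψ + (0, 0, η)) = gsq ψ := by simp [gsq]
    rw [this]; exact hψ
  have hev' : ∀ η, ev (transp 𝔇 F ψ b + (0, 0, η)) (𝔇.D (F b).face v) = η := by
    intro η; rw [ev_add, hz, ev_const, zero_add]
  obtain ⟨η, p1, p2, p3⟩ := exists_gen 𝔇 (transp 𝔇 F ψ b) hm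
  obtain ⟨η', q1, q2, q3⟩ := exists_gen 𝔇 (transp 𝔇 F ψ b) (neg_lt_zero.2 hm)
  rw [← transp_add_const] at p3 q3
  obtain ⟨c, m, c1, c2, c3, c4, -⟩ := exists_extension hF.inv hF.step (hgs η) hn
    (fun k h1 h2 => hball (by rw [Real.dist_0_eq_abs, abs_of_pos p1]
                              exact p2.trans_le (min_le_left _ _)) k (Finset.mem_Icc.2 ⟨h1, h2⟩))
    p3 h.mem h.ne_l h.ne_r
  obtain ⟨c', m', d1, d2, d3, -, d4⟩ := exists_extension hF.inv hF.step (hgs η') hn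
    (fun k h1 h2 => hball (by rw [Real.dist_0_eq_abs, abs_of_neg q2]
                              linarith [min_le_left δ η₀]) k (Finset.mem_Icc.2 ⟨h1, h2⟩))
    q3 h.mem h.ne_l h.ne_r
  rw [transp_add_const, hev'] at c4 d4
  rw [transp_add_const] at c1 d1
  refine ⟨_, _, hno η η' p1 (p2.trans_le (min_le_right _ _)) (by linarith [min_le_right δ η₀]) q2
    c m c' m' c1 c2 (c4 p1).1 (c4 p1).2 d1 d2 (d4 q2).1 (d4 q2).2, c3, d3⟩

/-- The orbit bounces at `A`, then not before it reaches `F b`, and follows `F` up to `n`. For large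
`n` its bounce sequence agrees with `A` followed by the tail from `i₀` on as many letters as
desired. -/
lemma isPrefix_of_precedes {E : ℕ → P.BoundaryEdge} {F : ℕ → CState V} {κ : ℕ → ℕ}
    (hB : Bounces P F κ E) {b i₀ : ℕ} (hi₀ : ∀ i, b ≤ κ i ↔ i₀ ≤ i) {A : P.BoundaryEdge}
    (hA : ∀ N, ∃ n, N ≤ n ∧ b ≤ n ∧ Precedes 𝔇 F b n A.1) :
    P.IsPrefix A (fun i => E (i₀ + i)) := by
  unfold IsPrefix
  rw [mem_closure_seq_iff]
  intro N
  obtain ⟨n, hn, hbn, c, ψ, m, h1, h2, h3, h4, h5⟩ := hA (κ (i₀ + N))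
  obtain ⟨κ', E', hB'⟩ := h1.exists_bounces
  refine ⟨E', (mem_spectrum_iff 𝔇 _).2 ⟨c, ψ, κ', h1, hB'⟩, ?_⟩
  have h0 : κ' 0 = 0 := by
    have : 0 ∈ Set.range κ' := by rw [hB'.range]; exact h2
    obtain ⟨i, hi⟩ := this
    have := hB'.mono.monotone (Nat.zero_le i)
    omega
  have hfirst : ∀ i, m + 1 ≤ κ' i ↔ 1 ≤ i := by
    intro i
    constructor
    · intro h
      by_contra hi
      obtain rfl : i = 0 := by omega
      omega
    · intro h
      by_contra hi
      have hlt := hB'.mono (show 0 < i by omega)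
      have : κ' i ∈ {k | P.IsBoundaryEdge (c k).edge} := hB'.range ▸ Set.mem_range_self _
      exact h4 (κ' i) (by omega) (by omega) this
  rintro (_ | i) hi
  · apply Subtype.ext
    rw [hB'.edge, h0, h3]
    rfl
  · have hle : κ (i₀ + i) ≤ n := (hB.mono.monotone (by omega)).trans hn
    have hbi := (hi₀ (i₀ + i)).2 (by omega)
    have := enum_local hB.mono hB'.mono hB.range hB'.range hi₀ hfirst (L := n - b)
      (fun j hj => by rw [h5 j hj]) i (by omega)
    apply Subtype.ext
    change (E' (i + 1)).1 = (E (i₀ + i)).1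
    rw [hB'.edge, hB.edge]
    obtain ⟨j, hj⟩ := Nat.exists_eq_add_of_le hbi
    rw [hj, ← h5 j (by omega)]
    congr 2
    rw [add_comm i 1]; omega

/-- If all prefixes are unique, the sequence is realizable. -/
theorem realizable_of_unique (hNF : NoFold 𝔇) {E : ℕ → P.BoundaryEdge}
    (hE : E ∈ closure P.forwardBounceSpectrum) (hu : P.HasUniquePrefixes E) :
    E ∈ P.forwardBounceSpectrum := by
  obtain ⟨F, κ, T, hB, hκ, h1, h2, h3, h4, h5⟩ := exists_limit_code (𝔇 := 𝔇) hE
  have hlim : IsLim 𝔇 F T := ⟨h1, h2, h3, h4, h5⟩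
  by_cases hS : ∀ k, Sep 𝔇 (transp 𝔇 F T k) (F k)
  · exact (mem_spectrum_iff 𝔇 E).2 ⟨F, T, κ, ⟨h1, h2, h3, hS⟩, hB⟩
  exfalso
  obtain ⟨F', T', hlim', hB', χ, b, v, hpiv⟩ : ∃ F' T', IsLim 𝔇 F' T' ∧ Bounces P F' κ E ∧
      ∃ χ b v, Pivot 𝔇 F' T' χ b v := by
    rcases hlim.select hS with ⟨k, k1, k2⟩ | ⟨k, k1, k2⟩
    · exact ⟨F, T, hlim, hB, hlim.exists_pivot k1 k2⟩
    · refine ⟨_, _, hlim.neg, hB.neg, hlim.neg.exists_pivot (k₀ := k) ?_ fun j hj => ?_⟩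
      · rw [Lp_neg]; simpa using k1
      · rw [Rp_neg] at hj ⊢
        rw [Lp_neg]
        exact k2 j (by simpa using hj)
  -- As `κ 0 = 0 < b`, the first bounce from `b` on has an index `m + 1`, so there is a letter `E m`
  -- before the tail and the hypothesis applies.
  have hi₀ : ∃ m, ∀ i, b ≤ κ i ↔ m + 1 ≤ i := by
    classical
    have hex : ∃ i, b ≤ κ i := ⟨b, hB'.mono.le_apply⟩
    have hne : Nat.find hex ≠ 0 := by
      intro h0
      have := Nat.find_spec hex
      rw [h0, hκ] at this
      have := hpiv.pos
      omega
    obtain ⟨m, hm⟩ := Nat.exists_eq_succ_of_ne_zero hne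
    refine ⟨m, fun i => ⟨fun h => ?_, fun h => ?_⟩⟩
    · have := Nat.find_min' hex h
      omega
    · have := Nat.find_spec hex
      exact this.trans (hB'.mono.monotone (by omega))
  obtain ⟨m, hm⟩ := hi₀
  have htwo := fun n : ℕ => hpiv.exists_two hNF hlim' (n := b + n) (by omega)
  choose A B hAB hA hBp using htwo
  -- The two edges depend on `n`; one pair occurs for arbitrarily large `n`.
  obtain ⟨x, hx⟩ := Ultrafilter.exists_eventually_eq (hyperfilter ℕ) fun n => (A n, B n)
  have hinf : ∀ N, ∃ n, N ≤ n ∧ A n = x.1 ∧ B n = x.2 := by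
    intro N
    have h6 : ∀ᶠ n in (hyperfilter ℕ : Filter ℕ), N ≤ n :=
      Nat.hyperfilter_le_atTop (Filter.eventually_ge_atTop N)
    obtain ⟨n, h7, h8⟩ := (h6.and hx).exists
    exact ⟨n, h7, congrArg Prod.fst h8, congrArg Prod.snd h8⟩
  have hbd : ∀ n C, Precedes 𝔇 F' b n C → P.IsBoundaryEdge C := by
    rintro n C ⟨c, ψ, j, -, h6, rfl, -⟩
    exact h6
  have hne : x.1 ≠ x.2 := by
    obtain ⟨n, -, h7, h8⟩ := hinf 0
    rw [← h7, ← h8]; exact hAB n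
  have hx1 : P.IsBoundaryEdge x.1 := by
    obtain ⟨n, -, h7, h8⟩ := hinf 0
    rw [← h7]; exact hbd _ _ (hA n)
  have hx2 : P.IsBoundaryEdge x.2 := by
    obtain ⟨n, -, h7, h8⟩ := hinf 0
    rw [← h8]; exact hbd _ _ (hBp n)
  have p1 : P.IsPrefix ⟨x.1, hx1⟩ (fun i => E (m + 1 + i)) := by
    refine isPrefix_of_precedes (𝔇 := 𝔇) hB' hm fun N => ?_
    obtain ⟨n, h6, h7, h8⟩ := hinf N
    refine ⟨b + n, by omega, by omega, ?_⟩
    have := hA n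
    rwa [h7] at this
  have p2 : P.IsPrefix ⟨x.2, hx2⟩ (fun i => E (m + 1 + i)) := by
    refine isPrefix_of_precedes (𝔇 := 𝔇) hB' hm fun N => ?_
    obtain ⟨n, h6, h7, h8⟩ := hinf N
    refine ⟨b + n, by omega, by omega, ?_⟩
    have := hBp n
    rwa [h8] at this
  exact hne (congrArg Subtype.val (((hu m _).1 p1).trans ((hu m _).1 p2).symm))

/-! ### The billiard map on boundary edges -/

lemma BoundaryEdge.exists_rep (e : P.BoundaryEdge) :
    ∃ t u v, t ∈ P.faces ∧ u ∈ t ∧ v ∈ t ∧ u ≠ v ∧ e.1 = {u, v} := by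
  obtain ⟨u, v, huv, he⟩ := Finset.card_eq_two.1 e.2.1
  obtain ⟨t, ⟨ht, hs⟩, -⟩ := e.2.2
  exact ⟨t, u, v, ht, hs (by rw [he]; simp), hs (by rw [he]; simp), huv, he⟩

/-- Reflection of functionals in a boundary edge. -/
noncomputable def eref (𝔇 : Dev P) (e : P.BoundaryEdge) (φ : Fn) : Fn :=
  pull (𝔇.D (BoundaryEdge.exists_rep e).choose (BoundaryEdge.exists_rep e).choose_spec.choose)
    (𝔇.D (BoundaryEdge.exists_rep e).choose
      (BoundaryEdge.exists_rep e).choose_spec.choose_spec.choose) φ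

lemma eref_spec (𝔇 : Dev P) (e : P.BoundaryEdge) : ∃ t u v, t ∈ P.faces ∧ u ∈ t ∧ v ∈ t ∧ u ≠ v ∧
    e.1 = {u, v} ∧ ∀ φ, eref 𝔇 e φ = pull (𝔇.D t u) (𝔇.D t v) φ := by
  obtain ⟨h1, h2, h3, h4, h5⟩ :=
    (BoundaryEdge.exists_rep e).choose_spec.choose_spec.choose_spec
  exact ⟨_, _, _, h1, h2, h3, h4, h5, fun φ => rfl⟩

/-- A boundary edge lies in one face only, so the reflection depends only on the label. -/
lemma refr_eq_eref {s : CState V} (hs : VInv 𝔇 s) {e : P.BoundaryEdge} (he : s.edge = e.1)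
    (φ : Fn) : refr 𝔇 s φ = eref 𝔇 e φ := by
  obtain ⟨t, u, v, ht, hu, hv, huv, h1, h2⟩ := eref_spec 𝔇 e
  have hb : P.IsBoundaryEdge s.edge := he ▸ e.2
  rw [refr, if_pos hb, h2]
  have hf : s.face = t := hb.2.unique ⟨hs.face_mem, hs.edge_subset⟩ ⟨ht, by
    rw [he, h1]
    intro x hx
    simp only [Finset.mem_insert, Finset.mem_singleton] at hx
    rcases hx with rfl | rfl <;> assumption⟩
  have hp : ({s.l, s.r} : Finset V) = {u, v} := he.trans h1
  rw [hf]
  have hl : s.l ∈ ({u, v} : Finset V) := hp ▸ by simp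
  have hr : s.r ∈ ({u, v} : Finset V) := hp ▸ by simp
  simp only [Finset.mem_insert, Finset.mem_singleton] at hl hr
  have hne := hs.ne
  rcases hl with hl | hl <;> rcases hr with hr | hr
  · exact absurd (hl.trans hr.symm) hne
  · rw [hl, hr]
  · rw [hl, hr, pull_comm]
  · exact absurd (hl.trans hr.symm) hne

lemma eref_eref (e : P.BoundaryEdge) (φ : Fn) : eref 𝔇 e (eref 𝔇 e φ) = φ := by
  obtain ⟨t, u, v, ht, hu, hv, huv, -, h⟩ := eref_spec 𝔇 e
  rw [h, h, pull_pull (𝔇.D_ne ht hu hv huv)]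

lemma gsq_eref (e : P.BoundaryEdge) (φ : Fn) : gsq (eref 𝔇 e φ) = gsq φ := by
  obtain ⟨t, u, v, ht, hu, hv, huv, -, h⟩ := eref_spec 𝔇 e
  rw [h, gsq_pull (𝔇.D_ne ht hu hv huv)]

lemma dt_eref (e : P.BoundaryEdge) (η φ : Fn) : dt (eref 𝔇 e η) (eref 𝔇 e φ) = - dt η φ := by
  obtain ⟨t, u, v, ht, hu, hv, huv, -, h⟩ := eref_spec 𝔇 e
  rw [h, h, dt_pull (𝔇.D_ne ht hu hv huv)]

lemma eref_add (e : P.BoundaryEdge) (η φ : Fn) :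
    eref 𝔇 e (η + φ) = eref 𝔇 e η + eref 𝔇 e φ := by unfold eref; rw [pull_add]

lemma eref_neg (e : P.BoundaryEdge) (φ : Fn) : eref 𝔇 e (-φ) = - eref 𝔇 e φ := by
  unfold eref; rw [pull_neg]

lemma eref_const (e : P.BoundaryEdge) (η : ℝ) : eref 𝔇 e (0, 0, η) = (0, 0, η) := by
  unfold eref; rw [pull_const]

lemma continuous_eref (e : P.BoundaryEdge) : Continuous (eref 𝔇 e) := by
  unfold eref pull; fun_prop

/-- Orientations alternate. -/
def fl (ε : Bool) : ℕ → Bool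
  | 0 => ε
  | m + 1 => !(fl ε m)

lemma fl_add (ε : Bool) (i j : ℕ) : fl ε (i + j) = fl (fl ε i) j := by
  induction j with
  | zero => rfl
  | succ j ih => rw [← add_assoc, fl, ih]; rfl

lemma fl_even (ε : Bool) {m : ℕ} (h : Even m) : fl ε m = ε := by
  obtain ⟨k, rfl⟩ := h
  induction k with
  | zero => rfl
  | succ k ih => rw [show k + 1 + (k + 1) = k + k + 1 + 1 by ring, fl, fl, ih, Bool.not_not]

/-- The functional along a sequence of bounces, after the bounce with index `m`. -/
noncomputable def tr (𝔇 : Dev P) (ω : ℕ → P.BoundaryEdge) : ℕ → Fn → Fn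
  | 0, φ => φ
  | m + 1, φ => eref 𝔇 (ω (m + 1)) (tr 𝔇 ω m φ)

/-! ### Functionals transported along a bounce sequence -/

lemma tr_shift (ω : ℕ → P.BoundaryEdge) (i j : ℕ) (φ : Fn) :
    tr 𝔇 ω (i + j) φ = tr 𝔇 (fun k => ω (i + k)) j (tr 𝔇 ω i φ) := by
  induction j with
  | zero => rfl
  | succ j ih => rw [← add_assoc, tr, ih]; rfl

lemma tr_congr {ω ω' : ℕ → P.BoundaryEdge} {m : ℕ} (h : ∀ k, 0 < k → k ≤ m → ω k = ω' k)
    (φ : Fn) : tr 𝔇 ω m φ = tr 𝔇 ω' m φ := by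
  induction m with
  | zero => rfl
  | succ m ih => rw [tr, tr, ih fun k h1 h2 => h k h1 (by omega), h _ (by omega) le_rfl]

lemma tr_add (ω : ℕ → P.BoundaryEdge) (m : ℕ) (η φ : Fn) :
    tr 𝔇 ω m (η + φ) = tr 𝔇 ω m η + tr 𝔇 ω m φ := by
  induction m with
  | zero => rfl
  | succ m ih => rw [tr, ih, eref_add]; rfl

lemma tr_neg (ω : ℕ → P.BoundaryEdge) (m : ℕ) (φ : Fn) :
    tr 𝔇 ω m (-φ) = - tr 𝔇 ω m φ := by
  induction m with
  | zero => rfl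
  | succ m ih => rw [tr, ih, eref_neg]; rfl

lemma tr_sub (ω : ℕ → P.BoundaryEdge) (m : ℕ) (η φ : Fn) :
    tr 𝔇 ω m (η - φ) = tr 𝔇 ω m η - tr 𝔇 ω m φ := by
  rw [sub_eq_add_neg, tr_add, tr_neg, ← sub_eq_add_neg]

lemma tr_const (ω : ℕ → P.BoundaryEdge) (m : ℕ) (η : ℝ) :
    tr 𝔇 ω m (0, 0, η) = (0, 0, η) := by
  induction m with
  | zero => rfl
  | succ m ih => rw [tr, ih, eref_const]

lemma gsq_tr (ω : ℕ → P.BoundaryEdge) (m : ℕ) (φ : Fn) : gsq (tr 𝔇 ω m φ) = gsq φ := by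
  induction m with
  | zero => rfl
  | succ m ih => rw [tr, gsq_eref, ih]

lemma continuous_tr (ω : ℕ → P.BoundaryEdge) (m : ℕ) : Continuous (tr 𝔇 ω m) := by
  induction m with
  | zero => exact continuous_id
  | succ m ih => exact (continuous_eref _).comp ih

/-- The line `φ` runs from the boundary edge `a` to the boundary edge `b`. -/
def Ch (𝔇 : Dev P) (ε : Bool) (φ : Fn) (a b : P.BoundaryEdge) : Prop :=
  ∃ c n, SChain 𝔇 φ c (n + 1) ∧ (c 0).edge = a.1 ∧ (c (n + 1)).edge = b.1 ∧ (c 1).ε = ε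

/-- Functionals, after the bounce with index `0`, of orbits that bounce at `ω 0, …, ω n`. -/
def Cell (𝔇 : Dev P) (ε : Bool) (ω : ℕ → P.BoundaryEdge) (n : ℕ) : Set Fn :=
  {φ | ∃ c ψ κ E, IsOrbit 𝔇 c ψ ∧ Bounces P c κ E ∧ κ 0 = 0 ∧ (∀ i ≤ n, E i = ω i) ∧
    φ = transp 𝔇 c ψ 1 ∧ (c 1).ε = ε}

/-! ### Cells of orbits and their chords -/

lemma Bounces.int {c : ℕ → CState V} {κ : ℕ → ℕ} {E : ℕ → P.BoundaryEdge} (h : Bounces P c κ E)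
    {m k : ℕ} (h1 : κ m < k) (h2 : k < κ (m + 1)) : ¬ P.IsBoundaryEdge (c k).edge := by
  intro hb
  have : k ∈ Set.range κ := by rw [h.range]; exact hb
  obtain ⟨j, rfl⟩ := this
  have h3 := h.mono.lt_iff_lt.1 h1
  have h4 := h.mono.lt_iff_lt.1 h2
  omega

lemma Bounces.bd {c : ℕ → CState V} {κ : ℕ → ℕ} {E : ℕ → P.BoundaryEdge} (h : Bounces P c κ E)
    (m : ℕ) : P.IsBoundaryEdge (c (κ m)).edge := by
  rw [← h.edge]; exact (E m).2

/-- The functional is constant between bounces. This turns transport by edges into transport by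
bounces. -/
lemma Bounces.transp_tr {c : ℕ → CState V} {κ : ℕ → ℕ} {E : ℕ → P.BoundaryEdge}
    (h : Bounces P c κ E) (hv : ∀ k, VInv 𝔇 (c k)) (h0 : κ 0 = 0) (η : Fn) (m : ℕ) :
    transp 𝔇 c η (κ m + 1) = tr 𝔇 E m (transp 𝔇 c η 1) ∧
      ∀ k, κ m < k → k ≤ κ (m + 1) → transp 𝔇 c η k = tr 𝔇 E m (transp 𝔇 c η 1) := by
  have step : ∀ m, transp 𝔇 c η (κ m + 1) = tr 𝔇 E m (transp 𝔇 c η 1) →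
      ∀ j, κ m + 1 + j ≤ κ (m + 1) →
        transp 𝔇 c η (κ m + 1 + j) = tr 𝔇 E m (transp 𝔇 c η 1) := by
    intro m hm j
    induction j with
    | zero => intro _; exact hm
    | succ j ih =>
      intro hj
      rw [← add_assoc, transp, refr, if_neg (h.int (m := m) (by omega) (by omega))]
      exact ih (by omega)
  have first : ∀ m, transp 𝔇 c η (κ m + 1) = tr 𝔇 E m (transp 𝔇 c η 1) := by
    intro m
    induction m with
    | zero => rw [h0]; rfl
    | succ m ih =>
      have hlt := h.mono (Nat.lt_succ_self m)
      rw [transp, refr_eq_eref (hv _) (h.edge (m + 1)).symm]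
      obtain ⟨j, hj⟩ := Nat.exists_eq_add_of_le (show κ m + 1 ≤ κ (m + 1) from hlt)
      rw [hj, step m ih j (by omega)]
      rfl
  refine ⟨first m, fun k h1 h2 => ?_⟩
  obtain ⟨j, rfl⟩ := Nat.exists_eq_add_of_le (show κ m + 1 ≤ k from h1)
  exact step m (first m) j h2

lemma Bounces.orient {c : ℕ → CState V} {κ : ℕ → ℕ} {E : ℕ → P.BoundaryEdge}
    (h : Bounces P c κ E) (hs : ∀ k, CStep P (c k) (c (k + 1))) (h0 : κ 0 = 0) (m : ℕ) :
    (c (κ m + 1)).ε = fl (c 1).ε m := by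
  have step : ∀ m j, κ m + 1 + j ≤ κ (m + 1) → (c (κ m + 1 + j)).ε = (c (κ m + 1)).ε := by
    intro m j
    induction j with
    | zero => intro _; rfl
    | succ j ih =>
      intro hj
      rw [← add_assoc, ((hs _).int (h.int (m := m) (by omega) (by omega))).2]
      exact ih (by omega)
  induction m with
  | zero => rw [h0]; rfl
  | succ m ih =>
    have hlt := h.mono (Nat.lt_succ_self m)
    obtain ⟨j, hj⟩ := Nat.exists_eq_add_of_le (show κ m + 1 ≤ κ (m + 1) from hlt)
    rw [((hs _).bd (h.bd (m + 1))).2, fl, ← ih, hj, step m j (by omega)]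

lemma Cell.shift {ε : Bool} {ω : ℕ → P.BoundaryEdge} {n : ℕ} {φ : Fn} (h : φ ∈ Cell 𝔇 ε ω n)
    {i : ℕ} (hi : i ≤ n) :
    tr 𝔇 ω i φ ∈ Cell 𝔇 (fl ε i) (fun k => ω (i + k)) (n - i) := by
  obtain ⟨c, ψ, κ, E, h1, h2, h3, h4, rfl, rfl⟩ := h
  refine ⟨_, _, _, _, h1.drop (κ i), h2.drop i, by simp, fun j hj => h4 _ (by omega), ?_,
    h2.orient h1.step h3 i⟩
  rw [tr_congr (fun k _ hk => (h4 k (by omega)).symm), ← (h2.transp_tr h1.inv h3 ψ i).1]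
  rfl

lemma Cell.mono {ε : Bool} {ω ω' : ℕ → P.BoundaryEdge} {n m : ℕ} {φ : Fn}
    (h : φ ∈ Cell 𝔇 ε ω n) (hmn : m ≤ n) (hω : ∀ i ≤ m, ω i = ω' i) : φ ∈ Cell 𝔇 ε ω' m := by
  obtain ⟨c, ψ, κ, E, h1, h2, h3, h4, h5⟩ := h
  exact ⟨c, ψ, κ, E, h1, h2, h3, fun i hi => (h4 i (by omega)).trans (hω i hi), h5⟩

lemma Cell.neg {ε : Bool} {ω : ℕ → P.BoundaryEdge} {n : ℕ} {φ : Fn} (h : φ ∈ Cell 𝔇 ε ω n) :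
    -φ ∈ Cell 𝔇 (!ε) ω n := by
  obtain ⟨c, ψ, κ, E, h1, h2, h3, h4, rfl, rfl⟩ := h
  exact ⟨_, _, κ, E, h1.neg, h2.neg, h3, h4, (transp_neg _ _ _).symm, rfl⟩

lemma Cell.unit {ε : Bool} {ω : ℕ → P.BoundaryEdge} {n : ℕ} {φ : Fn} (h : φ ∈ Cell 𝔇 ε ω n) :
    gsq φ = 1 := by
  obtain ⟨c, ψ, κ, E, h1, h2, h3, h4, rfl, -⟩ := h
  rw [gsq_transp h1.inv, h1.unit]

lemma Cell.ch_zero {ε : Bool} {ω : ℕ → P.BoundaryEdge} {n : ℕ} {φ : Fn}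
    (h : φ ∈ Cell 𝔇 ε ω n) (hn : 0 < n) : Ch 𝔇 ε φ (ω 0) (ω 1) := by
  obtain ⟨c, ψ, κ, E, h1, h2, h3, h4, rfl, rfl⟩ := h
  have hlt := h2.mono (show 0 < 1 by omega)
  rw [h3] at hlt
  obtain ⟨k, hk⟩ := Nat.exists_eq_succ_of_ne_zero hlt.ne'
  have hb := h2.bd 0
  rw [h3] at hb
  have hs := h1.schain hb (n := k) fun j h5 h6 => h2.int (m := 0) (by rw [h3]; exact h5)
    (by rw [zero_add, hk]; exact h6)
  refine ⟨c, k, ?_, ?_, ?_, rfl⟩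
  · have := (h2.transp_tr h1.inv h3 ψ 0).2 (k + 1) (by omega) (by rw [zero_add, hk])
    rw [this] at hs
    exact hs
  · rw [← h4 0 (by omega), h2.edge, h3]
  · rw [← h4 1 (by omega), h2.edge, hk]

lemma Cell.ch {ε : Bool} {ω : ℕ → P.BoundaryEdge} {n : ℕ} {φ : Fn} (h : φ ∈ Cell 𝔇 ε ω n) {m : ℕ}
    (hm : m < n) : Ch 𝔇 (fl ε m) (tr 𝔇 ω m φ) (ω m) (ω (m + 1)) :=
  Cell.ch_zero (Cell.shift h hm.le) (by omega)

lemma Dev.Const.cell_ball {ρ κ : ℝ} (hc : 𝔇.Const ρ κ) {ε : Bool} {ω : ℕ → P.BoundaryEdge}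
    {n : ℕ} {φ : Fn} (h : φ ∈ Cell 𝔇 ε ω n) : φ ∈ Metric.closedBall (0 : Fn) (2 * ρ) := by
  have hu := Cell.unit h
  obtain ⟨c, ψ, κ, E, h1, h2, h3, h4, rfl, -⟩ := h
  exact hc.mem_ball hu (h1.inv 1) (h1.sep 1)

/-- Drift of the bounce points along the line. -/
lemma Cell.exists_drift (𝔇 : Dev P) {ρ κ : ℝ} (hc : 𝔇.Const ρ κ) : ∃ d C : ℝ, 0 < d ∧ 0 < C ∧
    ∀ (ε : Bool) (ω : ℕ → P.BoundaryEdge) (n : ℕ) (φ : Fn), φ ∈ Cell 𝔇 ε ω n →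
    ∃ (t : ℕ → ℝ) (Y : ℕ → Pt), ∀ m ≤ n, d * m - C ≤ t m ∧ |(Y m).1| ≤ ρ ∧ |(Y m).2| ≤ ρ ∧
      ∀ η : Fn, ev (tr 𝔇 ω m η) (Y m) = ev η (Y 0) + t m * (sg ε * dt η φ) := by
  obtain ⟨d, C, hd, hC, h⟩ := 𝔇.exists_drift
  refine ⟨d, C, hd, hC, fun ε ω n φ hφ => ?_⟩
  obtain ⟨c, ψ, κ, E, h1, h2, h3, h4, rfl, rfl⟩ := hφ
  obtain ⟨t, ht⟩ := h c (κ n) ψ (h1.chain _) h1.unit (h1.fsep _)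
  refine ⟨fun m => t (κ m), fun m => Yc 𝔇 (transp 𝔇 c ψ (κ m)) (c (κ m)), fun m hm => ?_⟩
  have hle : m ≤ κ m := h2.mono.le_apply
  obtain ⟨e1, e2⟩ := ht (κ m) (h2.mono.monotone hm)
  obtain ⟨b1, b2⟩ := hc.Yc_le (h1.inv (κ m)) (h1.sep (κ m))
  refine ⟨?_, b1, b2, fun η => ?_⟩
  · have : d * m ≤ d * (κ m : ℕ) := mul_le_mul_of_nonneg_left (by exact_mod_cast hle) hd.le
    linarith
  · have hb0 : (c 0).edge = (E 0).1 := by rw [h2.edge, h3]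
    -- `η` belongs to the line after bounce `0`, whereas the drift is measured from before that
    -- bounce; hence the extra reflection.
    have e3 : transp 𝔇 c (eref 𝔇 (E 0) η) 1 = η := by
      rw [transp, transp, refr_eq_eref (h1.inv 0) hb0, eref_eref]
    have e4 := (h2.transp_tr h1.inv h3 (eref 𝔇 (E 0) η) m).1
    rw [e3] at e4
    have e5 := e2 (eref 𝔇 (E 0) η)
    rw [← ev_Yc_refr (h1.inv (κ m)) (h1.sep (κ m)), ← transp, e4,
      tr_congr (fun k _ hk => h4 k (by omega))] at e5
    have h00 : Yc 𝔇 (transp 𝔇 c ψ (κ 0)) (c (κ 0)) = Yc 𝔇 ψ (c 0) := by rw [h3]; rfl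
    have e6 : ev (eref 𝔇 (E 0) η) (Yc 𝔇 ψ (c 0)) = ev η (Yc 𝔇 ψ (c 0)) := by
      rw [← refr_eq_eref (h1.inv 0) hb0]
      exact ev_Yc_refr (h1.inv 0) (h1.sep 0) η
    have e7 := (h1.step 0).dt_refr (𝔇 := 𝔇) (h1.inv 0) (eref 𝔇 (E 0) η) ψ
    rw [refr_eq_eref (h1.inv 0) hb0, eref_eref] at e7
    simp only [h00]
    rw [e5, e6, ← e7]
    rfl

lemma exists_cell {E : ℕ → P.BoundaryEdge} (hE : E ∈ P.forwardBounceSpectrum) :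
    ∃ ε T, ∀ n, T ∈ Cell 𝔇 ε E n := by
  obtain ⟨c, ψ, κ, h1, h2⟩ := (mem_spectrum_iff 𝔇 E).1 hE
  exact ⟨_, _, fun n => ⟨_, _, _, _, h1.drop (κ 0), h2.drop 0, by simp,
    fun i _ => by rw [zero_add], rfl, rfl⟩⟩

/-- The orientation can be prescribed because changing the sign of the functional flips it. -/
lemma exists_cell_of_closure {E : ℕ → P.BoundaryEdge} (hE : E ∈ closure P.forwardBounceSpectrum)
    (ε : Bool) (n : ℕ) : (Cell 𝔇 ε E n).Nonempty := by
  obtain ⟨E', h1, h2⟩ := mem_closure_seq_iff.1 hE (n + 1)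
  obtain ⟨ε', T, hT⟩ := exists_cell (𝔇 := 𝔇) h1
  have := Cell.mono (hT n) le_rfl fun i hi => h2 i (by omega)
  by_cases he : ε' = ε
  · exact ⟨T, he ▸ this⟩
  · refine ⟨-T, ?_⟩
    have hne : (!ε') = ε := by revert he; cases ε <;> cases ε' <;> simp
    exact hne ▸ Cell.neg this

/-! ### Chords -/

lemma VInv.eq_of_edge {s s' : CState V} (hs : VInv 𝔇 s) (hs' : VInv 𝔇 s') (he : s.edge = s'.edge)
    (hb : P.IsBoundaryEdge s.edge) {φ : Fn} (hS : Sep 𝔇 φ s) (hS' : Sep 𝔇 φ s') : s = s' := by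
  have hf : s.face = s'.face := hb.2.unique ⟨hs.face_mem, hs.edge_subset⟩
    ⟨hs'.face_mem, he ▸ hs'.edge_subset⟩
  have h1 : s.l ∈ s'.edge := he ▸ by simp [CState.edge]
  have h2 : s.r ∈ s'.edge := he ▸ by simp [CState.edge]
  simp only [CState.edge, Finset.mem_insert, Finset.mem_singleton] at h1 h2
  have hl : s.l = s'.l := h1.resolve_right fun h => by
    have := hS.1
    rw [h, hf] at this
    exact lt_asymm this hS'.2
  have hr : s.r = s'.r := h2.resolve_left fun h => by
    have := hS.2
    rw [h, hf] at this
    exact lt_asymm this hS'.1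
  refine CState.ext' hf hl hr ?_
  obtain ⟨c, c1, c2, c3⟩ := hs.exists_apex
  have hc : c ∈ s.face := by rw [c3]; simp
  have b1 := hs.behind c hc c1 c2
  have b2 := hs'.behind c (hf ▸ hc) (hl ▸ c1) (hr ▸ c2)
  rw [← hf, ← hl, ← hr] at b2
  by_contra hne
  have h3 : s'.ε = !s.ε := by revert hne; cases s.ε <;> cases s'.ε <;> simp
  rw [h3, sg_not] at b2
  linarith

lemma eventually_sep {φ : Fn} {s : CState V} (h : Sep 𝔇 φ s) : ∀ᶠ φ' in 𝓝 φ, Sep 𝔇 φ' s :=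
  ((continuous_ev _).tendsto φ).eventually (lt_mem_nhds h.1) |>.and
    (((continuous_ev _).tendsto φ).eventually (gt_mem_nhds h.2))

/-- The end of a chord is determined by its beginning and is locally constant. -/
lemma Ch.eventually_eq {ε : Bool} {φ : Fn} {a b : P.BoundaryEdge} (h : Ch 𝔇 ε φ a b) :
    ∀ᶠ φ' in 𝓝 φ, ∀ ε' b', Ch 𝔇 ε' φ' a b' → b' = b := by
  obtain ⟨c, n, hc, h1, h2, -⟩ := h
  have hev : ∀ᶠ φ' in 𝓝 φ, ∀ k ∈ Finset.range (n + 2), Sep 𝔇 φ' (c k) := by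
    rw [Filter.eventually_all_finset]
    exact fun k hk => eventually_sep (hc.sep k (by have := Finset.mem_range.1 hk; omega))
  filter_upwards [hev] with φ' hφ' ε' b' hb'
  obtain ⟨c', n', hc', h1', h2', -⟩ := hb'
  have hsep : ∀ k ≤ n + 1, Sep 𝔇 φ' (c k) := fun k hk => hφ' k (by rw [Finset.mem_range]; omega)
  have key : ∀ k, k ≤ n + 1 → k ≤ n' + 1 → c' k = c k := by
    intro k
    induction k with
    | zero =>
      exact fun _ _ => (hc'.chain.inv 0 (by omega)).eq_of_edge (hc.chain.inv 0 (by omega))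
        (h1'.trans h1.symm) hc'.bd (hc'.sep 0 (by omega)) (hsep 0 (by omega))
    | succ k ih =>
      intro k1 k2
      have e := ih (by omega) (by omega)
      have s1 := hc'.chain.step k (by omega)
      rw [e] at s1
      exact s1.unique (hc.chain.step k (by omega)) (hc.chain.inv _ (by omega))
        (hc'.chain.inv _ k2) (hc.chain.inv _ k1) (hc'.sep _ k2) (hsep _ k1)
  have hb1 : P.IsBoundaryEdge (c (n + 1)).edge := h2 ▸ b.2
  have hb2 : P.IsBoundaryEdge (c' (n' + 1)).edge := h2' ▸ b'.2
  rcases lt_trichotomy n n' with hlt | rfl | hlt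
  · refine absurd ?_ (hc'.int (n + 1) (by omega) (by omega))
    rw [key _ le_rfl (by omega)]; exact hb1
  · exact Subtype.ext (by rw [← h2, ← h2', key _ le_rfl le_rfl])
  · refine absurd ?_ (hc.int (n' + 1) (by omega) (by omega))
    rw [← key _ (by omega) le_rfl]; exact hb2

lemma Ch.unique {ε ε' : Bool} {φ : Fn} {a b b' : P.BoundaryEdge} (h : Ch 𝔇 ε φ a b)
    (h' : Ch 𝔇 ε' φ a b') : b' = b := h.eventually_eq.self_of_nhds _ _ h'

lemma SChain.orient {φ : Fn} {c : ℕ → CState V} {n : ℕ} (h : SChain 𝔇 φ c (n + 1)) :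
    ∀ k ≤ n, (c (k + 1)).ε = (c 1).ε := by
  intro k
  induction k with
  | zero => exact fun _ => rfl
  | succ k ih =>
    intro hk
    rw [← ih (by omega), ((h.chain.step (k + 1) (by omega)).int
      (h.int _ (by omega) (by omega))).2]

/-- A straight chain run backwards. -/
def revChain (c : ℕ → CState V) (n : ℕ) : ℕ → CState V
  | 0 => c (n + 1)
  | k + 1 => ⟨(c (n + 1 - k)).face, (c (n - k)).l, (c (n - k)).r, !(c (n + 1 - k)).ε⟩

/-- The functional and hence left and right are kept. Running backward only flips the orientation,
and the exit edge of a triangle becomes the edge through which it was entered before. -/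
lemma SChain.reverse {φ : Fn} {c : ℕ → CState V} {n : ℕ} (h : SChain 𝔇 φ c (n + 1))
    (hb : P.IsBoundaryEdge (c (n + 1)).edge) : SChain 𝔇 φ (revChain c n) (n + 1) := by
  have hv := h.chain.inv
  have hs := h.chain.step
  have inv : ∀ k ≤ n + 1, VInv 𝔇 (revChain c n k) := by
    rintro (_ | k) hk
    · exact hv _ le_rfl
    · obtain ⟨j, rfl⟩ := Nat.exists_eq_add_of_le' (show k ≤ n by omega)
      have e1 : j + k + 1 - k = j + 1 := by omega
      have e2 : j + k - k = j := by omega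
      have st := hs j (by omega)
      simp only [revChain, e1, e2]
      refine ⟨(hv _ (by omega)).face_mem, st.l_mem, st.r_mem, (hv j (by omega)).ne,
        fun c hc c1 c2 => ?_⟩
      have := st.ahead (hv j (by omega)) (hv (j + 1) (by omega)) hc c1 c2
      simp only [sg_not]
      linarith
  have swap : ∀ {a b a' b' : V}, (a = a' ∧ b ≠ b') ∨ (b = b' ∧ a ≠ a') →
      (a' = a ∧ b' ≠ b) ∨ (b' = b ∧ a' ≠ a) := fun h =>
    h.imp (fun h => ⟨h.1.symm, h.2.symm⟩) (fun h => ⟨h.1.symm, h.2.symm⟩)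
  refine ⟨⟨inv, ?_⟩, ?_, hb, ?_⟩
  · rintro (_ | k) hk
    · refine ⟨fun _ => ⟨rfl, rfl⟩, fun h => absurd hb h, (hv _ le_rfl).l_mem, (hv _ le_rfl).r_mem,
        swap (hs n (by omega)).turn⟩
    · obtain ⟨j, rfl⟩ := Nat.exists_eq_add_of_le' (show k + 1 ≤ n by omega)
      have e1 : j + (k + 1) + 1 - k = j + 2 := by omega
      have e2 : j + (k + 1) - k = j + 1 := by omega
      have e3 : j + (k + 1) + 1 - (k + 1) = j + 1 := by omega
      have e4 : j + (k + 1) - (k + 1) = j := by omega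
      have hi := h.int (j + 1) (by omega) (by omega)
      have st := hs (j + 1) (by omega)
      have st' := hs j (by omega)
      obtain ⟨i1, i2⟩ := st.int hi
      simp only [revChain, e1, e2, e3, e4]
      refine ⟨fun hb => absurd hb hi, fun _ => ⟨i1.symm, ?_⟩, (hv _ (by omega)).l_mem,
        (hv _ (by omega)).r_mem, swap st'.turn⟩
      simp only [i2]
  · rintro (_ | k) hk
    · exact h.sep _ le_rfl
    · obtain ⟨j, rfl⟩ := Nat.exists_eq_add_of_le' (show k ≤ n by omega)
      have e1 : j + k + 1 - k = j + 1 := by omega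
      have e2 : j + k - k = j := by omega
      have st := hs j (by omega)
      have hS := h.sep j (by omega)
      simp only [revChain, e1, e2, Sep]
      rw [st.D_l (hv _ (by omega)) (hv _ (by omega)), st.D_r (hv _ (by omega)) (hv _ (by omega))]
      exact hS
  · rintro (_ | k) h0 hk
    · omega
    · exact h.int (n - k) (by omega) (by omega)

lemma Ch.reverse {ε : Bool} {φ : Fn} {a b : P.BoundaryEdge} (h : Ch 𝔇 ε φ a b) :
    Ch 𝔇 (!ε) φ b a := by
  obtain ⟨c, n, hc, h1, h2, rfl⟩ := h
  refine ⟨revChain c n, n, hc.reverse (h2 ▸ b.2), h2, ?_, ?_⟩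
  · simp only [revChain, Nat.sub_self]; exact h1
  · change (!(c (n + 1)).ε) = _
    rw [hc.orient n le_rfl]

/-- Pointwise order at all vertices of the development. -/
def Below (𝔇 : Dev P) (φ φ' : Fn) : Prop :=
  ∀ t ∈ P.faces, ∀ v ∈ t, ev φ (𝔇.D t v) < ev φ' (𝔇.D t v)

def BelowEq (𝔇 : Dev P) (φ φ' : Fn) : Prop :=
  ∀ t ∈ P.faces, ∀ v ∈ t, ev φ (𝔇.D t v) ≤ ev φ' (𝔇.D t v)

lemma Below.le {φ φ' : Fn} (h : Below 𝔇 φ φ') : BelowEq 𝔇 φ φ' := fun t ht v hv => (h t ht v hv).le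

lemma BelowEq.refl (φ : Fn) : BelowEq 𝔇 φ φ := fun _ _ _ _ => le_rfl

lemma Below.trans {φ φ' φ'' : Fn} (h : Below 𝔇 φ φ') (h' : Below 𝔇 φ' φ'') : Below 𝔇 φ φ'' :=
  fun t ht v hv => (h t ht v hv).trans (h' t ht v hv)

/-- Chords from one edge to two different edges are not interlaced. -/
def Stag (𝔇 : Dev P) : Prop := ∀ (ε : Bool) (a b c : P.BoundaryEdge) (x x' z y y' z₁ : Fn),
  Ch 𝔇 ε x a b → Ch 𝔇 ε x' a b → Ch 𝔇 ε z a b → Ch 𝔇 ε y a c → Ch 𝔇 ε y' a c → Ch 𝔇 ε z₁ a c →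
  Below 𝔇 x z₁ → Below 𝔇 z₁ x' → Below 𝔇 y z → Below 𝔇 z y' → BelowEq 𝔇 x z → BelowEq 𝔇 z x' →
  b = c

lemma Below.exists_ball {φ φ' : Fn} (h : Below 𝔇 φ φ') :
    ∃ δ > 0, ∀ ψ ψ', dist ψ φ < δ → dist ψ' φ' < δ → Below 𝔇 ψ ψ' := by
  have h1 : ∀ᶠ p : Fn × Fn in 𝓝 (φ, φ'), ∀ t ∈ P.faces, ∀ v ∈ t,
      ev p.1 (𝔇.D t v) < ev p.2 (𝔇.D t v) := by
    rw [Filter.eventually_all_finset]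
    intro t ht
    rw [Filter.eventually_all_finset]
    intro v hv
    exact (((continuous_ev (𝔇.D t v)).comp continuous_fst).tendsto (φ, φ')).eventually_lt
      (((continuous_ev (𝔇.D t v)).comp continuous_snd).tendsto (φ, φ')) (h t ht v hv)
  obtain ⟨δ, hδ, hb⟩ := Metric.eventually_nhds_iff.1 h1
  exact ⟨δ, hδ, fun ψ ψ' h1 h2 => hb (y := (ψ, ψ')) (by rw [Prod.dist_eq]; exact max_lt h1 h2)⟩

/-- The closed set of limits of chords from `a` to `b`. -/
def CCh (𝔇 : Dev P) (ε : Bool) (a b : P.BoundaryEdge) : Set Fn := closure {φ | Ch 𝔇 ε φ a b}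

lemma CCh.reverse {ε : Bool} {a b : P.BoundaryEdge} {φ : Fn} (h : φ ∈ CCh 𝔇 ε a b) :
    φ ∈ CCh 𝔇 (!ε) b a := closure_mono (fun _ h => h.reverse) h

/-- Strict inequalities pass to nearby chords, which are interlaced as `x < y < x' < y'`; here `x'`
and `y` serve as the middle chords. -/
lemma Stag.four (hS : Stag 𝔇) {ε : Bool} {a b c : P.BoundaryEdge} {x x' y y' : Fn}
    (h1 : x ∈ CCh 𝔇 ε a b) (h2 : x' ∈ CCh 𝔇 ε a b) (h3 : y ∈ CCh 𝔇 ε a c) (h4 : y' ∈ CCh 𝔇 ε a c)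
    (l1 : Below 𝔇 x y) (l2 : Below 𝔇 y x') (l3 : Below 𝔇 x' y') : b = c := by
  obtain ⟨δ₁, p1, b1⟩ := l1.exists_ball
  obtain ⟨δ₂, p2, b2⟩ := l2.exists_ball
  obtain ⟨δ₃, p3, b3⟩ := l3.exists_ball
  have hδ : 0 < min δ₁ (min δ₂ δ₃) := by positivity
  obtain ⟨X, c1, d1⟩ := Metric.mem_closure_iff.1 h1 _ hδ
  obtain ⟨X', c2, d2⟩ := Metric.mem_closure_iff.1 h2 _ hδ
  obtain ⟨Y, c3, d3⟩ := Metric.mem_closure_iff.1 h3 _ hδ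
  obtain ⟨Y', c4, d4⟩ := Metric.mem_closure_iff.1 h4 _ hδ
  rw [dist_comm, lt_min_iff, lt_min_iff] at d1 d2 d3 d4
  have m1 := b1 X Y d1.1 d3.1
  have m2 := b2 Y X' d3.2.1 d2.2.1
  have m3 := b3 X' Y' d2.2.2 d4.2.2
  exact hS ε a b c X X' X' Y Y' Y c1 c2 c2 c3 c4 c3 m1 m2 m2 m3 (m1.trans m2).le (BelowEq.refl _)

/-- Each of the three lines is approximated independently by a chord to `b` and by a chord to `c`.
-/
lemma Stag.three (hS : Stag 𝔇) {ε : Bool} {a b c : P.BoundaryEdge} {x z x' : Fn}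
    (h1 : x ∈ CCh 𝔇 ε a b) (h2 : z ∈ CCh 𝔇 ε a b) (h3 : x' ∈ CCh 𝔇 ε a b)
    (k1 : x ∈ CCh 𝔇 ε a c) (k2 : z ∈ CCh 𝔇 ε a c) (k3 : x' ∈ CCh 𝔇 ε a c)
    (l1 : Below 𝔇 x z) (l2 : Below 𝔇 z x') : b = c := by
  obtain ⟨δ₁, p1, b1⟩ := l1.exists_ball
  obtain ⟨δ₂, p2, b2⟩ := l2.exists_ball
  have hδ : 0 < min δ₁ δ₂ := by positivity
  obtain ⟨X, c1, d1⟩ := Metric.mem_closure_iff.1 h1 _ hδ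
  obtain ⟨Z, c2, d2⟩ := Metric.mem_closure_iff.1 h2 _ hδ
  obtain ⟨X', c3, d3⟩ := Metric.mem_closure_iff.1 h3 _ hδ
  obtain ⟨Y, c4, d4⟩ := Metric.mem_closure_iff.1 k1 _ hδ
  obtain ⟨Z', c5, d5⟩ := Metric.mem_closure_iff.1 k2 _ hδ
  obtain ⟨Y', c6, d6⟩ := Metric.mem_closure_iff.1 k3 _ hδ
  rw [dist_comm, lt_min_iff] at d1 d2 d3 d4 d5 d6
  exact hS ε a b c X X' Z Y Y' Z' c1 c3 c2 c4 c6 c5 (b1 _ _ d1.1 d5.1) (b2 _ _ d5.2 d3.2)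
    (b1 _ _ d4.1 d2.1) (b2 _ _ d2.2 d6.2) (b1 _ _ d1.1 d2.1).le (b2 _ _ d2.2 d3.2).le

/-! ### Limits of functionals with a given bounce sequence -/

instance : Finite P.BoundaryEdge := Subtype.finite

/-- Lines after bounce `0` that are, for every `n`, limits of orbits with the letters `ω 0, …, ω n`.
Such a line may run through vertices. -/
def R (𝔇 : Dev P) (ε : Bool) (ω : ℕ → P.BoundaryEdge) : Set Fn :=
  {φ | ∀ n, φ ∈ closure (Cell 𝔇 ε ω n)}

lemma R.of_cell {ε : Bool} {ω : ℕ → P.BoundaryEdge} {φ : Fn} (h : ∀ n, φ ∈ Cell 𝔇 ε ω n) :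
    φ ∈ R 𝔇 ε ω := fun n => subset_closure (h n)

lemma R.shift {ε : Bool} {ω : ℕ → P.BoundaryEdge} {φ : Fn} (h : φ ∈ R 𝔇 ε ω) (i : ℕ) :
    tr 𝔇 ω i φ ∈ R 𝔇 (fl ε i) (fun k => ω (i + k)) := fun n =>
  map_mem_closure (continuous_tr ω i) (h (i + n)) fun ψ hψ => by
    have := Cell.shift hψ (show i ≤ i + n by omega)
    rwa [Nat.add_sub_cancel_left] at this

lemma R.neg {ε : Bool} {ω : ℕ → P.BoundaryEdge} {φ : Fn} (h : φ ∈ R 𝔇 ε ω) : -φ ∈ R 𝔇 (!ε) ω :=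
  fun n => map_mem_closure continuous_neg (h n) fun _ hψ => Cell.neg hψ

lemma R.unit {ε : Bool} {ω : ℕ → P.BoundaryEdge} {φ : Fn} (h : φ ∈ R 𝔇 ε ω) : gsq φ = 1 := by
  have : closure (Cell 𝔇 ε ω 0) ⊆ gsq ⁻¹' {1} :=
    closure_minimal (fun _ hψ => Cell.unit hψ) (isClosed_singleton.preimage continuous_gsq)
  exact this (h 0)

lemma R.ball {ρ κ : ℝ} (hc : 𝔇.Const ρ κ) {ε : Bool} {ω : ℕ → P.BoundaryEdge} {φ : Fn}
    (h : φ ∈ R 𝔇 ε ω) : φ ∈ Metric.closedBall (0 : Fn) (2 * ρ) :=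
  closure_minimal (fun _ hψ => hc.cell_ball hψ) Metric.isClosed_closedBall (h 0)

lemma R.cch {ε : Bool} {ω : ℕ → P.BoundaryEdge} {φ : Fn} (h : φ ∈ R 𝔇 ε ω) :
    φ ∈ CCh 𝔇 ε (ω 0) (ω 1) :=
  closure_mono (fun _ hψ => Cell.ch_zero hψ one_pos) (h 1)

lemma R.cch_shift {ε : Bool} {ω : ℕ → P.BoundaryEdge} {φ : Fn} (h : φ ∈ R 𝔇 ε ω) (m : ℕ) :
    tr 𝔇 ω m φ ∈ CCh 𝔇 (fl ε m) (ω m) (ω (m + 1)) := R.cch (R.shift h m)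

lemma R.of_tendsto {ι : Type*} {U : Filter ι} [U.NeBot] {ε : Bool} {ω : ℕ → P.BoundaryEdge}
    {φ : Fn} {f : ι → Fn} {Ω : ι → ℕ → P.BoundaryEdge} (hf : Tendsto f U (𝓝 φ))
    (hR : ∀ᶠ i in U, f i ∈ R 𝔇 ε (Ω i)) (hΩ : ∀ k, ∀ᶠ i in U, Ω i k = ω k) : φ ∈ R 𝔇 ε ω := by
  intro n
  have h1 : ∀ᶠ i in U, ∀ k ∈ Finset.range (n + 1), Ω i k = ω k := by
    rw [Filter.eventually_all_finset]
    exact fun k _ => hΩ k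
  refine isClosed_closure.mem_of_tendsto hf ?_
  filter_upwards [hR, h1] with i hi hi'
  exact closure_mono (fun ψ hψ => Cell.mono hψ le_rfl
    fun k hk => hi' k (Finset.mem_range.2 (by omega))) (hi n)

lemma R.nonempty {E : ℕ → P.BoundaryEdge} (hE : E ∈ closure P.forwardBounceSpectrum) (ε : Bool) :
    (R 𝔇 ε E).Nonempty := by
  obtain ⟨ρ, κ, hc⟩ := 𝔇.exists_const
  choose f hf using exists_cell_of_closure (𝔇 := 𝔇) hE ε
  obtain ⟨T, hT⟩ := Ultrafilter.exists_tendsto (hyperfilter ℕ) fun n => hc.cell_ball (hf n)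
  refine ⟨T, fun n => isClosed_closure.mem_of_tendsto hT ?_⟩
  filter_upwards [Nat.hyperfilter_le_atTop (eventually_ge_atTop n)] with N hN
  exact subset_closure (Cell.mono (hf N) hN fun _ _ => rfl)

lemma R.congr {ε : Bool} {ω ω' : ℕ → P.BoundaryEdge} (h : ∀ k, ω k = ω' k) {φ : Fn}
    (hφ : φ ∈ R 𝔇 ε ω) : φ ∈ R 𝔇 ε ω' := by rwa [← funext h]

/-! ### Parallelism -/

lemma abs_ev_sub_le {ζ : Fn} {G ρ : ℝ} {p q : Pt} (h1 : |ζ.1| ≤ G) (h2 : |ζ.2.1| ≤ G)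
    (hp : |p.1| ≤ ρ ∧ |p.2| ≤ ρ) (hq : |q.1| ≤ ρ ∧ |q.2| ≤ ρ) :
    |ev ζ p - ev ζ q| ≤ 4 * G * ρ := by
  have hG := (abs_nonneg _).trans h1
  have e : ev ζ p - ev ζ q = ζ.1 * (p.1 - q.1) + ζ.2.1 * (p.2 - q.2) := by unfold ev; ring
  have a1 : |p.1 - q.1| ≤ 2 * ρ := (abs_sub _ _).trans (by linarith [hp.1, hq.1])
  have a2 : |p.2 - q.2| ≤ 2 * ρ := (abs_sub _ _).trans (by linarith [hp.2, hq.2])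
  have b1 : |ζ.1 * (p.1 - q.1)| ≤ G * (2 * ρ) := by
    rw [abs_mul]; exact mul_le_mul h1 a1 (abs_nonneg _) hG
  have b2 : |ζ.2.1 * (p.2 - q.2)| ≤ G * (2 * ρ) := by
    rw [abs_mul]; exact mul_le_mul h2 a2 (abs_nonneg _) hG
  rw [e]
  exact (abs_add_le _ _).trans (by linarith)

lemma abs_le_of_gsq_le {ζ : Fn} {G : ℝ} (hG : 0 ≤ G) (h : gsq ζ ≤ G ^ 2) :
    |ζ.1| ≤ G ∧ |ζ.2.1| ≤ G := by
  unfold gsq at h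
  exact ⟨abs_le_of_sq_le_sq (by nlinarith [sq_nonneg ζ.2.1]) hG,
    abs_le_of_sq_le_sq (by nlinarith [sq_nonneg ζ.1]) hG⟩

lemma continuous_dt (η : Fn) : Continuous fun φ => dt η φ := by unfold dt; fun_prop

/-- Limit functionals with the same bounce sequence are parallel. -/
lemma R.parallel {ε : Bool} {ω : ℕ → P.BoundaryEdge} {x y : Fn} (hx : x ∈ R 𝔇 ε ω)
    (hy : y ∈ R 𝔇 ε ω) : ∃ s : ℝ, y = x + (0, 0, s) := by
  obtain ⟨ρ, κ, hc⟩ := 𝔇.exists_const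
  obtain ⟨d, C, hd, hC, hdr⟩ := Cell.exists_drift 𝔇 hc
  have ux := R.unit hx
  have uy := R.unit hy
  unfold gsq at ux uy
  set c := 1 - (x.1 * y.1 + x.2.1 * y.2.1) with hcdef
  have hc2 : 2 * c = (x.1 - y.1) ^ 2 + (x.2.1 - y.2.1) ^ 2 := by
    rw [hcdef]; linear_combination - ux - uy
  rcases (show 0 ≤ c by nlinarith [sq_nonneg (x.1 - y.1), sq_nonneg (x.2.1 - y.2.1)]).eq_or_lt
    with h0 | h0
  · have h1 : x.1 - y.1 = 0 := by
      nlinarith [sq_nonneg (x.1 - y.1), sq_nonneg (x.2.1 - y.2.1)]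
    have h2 : x.2.1 - y.2.1 = 0 := by
      nlinarith [sq_nonneg (x.1 - y.1), sq_nonneg (x.2.1 - y.2.1)]
    refine ⟨y.2.2 - x.2.2, Prod.ext ?_ (Prod.ext ?_ ?_)⟩
    · simp; linarith
    · simp; linarith
    · simp
  · exfalso
    -- This functional grows at rate `c` along `x` and falls at rate `c` along `y`. Bounce points of
    -- nearby orbits with the same letters would separate linearly, whereas the transports of `η`
    -- coincide and differ boundedly on the polygon.
    set η : Fn := (sg ε * (x.2.1 - y.2.1), -(sg ε * (x.1 - y.1)), 0) with hη
    have hs := sg_sq ε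
    have hval : ∀ φ : Fn, sg ε * dt η φ = (x.2.1 - y.2.1) * φ.2.1 + (x.1 - y.1) * φ.1 := by
      intro φ
      simp only [hη, dt]
      linear_combination ((x.2.1 - y.2.1) * φ.2.1 + (x.1 - y.1) * φ.1) * hs
    have hgη : gsq η ≤ 2 ^ 2 := by
      have : gsq η = 2 * c := by
        rw [hc2]; simp only [hη, gsq]
        linear_combination ((x.1 - y.1) ^ 2 + (x.2.1 - y.2.1) ^ 2) * hs
      rw [this]
      nlinarith [sq_nonneg (x.1 + y.1), sq_nonneg (x.2.1 + y.2.1)]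
    have hcont : Continuous fun φ => sg ε * dt η φ := (continuous_dt η).const_mul _
    have nx : {φ | c / 2 < sg ε * dt η φ} ∈ 𝓝 x :=
      (hcont.tendsto x).eventually (lt_mem_nhds (by
        rw [hval]; rw [hcdef] at h0 ⊢; nlinarith))
    have ny : {φ | sg ε * dt η φ < -(c / 2)} ∈ 𝓝 y :=
      (hcont.tendsto y).eventually (gt_mem_nhds (by
        rw [hval]; rw [hcdef] at h0 ⊢; nlinarith))
    -- A path longer than `16 * ρ / c` changes `η` by more than `8 * ρ` on each orbit, in opposite
    -- directions, while at either end the values differ by at most `8 * ρ`.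
    obtain ⟨n, hn⟩ := exists_nat_gt ((C + 16 * ρ / c) / d)
    rw [div_lt_iff₀ hd] at hn
    have hρ := hc.one_le
    have hpos : 0 < 16 * ρ / c := by positivity
    obtain ⟨φ, f1, f2⟩ := mem_closure_iff_nhds.1 (hx n) _ nx
    obtain ⟨φ', f1', f2'⟩ := mem_closure_iff_nhds.1 (hy n) _ ny
    have f1 : c / 2 < sg ε * dt η φ := f1
    have f1' : sg ε * dt η φ' < -(c / 2) := f1'
    obtain ⟨t, Y, ht⟩ := hdr ε ω n φ f2
    obtain ⟨t', Y', ht'⟩ := hdr ε ω n φ' f2'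
    obtain ⟨a1, a2, a3, a4⟩ := ht n le_rfl
    obtain ⟨b1, b2, b3, b4⟩ := ht' n le_rfl
    obtain ⟨-, a6, a7, -⟩ := ht 0 (Nat.zero_le _)
    obtain ⟨-, b6, b7, -⟩ := ht' 0 (Nat.zero_le _)
    have g1 := abs_le_of_gsq_le (G := 2) (by norm_num) hgη
    have g2 := abs_le_of_gsq_le (G := 2) (ζ := tr 𝔇 ω n η) (by norm_num) (by rw [gsq_tr]; exact hgη)
    have v1 := (abs_le.1 (abs_ev_sub_le g1.1 g1.2 ⟨a6, a7⟩ ⟨b6, b7⟩)).1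
    have v2 := (abs_le.1 (abs_ev_sub_le g2.1 g2.2 ⟨a2, a3⟩ ⟨b2, b3⟩)).2
    rw [a4 η, b4 η] at v2
    have m1 : 16 * ρ / c * (c / 2) < t n * (sg ε * dt η φ) := by
      apply mul_lt_mul'' (by linarith) f1 hpos.le (by linarith)
    have m2 : 16 * ρ / c * (c / 2) < t' n * -(sg ε * dt η φ') := by
      apply mul_lt_mul'' (by linarith) (by linarith) hpos.le (by linarith)
    have m3 : 16 * ρ / c * (c / 2) = 8 * ρ := by field_simp; ring
    rw [m3] at m1 m2
    linarith

lemma R.width_le {ρ κ : ℝ} (hc : 𝔇.Const ρ κ) {ε : Bool} {ω : ℕ → P.BoundaryEdge} {x : Fn} {u : ℝ}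
    (hx : x ∈ R 𝔇 ε ω) (hy : x + (0, 0, u) ∈ R 𝔇 ε ω) : |u| ≤ 4 * ρ := by
  have h : ∀ φ : Fn, φ ∈ Metric.closedBall (0 : Fn) (2 * ρ) → |φ.2.2| ≤ 2 * ρ := by
    intro φ hφ
    rw [mem_closedBall_zero_iff] at hφ
    exact ((norm_snd_le φ.2).trans (norm_snd_le φ)).trans hφ
  have h1 := abs_le.1 (h _ (R.ball hc hx))
  have h2 := abs_le.1 (h _ (R.ball hc hy))
  simp only [Prod.snd_add] at h2
  exact abs_le.2 ⟨by linarith, by linarith⟩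

/-! ### Orbit closures -/

/-- `ω` lies in the orbit closure of `E` under the shift. -/
def InHull {α : Type*} (E ω : ℕ → α) : Prop := ∀ n, ∃ i, ∀ k < n, ω k = E (i + k)

lemma InHull.refl {α : Type*} (E : ℕ → α) : InHull E E := fun _ => ⟨0, fun k _ => by rw [zero_add]⟩

lemma InHull.trans {α : Type*} {E ω ω' : ℕ → α} (h : InHull E ω) (h' : InHull ω ω') :
    InHull E ω' := by
  intro n
  obtain ⟨i, hi⟩ := h' n
  obtain ⟨j, hj⟩ := h (i + n)
  exact ⟨j + i, fun k hk => by rw [hi k hk, hj (i + k) (by omega), add_assoc]⟩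

lemma exists_limit_seq {ι α : Type*} [Finite α] (U : Ultrafilter ι) (E : ℕ → α) (I : ι → ℕ) :
    ∃ ω, (∀ k, ∀ᶠ N in U, E (I N + k) = ω k) ∧ InHull E ω := by
  choose ω hω using fun k => Ultrafilter.exists_eventually_eq U fun N => E (I N + k)
  refine ⟨ω, hω, fun n => ?_⟩
  have h1 : ∀ᶠ i in U, ∀ k ∈ Finset.range n, E (I i + k) = ω k := by
    rw [Filter.eventually_all_finset]
    exact fun k _ => hω k
  obtain ⟨i, hi⟩ := h1.exists
  exact ⟨I i, fun k hk => (hi k (Finset.mem_range.2 hk)).symm⟩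

/-- Transport commutes with adding constants, so the limit of one line carries all parallel lines of
its strip along. -/
lemma R.exists_limit {ι : Type*} (U : Ultrafilter ι) {E ω : ℕ → P.BoundaryEdge} {I : ι → ℕ}
    (hω : ∀ k, ∀ᶠ N in U, E (I N + k) = ω k) {ε ε' : Bool} (hε : ∀ᶠ N in U, fl ε (I N) = ε')
    {x : Fn} (hx : x ∈ R 𝔇 ε E) :
    ∃ z, Tendsto (fun N => tr 𝔇 E (I N) x) U (𝓝 z) ∧ z ∈ R 𝔇 ε' ω ∧
      ∀ v : ℝ, x + (0, 0, v) ∈ R 𝔇 ε E → z + (0, 0, v) ∈ R 𝔇 ε' ω := by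
  obtain ⟨ρ, κ, hc⟩ := 𝔇.exists_const
  obtain ⟨z, hz⟩ := Ultrafilter.exists_tendsto U fun N => R.ball hc (R.shift hx (I N))
  refine ⟨z, hz, R.of_tendsto hz (hε.mono fun N hN => hN ▸ R.shift hx (I N)) hω, fun v hv => ?_⟩
  refine R.of_tendsto (hz.add_const (0, 0, v)) (hε.mono fun N hN => ?_) hω
  have := R.shift hv (I N)
  rw [tr_add, tr_const] at this
  exact hN ▸ this

/-! ### Pairs of parallel limit functionals -/

/-- Two strips of width `v` are shifted against each other by less than `v` and in a constant
direction over the polygon, so their border lines interlace as in `Stag.four`. -/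
lemma Stag.parallel (hS : Stag 𝔇) {ε : Bool} {a b c : P.BoundaryEdge} {x y : Fn} {v : ℝ}
    (h1 : x ∈ CCh 𝔇 ε a b) (h2 : x + (0, 0, v) ∈ CCh 𝔇 ε a b) (h3 : y ∈ CCh 𝔇 ε a c)
    (h4 : y + (0, 0, v) ∈ CCh 𝔇 ε a c)
    (hlt : ∀ t ∈ P.faces, ∀ p ∈ t, |ev (y - x) (𝔇.D t p)| < v)
    (hsign : (∀ t ∈ P.faces, ∀ p ∈ t, 0 < ev (y - x) (𝔇.D t p)) ∨
      (∀ t ∈ P.faces, ∀ p ∈ t, ev (y - x) (𝔇.D t p) < 0)) : b = c := by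
  simp only [ev_sub, abs_lt] at hlt hsign
  rcases hsign with h | h
  · refine hS.four h1 h2 h3 h4 (fun t ht p hp => ?_) (fun t ht p hp => ?_) fun t ht p hp => ?_
    · linarith [h t ht p hp]
    · rw [ev_add, ev_const]; linarith [hlt t ht p hp]
    · rw [ev_add, ev_add, ev_const]; linarith [h t ht p hp]
  · refine (hS.four h3 h4 h1 h2 (fun t ht p hp => ?_) (fun t ht p hp => ?_)
      fun t ht p hp => ?_).symm
    · linarith [h t ht p hp]
    · rw [ev_add, ev_const]; linarith [hlt t ht p hp]
    · rw [ev_add, ev_add, ev_const]; linarith [h t ht p hp]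

/-- If a strip is almost of maximal width, its returns are close to each other. -/
lemma R.exists_close {ε : Bool} {ω : ℕ → P.BoundaryEdge} {x : Fn} {v : ℝ} (hx : x ∈ R 𝔇 ε ω)
    (hx' : x + (0, 0, v) ∈ R 𝔇 ε ω)
    (hW : ∀ ω' ε' z u, InHull ω ω' → z ∈ R 𝔇 ε' ω' → z + (0, 0, u) ∈ R 𝔇 ε' ω' → u < 5 / 4 * v)
    {g : ℝ} (hg : 0 < g) : ∃ N, ∀ i j, fl ε i = fl ε j → (∀ k < N, ω (i + k) = ω (j + k)) →
      (∀ t ∈ P.faces, ∀ p ∈ t, |ev (tr 𝔇 ω j x - tr 𝔇 ω i x) (𝔇.D t p)| < v / 4) ∧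
      gsq (tr 𝔇 ω j x - tr 𝔇 ω i x) < g := by
  by_contra hcon
  push Not at hcon
  choose I J h1 h2 h3 using hcon
  set U : Ultrafilter ℕ := hyperfilter ℕ with hU
  obtain ⟨ω', hI, hH⟩ := exists_limit_seq U ω I
  have hJ : ∀ k, ∀ᶠ N in U, ω (J N + k) = ω' k := by
    intro k
    have : ∀ᶠ N in (U : Filter ℕ), k < N := Nat.hyperfilter_le_atTop (eventually_gt_atTop k)
    filter_upwards [hI k, this] with N a1 a2
    rw [← h2 N k a2, a1]
  obtain ⟨ε', hε⟩ := Ultrafilter.exists_eventually_eq U fun N => fl ε (I N)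
  have hε' : ∀ᶠ N in U, fl ε (J N) = ε' := hε.mono fun N hN => by rw [← h1, hN]
  obtain ⟨z, z1, z2, z3⟩ := R.exists_limit U hI hε hx
  obtain ⟨y, y1, y2, y3⟩ := R.exists_limit U hJ hε' hx
  -- Both limit strips have the code `ω'`, so the widths `s + v` and `-s + v` occur in the orbit
  -- closure. Both are below `5 / 4 * v`, hence `|s| < v / 4`; moreover the gradients agree in the
  -- limit.
  obtain ⟨s, rfl⟩ := R.parallel z2 y2
  have e1 : s + v < 5 / 4 * v := by
    refine hW ω' ε' z _ hH z2 ?_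
    have := y3 v hx'
    rwa [add_assoc, show ((0, 0, s) : Fn) + (0, 0, v) = (0, 0, s + v) by simp] at this
  have e2 : -s + v < 5 / 4 * v := by
    refine hW ω' ε' (z + (0, 0, s)) _ hH y2 ?_
    have := z3 v hx'
    rwa [add_assoc, show ((0, 0, s) : Fn) + (0, 0, -s + v) = (0, 0, v) by simp]
  have hD : Tendsto (fun N => tr 𝔇 ω (J N) x - tr 𝔇 ω (I N) x) U (𝓝 (0, 0, s)) := by
    have := y1.sub z1
    rwa [add_sub_cancel_left] at this
  have f1 : ∀ᶠ N in U, ∀ t ∈ P.faces, ∀ p ∈ t,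
      |ev (tr 𝔇 ω (J N) x - tr 𝔇 ω (I N) x) (𝔇.D t p)| < v / 4 := by
    rw [Filter.eventually_all_finset]
    intro t _
    rw [Filter.eventually_all_finset]
    intro p _
    refine (((continuous_ev (𝔇.D t p)).abs.tendsto _).comp hD).eventually (gt_mem_nhds ?_)
    rw [ev_const, abs_lt]
    constructor <;> linarith
  have f2 : ∀ᶠ N in U, gsq (tr 𝔇 ω (J N) x - tr 𝔇 ω (I N) x) < g :=
    ((continuous_gsq.tendsto _).comp hD).eventually (gt_mem_nhds (by simpa [gsq] using hg))
  obtain ⟨N, a1, a2⟩ := (f1.and f2).exists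
  exact absurd a2 (not_lt.2 (h3 N a1))

/-- The value at an end of the reflecting edge does not change, and a gradient of size `G` varies by
at most `4 * G * ρ` over the polygon. -/
lemma Dev.Const.eref_le {ρ κ : ℝ} (hc : 𝔇.Const ρ κ) (e : P.BoundaryEdge) {η : Fn} {G B : ℝ}
    (hG : 0 ≤ G) (hη : gsq η ≤ G ^ 2)
    (hB : ∀ t ∈ P.faces, ∀ p ∈ t, |ev η (𝔇.D t p)| ≤ B) {t : Finset V} (ht : t ∈ P.faces) {p : V}
    (hp : p ∈ t) : |ev (eref 𝔇 e η) (𝔇.D t p)| ≤ B + 4 * G * ρ := by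
  obtain ⟨s, u, w, hs, hu, hw, huw, -, h⟩ := eref_spec 𝔇 e
  have g := abs_le_of_gsq_le hG (show gsq (eref 𝔇 e η) ≤ G ^ 2 by rwa [gsq_eref])
  have h1 : ev (eref 𝔇 e η) (𝔇.D s u) = ev η (𝔇.D s u) := by rw [h, ev_pull, mirror_left]
  have h2 := abs_ev_sub_le g.1 g.2 (hc.bound t ht p hp) (hc.bound s hs u hu)
  have h3 := hB s hs u hu
  rw [h1] at h2
  rw [abs_le] at *
  constructor <;> linarith

lemma Dev.Const.tr_le {ρ κ : ℝ} (hc : 𝔇.Const ρ κ) (ω : ℕ → P.BoundaryEdge) {η : Fn} {G B : ℝ}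
    (hG : 0 ≤ G) (hη : gsq η ≤ G ^ 2)
    (hB : ∀ t ∈ P.faces, ∀ p ∈ t, |ev η (𝔇.D t p)| ≤ B) (m : ℕ) :
    ∀ t ∈ P.faces, ∀ p ∈ t, |ev (tr 𝔇 ω m η) (𝔇.D t p)| ≤ B + 4 * G * ρ * m := by
  induction m with
  | zero => intro t ht p hp; simpa [tr] using hB t ht p hp
  | succ m ih =>
    intro t ht p hp
    refine (hc.eref_le _ hG (by rwa [gsq_tr]) ih ht hp).trans ?_
    push_cast
    linarith

/-- For unit gradients at angle `θ` one has `G = 2 * sin (θ / 2)` up to sign, and the determinant is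
`sin θ` up to sign. -/
lemma dt_sub_unit {a b : Fn} {G : ℝ} (ha : gsq a = 1) (hb : gsq b = 1) (h : gsq (b - a) = G ^ 2)
    (h0 : 0 < G) (h1 : G ≤ 1) : G / 2 < |dt (b - a) a| := by
  have e : dt (b - a) a ^ 2 = G ^ 2 - (G ^ 2) ^ 2 / 4 := by
    rw [← h]
    unfold gsq at ha hb
    simp only [dt, gsq, Prod.fst_sub, Prod.snd_sub]
    set p := a.1; set q := a.2.1; set r := b.1; set s := b.2.1
    have e1 : (r - p) ^ 2 + (s - q) ^ 2 = 2 - 2 * (p * r + q * s) := by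
      linear_combination ha + hb
    rw [e1]
    linear_combination (r ^ 2 + s ^ 2) * ha + hb
  refine lt_of_pow_lt_pow_left₀ 2 (abs_nonneg _) ?_
  rw [sq_abs, e]
  have : G ^ 2 ≤ 1 := by nlinarith
  nlinarith [pow_pos h0 2]

/-- Growth of the difference of two functionals along a bounce sequence. -/
lemma R.exists_growth (𝔇 : Dev P) {ρ κ : ℝ} (hc : 𝔇.Const ρ κ) : ∃ d C : ℝ, 0 < d ∧
    ∀ (ε : Bool) (ω : ℕ → P.BoundaryEdge) (x y : Fn) (G : ℝ), x ∈ R 𝔇 ε ω → gsq y = 1 →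
    gsq (y - x) = G ^ 2 → 0 < G → G ≤ 1 →
    (∃ t ∈ P.faces, ∃ p ∈ t, ev (y - x) (𝔇.D t p) ≤ 0) →
    (∃ t ∈ P.faces, ∃ p ∈ t, 0 ≤ ev (y - x) (𝔇.D t p)) → ∀ m : ℕ, 0 ≤ d * m - C →
    (∀ t ∈ P.faces, ∀ p ∈ t, (d * m - C) * G < ev (tr 𝔇 ω m (y - x)) (𝔇.D t p)) ∨
    (∀ t ∈ P.faces, ∀ p ∈ t, ev (tr 𝔇 ω m (y - x)) (𝔇.D t p) < -((d * m - C) * G)) := by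
  obtain ⟨d, C, hd, hC, hdr⟩ := Cell.exists_drift 𝔇 hc
  have hρ := hc.one_le
  -- The factor one half comes from the rate, which is only known to exceed `G / 2`. The term `8 *
  -- ρ` pays for moving from bounce points to vertices at the start and at the end, at a cost of `4
  -- * G * ρ` each.
  refine ⟨d / 2, C / 2 + 8 * ρ, by linarith, fun ε ω x y G hx hy hG h0 h1 hle hge m hm => ?_⟩
  obtain ⟨t₁, ht₁, p₁, hp₁, q₁⟩ := hle
  obtain ⟨t₂, ht₂, p₂, hp₂, q₂⟩ := hge
  have g0 := abs_le_of_gsq_le h0.le hG.le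
  have g1 := abs_le_of_gsq_le (ζ := tr 𝔇 ω m (y - x)) h0.le (by rw [gsq_tr]; exact hG.le)
  have nx : {φ | G / 2 < |dt (y - x) φ|} ∈ 𝓝 x :=
    ((continuous_dt (y - x)).abs.tendsto x).eventually
      (lt_mem_nhds (dt_sub_unit (R.unit hx) hy hG h0 h1))
  obtain ⟨φ, f1, f2⟩ := mem_closure_iff_nhds.1 (hx m) _ nx
  have f1 : G / 2 < |dt (y - x) φ| := f1
  obtain ⟨t, Y, ht⟩ := hdr ε ω m φ f2
  obtain ⟨a1, a2, a3, a4⟩ := ht m le_rfl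
  obtain ⟨-, b2, b3, -⟩ := ht 0 (Nat.zero_le _)
  have k1 := (abs_le.1 (abs_ev_sub_le g0.1 g0.2 ⟨b2, b3⟩ (hc.bound t₁ ht₁ p₁ hp₁))).2
  have k2 := (abs_le.1 (abs_ev_sub_le g0.1 g0.2 ⟨b2, b3⟩ (hc.bound t₂ ht₂ p₂ hp₂))).1
  have k3 : ∀ s ∈ P.faces, ∀ p ∈ s, _ := fun s hs p hp =>
    abs_le.1 (abs_ev_sub_le g1.1 g1.2 (hc.bound s hs p hp) ⟨a2, a3⟩)
  have hmt : d * m - C ≤ t m := a1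
  have hm2 : 16 * ρ ≤ d * m - C := by linarith
  have hsg : |sg ε * dt (y - x) φ| = |dt (y - x) φ| := by
    rw [abs_mul]; cases ε <;> simp [sg]
  rw [← hsg] at f1
  have hGt : 0 < t m := by linarith
  rcases le_total 0 (sg ε * dt (y - x) φ) with hs | hs
  · left
    intro s hs' p hp
    rw [abs_of_nonneg hs] at f1
    have h5 := (k3 s hs' p hp).1
    rw [a4] at h5
    have h6 := mul_lt_mul_of_pos_left f1 hGt
    have h7 := mul_le_mul_of_nonneg_right hmt (show 0 ≤ G / 2 by linarith)
    nlinarith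
  · right
    intro s hs' p hp
    rw [abs_of_nonpos hs] at f1
    have h5 := (k3 s hs' p hp).2
    rw [a4] at h5
    have h6 := mul_lt_mul_of_pos_left f1 hGt
    have h7 := mul_le_mul_of_nonneg_right hmt (show 0 ≤ G / 2 by linarith)
    nlinarith

lemma tr_sub_shift {ω : ℕ → P.BoundaryEdge} {i j m : ℕ}
    (h : ∀ k, 0 < k → k ≤ m → ω (i + k) = ω (j + k)) (x : Fn) :
    tr 𝔇 ω (j + m) x - tr 𝔇 ω (i + m) x
      = tr 𝔇 (fun k => ω (i + k)) m (tr 𝔇 ω j x - tr 𝔇 ω i x) := by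
  rw [tr_sub, tr_shift, tr_shift]
  congr 1
  exact tr_congr (fun k h1 h2 => (h k h1 h2).symm) _

/-- The limit functional of an almost maximal strip is the same at left special positions with
the same long future. -/
theorem R.exists_special (hS : Stag 𝔇) {ε : Bool} {ω : ℕ → P.BoundaryEdge} {x : Fn} {v : ℝ}
    (hv : 0 < v) (hx : x ∈ R 𝔇 ε ω) (hx' : x + (0, 0, v) ∈ R 𝔇 ε ω)
    (hW : ∀ ω' ε' z u, InHull ω ω' → z ∈ R 𝔇 ε' ω' → z + (0, 0, u) ∈ R 𝔇 ε' ω' →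
      u < 5 / 4 * v) :
    ∃ N, ∀ i j, fl ε i = fl ε j → (∀ k < N, ω (i + 1 + k) = ω (j + 1 + k)) → ω i ≠ ω j →
      tr 𝔇 ω i x = tr 𝔇 ω j x := by
  obtain ⟨ρ, κ, hc⟩ := 𝔇.exists_const
  have hρ := hc.one_le
  obtain ⟨d, C, hd, hgr⟩ := R.exists_growth 𝔇 hc
  obtain ⟨A, hA⟩ := R.exists_close hx hx' hW one_pos
  -- With a gradient below `g`, a total of `A + 1` reflections alter the bound for the values by
  -- less than `v / 4`.
  set g : ℝ := min 1 (v / (16 * ρ * (A + 1))) with hg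
  have hg0 : 0 < g := by positivity
  obtain ⟨B, hB⟩ := R.exists_close hx hx' hW (pow_pos hg0 2)
  obtain ⟨M, hM⟩ := exists_nat_gt (C / d)
  rw [div_lt_iff₀ hd] at hM
  have hfl : ∀ {i j}, fl ε i = fl ε j → ∀ m, fl ε (i + m) = fl ε (j + m) := fun h m => by
    rw [fl_add, fl_add, h]
  have hxs : ∀ m, tr 𝔇 ω m x ∈ CCh 𝔇 (fl ε m) (ω m) (ω (m + 1)) := R.cch_shift hx
  have hxs' : ∀ m, tr 𝔇 ω m x + (0, 0, v) ∈ CCh 𝔇 (fl ε m) (ω m) (ω (m + 1)) := fun m => by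
    have := R.cch_shift hx' m
    rwa [tr_add, tr_const] at this
  refine ⟨A + B + M + 1, fun i j hij hag hne => ?_⟩
  have hag1 : ω (i + 1) = ω (j + 1) := hag 0 (by omega)
  set D : ℕ → Fn := fun m => tr 𝔇 ω (j + m) x - tr 𝔇 ω (i + m) x with hD
  obtain ⟨c1, -⟩ := hA (i + 1) (j + 1) (hfl hij 1) fun k hk => hag k (by omega)
  obtain ⟨-, c2⟩ := hB (i + 1) (j + 1) (hfl hij 1) fun k hk => hag k (by omega)
  have hD10 : D 1 = eref 𝔇 (ω (i + 1)) (D 0) :=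
    tr_sub_shift (m := 1) (fun k h1 h2 => by rw [show k = 1 by omega]; exact hag1) x
  have hD01 : D 0 = eref 𝔇 (ω (i + 1)) (D 1) := by rw [hD10, eref_eref]
  set G := Real.sqrt (gsq (D 0)) with hG
  have hG2 : gsq (D 0) = G ^ 2 := (Real.sq_sqrt (by unfold gsq; positivity)).symm
  have hG0 : 0 ≤ G := Real.sqrt_nonneg _
  have hGg : G < g := by
    refine lt_of_pow_lt_pow_left₀ 2 hg0.le ?_
    rw [← hG2, hD01, gsq_eref]
    exact c2
  have hGA : 4 * G * ρ * (A + 1) < v / 4 := by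
    have h1 : G < v / (16 * ρ * (A + 1)) := hGg.trans_le (min_le_right _ _)
    rw [lt_div_iff₀ (by positivity)] at h1
    linarith
  have hA0 : (0 : ℝ) ≤ A := Nat.cast_nonneg _
  have hGρ : 0 ≤ 4 * G * ρ := by positivity
  have hGA' : 4 * G * ρ ≤ 4 * G * ρ * (A + 1) := by nlinarith
  have hlt0 : ∀ t ∈ P.faces, ∀ p ∈ t, |ev (D 0) (𝔇.D t p)| < v := by
    intro t ht p hp
    have := hc.eref_le (ω (i + 1)) (η := D 1) (B := v / 4) hG0
      (by rw [hD10, gsq_eref, hG2]) (fun t ht p hp => (c1 t ht p hp).le) ht hp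
    rw [← hD01] at this
    linarith
  have hrev : ∀ {m}, fl ε m = fl ε i → ω (m + 1) = ω (i + 1) →
      tr 𝔇 ω m x ∈ CCh 𝔇 (!(fl ε i)) (ω (i + 1)) (ω m) ∧
      tr 𝔇 ω m x + (0, 0, v) ∈ CCh 𝔇 (!(fl ε i)) (ω (i + 1)) (ω m) := by
    intro m h1 h2
    rw [← h1, ← h2]
    exact ⟨CCh.reverse (hxs m), CCh.reverse (hxs' m)⟩
  -- If the difference had constant sign, the strips run backward from the common edge `ω (i + 1)`
  -- would interlace, and the letters `ω i` and `ω j` would agree.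
  have hno : ¬ ((∀ t ∈ P.faces, ∀ p ∈ t, 0 < ev (D 0) (𝔇.D t p)) ∨
      (∀ t ∈ P.faces, ∀ p ∈ t, ev (D 0) (𝔇.D t p) < 0)) := fun h =>
    hne (hS.parallel (hrev rfl rfl).1 (hrev rfl rfl).2 (hrev hij.symm hag1.symm).1
      (hrev hij.symm hag1.symm).2 hlt0 h)
  push Not at hno
  obtain ⟨⟨t₁, ht₁, p₁, hp₁, q₁⟩, t₂, ht₂, p₂, hp₂, q₂⟩ := hno
  -- A difference without gradient is constant, and as it takes values of both weak signs it is
  -- zero. Otherwise it grows linearly, which is impossible.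
  rcases hG0.eq_or_lt with h0 | h0
  · have g0 := abs_le_of_gsq_le hG0 hG2.le
    rw [← h0] at g0
    have z1 := abs_nonpos_iff.1 g0.1
    have z2 := abs_nonpos_iff.1 g0.2
    simp only [ev, z1, z2] at q₁ q₂
    have z3 : D 0 = 0 := Prod.ext z1 (Prod.ext z2 (by simp at q₁ q₂ ⊢; linarith))
    exact (sub_eq_zero.1 z3).symm
  exfalso
  have hgrow := hgr (fl ε i) (fun k => ω (i + k)) (tr 𝔇 ω i x) (tr 𝔇 ω j x) G (R.shift hx i)
    (by rw [gsq_tr]; exact R.unit hx) hG2 h0 (hGg.le.trans (min_le_left _ _))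
    ⟨t₁, ht₁, p₁, hp₁, q₁⟩ ⟨t₂, ht₂, p₂, hp₂, q₂⟩
  -- While the letters agree, the difference stays below `v`: it is below `v / 4` at a position `A`
  -- letters earlier, where `A` common letters are still ahead, and `A` reflections add little. By
  -- growth it has a constant sign by then.
  have hstep : ∀ L, M ≤ L → A + 1 ≤ L → (∀ k < L, ω (i + 1 + k) = ω (j + 1 + k)) →
      (∀ t ∈ P.faces, ∀ p ∈ t, |ev (D L) (𝔇.D t p)| < v) ∧
      ((∀ t ∈ P.faces, ∀ p ∈ t, (d * L - C) * G < ev (D L) (𝔇.D t p)) ∨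
      (∀ t ∈ P.faces, ∀ p ∈ t, ev (D L) (𝔇.D t p) < -((d * L - C) * G))) := by
    intro L hL hL' hk
    have hk' : ∀ k, 0 < k → k ≤ L → ω (i + k) = ω (j + k) := fun k k1 k2 => by
      have := hk (k - 1) (by omega)
      rwa [show i + 1 + (k - 1) = i + k by omega, show j + 1 + (k - 1) = j + k by omega] at this
    refine ⟨fun t ht p hp => ?_, ?_⟩
    · obtain ⟨m, rfl⟩ := Nat.exists_eq_add_of_le' (show A ≤ L by omega)
      obtain ⟨b1, -⟩ := hA (i + m) (j + m) (hfl hij m) fun k hk => by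
        rw [add_assoc, add_assoc]; exact hk' _ (by omega) (by omega)
      have e : D (m + A) = tr 𝔇 (fun k => ω (i + m + k)) A (D m) := by
        rw [hD]
        simp only [← add_assoc]
        refine tr_sub_shift (fun k k1 k2 => ?_) x
        rw [add_assoc, add_assoc]; exact hk' _ (by omega) (by omega)
      have e2 : D m = tr 𝔇 (fun k => ω (i + k)) m (D 0) :=
        tr_sub_shift (fun k k1 k2 => hk' k k1 (by omega)) x
      have := hc.tr_le (fun k => ω (i + m + k)) (η := D m) (B := v / 4) hG0
        (by rw [e2, gsq_tr, hG2]) (fun t ht p hp => (b1 t ht p hp).le) A t ht p hp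
      rw [← e] at this
      nlinarith
    · have hML : (M : ℝ) ≤ L := by exact_mod_cast hL
      have := hgrow L (by nlinarith)
      rw [← tr_sub_shift hk'] at this
      exact this
  -- The interlaced strips force one more common letter each time, so the difference would stay
  -- below `v` for ever.
  have hall : ∀ n, ∀ k < A + B + M + 1 + n, ω (i + 1 + k) = ω (j + 1 + k) := by
    intro n
    induction n with
    | zero => exact hag
    | succ n ih =>
      intro k hk
      rcases (show k < A + B + M + 1 + n ∨ k = A + B + M + 1 + n by omega) with h | rfl
      · exact ih k h
      set L := A + B + M + 1 + n with hL
      obtain ⟨b1, b2⟩ := hstep L (by omega) (by omega) ih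
      have hML : (M : ℝ) ≤ L := by exact_mod_cast (show M ≤ L by omega)
      have hpos : 0 < (d * L - C) * G := mul_pos (by nlinarith) h0
      have e1 : ω (i + L) = ω (j + L) := by
        have := ih (L - 1) (by omega)
        rwa [show i + 1 + (L - 1) = i + L by omega, show j + 1 + (L - 1) = j + L by omega] at this
      have k1 := hxs (j + L)
      have k2 := hxs' (j + L)
      rw [← e1, ← hfl hij L] at k1 k2
      have := hS.parallel (hxs (i + L)) (hxs' (i + L)) k1 k2 b1
        (b2.imp (fun h t ht p hp => hpos.trans (h t ht p hp))
          (fun h t ht p hp => (h t ht p hp).trans (by linarith)))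
      rwa [add_right_comm i, add_right_comm j] at this
  obtain ⟨L, hL⟩ := exists_nat_gt ((v / G + C) / d)
  rw [div_lt_iff₀ hd] at hL
  obtain ⟨b1, b2⟩ := hstep (max L (A + B + M + 1)) (by omega) (by omega)
    fun k hk => hall (max L (A + B + M + 1)) k (by omega)
  have hLm : (L : ℝ) ≤ (max L (A + B + M + 1) : ℕ) := by exact_mod_cast le_max_left _ _
  have hlow : v < (d * (max L (A + B + M + 1) : ℕ) - C) * G := by
    rw [← div_lt_iff₀ h0]
    nlinarith
  have b3 := abs_lt.1 (b1 t₁ ht₁ p₁ hp₁)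
  rcases b2 with b2 | b2
  · linarith [b2 t₁ ht₁ p₁ hp₁]
  · linarith [b2 t₁ ht₁ p₁ hp₁]

/-! ### Uniqueness of prefixes of aperiodic realizable sequences -/

@[simp] lemma Fn.add_const_zero (φ : Fn) : φ + (0, 0, 0) = φ := add_zero φ

lemma fl_add_even {ε : Bool} {q : ℕ} (hq : Even q) (i : ℕ) : fl ε (i + q) = fl ε i := by
  rw [fl_add, fl_even _ hq]

/-- A sequence without left special words of a certain length is periodic. -/
lemma exists_even_period {α : Type*} [Finite α] {ω : ℕ → α} {ε : Bool} {N : ℕ}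
    (h : ∀ i j, fl ε i = fl ε j → (∀ k < N, ω (i + 1 + k) = ω (j + 1 + k)) → ω i = ω j) :
    ∃ q, 0 < q ∧ Even q ∧ ∀ k, ω (k + q) = ω k := by
  set U : Ultrafilter ℕ := hyperfilter ℕ
  -- `W d` is the window of `N` letters after position `2 * (l + d)` for almost all `l`. The
  -- pigeonhole principle in `d` fixes the period before `l` is taken as large as needed.
  choose W hW using fun d : ℕ => Ultrafilter.exists_eventually_eq U
    fun l => fun k : Fin N => ω (2 * (l + d) + 1 + k)
  obtain ⟨a, b, hlt, hab⟩ : ∃ a b, a < b ∧ W a = W b := by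
    obtain ⟨a, b, hne, hab⟩ := Finite.exists_ne_map_eq_of_infinite W
    rcases hne.lt_or_gt with h | h
    · exact ⟨a, b, h, hab⟩
    · exact ⟨b, a, h, hab.symm⟩
  have hq : Even (2 * (b - a)) := even_two_mul _
  refine ⟨2 * (b - a), by omega, hq, fun k => ?_⟩
  have hl : ∀ᶠ l in (U : Filter ℕ), k < l := Nat.hyperfilter_le_atTop (eventually_gt_atTop k)
  obtain ⟨l, ⟨l1, l2⟩, l3⟩ := (((hW a).and (hW b)).and hl).exists
  set i := 2 * (l + a) with hi
  -- Equal windows determine equal preceding letters, so the agreement spreads to the left down to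
  -- the beginning.
  have key : ∀ m ≤ i, ∀ k < N, ω (i - m + 2 * (b - a) + 1 + k) = ω (i - m + 1 + k) := by
    intro m
    induction m with
    | zero =>
      intro _ k hk
      have := congrFun (l1.trans (hab.trans l2.symm)) ⟨k, hk⟩
      simp only at this
      rw [Nat.sub_zero, this]
      congr 2
      omega
    | succ m ih =>
      intro hm k hk
      have h1 := ih (by omega)
      rcases k with _ | k
      · have := h _ _ (fl_add_even hq (i - m)) h1
        rwa [show i - m = i - (m + 1) + 1 by omega, add_right_comm] at this
      · have := h1 k (by omega)
        convert this using 2 <;> omega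
  have := h _ _ (fl_add_even hq (i - (i - k))) (key (i - k) (by omega))
  rwa [show i - (i - k) = k by omega] at this

/-! ### Periodic sequences in the orbit closure -/

lemma dt_tr (ω : ℕ → P.BoundaryEdge) (m : ℕ) (η φ : Fn) :
    dt (tr 𝔇 ω m η) (tr 𝔇 ω m φ) = (-1) ^ m * dt η φ := by
  induction m with
  | zero => simp [tr]
  | succ m ih => rw [tr, tr, dt_eref, ih, pow_succ]; ring

lemma exists_sub_of_gradient {x y : Fn} (h1 : y.1 = x.1) (h2 : y.2.1 = x.2.1) :
    ∃ s : ℝ, y = x + (0, 0, s) :=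
  ⟨y.2.2 - x.2.2, Prod.ext (by simp [h1]) (Prod.ext (by simp [h2]) (by simp))⟩

/-- Along an even period the unfolding is a translation. -/
lemma R.tr_period {ε : Bool} {ω : ℕ → P.BoundaryEdge} {q : ℕ} (hq : Even q)
    (hω : ∀ k, ω (k + q) = ω k) {z : Fn} (hz : z ∈ R 𝔇 ε ω) :
    tr 𝔇 ω q z = z ∧ ∀ η : Fn, ∃ s : ℝ, tr 𝔇 ω q η = η + (0, 0, s) := by
  have hshift : (fun k => ω (q + k)) = ω := funext fun k => by rw [add_comm, hω]
  have h1 : ∀ {y}, y ∈ R 𝔇 ε ω → tr 𝔇 ω q y ∈ R 𝔇 ε ω := fun {y} hy => by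
    have := R.shift hy q
    rwa [hshift, fl_even _ hq] at this
  obtain ⟨s, hs⟩ := R.parallel hz (h1 hz)
  -- Repeating the period repeats the shift `s`. As all these lines have the code `ω`, the bounded
  -- width forces `s = 0`.
  have hn : ∀ n : ℕ, z + (0, 0, n * s) ∈ R 𝔇 ε ω := by
    intro n
    induction n with
    | zero => simpa using hz
    | succ n ih =>
      have := h1 ih
      rw [tr_add, tr_const, hs, add_assoc] at this
      rw [show ((0, 0, s) : Fn) + (0, 0, n * s) = (0, 0, s + n * s) by simp] at this
      rwa [Nat.cast_succ, add_mul, one_mul, add_comm (n * s)]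
  obtain ⟨ρ, κ, hc⟩ := 𝔇.exists_const
  have hs0 : s = 0 := by
    by_contra hne
    obtain ⟨n, hn'⟩ := exists_nat_gt (4 * ρ / |s|)
    rw [div_lt_iff₀ (abs_pos.2 hne)] at hn'
    have := R.width_le hc hz (hn n)
    rw [abs_mul, Nat.abs_cast] at this
    linarith
  rw [hs0, show ((0, 0, 0) : Fn) = 0 from rfl, add_zero] at hs
  refine ⟨hs, fun η => ?_⟩
  -- An even number of reflections acts on gradients as a rotation, and it fixes the gradient of
  -- `z`. Hence it acts trivially on gradients.
  have hu := R.unit hz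
  have e1 := dt_tr (𝔇 := 𝔇) ω q η z
  rw [hq.neg_one_pow, one_mul, hs] at e1
  have e2 := gsq_tr (𝔇 := 𝔇) ω q (η + z)
  have e3 := gsq_tr (𝔇 := 𝔇) ω q η
  rw [tr_add, hs] at e2
  set y := tr 𝔇 ω q η
  simp only [gsq, dt, Prod.fst_add, Prod.snd_add] at hu e1 e2 e3
  have e4 : (y.1 - η.1) * z.1 + (y.2.1 - η.2.1) * z.2.1 = 0 := by linarith
  refine exists_sub_of_gradient ?_ ?_
  · linear_combination z.1 * e4 + z.2.1 * e1 - (y.1 - η.1) * hu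
  · linear_combination z.2.1 * e4 - z.1 * e1 - (y.2.1 - η.2.1) * hu

lemma InHull.exists_index {α : Type*} {E ω : ℕ → α} (h : InHull E ω) : ∃ I : ℕ → ℕ,
    ∀ k, ∀ᶠ N in (hyperfilter ℕ : Filter ℕ), E (I N + k) = ω k := by
  choose I hI using h
  refine ⟨I, fun k => ?_⟩
  filter_upwards [Nat.hyperfilter_le_atTop (eventually_gt_atTop k)] with N hN
  exact (hI N k hN).symm

/-- Two parallel limit functionals force a periodic sequence in the orbit closure. -/
lemma exists_periodic_in_hull (hS : Stag 𝔇) {ε : Bool} {F : ℕ → P.BoundaryEdge} {T : Fn} {w : ℝ}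
    (hw : w ≠ 0) (hT : T ∈ R 𝔇 ε F) (hL : T + (0, 0, w) ∈ R 𝔇 ε F)
    (hdet : ∀ i j, tr 𝔇 F i T = tr 𝔇 F j T → F (i + 1) = F (j + 1) → F i = F j) :
    ∃ ω q, InHull F ω ∧ 0 < q ∧ Even q ∧ ∀ k, ω (k + q) = ω k := by
  obtain ⟨ρ, κ, hc⟩ := 𝔇.exists_const
  set W : Set ℝ := {u | ∃ ω ε' z, InHull F ω ∧ z ∈ R 𝔇 ε' ω ∧ z + (0, 0, u) ∈ R 𝔇 ε' ω} with hW
  have hbd : BddAbove W := ⟨4 * ρ, by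
    rintro u ⟨ω, ε', z, -, h1, h2⟩
    exact (le_abs_self u).trans (R.width_le hc h1 h2)⟩
  obtain ⟨x, hx, hx', hxT⟩ : ∃ x, x ∈ R 𝔇 ε F ∧ x + (0, 0, |w|) ∈ R 𝔇 ε F ∧
      ∀ i j, tr 𝔇 F i x = tr 𝔇 F j x → tr 𝔇 F i T = tr 𝔇 F j T := by
    rcases hw.lt_or_gt with h | h
    · refine ⟨_, hL, ?_, fun i j h => ?_⟩
      · rw [abs_of_neg h, add_assoc]
        simpa using hT
      · rwa [tr_add, tr_add, tr_const, tr_const, add_left_inj] at h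
    · exact ⟨T, hT, by rwa [abs_of_pos h], fun _ _ h => h⟩
  have hwW : |w| ∈ W := ⟨F, ε, x, InHull.refl F, hx, hx'⟩
  have hw0 : 0 < |w| := abs_pos.2 hw
  have hle : |w| ≤ sSup W := le_csSup hbd hwW
  -- Either the given strip is almost of maximal width, or a properly wider one exists in the orbit
  -- closure.
  rcases lt_or_ge (sSup W) (5 / 4 * |w|) with hcase | hcase
  · obtain ⟨N, hN⟩ := R.exists_special hS hw0 hx hx' fun ω' ε' z u h1 h2 h3 =>
      (le_csSup hbd ⟨ω', ε', z, h1, h2, h3⟩).trans_lt hcase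
    obtain ⟨q, q1, q2, q3⟩ := exists_even_period (ω := F) (ε := ε) (N := N + 1)
      fun i j h1 h2 => by
        by_contra hne
        exact hne (hdet i j (hxT i j (hN i j h1 (fun k hk => h2 k (by omega)) hne))
          (h2 0 (by omega)))
    exact ⟨F, q, InHull.refl F, q1, q2, q3⟩
  -- The factor `4 / 5` makes the strip of width `u` almost maximal in the sense of
  -- `R.exists_special`. The limit of `T` along the same indices adds a pair of lines at distance
  -- `|w| < u` with the same code.
  · obtain ⟨u, ⟨ω, ε', z', hH, hz', hzu'⟩, hu⟩ := exists_lt_of_lt_csSup ⟨_, hwW⟩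
      (show 4 / 5 * sSup W < sSup W by linarith)
    have hwu : |w| < u := by linarith
    obtain ⟨I, hI⟩ := hH.exists_index
    obtain ⟨ε'', hε⟩ := Ultrafilter.exists_eventually_eq (hyperfilter ℕ) fun N => fl ε (I N)
    obtain ⟨y, -, hy, hy'⟩ := R.exists_limit (hyperfilter ℕ) hI hε hT
    obtain ⟨z, hz, hzu⟩ : ∃ z, z ∈ R 𝔇 ε'' ω ∧ z + (0, 0, u) ∈ R 𝔇 ε'' ω := by
      by_cases he : ε'' = ε'
      · exact ⟨z', he ▸ hz', he ▸ hzu'⟩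
      · have : ε'' = !ε' := by revert he; cases ε'' <;> cases ε' <;> simp
        subst this
        refine ⟨_, R.neg hzu', ?_⟩
        convert R.neg hz' using 1
        rw [neg_add, add_assoc]
        simp
    obtain ⟨s, rfl⟩ := R.parallel hz hy
    -- A pair at distance `u` and a pair at a smaller distance contain three different lines, the
    -- outer two at least `u` apart. Run backward from a left special position, three common lines
    -- would violate `Stag.three`.
    have hQ : ∃ a b c, a < b ∧ b < c ∧ u ≤ c - a ∧ z + (0, 0, a) ∈ R 𝔇 ε'' ω ∧
        z + (0, 0, b) ∈ R 𝔇 ε'' ω ∧ z + (0, 0, c) ∈ R 𝔇 ε'' ω := by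
      have Q0 : z + (0, 0, 0) ∈ R 𝔇 ε'' ω := by simpa using hz
      obtain ⟨p, p', hp, hpu, Qp, Qp'⟩ : ∃ p p', p < p' ∧ p' - p < u ∧
          z + (0, 0, p) ∈ R 𝔇 ε'' ω ∧ z + (0, 0, p') ∈ R 𝔇 ε'' ω := by
        have Qw : z + (0, 0, s + w) ∈ R 𝔇 ε'' ω := by
          have := hy' w hL
          rw [add_assoc] at this
          simpa using this
        rcases hw.lt_or_gt with h | h
        · rw [abs_of_neg h] at hwu
          exact ⟨s + w, s, by linarith, by linarith, Qw, hy⟩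
        · rw [abs_of_pos h] at hwu
          exact ⟨s, s + w, by linarith, by linarith, hy, Qw⟩
      rcases lt_or_ge p 0 with c1 | c1
      · exact ⟨p, 0, u, c1, by linarith, by linarith, Qp, Q0, hzu⟩
      rcases lt_or_ge u p' with c2 | c2
      · exact ⟨0, u, p', by linarith, c2, by linarith, Q0, hzu, Qp'⟩
      rcases c1.lt_or_eq with c1 | c1
      · exact ⟨0, p, u, c1, by linarith, by linarith, Q0, Qp, hzu⟩
      · exact ⟨0, p', u, by linarith, by linarith, by linarith, Q0, Qp', hzu⟩
    obtain ⟨a, b, c, hab, hbc, huc, Qa, Qb, Qc⟩ := hQ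
    obtain ⟨N, hN⟩ := R.exists_special hS (v := c - a) (by linarith) Qa
      (by rw [add_assoc]; simpa using Qc) fun ω' ε₁ y u' h1 h2 h3 => by
        have := le_csSup hbd (show u' ∈ W from ⟨ω', ε₁, y, hH.trans h1, h2, h3⟩)
        linarith
    obtain ⟨q, q1, q2, q3⟩ := exists_even_period (ω := ω) (ε := ε'') (N := N + 1)
      fun i j h1 h2 => by
        by_contra hne
        have e1 := hN i j h1 (fun k hk => h2 k (by omega)) hne
        have e2 : ω (i + 1) = ω (j + 1) := h2 0 (by omega)
        have e3 : tr 𝔇 ω i z = tr 𝔇 ω j z := by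
          rwa [tr_add, tr_add, tr_const, tr_const, add_left_inj] at e1
        have k1 : ∀ {r : ℝ}, z + (0, 0, r) ∈ R 𝔇 ε'' ω → tr 𝔇 ω i z + (0, 0, r) ∈
            CCh 𝔇 (!(fl ε'' i)) (ω (i + 1)) (ω i) := fun {r} hr => by
          have := CCh.reverse (R.cch_shift hr i)
          rwa [tr_add, tr_const] at this
        have k2 : ∀ {r : ℝ}, z + (0, 0, r) ∈ R 𝔇 ε'' ω → tr 𝔇 ω i z + (0, 0, r) ∈
            CCh 𝔇 (!(fl ε'' i)) (ω (i + 1)) (ω j) := fun {r} hr => by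
          have := CCh.reverse (R.cch_shift hr j)
          rwa [tr_add, tr_const, ← e3, ← e2, ← h1] at this
        exact hne (hS.three (k1 Qa) (k1 Qb) (k1 Qc) (k2 Qa) (k2 Qb) (k2 Qc)
          (fun t _ p _ => by rw [ev_add, ev_add, ev_const, ev_const]; linarith)
          (fun t _ p _ => by rw [ev_add, ev_add, ev_const, ev_const]; linarith))
    exact ⟨ω, q, hH, q1, q2, q3⟩

/-- Where `F` follows `ω` for one period, the line returns shifted by a constant `S` with `|S| <
|w|`. The strip and its shifted copy interlace, so the next letter repeats as well, with the same
shift, and this goes on for ever. After `n` periods the shift is `n * S`, which is bounded, so `S =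
0`. -/
lemma eventually_periodic (hS : Stag 𝔇) {ε : Bool} {F : ℕ → P.BoundaryEdge} {T : Fn} {w : ℝ}
    (hw : w ≠ 0) (hT : T ∈ R 𝔇 ε F) (hL : T + (0, 0, w) ∈ R 𝔇 ε F)
    (hch : ∀ i, Ch 𝔇 (fl ε i) (tr 𝔇 F i T) (F i) (F (i + 1))) {ω : ℕ → P.BoundaryEdge} {q : ℕ}
    (hH : InHull F ω) (hq0 : 0 < q) (hq : Even q) (hω : ∀ k, ω (k + q) = ω k) :
    ∃ i, tr 𝔇 F (i + q) T = tr 𝔇 F i T ∧ ∀ k, F (i + k + q) = F (i + k) := by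
  obtain ⟨ρ, κ, hc⟩ := 𝔇.exists_const
  have hw0 : 0 < |w| := abs_pos.2 hw
  obtain ⟨I, hI⟩ := hH.exists_index
  obtain ⟨ε', hε⟩ := Ultrafilter.exists_eventually_eq (hyperfilter ℕ) fun N => fl ε (I N)
  obtain ⟨z, hz, hzR, -⟩ := R.exists_limit (hyperfilter ℕ) hI hε hT
  obtain ⟨hz0, htr⟩ := R.tr_period hq hω hzR
  have h1 : ∀ᶠ N in (hyperfilter ℕ : Filter ℕ), ∀ k ∈ Finset.range (q + 1), F (I N + k) = ω k := by
    rw [Filter.eventually_all_finset]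
    exact fun k _ => hI k
  have h2 : ∀ᶠ N in (hyperfilter ℕ : Filter ℕ),
      |(tr 𝔇 ω q (tr 𝔇 F (I N) T) - tr 𝔇 F (I N) T).2.2| < |w| := by
    have hcont : Continuous fun φ : Fn => |(tr 𝔇 ω q φ - φ).2.2| :=
      (continuous_snd.comp (continuous_snd.comp ((continuous_tr ω q).sub continuous_id))).abs
    refine ((hcont.tendsto z).comp hz).eventually (gt_mem_nhds ?_)
    rw [hz0, sub_self]
    simpa using hw
  obtain ⟨N, a1, a2⟩ := (h1.and h2).exists
  set i := I N
  obtain ⟨S, hSd⟩ := htr (tr 𝔇 F i T)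
  rw [hSd, add_sub_cancel_left] at a2
  have a2 : |S| < |w| := a2
  have hiq : tr 𝔇 F (i + q) T = tr 𝔇 F i T + (0, 0, S) := by
    rw [tr_shift, ← hSd]
    exact tr_congr (fun k _ hk => a1 k (Finset.mem_range.2 (by omega))) _
  have hFq : F (i + q) = F i := by
    have e1 := a1 q (Finset.mem_range.2 (by omega))
    have e2 := a1 0 (Finset.mem_range.2 (by omega))
    have e3 := hω 0
    rw [zero_add] at e3
    rw [e1, e3, ← e2, add_zero]
  have hnext : ∀ j, F (j + q) = F j → tr 𝔇 F (j + q) T = tr 𝔇 F j T + (0, 0, S) →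
      F (j + 1 + q) = F (j + 1) := by
    intro j e1 e2
    by_cases hS0 : S = 0
    · have c1 := hch (j + q)
      rw [e1, e2, hS0, show ((0, 0, 0) : Fn) = 0 from rfl, add_zero] at c1
      rw [add_right_comm]
      exact (hch j).unique c1
    · have k0 := R.cch_shift hT j
      have k1 := R.cch_shift hL j
      have k2 := R.cch_shift hT (j + q)
      have k3 := R.cch_shift hL (j + q)
      rw [tr_add, tr_const] at k1 k3
      rw [fl_add_even hq, e1, e2] at k2 k3
      rw [add_right_comm]
      have hsign : ∀ {x y : Fn}, y - x = (0, 0, S) →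
          ((∀ t ∈ P.faces, ∀ p ∈ t, |ev (y - x) (𝔇.D t p)| < |w|) ∧
          ((∀ t ∈ P.faces, ∀ p ∈ t, 0 < ev (y - x) (𝔇.D t p)) ∨
            (∀ t ∈ P.faces, ∀ p ∈ t, ev (y - x) (𝔇.D t p) < 0))) := by
        intro x y hxy
        simp only [hxy, ev_const]
        refine ⟨fun _ _ _ _ => a2, ?_⟩
        rcases lt_or_gt_of_ne hS0 with h | h
        · exact Or.inr fun _ _ _ _ => h
        · exact Or.inl fun _ _ _ _ => h
      rcases hw.lt_or_gt with h | h
      · have hb := hsign (x := tr 𝔇 F j T + (0, 0, w))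
          (y := tr 𝔇 F j T + (0, 0, S) + (0, 0, w)) (by abel)
        refine (hS.parallel (v := |w|) k1 ?_ k3 ?_ hb.1 hb.2).symm
        · rw [abs_of_neg h, add_assoc]
          simpa using k0
        · rw [abs_of_neg h, add_assoc (tr 𝔇 F j T + (0, 0, S))]
          simpa using k2
      · have hb := hsign (x := tr 𝔇 F j T) (y := tr 𝔇 F j T + (0, 0, S)) (by abel)
        rw [← abs_of_pos h] at k1 k3
        exact (hS.parallel k0 k1 k2 k3 hb.1 hb.2).symm
  have hall : ∀ k, F (i + k + q) = F (i + k) ∧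
      tr 𝔇 F (i + k + q) T = tr 𝔇 F (i + k) T + (0, 0, S) := by
    intro k
    induction k with
    | zero => exact ⟨hFq, hiq⟩
    | succ k ih =>
      have e := hnext _ ih.1 ih.2
      rw [← add_assoc]
      refine ⟨e, ?_⟩
      rw [show i + k + 1 + q = i + k + q + 1 by omega] at e ⊢
      rw [tr, tr, ih.2, eref_add, eref_const, e]
  refine ⟨i, ?_, fun k => (hall k).1⟩
  have hn : ∀ n : ℕ, tr 𝔇 F (i + q * n) T = tr 𝔇 F i T + (0, 0, n * S) := by
    intro n
    induction n with
    | zero => simp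
    | succ n ih =>
      rw [show i + q * (n + 1) = i + q * n + q by ring, (hall _).2, ih, add_assoc]
      congr 1
      simp
      ring
  have hS0 : S = 0 := by
    by_contra hne
    obtain ⟨n, hn'⟩ := exists_nat_gt (4 * ρ / |S|)
    rw [div_lt_iff₀ (abs_pos.2 hne)] at hn'
    have b : ∀ j, |(tr 𝔇 F j T).2.2| ≤ 2 * ρ := fun j => by
      have := R.ball hc (R.shift hT j)
      rw [mem_closedBall_zero_iff] at this
      exact ((norm_snd_le _).trans (norm_snd_le _)).trans this
    have b1 := abs_le.1 (b i)
    have b2 := b (i + q * n)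
    rw [hn] at b2
    simp only [Prod.snd_add] at b2
    have b2 := abs_le.1 b2
    have b3 : |(n : ℝ) * S| ≤ 4 * ρ := abs_le.2 ⟨by linarith, by linarith⟩
    rw [abs_mul, Nat.abs_cast] at b3
    linarith
  rw [hiq, hS0]
  simp

/-- The limit line `L` of the sequence with prefix `A` and the realizing line are compared after the
bounce at `E (n + 1)`, where they are parallel at distance `w`. -/
theorem isPrefix_eq (hS : Stag 𝔇) {E : ℕ → P.BoundaryEdge} (hE : E ∈ P.forwardBounceSpectrum)
    (hap : ¬ ∃ k : ℕ, 0 < k ∧ Function.Periodic E k) {n : ℕ} {A : P.BoundaryEdge}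
    (hA : P.IsPrefix A (fun i => E (n + 1 + i))) : A = E n := by
  obtain ⟨ε, T, hT⟩ := exists_cell (𝔇 := 𝔇) hE
  set F : ℕ → P.BoundaryEdge := fun i => E (n + 1 + i) with hF
  have hch : ∀ i, Ch 𝔇 (fl ε i) (tr 𝔇 E i T) (E i) (E (i + 1)) := fun i =>
    Cell.ch (hT (i + 1)) (Nat.lt_succ_self i)
  have hdet : ∀ i j, tr 𝔇 E i T = tr 𝔇 E j T → E (i + 1) = E (j + 1) → E i = E j := by
    intro i j h1 h2
    have c1 := (hch i).reverse
    rw [h1, h2] at c1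
    exact (hch j).reverse.unique c1
  have hT1 : tr 𝔇 E (n + 1) T ∈ R 𝔇 (fl ε (n + 1)) F := R.shift (R.of_cell hT) (n + 1)
  have htr : ∀ i, tr 𝔇 F i (tr 𝔇 E (n + 1) T) = tr 𝔇 E (n + 1 + i) T := fun i =>
    (tr_shift _ _ _ _).symm
  obtain ⟨L, hL⟩ := R.nonempty (𝔇 := 𝔇) hA (fl ε n)
  have hL1 : eref 𝔇 (F 0) L ∈ R 𝔇 (fl ε (n + 1)) F :=
    R.congr (fun k => by rw [add_comm]; rfl) (R.shift hL 1)
  obtain ⟨w, hw⟩ := R.parallel hT1 hL1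
  -- If the lines coincide, the chord run backward from `E (n + 1)` ends at `E n`, and so do nearby
  -- chords, among them approximations of `L` that start at `A`.
  by_cases hw0 : w = 0
  · rw [hw0, show ((0, 0, 0) : Fn) = 0 from rfl, add_zero] at hw
    have e : L = tr 𝔇 E n T := by
      rw [← eref_eref (𝔇 := 𝔇) (F 0) L, hw, tr]
      exact eref_eref _ _
    have hev := (hch n).reverse.eventually_eq
    rw [← e] at hev
    obtain ⟨φ, f1, f2⟩ := mem_closure_iff_nhds.1 (R.cch hL) _ hev
    exact f1 _ _ (Ch.reverse f2)
  · exfalso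
    rw [hw] at hL1
    have hchF : ∀ i, Ch 𝔇 (fl (fl ε (n + 1)) i) (tr 𝔇 F i (tr 𝔇 E (n + 1) T)) (F i) (F (i + 1)) :=
      fun i => by rw [htr, ← fl_add]; exact hch _
    obtain ⟨ω, q, hH, q1, q2, q3⟩ := exists_periodic_in_hull hS hw0 hT1 hL1 fun i j h1 h2 => by
      rw [htr, htr] at h1
      exact hdet _ _ h1 h2
    obtain ⟨i, i1, i2⟩ := eventually_periodic hS hw0 hT1 hL1 hchF hH q1 q2 q3
    rw [htr, htr] at i1
    set I := n + 1 + i with hI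
    -- On the realizing line the functional and the next letter determine the letter, so the period
    -- extends back to index `0`.
    have hback : ∀ m ≤ I, E (I - m + q) = E (I - m) ∧
        tr 𝔇 E (I - m + q) T = tr 𝔇 E (I - m) T := by
      intro m
      induction m with
      | zero =>
        intro _
        refine ⟨?_, by rw [Nat.sub_zero, hI, add_assoc]; exact i1⟩
        have := i2 0
        simp only [hF, add_zero] at this
        rw [Nat.sub_zero, hI, add_assoc]
        exact this
      | succ m ih =>
        intro hm
        obtain ⟨e1, e2⟩ := ih (by omega)
        set j := I - (m + 1) with hj
        rw [show I - m = j + 1 by omega, add_right_comm] at e1 e2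
        rw [tr, tr, e1] at e2
        have e3 := congrArg (eref 𝔇 (E (j + 1))) e2
        rw [eref_eref, eref_eref] at e3
        exact ⟨hdet _ _ e3 e1, e3⟩
    refine hap ⟨q, q1, fun k => ?_⟩
    rcases le_total k I with hk | hk
    · have := (hback (I - k) (by omega)).1
      rwa [show I - (I - k) = k by omega] at this
    · obtain ⟨m, rfl⟩ := Nat.exists_eq_add_of_le hk
      have := i2 m
      simp only [hF] at this
      rw [hI, add_assoc (n + 1), add_assoc (n + 1)]
      exact this

/-- The prefixes of the tails of an aperiodic realizable sequence are unique. -/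
theorem hasUniquePrefixes (hS : Stag 𝔇) {E : ℕ → P.BoundaryEdge}
    (hE : E ∈ P.forwardBounceSpectrum) (hap : ¬ ∃ k : ℕ, 0 < k ∧ Function.Periodic E k) :
    P.HasUniquePrefixes E := by
  intro n A
  refine ⟨isPrefix_eq hS hE hap, ?_⟩
  rintro rfl
  refine subset_closure ?_
  obtain ⟨c, ψ, κ, h1, h2⟩ := (mem_spectrum_iff 𝔇 E).1 hE
  suffices h : prepend (E n) (fun i => E (n + 1 + i)) = fun i => E (n + i) by
    rw [h]
    exact (mem_spectrum_iff 𝔇 _).2 ⟨_, _, _, h1.drop (κ n), h2.drop n⟩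
  funext i
  rcases i with _ | i
  · rfl
  · change E _ = E _
    congr 1
    omega

/-! ### Walks in acyclic graphs -/

/-- Geodesics through `u` and through `u'` are two paths from `r` to `v`, hence equal. -/
lemma IsAcyclic.parent_unique {α : Type*} {G : SimpleGraph α} (hG : G.IsAcyclic) {r u u' v : α}
    (hu : G.Adj u v) (hu' : G.Adj u' v) (hr : G.Reachable r v) (d : G.dist r v = G.dist r u + 1)
    (d' : G.dist r v = G.dist r u' + 1) : u = u' := by
  have key : ∀ {u}, G.Adj u v → G.dist r v = G.dist r u + 1 →
      ∃ p : G.Walk r v, p.IsPath ∧ p.penultimate = u := by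
    intro u hu d
    obtain ⟨p, hp⟩ := (hr.trans hu.symm.reachable).exists_walk_length_eq_dist
    refine ⟨p.concat hu, SimpleGraph.Walk.isPath_of_length_eq_dist _ ?_, by simp⟩
    rw [SimpleGraph.Walk.length_concat, hp, d]
  obtain ⟨p, hp, e⟩ := key hu d
  obtain ⟨p', hp', e'⟩ := key hu' d'
  have := congrArg Subtype.val ((hG.subsingleton_path r v).elim ⟨p, hp⟩ ⟨p', hp'⟩)
  simp only at this
  rw [← e, ← e', this]

/-- The distance to the start changes by one at each step, and a decrease would lead to the unique
parent, the vertex just left. -/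
lemma IsAcyclic.dist_of_nonbacktracking {α : Type*} {G : SimpleGraph α} (hG : G.IsAcyclic)
    {f : ℕ → α} {n : ℕ} (h1 : ∀ k < n, G.Adj (f k) (f (k + 1)))
    (h2 : ∀ k, k + 1 < n → f k ≠ f (k + 2)) :
    ∀ k ≤ n, G.Reachable (f 0) (f k) ∧ G.dist (f 0) (f k) = k := by
  have hr : ∀ k ≤ n, G.Reachable (f 0) (f k) := by
    intro k
    induction k with
    | zero => exact fun _ => SimpleGraph.Reachable.refl _
    | succ k ih => exact fun hk => (ih (by omega)).trans (h1 k (by omega)).reachable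
  refine fun k => Nat.strong_induction_on k fun k ih hk => ⟨hr k hk, ?_⟩
  rcases k with _ | k
  · exact SimpleGraph.dist_self
  have e1 := (ih k (by omega) (by omega)).2
  rcases hG.dist_eq_dist_add_one_of_adj_of_reachable (f 0) (h1 k (by omega)) (hr k (by omega))
    with h | h
  · exfalso
    rcases k with _ | k
    · omega
    have e2 := (ih k (by omega) (by omega)).2
    exact h2 k (by omega) (IsAcyclic.parent_unique hG (h1 k (by omega)) (h1 (k + 1) (by omega)).symm
      (hr _ (by omega)) (by omega) h)
  · omega

lemma IsAcyclic.nonbacktracking_unique {α : Type*} {G : SimpleGraph α} (hG : G.IsAcyclic)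
    {f g : ℕ → α} {n m : ℕ} (h1 : ∀ k < n, G.Adj (f k) (f (k + 1)))
    (h2 : ∀ k, k + 1 < n → f k ≠ f (k + 2)) (h1' : ∀ k < m, G.Adj (g k) (g (k + 1)))
    (h2' : ∀ k, k + 1 < m → g k ≠ g (k + 2)) (h0 : f 0 = g 0) (he : f n = g m) :
    n = m ∧ ∀ k ≤ n, f k = g k := by
  have df := IsAcyclic.dist_of_nonbacktracking hG h1 h2
  have dg := IsAcyclic.dist_of_nonbacktracking hG h1' h2'
  have hnm : n = m := by rw [← (df n le_rfl).2, ← (dg m le_rfl).2, h0, he]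
  subst hnm
  refine ⟨rfl, ?_⟩
  have key : ∀ j ≤ n, f (n - j) = g (n - j) := by
    intro j
    induction j with
    | zero => exact fun _ => he
    | succ j ih =>
      intro hj
      have e := ih (by omega)
      obtain ⟨i, hi⟩ : ∃ i, n - j = i + 1 := ⟨n - j - 1, by omega⟩
      rw [show n - (j + 1) = i by omega]
      rw [hi] at e
      refine IsAcyclic.parent_unique hG (h1 i (by omega)) (e ▸ h1' i (by omega))
        (df _ (by omega)).1 ?_ ?_
      · rw [(df _ (by omega)).2, (df _ (by omega)).2]
      · rw [(df _ (by omega)).2, h0, (dg _ (by omega)).2]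
  exact fun k hk => by have := key (n - k) (by omega); rwa [show n - (n - k) = k by omega] at this

/-! ### Chains in simply connected polygons -/

lemma inter_eq_edge {s : CState V} (hs : VInv 𝔇 s) {t : Finset V} (ht : t ∈ P.faces)
    (hne : s.face ≠ t) (hl : s.l ∈ t) (hr : s.r ∈ t) : s.face ∩ t = s.edge := by
  refine (Finset.eq_of_subset_of_card_le ?_ ?_).symm
  · intro x hx
    simp only [CState.edge, Finset.mem_insert, Finset.mem_singleton] at hx
    rw [Finset.mem_inter]
    rcases hx with rfl | rfl
    exacts [⟨hs.l_mem, hl⟩, ⟨hs.r_mem, hr⟩]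
  · rw [hs.edge_card]
    by_contra hcon
    have h1 : s.face ∩ t = s.face := Finset.eq_of_subset_of_card_le Finset.inter_subset_left
      (by rw [P.card_face _ hs.face_mem]; omega)
    exact hne (Finset.eq_of_subset_of_card_le (Finset.inter_eq_left.1 h1)
      (by rw [P.card_face _ hs.face_mem, P.card_face _ ht]))

lemma CStep.edge_ne {s s' : CState V} (h : CStep P s s') (hs : VInv 𝔇 s) (hs' : VInv 𝔇 s') :
    s.edge ≠ s'.edge := by
  intro he
  have h1 : s'.l ∈ s.edge := he ▸ by simp [CState.edge]
  have h2 : s'.r ∈ s.edge := he ▸ by simp [CState.edge]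
  simp only [CState.edge, Finset.mem_insert, Finset.mem_singleton] at h1 h2
  rcases h.mem_cases hs hs' with ⟨t1, t2, t3, -⟩ | ⟨t1, t2, t3, -⟩
  · exact h2.elim t3 t2
  · exact h1.elim t2 t3

/-- The triangles of a straight chain form a walk in the dual tree that does not turn back, because
successive exit edges differ. -/
lemma SChain.face_unique (hP : P.IsSimplyConnected) {φ φ' : Fn} {c c' : ℕ → CState V} {n n' : ℕ}
    (h : SChain 𝔇 φ c (n + 1)) (h' : SChain 𝔇 φ' c' (n' + 1)) (h0 : (c 1).face = (c' 1).face)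
    (he : (c (n + 1)).face = (c' (n' + 1)).face) :
    n = n' ∧ ∀ k ≤ n, (c (k + 1)).face = (c' (k + 1)).face := by
  have key : ∀ {φ : Fn} {c : ℕ → CState V} {n : ℕ}, SChain 𝔇 φ c (n + 1) →
      ∃ f : ℕ → {t : Finset V // t ∈ P.faces}, (∀ k ≤ n, (f k).1 = (c (k + 1)).face) ∧
        (∀ k < n, P.dualGraph.Adj (f k) (f (k + 1))) ∧ ∀ k, k + 1 < n → f k ≠ f (k + 2) := by
    intro φ c n h
    have hv := h.chain.inv
    have hs := h.chain.step
    have hf : ∀ k ≤ n, (⟨(c (min k n + 1)).face, (hv _ (by omega)).face_mem⟩ :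
      {t : Finset V // t ∈ P.faces}).1 = (c (k + 1)).face := fun k hk => by
        simp only [min_eq_left hk]
    have hne : ∀ k < n, (c (k + 1)).face ≠ (c (k + 2)).face := fun k hk =>
      ((hs (k + 1) (by omega)).int (h.int _ (by omega) (by omega))).1.symm
    have hinter : ∀ k < n, (c (k + 1)).face ∩ (c (k + 2)).face = (c (k + 1)).edge := fun k hk =>
      inter_eq_edge (hv _ (by omega)) (hv _ (by omega)).face_mem (hne k hk)
        (hs (k + 1) (by omega)).l_mem (hs (k + 1) (by omega)).r_mem
    refine ⟨fun k => ⟨(c (min k n + 1)).face, (hv _ (by omega)).face_mem⟩, hf, fun k hk => ?_,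
      fun k hk => ?_⟩
    · refine ⟨fun e => hne k hk ?_, ?_⟩
      · rw [← hf k (by omega), ← hf (k + 1) (by omega)]
        exact congrArg Subtype.val e
      · rw [hf k (by omega), hf (k + 1) (by omega), hinter k hk, (hv _ (by omega)).edge_card]
    · intro e
      have e1 := congrArg Subtype.val e
      rw [hf k (by omega), hf (k + 2) (by omega)] at e1
      have e2 := hinter k (by omega)
      rw [e1, Finset.inter_comm] at e2
      exact (hs (k + 1) (by omega)).edge_ne (hv _ (by omega)) (hv _ (by omega))
        (e2.symm.trans (hinter (k + 1) hk))
  obtain ⟨f, f1, f2, f3⟩ := key h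
  obtain ⟨g, g1, g2, g3⟩ := key h'
  obtain ⟨e1, e2⟩ := IsAcyclic.nonbacktracking_unique hP f2 f3 g2 g3
    (Subtype.ext (by rw [f1 0 (by omega), g1 0 (by omega)]; exact h0))
    (Subtype.ext (by rw [f1 n le_rfl, g1 n' le_rfl]; exact he))
  subst e1
  exact ⟨rfl, fun k hk => by rw [← f1 k hk, ← g1 k hk, e2 k hk]⟩

lemma face_eq_of_bd {s s' : CState V} (hs : VInv 𝔇 s) (hs' : VInv 𝔇 s') (he : s.edge = s'.edge)
    (hb : P.IsBoundaryEdge s.edge) : s.face = s'.face :=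
  hb.2.unique ⟨hs.face_mem, hs.edge_subset⟩ ⟨hs'.face_mem, he ▸ hs'.edge_subset⟩

lemma SChain.first_face {φ φ' : Fn} {c c' : ℕ → CState V} {n n' : ℕ}
    (h : SChain 𝔇 φ c (n + 1)) (h' : SChain 𝔇 φ' c' (n' + 1)) (he : (c 0).edge = (c' 0).edge) :
    (c 1).face = (c' 1).face := by
  rw [((h.chain.step 0 (by omega)).bd h.bd).1, ((h'.chain.step 0 (by omega)).bd h'.bd).1]
  exact face_eq_of_bd (h.chain.inv 0 (by omega)) (h'.chain.inv 0 (by omega)) he h.bd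

/-- Chains from the same edge to the same triangle cross the same triangles, so they enter the last
one through the same edge. Here these edges are `{v, s.r}` and `{s.l, v}`. No closeness is needed.
-/
theorem noFold_of_isSimplyConnected (hP : P.IsSimplyConnected) : NoFold 𝔇 := by
  intro s v φ hs hv hl hr _ _ _
  refine ⟨1, one_pos, fun η η' _ _ _ _ c m c' m' h e1 e2 e3 h' e1' e2' e3' he => ?_⟩
  have hne : (c m).edge ≠ (c' m').edge := by
    rw [CState.edge, CState.edge, e2, e3, e2', e3']
    intro h
    have : s.l ∈ ({v, s.r} : Finset V) := h ▸ by simp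
    simp only [Finset.mem_insert, Finset.mem_singleton] at this
    exact this.elim (Ne.symm hl) hs.ne
  obtain ⟨rfl, hf⟩ := h.face_unique hP h' (h.first_face h' he) (by rw [e1, e1'])
  rcases m with _ | m
  · exact hne he
  have key : ∀ {φ : Fn} {c : ℕ → CState V}, SChain 𝔇 φ c (m + 1 + 1) →
      (c (m + 1)).face ∩ (c (m + 2)).face = (c (m + 1)).edge := fun h =>
    inter_eq_edge (h.chain.inv _ (by omega)) (h.chain.inv _ (by omega)).face_mem
      ((h.chain.step (m + 1) (by omega)).int (h.int _ (by omega) (by omega))).1.symm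
      (h.chain.step (m + 1) (by omega)).l_mem (h.chain.step (m + 1) (by omega)).r_mem
  apply hne
  rw [← key h, ← key h', hf m (by omega), hf (m + 1) le_rfl]

/-- A state is determined by its edge, face and orientation. -/
lemma VInv.eq_of_orient {s s' : CState V} (hs : VInv 𝔇 s) (hs' : VInv 𝔇 s')
    (he : s.edge = s'.edge) (hf : s.face = s'.face) (hε : s.ε = s'.ε) : s = s' := by
  have h1 : s.l ∈ s'.edge := he ▸ by simp [CState.edge]
  have h2 : s.r ∈ s'.edge := he ▸ by simp [CState.edge]
  simp only [CState.edge, Finset.mem_insert, Finset.mem_singleton] at h1 h2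
  rcases h1 with h1 | h1
  · exact CState.ext' hf h1 (h2.resolve_left fun h => hs.ne (h1.trans h.symm)) hε
  · exfalso
    have h2 : s.r = s'.l := h2.resolve_right fun h => hs.ne (h1.trans h.symm)
    obtain ⟨c, c1, c2, c3⟩ := hs.exists_apex
    have hc : c ∈ s.face := by rw [c3]; simp
    have b1 := hs.behind c hc c1 c2
    have b2 := hs'.behind c (hf ▸ hc) (h2 ▸ c2) (h1 ▸ c1)
    rw [← hf, ← h1, ← h2, ← hε, cr_swap] at b2
    linarith

lemma SChain.state_unique (hP : P.IsSimplyConnected) {φ φ' : Fn} {c c' : ℕ → CState V} {n n' : ℕ}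
    (h : SChain 𝔇 φ c (n + 1)) (h' : SChain 𝔇 φ' c' (n' + 1)) (h0 : (c 0).edge = (c' 0).edge)
    (hb : P.IsBoundaryEdge (c (n + 1)).edge) (he : (c (n + 1)).edge = (c' (n' + 1)).edge)
    (hε : (c 1).ε = (c' 1).ε) : n = n' ∧ ∀ k ≤ n + 1, c k = c' k := by
  obtain ⟨rfl, hf⟩ := h.face_unique hP h' (h.first_face h' h0)
    (face_eq_of_bd (h.chain.inv _ le_rfl) (h'.chain.inv _ le_rfl) he hb)
  refine ⟨rfl, fun k hk => ?_⟩
  have hedge : ∀ k, 0 < k → k ≤ n → (c k).edge = (c' k).edge := by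
    intro k k1 k2
    obtain ⟨k, rfl⟩ := Nat.exists_eq_succ_of_ne_zero k1.ne'
    have key : ∀ {φ : Fn} {c : ℕ → CState V}, SChain 𝔇 φ c (n + 1) →
        (c (k + 1)).face ∩ (c (k + 2)).face = (c (k + 1)).edge := fun h =>
      inter_eq_edge (h.chain.inv _ (by omega)) (h.chain.inv _ (by omega)).face_mem
        ((h.chain.step (k + 1) (by omega)).int (h.int _ (by omega) (by omega))).1.symm
        (h.chain.step (k + 1) (by omega)).l_mem (h.chain.step (k + 1) (by omega)).r_mem
    rw [Nat.succ_eq_add_one, ← key h, ← key h', hf k (by omega), hf (k + 1) (by omega)]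
  rcases k with _ | k
  · refine (h.chain.inv _ hk).eq_of_orient (h'.chain.inv _ hk) h0 (face_eq_of_bd
      (h.chain.inv _ hk) (h'.chain.inv _ hk) h0 h.bd) ?_
    rw [((h.chain.step 0 (by omega)).bd h.bd).2, ((h'.chain.step 0 (by omega)).bd h'.bd).2] at hε
    simpa using hε
  · refine (h.chain.inv _ hk).eq_of_orient (h'.chain.inv _ hk) ?_ (hf k (by omega))
      (by rw [h.orient k (by omega), h'.orient k (by omega), hε])
    rcases (show k + 1 ≤ n ∨ k = n by omega) with h | rfl
    · exact hedge _ (by omega) h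
    · exact he

/-- The chords `x` and `x'` pass through the same states. If `z₁` turned off somewhere, some vertex
would be on one side of both `x` and `x'` and on the other side of `z₁`, although `z₁` lies between
them. -/
theorem stag_of_isSimplyConnected (hP : P.IsSimplyConnected) : Stag 𝔇 := by
  rintro ε a b e x x' z y y' z₁ ⟨c, n, hc, c1, c2, c3⟩ ⟨c', n', hc', c1', c2', c3'⟩ - - -
    ⟨s, m, hs, s1, s2, s3⟩ l1 l2 - - - -
  obtain ⟨rfl, hcc⟩ := hc.state_unique hP hc' (c1.trans c1'.symm) (c2 ▸ b.2) (c2.trans c2'.symm)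
    (c3.trans c3'.symm)
  by_contra hbe
  have h0 : c 0 = s 0 := by
    have e1 := c1.trans s1.symm
    refine (hc.chain.inv 0 (by omega)).eq_of_orient (hs.chain.inv 0 (by omega)) e1 (face_eq_of_bd
      (hc.chain.inv 0 (by omega)) (hs.chain.inv 0 (by omega)) e1 hc.bd) ?_
    have e2 := c3.trans s3.symm
    rw [((hc.chain.step 0 (by omega)).bd hc.bd).2, ((hs.chain.step 0 (by omega)).bd hs.bd).2] at e2
    simpa using e2
  have hstep : ∀ k, k ≤ n → k ≤ m → c k = s k → c (k + 1) = s (k + 1) := by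
    intro k k1 k2 e
    have v0 := hc.chain.inv k (by omega)
    have v1 := hc.chain.inv (k + 1) (by omega)
    have v2 := hs.chain.inv (k + 1) (by omega)
    have st := hc.chain.step k (by omega)
    have st' := hs.chain.step k (by omega)
    rw [← e] at st'
    obtain ⟨hf, hε⟩ := st.face_eq st' v0 v1 v2
    have p1 := hc.sep (k + 1) (by omega)
    have p2 := hc'.sep (k + 1) (by omega)
    have p3 := hs.sep (k + 1) (by omega)
    rw [← hcc _ (by omega)] at p2
    rcases st.mem_cases v0 v1 with ⟨t1, t2, t3, t4⟩ | ⟨t1, t2, t3, t4⟩ <;>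
      rcases st'.mem_cases v0 v2 with ⟨r1, r2, r3, r4⟩ | ⟨r1, r2, r3, r4⟩
    · refine CState.ext' hf (t1.trans r1.symm) ?_ hε
      have := v1.r_mem
      rw [hf, r4] at this
      simp only [Finset.mem_insert, Finset.mem_singleton] at this
      tauto
    · exfalso
      have e1 : (c (k + 1)).r = (s (k + 1)).l := by
        have := v1.r_mem
        rw [hf, r4] at this
        simp only [Finset.mem_insert, Finset.mem_singleton] at this
        tauto
      have q1 := p2.2
      have q2 := p3.1
      rw [e1, hf] at q1
      linarith [l2 _ v2.face_mem _ v2.l_mem]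
    · exfalso
      have e1 : (c (k + 1)).l = (s (k + 1)).r := by
        have := v1.l_mem
        rw [hf, r4] at this
        simp only [Finset.mem_insert, Finset.mem_singleton] at this
        tauto
      have q1 := p1.1
      have q2 := p3.2
      rw [e1, hf] at q1
      linarith [l1 _ v2.face_mem _ v2.r_mem]
    · refine CState.ext' hf ?_ (t1.trans r1.symm) hε
      have := v1.l_mem
      rw [hf, r4] at this
      simp only [Finset.mem_insert, Finset.mem_singleton] at this
      tauto
  have hall : ∀ k, k ≤ n + 1 → k ≤ m + 1 → c k = s k := by
    intro k
    induction k with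
    | zero => exact fun _ _ => h0
    | succ k ih => exact fun k1 k2 => hstep k (by omega) (by omega) (ih (by omega) (by omega))
  have hb1 : P.IsBoundaryEdge (c (n + 1)).edge := c2 ▸ b.2
  have hb2 : P.IsBoundaryEdge (s (m + 1)).edge := s2 ▸ e.2
  rcases lt_trichotomy n m with hlt | rfl | hlt
  · refine absurd ?_ (hs.int (n + 1) (by omega) (by omega))
    rw [← hall _ le_rfl (by omega)]; exact hb1
  · exact hbe (Subtype.ext (by rw [← c2, ← s2, hall _ le_rfl le_rfl]))
  · refine absurd ?_ (hc.int (m + 1) (by omega) (by omega))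
    rw [hall _ (by omega) le_rfl]; exact hb2

/-! ### Development of a simply connected polygon -/

/-- The coordinates `s` and `t` of the point along and across `AB` come from the law of cosines and
from Heron's formula; `σ` selects the side. -/
lemma exists_third_point {A B : Pt} {x y z : ℝ} (hx : 0 < x) (hxy : sqd A B = x ^ 2)
    (h1 : x < y + z) (h2 : y < x + z) (h3 : z < x + y) {σ : ℝ} (hσ : σ ^ 2 = 1) :
    ∃ q, sqd A q = y ^ 2 ∧ sqd B q = z ^ 2 ∧ 0 < σ * cr A B q := by
  set K := (x + y + z) * (x + y - z) * (y + z - x) * (x + z - y) with hK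
  have hK0 : 0 < K := mul_pos (mul_pos (mul_pos (by linarith) (by linarith)) (by linarith))
    (by linarith)
  set t := σ * (Real.sqrt K / (2 * x ^ 2)) with ht
  set s := (x ^ 2 + y ^ 2 - z ^ 2) / (2 * x ^ 2) with hs
  have hx2 : x ^ 2 ≠ 0 := by positivity
  have e1 : 2 * (s * x ^ 2) = x ^ 2 + y ^ 2 - z ^ 2 := by rw [hs]; field_simp
  have e2 : (s ^ 2 + t ^ 2) * x ^ 2 = y ^ 2 := by
    have : t ^ 2 = K / (4 * (x ^ 2) ^ 2) := by
      rw [ht, mul_pow, hσ, div_pow, Real.sq_sqrt hK0.le]; ring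
    rw [this, hs, hK]
    field_simp
    ring
  unfold sqd at hxy
  refine ⟨(A.1 + s * (B.1 - A.1) - t * (B.2 - A.2), A.2 + s * (B.2 - A.2) + t * (B.1 - A.1)),
    ?_, ?_, ?_⟩
  · unfold sqd
    linear_combination (s ^ 2 + t ^ 2) * hxy + e2
  · unfold sqd
    linear_combination ((1 - s) ^ 2 + t ^ 2) * hxy + e2 - e1
  · have : cr A B (A.1 + s * (B.1 - A.1) - t * (B.2 - A.2), A.2 + s * (B.2 - A.2) +
        t * (B.1 - A.1)) = t * x ^ 2 := by
      unfold cr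
      linear_combination t * hxy
    rw [this, ht]
    have e3 : σ * (σ * (√K / (2 * x ^ 2)) * x ^ 2) = σ ^ 2 * (√K / 2) := by field_simp
    rw [e3, hσ, one_mul]
    exact half_pos (Real.sqrt_pos.2 hK0)

/-- An isometric placement of a triangle. -/
def Placed (P : GeneralizedPolygon V) (p : V → Pt) (t : Finset V) : Prop :=
  ∀ a ∈ t, ∀ b ∈ t, sqd (p a) (p b) = P.len a b ^ 2

/-- The placement `p'` of `t'` continues the placement `p` of `t`. -/
def Continues (p : V → Pt) (t : Finset V) (p' : V → Pt) (t' : Finset V) : Prop :=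
  (∀ a, a ∈ t → a ∈ t' → p' a = p a) ∧ ∀ a b c c', a ≠ b → a ∈ t → b ∈ t → a ∈ t' → b ∈ t' →
    c ∈ t → c ≠ a → c ≠ b → c' ∈ t' → c' ≠ a → c' ≠ b →
    cr (p a) (p b) (p c) * cr (p' a) (p' b) (p' c') < 0

lemma placed_triple {a b c : V} {p : V → Pt} (h1 : sqd (p a) (p b) = P.len a b ^ 2)
    (h2 : sqd (p a) (p c) = P.len a c ^ 2) (h3 : sqd (p b) (p c) = P.len b c ^ 2) :
    Placed P p {a, b, c} := by
  have h0 : ∀ z : Pt, sqd z z = 0 := fun z => by simp [sqd]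
  intro x hx y hy
  simp only [Finset.mem_insert, Finset.mem_singleton] at hx hy
  rcases hx with rfl | rfl | rfl <;> rcases hy with rfl | rfl | rfl <;>
    first
    | assumption
    | rw [h0, P.len_self, zero_pow two_ne_zero]
    | rw [sqd_comm, P.len_symm]; assumption

lemma exists_apex_point {t : Finset V} (ht : t ∈ P.faces) {a b c : V} (hac : a ≠ b) (hca : c ≠ a)
    (hcb : c ≠ b) (e : t = {a, b, c}) {A B : Pt} (hAB : sqd A B = P.len a b ^ 2) {σ : ℝ}
    (hσ : σ ^ 2 = 1) :
    ∃ q, sqd A q = P.len a c ^ 2 ∧ sqd B q = P.len b c ^ 2 ∧ 0 < σ * cr A B q := by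
  have ha : a ∈ t := by simp [e]
  have hb : b ∈ t := by simp [e]
  have hc : c ∈ t := by simp [e]
  have i1 := P.triangle t ht a ha c hc b hb hca.symm hcb hac
  have i2 := P.triangle t ht a ha b hb c hc hac hcb.symm hca.symm
  have i3 := P.triangle t ht b hb a ha c hc hac.symm hca.symm hcb.symm
  rw [P.len_symm c b] at i1
  rw [P.len_symm b a] at i3
  exact exists_third_point (len_pos ht ha hb hc hac hcb.symm hca.symm) hAB (by linarith)
    (by linarith) (by linarith) hσ

/-- By Heron's formula the squared area depends only on the lengths, and `exists_apex_point`
provides a placement with nonzero area. -/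
lemma Placed.nondeg {t : Finset V} (ht : t ∈ P.faces) {p : V → Pt} (hp : Placed P p t) {a b c : V}
    (ha : a ∈ t) (hb : b ∈ t) (hc : c ∈ t) (hab : a ≠ b) (hbc : b ≠ c) (hac : a ≠ c) :
    cr (p a) (p b) (p c) ≠ 0 := by
  intro h0
  obtain ⟨d, d1, d2, d3⟩ := exists_apex ht ha hb hab
  have hcd : c = d := by
    rw [d3] at hc
    simp only [Finset.mem_insert, Finset.mem_singleton] at hc
    exact (hc.resolve_left hac.symm).resolve_left hbc.symm
  subst hcd
  obtain ⟨q, q1, q2, q3⟩ := exists_apex_point ht hab d1 d2 d3 (hp a ha b hb) (one_pow 2)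
  have heron : ∀ r : Pt, 4 * cr (p a) (p b) r ^ 2 = 2 * sqd (p a) (p b) * sqd (p b) r +
    2 * sqd (p b) r * sqd (p a) r + 2 * sqd (p a) r * sqd (p a) (p b) - sqd (p a) (p b) ^ 2
    - sqd (p b) r ^ 2 - sqd (p a) r ^ 2 := fun r => by unfold cr sqd; ring
  have k1 := heron (p c)
  have k2 := heron q
  rw [hp a ha c hc, hp b hb c hc, h0] at k1
  rw [q1, q2] at k2
  nlinarith

lemma exists_placed {t : Finset V} (ht : t ∈ P.faces) : ∃ p, Placed P p t := by
  obtain ⟨a, b, c, hab, hac, hbc, e⟩ := Finset.card_eq_three.1 (P.card_face t ht)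
  obtain ⟨q, q1, q2, -⟩ := exists_apex_point ht hab hac.symm hbc.symm e (A := (0, 0))
    (B := (P.len a b, 0)) (by simp [sqd]) (one_pow 2)
  refine ⟨fun v => if v = a then (0, 0) else if v = b then (P.len a b, 0) else q, ?_⟩
  rw [e]
  refine placed_triple ?_ ?_ ?_
  · simp [hab.symm, sqd]
  · simpa [hac.symm, hbc.symm] using q1
  · simpa [hab.symm, hac.symm, hbc.symm] using q2

/-- Only the apex of `t'` has to be placed anew, on the side of the common edge away from `t`. -/
lemma exists_continues {t t' : {t : Finset V // t ∈ P.faces}} (h : P.dualGraph.Adj t t')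
    {p : V → Pt} (hp : Placed P p t.1) : ∃ p', Placed P p' t'.1 ∧ Continues p t.1 p' t'.1 := by
  obtain ⟨hne, hcard⟩ := h
  obtain ⟨a, b, hab, e⟩ := Finset.card_eq_two.1 hcard
  have ha : a ∈ t.1 ∩ t'.1 := e ▸ by simp
  have hb : b ∈ t.1 ∩ t'.1 := e ▸ by simp
  rw [Finset.mem_inter] at ha hb
  obtain ⟨c, c1, c2, c3⟩ := exists_apex t.2 ha.1 hb.1 hab
  obtain ⟨d, d1, d2, d3⟩ := exists_apex t'.2 ha.2 hb.2 hab
  have hd : d ∉ t.1 := fun hd => by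
    have : d ∈ t.1 ∩ t'.1 := Finset.mem_inter.2 ⟨hd, by rw [d3]; simp⟩
    rw [e] at this
    simp only [Finset.mem_insert, Finset.mem_singleton] at this
    tauto
  have hc : c ∉ t'.1 := fun hc => by
    have : c ∈ t.1 ∩ t'.1 := Finset.mem_inter.2 ⟨by rw [c3]; simp, hc⟩
    rw [e] at this
    simp only [Finset.mem_insert, Finset.mem_singleton] at this
    tauto
  have hcr : cr (p a) (p b) (p c) ≠ 0 :=
    hp.nondeg t.2 ha.1 hb.1 (by rw [c3]; simp) hab c2.symm c1.symm
  obtain ⟨σ, hσ, hσc⟩ : ∃ σ : ℝ, σ ^ 2 = 1 ∧ σ * cr (p a) (p b) (p c) < 0 := by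
    rcases lt_or_gt_of_ne hcr with h | h
    · exact ⟨1, by norm_num, by linarith⟩
    · exact ⟨-1, by norm_num, by linarith⟩
  obtain ⟨q, q1, q2, q3⟩ := exists_apex_point t'.2 hab d1 d2 d3 (hp a ha.1 b hb.1) hσ
  have hpd : ∀ v, v ≠ d → Function.update p d q v = p v := fun v hv =>
    Function.update_of_ne hv _ _
  have hlt : cr (p a) (p b) (p c) * cr (p a) (p b) q < 0 := by
    have e1 : cr (p a) (p b) (p c) * cr (p a) (p b) q =
      (σ * cr (p a) (p b) (p c)) * (σ * cr (p a) (p b) q) := by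
      linear_combination -(cr (p a) (p b) (p c) * cr (p a) (p b) q) * hσ
    rw [e1]
    exact mul_neg_of_neg_of_pos hσc q3
  refine ⟨Function.update p d q, ?_, fun v hv _ => hpd v fun h => hd (h ▸ hv), ?_⟩
  · rw [d3]
    refine placed_triple ?_ ?_ ?_
    · rw [hpd _ d1.symm, hpd _ d2.symm]; exact hp a ha.1 b hb.1
    · rw [hpd _ d1.symm, Function.update_self]; exact q1
    · rw [hpd _ d2.symm, Function.update_self]; exact q2
  · intro a' b' c' d' h1 h2 h3 h4 h5 h6 h7 h8 h9 h10 h11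
    have ha' : a' ∈ t.1 ∩ t'.1 := Finset.mem_inter.2 ⟨h2, h4⟩
    have hb' : b' ∈ t.1 ∩ t'.1 := Finset.mem_inter.2 ⟨h3, h5⟩
    rw [e] at ha' hb'
    rw [c3] at h6
    rw [d3] at h9
    simp only [Finset.mem_insert, Finset.mem_singleton] at ha' hb' h6 h9
    have hc' : c' = c := by
      rcases ha' with rfl | rfl <;> rcases hb' with rfl | rfl <;> tauto
    have hd' : d' = d := by
      rcases ha' with rfl | rfl <;> rcases hb' with rfl | rfl <;> tauto
    subst hc' hd'
    rw [Function.update_self]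
    rcases ha' with rfl | rfl <;> rcases hb' with rfl | rfl
    · exact absurd rfl h1
    · rw [hpd _ d1.symm, hpd _ d2.symm]; exact hlt
    · rw [hpd _ d1.symm, hpd _ d2.symm, cr_swap (p b'), cr_swap (p b')]
      linarith
    · exact absurd rfl h1

lemma Dev.of_placements (D : {t : Finset V // t ∈ P.faces} → V → Pt)
    (h1 : ∀ t, Placed P (D t) t.1)
    (h2 : ∀ t t', P.dualGraph.Adj t t' →
      Continues (D t) t.1 (D t') t'.1 ∨ Continues (D t') t'.1 (D t) t.1) : Nonempty (Dev P) := by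
  have hadj : ∀ {t t' : {t : Finset V // t ∈ P.faces}} {a b : V}, t ≠ t' → a ≠ b → a ∈ t.1 →
      b ∈ t.1 → a ∈ t'.1 → b ∈ t'.1 → P.dualGraph.Adj t t' := by
    intro t t' a b hne hab ha hb ha' hb'
    refine ⟨hne, le_antisymm ?_ ?_⟩
    · by_contra hcon
      have e1 : t.1 ∩ t'.1 = t.1 := Finset.eq_of_subset_of_card_le Finset.inter_subset_left
        (by rw [P.card_face _ t.2]; omega)
      exact hne (Subtype.ext (Finset.eq_of_subset_of_card_le (Finset.inter_eq_left.1 e1)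
        (by rw [P.card_face _ t.2, P.card_face _ t'.2])))
    · rw [← Finset.card_pair hab]
      refine Finset.card_le_card fun x hx => ?_
      simp only [Finset.mem_insert, Finset.mem_singleton] at hx
      rw [Finset.mem_inter]
      rcases hx with rfl | rfl
      exacts [⟨ha, ha'⟩, ⟨hb, hb'⟩]
  refine ⟨⟨fun t v => if h : t ∈ P.faces then D ⟨t, h⟩ v else 0, fun t ht a ha b hb => ?_,
    fun t ht t' ht' a b hab ha hb ha' hb' => ?_,
    fun t ht t' ht' a b c c' hab ha hb ha' hb' hne hc h3 h4 hc' h5 h6 => ?_⟩⟩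
  · simp only [dif_pos ht]
    exact h1 ⟨t, ht⟩ a ha b hb
  · simp only [dif_pos ht, dif_pos ht']
    by_cases hne : t = t'
    · subst hne; rfl
    · rcases h2 ⟨t, ht⟩ ⟨t', ht'⟩ (hadj (fun h => hne (congrArg Subtype.val h)) hab ha hb ha' hb')
        with h | h
      · exact (h.1 a ha ha').symm
      · exact h.1 a ha' ha
  · simp only [dif_pos ht, dif_pos ht']
    rcases h2 ⟨t, ht⟩ ⟨t', ht'⟩ (hadj (fun h => hne (congrArg Subtype.val h)) hab ha hb ha' hb')
      with h | h
    · exact h.2 a b c c' hab ha hb ha' hb' hc h3 h4 hc' h5 h6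
    · rw [mul_comm]
      exact h.2 a b c' c hab ha' hb' ha hb hc' h5 h6 hc h3 h4

/-- Triangles are attached in the order of their distance `δ` from a root. In a forest two
neighbours are always parent and child, so no further compatibility has to be checked. Only the
values `place (δ t) t` matter. -/
theorem exists_dev_of_isSimplyConnected (hP : P.IsSimplyConnected) : Nonempty (Dev P) := by
  classical
  choose std hstd using fun t : {t // t ∈ P.faces} => exists_placed t.2
  have hatt : ∀ (t t' : {t // t ∈ P.faces}) (p : V → Pt), ∃ p', P.dualGraph.Adj t t' → Placed P p t.1 →
      Placed P p' t'.1 ∧ Continues p t.1 p' t'.1 := by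
    intro t t' p
    by_cases h : P.dualGraph.Adj t t' ∧ Placed P p t.1
    · obtain ⟨p', h'⟩ := exists_continues h.1 h.2
      exact ⟨p', fun _ _ => h'⟩
    · exact ⟨p, fun h1 h2 => absurd ⟨h1, h2⟩ h⟩
  choose att hatt using hatt
  set root : {t // t ∈ P.faces} → {t // t ∈ P.faces} := fun t => (P.dualGraph.connectedComponentMk t).out
  have hroot : ∀ t, P.dualGraph.Reachable (root t) t := fun t =>
    SimpleGraph.ConnectedComponent.exact (Quot.out_eq _)
  have hroot' : ∀ {t t'}, P.dualGraph.Adj t t' → root t = root t' := fun h => by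
    simp only [root, SimpleGraph.ConnectedComponent.sound h.reachable]
  set δ : {t // t ∈ P.faces} → ℕ := fun t => P.dualGraph.dist (root t) t
  have hpar : ∀ t, ∃ u, δ t ≠ 0 → P.dualGraph.Adj u t ∧ δ t = δ u + 1 := by
    intro t
    by_cases h0 : δ t = 0
    · exact ⟨t, fun h => absurd h0 h⟩
    obtain ⟨p, hp⟩ := (hroot t).exists_walk_length_eq_dist
    have hn : ¬ p.Nil := fun hn => h0 (by
      have := SimpleGraph.Walk.length_eq_zero_iff.2 hn
      rw [hp] at this
      exact this)
    have hadj := p.adj_penultimate hn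
    refine ⟨p.penultimate, fun _ => ⟨hadj, ?_⟩⟩
    have h1 : P.dualGraph.dist (root t) p.penultimate ≤ p.dropLast.length := SimpleGraph.dist_le _
    have h2 : p.dropLast.length + 1 = p.length := p.length_dropLast_add_one hn
    have h3 : δ p.penultimate = P.dualGraph.dist (root t) p.penultimate := by
      simp only [δ, hroot' hadj]
    rcases SimpleGraph.IsAcyclic.dist_eq_dist_add_one_of_adj_of_reachable hP (root t) hadj.symm
      (hroot t) with h | h
    · rw [h3]; exact h
    · omega
  choose par hpar using hpar
  set place : ℕ → {t // t ∈ P.faces} → V → Pt := fun n => Nat.rec std (fun _ f t => att (par t) t (f (par t))) n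
  have hplace : ∀ n t, δ t = n → Placed P (place n t) t.1 := by
    intro n
    induction n with
    | zero => exact fun t _ => hstd t
    | succ n ih =>
      intro t ht
      obtain ⟨h1, h2⟩ := hpar t (by omega)
      exact (hatt (par t) t _ h1 (ih _ (by omega))).1
  have hchild : ∀ {t t' : {t // t ∈ P.faces}}, P.dualGraph.Adj t t' → δ t' = δ t + 1 →
      Continues (place (δ t) t) t.1 (place (δ t') t') t'.1 := by
    intro t t' h hd
    obtain ⟨h1, h2⟩ := hpar t' (by omega)
    have e : par t' = t := by
      refine IsAcyclic.parent_unique hP h1 h (hroot t') ?_ ?_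
      · rw [← hroot' h1]
        rw [hroot' h1]
        have := h2
        simp only [δ, hroot' h1] at this
        exact this
      · have := hd
        simp only [δ, hroot' h] at this
        exact this
    have := (hatt t t' _ h (hplace _ t rfl)).2
    rw [hd]
    change Continues _ _ (att (par t') t' (place (δ t) (par t'))) _
    rw [e]
    exact this
  refine Dev.of_placements (fun t => place (δ t) t) (fun t => hplace _ t rfl) fun t t' h => ?_
  rcases SimpleGraph.IsAcyclic.dist_eq_dist_add_one_of_adj_of_reachable hP (root t) h (hroot t)
    with h' | h'
  · right
    refine hchild h.symm ?_
    simp only [δ, ← hroot' h]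
    exact h'
  · left
    refine hchild h ?_
    simp only [δ, ← hroot' h]
    exact h'

/-! ### Planar developments -/

/-- `z` lies in the open triangle `t`, placed by `p`. -/
def InT (p : V → Pt) (t : Finset V) (z : Pt) : Prop := ∀ a ∈ t, ∀ b ∈ t, ∀ c ∈ t,
  a ≠ b → b ≠ c → a ≠ c → 0 < cr (p a) (p b) (p c) * cr (p a) (p b) z

def OpenSeg (A B z : Pt) : Prop := ∃ s t : ℝ, 0 < s ∧ 0 < t ∧ s + t = 1 ∧ z = s • A + t • B

omit [Fintype V] in
lemma InT.of_three {p : V → Pt} {a b c : V} {z : Pt}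
    (h1 : 0 < cr (p a) (p b) (p c) * cr (p a) (p b) z)
    (h2 : 0 < cr (p a) (p b) (p c) * cr (p b) (p c) z)
    (h3 : 0 < cr (p a) (p b) (p c) * cr (p c) (p a) z) : InT p {a, b, c} z := by
  intro x hx y hy w hw hxy hyw hxw
  simp only [Finset.mem_insert, Finset.mem_singleton] at hx hy hw
  unfold cr at *
  rcases hx with rfl | rfl | rfl <;> rcases hy with rfl | rfl | rfl <;>
    rcases hw with rfl | rfl | rfl <;>
    first | exact (hxy rfl).elim | exact (hyw rfl).elim | exact (hxw rfl).elim | linarith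

omit [Fintype V] in
lemma InT.of_bary {p : V → Pt} {a b c : V} {α β γ : ℝ} (h : cr (p a) (p b) (p c) ≠ 0)
    (hα : 0 < α) (hβ : 0 < β) (hγ : 0 < γ) (e : α + β + γ = 1) :
    InT p {a, b, c} (α • p a + β • p b + γ • p c) := by
  have h2 : 0 < cr (p a) (p b) (p c) ^ 2 := by positivity
  obtain rfl : α = 1 - β - γ := by linarith
  have e1 : cr (p a) (p b) ((1 - β - γ) • p a + β • p b + γ • p c) = γ * cr (p a) (p b) (p c) := by
    simp [cr]; ring
  have e2 : cr (p b) (p c) ((1 - β - γ) • p a + β • p b + γ • p c)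
      = (1 - β - γ) * cr (p a) (p b) (p c) := by
    simp [cr]; ring
  have e3 : cr (p c) (p a) ((1 - β - γ) • p a + β • p b + γ • p c) = β * cr (p a) (p b) (p c) := by
    simp [cr]; ring
  refine InT.of_three ?_ ?_ ?_
  · rw [e1]; nlinarith
  · rw [e2]; nlinarith
  · rw [e3]; nlinarith

omit [Fintype V] [DecidableEq V] in
lemma eventually_cr_pos {k : ℝ} {A B X z : Pt} (h : 0 < k * cr A B z) :
    ∀ᶠ β in 𝓝[>] (0 : ℝ), 0 < k * cr A B ((1 - β) • z + β • X) := by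
  filter_upwards [eventually_add_pos (x := k * cr A B X - k * cr A B z) h] with β hβ
  rw [cr_combo _ _ _ _ _ _ (by ring)]
  linarith

omit [Fintype V] [DecidableEq V] in
lemma InT.eventually {p : V → Pt} {t : Finset V} {z : Pt} (h : InT p t z) (X : Pt) :
    ∀ᶠ β in 𝓝[>] (0 : ℝ), InT p t ((1 - β) • z + β • X) := by
  have h1 : ∀ᶠ β in 𝓝[>] (0 : ℝ), ∀ a ∈ t, ∀ b ∈ t, ∀ c ∈ t, a ≠ b → b ≠ c → a ≠ c →
      0 < cr (p a) (p b) (p c) * cr (p a) (p b) ((1 - β) • z + β • X) := by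
    refine (Filter.eventually_all_finset t).2 fun a ha => (Filter.eventually_all_finset t).2
      fun b hb => (Filter.eventually_all_finset t).2 fun c hc => ?_
    by_cases hh : a ≠ b ∧ b ≠ c ∧ a ≠ c
    · exact (eventually_cr_pos (h a ha b hb c hc hh.1 hh.2.1 hh.2.2)).mono fun _ hβ _ _ _ => hβ
    · exact Filter.Eventually.of_forall fun β x y w => absurd ⟨x, y, w⟩ hh
  exact h1

omit [Fintype V] in
/-- Points near an edge, on the side of the apex, lie in the triangle. -/
lemma eventually_inT {p : V → Pt} {a b c : V} {z X : Pt} (hz : OpenSeg (p a) (p b) z)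
    (hX : 0 < cr (p a) (p b) (p c) * cr (p a) (p b) X) :
    ∀ᶠ β in 𝓝[>] (0 : ℝ), InT p {a, b, c} ((1 - β) • z + β • X) := by
  obtain ⟨s, t, hs, ht, hst, rfl⟩ := hz
  have h0 : cr (p a) (p b) (p c) ≠ 0 := fun h => by rw [h, zero_mul] at hX; exact lt_irrefl _ hX
  have h2 : 0 < cr (p a) (p b) (p c) ^ 2 := by positivity
  have e1 : cr (p a) (p b) (s • p a + t • p b) = 0 := by
    rw [cr_combo _ _ _ _ _ _ hst]; unfold cr; ring
  have e2 : cr (p b) (p c) (s • p a + t • p b) = s * cr (p a) (p b) (p c) := by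
    rw [cr_combo _ _ _ _ _ _ hst]; unfold cr; ring
  have e3 : cr (p c) (p a) (s • p a + t • p b) = t * cr (p a) (p b) (p c) := by
    rw [cr_combo _ _ _ _ _ _ hst]; unfold cr; ring
  have k2 : 0 < cr (p a) (p b) (p c) * cr (p b) (p c) (s • p a + t • p b) := by rw [e2]; nlinarith
  have k3 : 0 < cr (p a) (p b) (p c) * cr (p c) (p a) (s • p a + t • p b) := by rw [e3]; nlinarith
  filter_upwards [self_mem_nhdsWithin, eventually_cr_pos (X := X) k2, eventually_cr_pos (X := X) k3]
    with β hβ b2 b3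
  refine InT.of_three ?_ b2 b3
  have hβ : 0 < β := hβ
  rw [cr_combo _ _ _ _ _ _ (by ring), e1, mul_zero, zero_add]
  nlinarith

/-- All triangles are placed in the same plane, with disjoint interiors. -/
structure Dev.Planar (𝔇 : Dev P) : Prop where
  const : ∀ t t' v, 𝔇.D t v = 𝔇.D t' v
  disjoint : ∀ t ∈ P.faces, ∀ t' ∈ P.faces, ∀ z, InT (𝔇.D t) t z → InT (𝔇.D t') t' z → t = t'

-- The three side conditions define an open set, and its points have positive barycentric
-- coordinates, so it is contained in the convex hull.
omit [Fintype V] in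
lemma InT.mem_interior {f : V → EuclideanSpace ℝ (Fin 2)} {a b c : V} (hab : a ≠ b) (hbc : b ≠ c)
    (hac : a ≠ c) {z : Pt} (h : InT (fun v => (f v 0, f v 1)) {a, b, c} z) :
    !₂[z.1, z.2] ∈ interior (convexHull ℝ (f '' (({a, b, c} : Finset V) : Set V))) := by
  set p : V → Pt := fun v => (f v 0, f v 1) with hp
  set k := cr (p a) (p b) (p c) with hk
  let q : EuclideanSpace ℝ (Fin 2) → Pt := fun y => (y 0, y 1)
  have hq : Continuous q := by fun_prop
  set U : Set (EuclideanSpace ℝ (Fin 2)) := {y | 0 < k * cr (p a) (p b) (q y) ∧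
    0 < k * cr (p b) (p c) (q y) ∧ 0 < k * cr (p c) (p a) (q y)} with hU
  have hcr : ∀ A B : Pt, Continuous fun y => k * cr A B (q y) := fun A B => by
    unfold cr; fun_prop
  have hUo : IsOpen U := (isOpen_lt continuous_const (hcr _ _)).inter
    ((isOpen_lt continuous_const (hcr _ _)).inter (isOpen_lt continuous_const (hcr _ _)))
  refine interior_maximal ?_ hUo ?_
  · rintro y ⟨h1, h2, h3⟩
    have k0 : k ≠ 0 := fun h => by rw [h, zero_mul] at h1; exact lt_irrefl _ h1
    have hsum : cr (p a) (p b) (q y) + cr (p b) (p c) (q y) + cr (p c) (p a) (q y) = k := by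
      rw [hk]; unfold cr; ring
    have hw : ∀ x : ℝ, 0 < k * x → 0 ≤ x / k := fun x hx => by
      have : x / k = k * x / k ^ 2 := by field_simp
      rw [this]; positivity
    have hmem : ∀ v ∈ ({a, b, c} : Finset V), f v ∈ convexHull ℝ (f '' (({a, b, c} : Finset V) :
      Set V)) := fun v hv => subset_convexHull ℝ _ ⟨v, hv, rfl⟩
    have := (convex_convexHull ℝ (f '' (({a, b, c} : Finset V) : Set V))).sum_mem
      (t := Finset.univ) (w := ![cr (p b) (p c) (q y) / k, cr (p c) (p a) (q y) / k,
        cr (p a) (p b) (q y) / k]) (z := ![f a, f b, f c]) ?_ ?_ ?_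
    · convert this using 1
      rw [Fin.sum_univ_three]
      ext i
      fin_cases i
      · simp [hp, q, cr]
        field_simp
        rw [hk]; simp [hp, cr]; ring
      · simp [hp, q, cr]
        field_simp
        rw [hk]; simp [hp, cr]; ring
    · intro i _
      fin_cases i
      exacts [hw _ h2, hw _ h3, hw _ h1]
    · rw [Fin.sum_univ_three]
      simp only [Matrix.cons_val_zero, Matrix.cons_val_one, Matrix.cons_val]
      rw [← add_div, ← add_div, div_eq_one_iff_eq k0]
      linarith
    · intro i _
      fin_cases i
      exacts [hmem a (by simp), hmem b (by simp), hmem c (by simp)]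
  · refine ⟨?_, ?_, ?_⟩
    · exact h a (by simp) b (by simp) c (by simp) hab hbc hac
    · have := h b (by simp) c (by simp) a (by simp) hbc hac.symm hab.symm
      rwa [show cr (p b) (p c) (p a) = k by rw [hk]; unfold cr; ring] at this
    · have := h c (by simp) a (by simp) b (by simp) hac.symm hab hbc.symm
      rwa [show cr (p c) (p a) (p b) = k by rw [hk]; unfold cr; ring] at this

theorem exists_dev_of_isPlanar (hP : P.IsPlanar) : ∃ 𝔇 : Dev P, 𝔇.Planar := by
  obtain ⟨f, h1, h2⟩ := hP
  set p : V → Pt := fun v => (f v 0, f v 1) with hp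
  have hpl : ∀ t ∈ P.faces, Placed P p t := by
    intro t ht a ha b hb
    rw [← h1 t ht a ha b hb, EuclideanSpace.dist_eq, Real.sq_sqrt (by positivity),
      Fin.sum_univ_two, Real.dist_eq, Real.dist_eq, sq_abs, sq_abs]
    rfl
  have hdis : ∀ t ∈ P.faces, ∀ t' ∈ P.faces, ∀ z, InT p t z → InT p t' z → t = t' := by
    intro t ht t' ht' z hz hz'
    by_contra hne
    obtain ⟨a, b, c, hab, hac, hbc, e⟩ := Finset.card_eq_three.1 (P.card_face t ht)
    obtain ⟨a', b', c', hab', hac', hbc', e'⟩ := Finset.card_eq_three.1 (P.card_face t' ht')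
    have hd := h2 t ht t' ht' hne
    rw [e] at hz hd
    rw [e'] at hz' hd
    exact Set.disjoint_left.1 hd (InT.mem_interior hab hbc hac hz)
      (InT.mem_interior hab' hbc' hac' hz')
  refine ⟨⟨fun _ => p, fun t ht => hpl t ht, fun _ _ _ _ _ _ _ _ _ _ _ => rfl,
    fun t ht t' ht' a b c c' hab ha hb ha' hb' hne hc hca hcb hc' hca' hcb' => ?_⟩,
    fun _ _ _ => rfl, hdis⟩
  -- Two neighbours on the same side of their common edge would share points close to the midpoint
  -- of this edge.
  by_contra hcon
  have n1 := Placed.nondeg ht (hpl t ht) ha hb hc hab hcb.symm hca.symm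
  have n2 := Placed.nondeg ht' (hpl t' ht') ha' hb' hc' hab hcb'.symm hca'.symm
  have hpos := lt_of_le_of_ne (not_lt.1 hcon) (mul_ne_zero n1 n2).symm
  have e : t = {a, b, c} := by
    obtain ⟨d, d1, d2, d3⟩ := exists_apex ht ha hb hab
    rw [d3] at hc ⊢
    simp only [Finset.mem_insert, Finset.mem_singleton] at hc
    obtain rfl : c = d := by tauto
    rfl
  have e' : t' = {a, b, c'} := by
    obtain ⟨d, d1, d2, d3⟩ := exists_apex ht' ha' hb' hab
    rw [d3] at hc' ⊢
    simp only [Finset.mem_insert, Finset.mem_singleton] at hc'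
    obtain rfl : c' = d := by tauto
    rfl
  have hm : OpenSeg (p a) (p b) ((1 / 2 : ℝ) • p a + (1 / 2 : ℝ) • p b) :=
    ⟨1 / 2, 1 / 2, by norm_num, by norm_num, by norm_num, rfl⟩
  obtain ⟨β, b1, b2⟩ := ((eventually_inT (X := p c) hm (by rw [← sq]; positivity)).and
    (eventually_inT (X := p c) hm (by rw [mul_comm]; exact hpos))).exists
  exact hne (hdis t ht t' ht' _ (e ▸ b1) (e' ▸ b2))

/-! ### Gates -/

/-- A functional that vanishes on the exit edge and is positive on its side of the triangle. -/
noncomputable def gate (𝔇 : Dev P) (s : CState V) : Fn :=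
  (sg s.ε * ((𝔇.D s.face s.r).2 - (𝔇.D s.face s.l).2),
   -(sg s.ε * ((𝔇.D s.face s.r).1 - (𝔇.D s.face s.l).1)),
   -(sg s.ε * (((𝔇.D s.face s.r).2 - (𝔇.D s.face s.l).2) * (𝔇.D s.face s.l).1
    - ((𝔇.D s.face s.r).1 - (𝔇.D s.face s.l).1) * (𝔇.D s.face s.l).2)))

lemma ev_gate (s : CState V) (z : Pt) :
    ev (gate 𝔇 s) z = -(sg s.ε * cr (𝔇.D s.face s.l) (𝔇.D s.face s.r) z) := by
  simp only [ev, gate, cr]; ring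

lemma gate_left (s : CState V) : ev (gate 𝔇 s) (𝔇.D s.face s.l) = 0 := by
  rw [ev_gate]; unfold cr; ring

lemma gate_right (s : CState V) : ev (gate 𝔇 s) (𝔇.D s.face s.r) = 0 := by
  rw [ev_gate]; unfold cr; ring

lemma VInv.gate_pos {s : CState V} (hs : VInv 𝔇 s) {c : V} (hc : c ∈ s.face) (h1 : c ≠ s.l)
    (h2 : c ≠ s.r) : 0 < ev (gate 𝔇 s) (𝔇.D s.face c) := by
  rw [ev_gate]; linarith [hs.behind c hc h1 h2]

lemma VInv.gate_nonneg {s : CState V} (hs : VInv 𝔇 s) {c : V} (hc : c ∈ s.face) :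
    0 ≤ ev (gate 𝔇 s) (𝔇.D s.face c) := by
  by_cases h1 : c = s.l
  · rw [h1, gate_left]
  by_cases h2 : c = s.r
  · rw [h2, gate_right]
  exact (hs.gate_pos hc h1 h2).le

lemma gate_add_dir (s : CState V) (φ : Fn) (X : Pt) (T : ℝ) :
    ev (gate 𝔇 s) (X + T • dir s.ε φ) = ev (gate 𝔇 s) X
      - T * (ev φ (𝔇.D s.face s.l) - ev φ (𝔇.D s.face s.r)) := by
  rw [ev_gate, ev_gate, cr_add_smul_dir]; ring

lemma dir_not (b : Bool) (φ : Fn) : dir (!b) φ = -dir b φ := by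
  ext <;> simp [dir, sg_not]

/-- The open exit edge. -/
def OnEdge (𝔇 : Dev P) (s : CState V) (z : Pt) : Prop :=
  OpenSeg (𝔇.D s.face s.l) (𝔇.D s.face s.r) z

lemma OnEdge.gate_eq {s : CState V} {z : Pt} (h : OnEdge 𝔇 s z) : ev (gate 𝔇 s) z = 0 := by
  obtain ⟨a, b, -, -, hab, rfl⟩ := h
  rw [ev_combo _ _ _ hab, gate_left, gate_right]; ring

lemma Sep.onEdge {φ : Fn} {s : CState V} (h : Sep 𝔇 φ s) : OnEdge 𝔇 s (Yc 𝔇 φ s) :=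
  ⟨_, _, by linarith [h.wr_lt], h.wr_pos, by ring, h.Yc_eq⟩

lemma OnEdge.eventually {s : CState V} (hs : VInv 𝔇 s) {z X : Pt} (h : OnEdge 𝔇 s z)
    (hX : 0 < ev (gate 𝔇 s) X) :
    ∀ᶠ β in 𝓝[>] (0 : ℝ), InT (𝔇.D s.face) s.face ((1 - β) • z + β • X) := by
  obtain ⟨c, c1, c2, c3⟩ := hs.exists_apex
  have hc : c ∈ s.face := by rw [c3]; simp
  have h1 := hs.gate_pos hc c1 c2
  have h2 := mul_pos h1 hX
  rw [ev_gate, ev_gate] at h2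
  have := eventually_inT (p := 𝔇.D s.face) (c := c) (X := X) h (by
    linear_combination h2 + (cr (𝔇.D s.face s.l) (𝔇.D s.face s.r) (𝔇.D s.face c) *
      cr (𝔇.D s.face s.l) (𝔇.D s.face s.r) X) * sg_sq s.ε)
  rwa [← c3] at this

/-- The gate of `s` is nonnegative on the triangle. If it vanishes at an inner point of another
edge, it vanishes at both ends of that edge. -/
lemma OnEdge.edge_eq {s s' : CState V} (hs : VInv 𝔇 s) (hs' : VInv 𝔇 s') (hf : s.face = s'.face)
    {z : Pt} (h : OnEdge 𝔇 s z) (h' : OnEdge 𝔇 s' z) : s.edge = s'.edge := by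
  have hl : s'.l ∈ s.face := hf ▸ hs'.l_mem
  have hr : s'.r ∈ s.face := hf ▸ hs'.r_mem
  have h0 := h.gate_eq
  obtain ⟨a, b, ha, hb, hab, rfl⟩ := h'
  rw [ev_combo _ _ _ hab, ← hf] at h0
  have g1 := hs.gate_nonneg hl
  have g2 := hs.gate_nonneg hr
  have key : ∀ {x}, x ∈ s.face → ev (gate 𝔇 s) (𝔇.D s.face x) = 0 → x ∈ s.edge := by
    intro x hx h0
    by_contra hcon
    simp only [CState.edge, Finset.mem_insert, Finset.mem_singleton, not_or] at hcon
    exact (hs.gate_pos hx hcon.1 hcon.2).ne' h0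
  refine (Finset.eq_of_subset_of_card_le (fun x hx => ?_)
    (by rw [hs.edge_card, hs'.edge_card])).symm
  simp only [CState.edge, Finset.mem_insert, Finset.mem_singleton] at hx
  rcases hx with rfl | rfl
  · exact key hl (by nlinarith)
  · exact key hr (by nlinarith)

/-- Moving slightly from `z` towards `X` leads into both triangles, which therefore coincide. -/
lemma Dev.Planar.edge_eq (hpl : 𝔇.Planar) {s s' : CState V} (hs : VInv 𝔇 s) (hs' : VInv 𝔇 s')
    {z X : Pt} (h : OnEdge 𝔇 s z) (h' : OnEdge 𝔇 s' z) (hX : 0 < ev (gate 𝔇 s) X)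
    (hX' : 0 < ev (gate 𝔇 s') X) : s.edge = s'.edge := by
  obtain ⟨β, b1, b2⟩ := ((h.eventually hs hX).and (h'.eventually hs' hX')).exists
  exact h.edge_eq hs hs' (hpl.disjoint _ hs.face_mem _ hs'.face_mem _ b1 b2) h'

/-! ### Points on chords -/

/-- `z` lies in an open triangle or on an open interior edge. -/
def Good (𝔇 : Dev P) (z : Pt) : Prop := (∃ t ∈ P.faces, InT (𝔇.D t) t z) ∨
  ∃ s t', VInv 𝔇 s ∧ VInv 𝔇 ⟨t', s.l, s.r, !s.ε⟩ ∧ ¬ P.IsBoundaryEdge s.edge ∧ OnEdge 𝔇 s z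

/-- Just in front of a boundary edge one is in its triangle. If `z` were in an open triangle, it
would be this one, which does not contain its edges. If `z` were on an interior edge, one of the two
triangles there would contain nearby points in front, and the edges would coincide. -/
lemma Dev.Planar.not_good (hpl : 𝔇.Planar) {s : CState V} (hs : VInv 𝔇 s)
    (hb : P.IsBoundaryEdge s.edge) {z : Pt} (h : OnEdge 𝔇 s z) : ¬ Good 𝔇 z := by
  obtain ⟨c, c1, c2, c3⟩ := hs.exists_apex
  have hc : c ∈ s.face := by rw [c3]; simp
  have hg := hs.gate_pos hc c1 c2
  rintro (⟨t, ht, hz⟩ | ⟨s', t', hs', ht', hn, hz⟩)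
  · obtain ⟨β, b1, b2⟩ := ((h.eventually hs hg).and (hz.eventually _)).exists
    obtain rfl := hpl.disjoint _ hs.face_mem _ ht _ b1 b2
    have h1 := hz _ hs.l_mem _ hs.r_mem _ hc hs.ne c2.symm c1.symm
    have h2 := h.gate_eq
    rw [ev_gate, neg_eq_zero, mul_eq_zero] at h2
    rw [h2.resolve_left (sg_ne _), mul_zero] at h1
    exact lt_irrefl _ h1
  · set s'' : CState V := ⟨t', s'.l, s'.r, !s'.ε⟩ with hs''
    have hgg : ∀ X, ev (gate 𝔇 s'') X = - ev (gate 𝔇 s') X := fun X => by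
      rw [ev_gate, ev_gate, hpl.const s''.face s'.face, hpl.const s''.face s'.face]
      simp only [hs'', sg_not]; ring
    have hz'' : OnEdge 𝔇 s'' z := by
      unfold OnEdge
      rw [hpl.const s''.face s'.face, hpl.const s''.face s'.face]
      exact hz
    -- The direction of approach has to avoid the line of the interior edge, so that it selects one
    -- of its two sides.
    obtain ⟨X, x1, x2⟩ : ∃ X, 0 < ev (gate 𝔇 s) X ∧ ev (gate 𝔇 s') X ≠ 0 := by
      by_cases h0 : ev (gate 𝔇 s') (𝔇.D s.face c) = 0
      · obtain ⟨d, d1, d2, d3⟩ := hs'.exists_apex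
        have hd := hs'.gate_pos (c := d) (by rw [d3]; simp) d1 d2
        obtain ⟨β, b1, b2⟩ := ((eventually_add_pos (x := ev (gate 𝔇 s) (𝔇.D s'.face d)
          - ev (gate 𝔇 s) (𝔇.D s.face c)) hg).and self_mem_nhdsWithin).exists
        have b2 : 0 < β := b2
        refine ⟨(1 - β) • 𝔇.D s.face c + β • 𝔇.D s'.face d, ?_, ?_⟩
        · rw [ev_combo _ _ _ (by ring)]; linarith
        · rw [ev_combo _ _ _ (by ring), h0, mul_zero, zero_add]
          exact (mul_pos b2 hd).ne'
      · exact ⟨_, hg, h0⟩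
    rcases lt_or_gt_of_ne x2 with hlt | hlt
    · have := hpl.edge_eq hs ht' h hz'' x1 (by rw [hgg]; linarith)
      rw [this] at hb
      exact hn hb
    · have := hpl.edge_eq hs hs' h hz x1 hlt
      rw [this] at hb
      exact hn hb

/-- Zeros of a functional differ by a multiple of its direction. -/
lemma exists_dir_smul (b : Bool) {φ : Fn} (h : gsq φ ≠ 0) {A B : Pt} (hA : ev φ A = 0)
    (hB : ev φ B = 0) : ∃ T : ℝ, B = A + T • dir b φ := by
  have hs := sg_sq b
  have e : φ.1 * (B.1 - A.1) + φ.2.1 * (B.2 - A.2) = 0 := by unfold ev at hA hB; linarith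
  refine ⟨sg b * (φ.2.1 * (B.1 - A.1) - φ.1 * (B.2 - A.2)) / gsq φ, ?_⟩
  have hgs : gsq φ = φ.1 ^ 2 + φ.2.1 ^ 2 := rfl
  ext
  · simp only [dir, Prod.fst_add, Prod.smul_fst, smul_eq_mul]
    field_simp
    rw [hgs, hs]
    linear_combination φ.1 * e
  · simp only [dir, Prod.snd_add, Prod.smul_snd, smul_eq_mul]
    field_simp
    rw [hgs, hs]
    linear_combination φ.2.1 * e

lemma Sep.gsq_ne {φ : Fn} {s : CState V} (h : Sep 𝔇 φ s) : gsq φ ≠ 0 := by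
  intro h0
  have g := abs_le_of_gsq_le (G := 0) le_rfl (by rw [h0]; norm_num)
  have e1 := abs_nonpos_iff.1 g.1
  have e2 := abs_nonpos_iff.1 g.2
  obtain ⟨h1, h2⟩ := h
  simp only [ev, e1, e2] at h1 h2
  linarith

lemma CStep.exists_advance {s s' : CState V} (h : CStep P s s') (hs : VInv 𝔇 s) (hs' : VInv 𝔇 s')
    {φ : Fn} (hS : Sep 𝔇 φ s) (hS' : Sep 𝔇 φ s') : ∃ T : ℝ, 0 < T ∧
      Yc 𝔇 φ s' = Yc 𝔇 φ s + T • dir s'.ε φ ∧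
      ∀ σ, 0 < σ → σ < T → InT (𝔇.D s'.face) s'.face (Yc 𝔇 φ s + σ • dir s'.ε φ) := by
  obtain ⟨T, hT⟩ := exists_dir_smul s'.ε hS.gsq_ne hS.ev_Yc hS'.ev_Yc
  have hY := hS.Yc_eq
  rw [← h.D_l hs hs', ← h.D_r hs hs'] at hY
  have hY' := hS'.Yc_eq
  set w := wr 𝔇 φ s
  set w' := wr 𝔇 φ s'
  have w1 : 0 < w := hS.wr_pos
  have w2 : w < 1 := hS.wr_lt
  have w1' : 0 < w' := hS'.wr_pos
  have w2' : w' < 1 := hS'.wr_lt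
  have hSl := hS.1
  have hSr := hS.2
  rw [← h.D_l hs hs'] at hSl
  rw [← h.D_r hs hs'] at hSr
  have e := cr_add_smul_dir s'.ε φ (𝔇.D s'.face s.l) (𝔇.D s'.face s.r) (Yc 𝔇 φ s) T
  have e0 : cr (𝔇.D s'.face s.l) (𝔇.D s'.face s.r) (Yc 𝔇 φ s) = 0 := by
    rw [hY, cr_combo _ _ _ _ _ _ (by ring)]; unfold cr; ring
  rw [← hT, e0, mul_zero, zero_add] at e
  have hmid : ∀ σ : ℝ, T ≠ 0 → Yc 𝔇 φ s + σ • dir s'.ε φ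
      = (1 - σ / T) • Yc 𝔇 φ s + (σ / T) • Yc 𝔇 φ s' := fun σ h0 => by
    rw [hT, smul_add, smul_smul, div_mul_cancel₀ _ h0, sub_smul, one_smul]; abel
  have cl : cr (𝔇.D s'.face s.l) (𝔇.D s'.face s.r) (𝔇.D s'.face s.l) = 0 := by unfold cr; ring
  have cr0 : cr (𝔇.D s'.face s.l) (𝔇.D s'.face s.r) (𝔇.D s'.face s.r) = 0 := by unfold cr; ring
  rcases h.mem_cases hs hs' with ⟨t1, t2, t3, t4⟩ | ⟨t1, t2, t3, t4⟩
  · have ha := h.ahead hs hs' hs'.r_mem t3 t2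
    rw [t1] at hY'
    have hT0 : 0 < T := by
      rw [hY', cr_combo _ _ _ _ _ _ (by ring), cl] at e
      have : 0 < T * (ev φ (𝔇.D s'.face s.l) - ev φ (𝔇.D s'.face s.r)) := by
        rw [← e]
        have := mul_pos w1' ha
        linarith
      exact pos_of_mul_pos_left this (by linarith)
    refine ⟨T, hT0, hT, fun σ h1 h2 => ?_⟩
    have m1 : 0 < σ / T := div_pos h1 hT0
    have m2 : σ / T < 1 := (div_lt_one hT0).2 h2
    have := InT.of_bary (p := 𝔇.D s'.face) (a := s.l) (b := s.r) (c := s'.r)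
      (𝔇.nondeg hs'.face_mem h.l_mem h.r_mem hs'.r_mem hs.ne t2.symm t3.symm)
      (α := (1 - σ / T) * (1 - w) + σ / T * (1 - w')) (β := (1 - σ / T) * w) (γ := σ / T * w')
      (by have := mul_pos (sub_pos.2 m2) (sub_pos.2 w2); have := mul_pos m1 (sub_pos.2 w2'); linarith)
      (mul_pos (by linarith) w1) (mul_pos m1 w1') (by ring)
    rw [← t4] at this
    rw [hmid σ hT0.ne', hY, hY']
    convert this using 1
    module
  · have ha := h.ahead hs hs' hs'.l_mem t2 t3
    rw [t1] at hY'
    have hT0 : 0 < T := by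
      rw [hY', cr_combo _ _ _ _ _ _ (by ring), cr0] at e
      have : 0 < T * (ev φ (𝔇.D s'.face s.l) - ev φ (𝔇.D s'.face s.r)) := by
        rw [← e]
        have := mul_pos (sub_pos.2 w2') ha
        linarith
      exact pos_of_mul_pos_left this (by linarith)
    refine ⟨T, hT0, hT, fun σ h1 h2 => ?_⟩
    have m1 : 0 < σ / T := div_pos h1 hT0
    have m2 : σ / T < 1 := (div_lt_one hT0).2 h2
    have := InT.of_bary (p := 𝔇.D s'.face) (a := s.l) (b := s.r) (c := s'.l)
      (𝔇.nondeg hs'.face_mem h.l_mem h.r_mem hs'.l_mem hs.ne t3.symm t2.symm)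
      (α := (1 - σ / T) * (1 - w)) (β := (1 - σ / T) * w + σ / T * w') (γ := σ / T * (1 - w'))
      (mul_pos (by linarith) (by linarith))
      (by have := mul_pos (sub_pos.2 m2) w1; have := mul_pos m1 w1'; linarith)
      (mul_pos m1 (by linarith)) (by ring)
    rw [← t4] at this
    rw [hmid σ hT0.ne', hY, hY']
    convert this using 1
    module

lemma SChain.exists_param {φ : Fn} {c : ℕ → CState V} {n : ℕ} (h : SChain 𝔇 φ c (n + 1)) :
    ∃ T : ℝ, 0 < T ∧ Yc 𝔇 φ (c (n + 1)) = Yc 𝔇 φ (c 0) + T • dir (c 1).ε φ ∧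
      ∀ σ, 0 < σ → σ < T → Good 𝔇 (Yc 𝔇 φ (c 0) + σ • dir (c 1).ε φ) := by
  have hv := h.chain.inv
  have hs := h.chain.step
  suffices key : ∀ k ≤ n, ∃ T : ℝ, 0 < T ∧
      Yc 𝔇 φ (c (k + 1)) = Yc 𝔇 φ (c 0) + T • dir (c 1).ε φ ∧
      ∀ σ, 0 < σ → σ < T → Good 𝔇 (Yc 𝔇 φ (c 0) + σ • dir (c 1).ε φ) from key n le_rfl
  intro k
  induction k with
  | zero =>
    intro hk
    obtain ⟨T, h1, h2, h3⟩ := (hs 0 (by omega)).exists_advance (hv _ (by omega)) (hv _ (by omega))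
      (h.sep 0 (by omega)) (h.sep 1 (by omega))
    exact ⟨T, h1, h2, fun σ s1 s2 => Or.inl ⟨_, (hv 1 (by omega)).face_mem, h3 σ s1 s2⟩⟩
  | succ k ih =>
    intro hk
    obtain ⟨T, h1, h2, h3⟩ := ih (by omega)
    obtain ⟨T', h1', h2', h3'⟩ := (hs (k + 1) (by omega)).exists_advance (hv _ (by omega))
      (hv _ (by omega)) (h.sep (k + 1) (by omega)) (h.sep (k + 2) (by omega))
    rw [h.orient (k + 1) hk] at h2' h3'
    refine ⟨T + T', by linarith, by rw [h2', h2, add_smul, add_assoc], fun σ s1 s2 => ?_⟩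
    rcases lt_trichotomy σ T with hlt | rfl | hlt
    · exact h3 σ s1 hlt
    · right
      rw [← h2]
      have st := hs (k + 1) (by omega)
      refine ⟨c (k + 1), (c (k + 2)).face, hv _ (by omega), ⟨(hv (k + 2) (by omega)).face_mem,
        st.l_mem, st.r_mem, (hv (k + 1) (by omega)).ne, fun x hx x1 x2 => ?_⟩,
        h.int _ (by omega) (by omega), (h.sep _ (by omega)).onEdge⟩
      have := st.ahead (hv _ (by omega)) (hv (k + 2) (by omega)) hx x1 x2
      rw [(st.int (h.int _ (by omega) (by omega))).2] at this
      simp only [sg_not]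
      linarith
    · left
      refine ⟨_, (hv (k + 2) (by omega)).face_mem, ?_⟩
      have := h3' (σ - T) (by linarith) (by linarith)
      rw [h2] at this
      convert this using 1
      module

lemma SChain.gate_dir {φ : Fn} {c : ℕ → CState V} {n : ℕ} (h : SChain 𝔇 φ c (n + 1)) (X : Pt)
    (T : ℝ) : ev (gate 𝔇 (c 0)) (X + T • dir (c 1).ε φ) = ev (gate 𝔇 (c 0)) X + T * aa 𝔇 φ (c 0) ∧
      ev (gate 𝔇 (c (n + 1))) (X + T • dir (c 1).ε φ)
        = ev (gate 𝔇 (c (n + 1))) X - T * aa 𝔇 φ (c (n + 1)) := by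
  constructor
  · rw [((h.chain.step 0 (by omega)).bd h.bd).2, dir_not, smul_neg, ← neg_smul, gate_add_dir, aa]
    ring
  · rw [← h.orient n le_rfl, gate_add_dir, aa]

/-- Along the chord the gate of the first edge increases from zero and the gate of the last edge
decreases to zero. -/
lemma SChain.gate_ends {φ : Fn} {c : ℕ → CState V} {n : ℕ} (h : SChain 𝔇 φ c (n + 1)) :
    0 < ev (gate 𝔇 (c (n + 1))) (Yc 𝔇 φ (c 0)) ∧ 0 < ev (gate 𝔇 (c 0)) (Yc 𝔇 φ (c (n + 1))) := by
  obtain ⟨T, h1, h2, -⟩ := h.exists_param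
  have a0 := (h.sep 0 (by omega)).aa_pos
  have a1 := (h.sep (n + 1) le_rfl).aa_pos
  have g0 := (h.sep 0 (by omega)).onEdge.gate_eq
  have g1 := (h.sep (n + 1) le_rfl).onEdge.gate_eq
  have e := h.gate_dir (Yc 𝔇 φ (c 0)) T
  rw [← h2, g0, g1] at e
  exact ⟨by nlinarith [mul_pos h1 a1], by rw [e.1]; nlinarith [mul_pos h1 a0]⟩

/-- Points of the line between the ends of a chord. -/
lemma SChain.good {φ : Fn} {c : ℕ → CState V} {n : ℕ} (h : SChain 𝔇 φ c (n + 1)) {z : Pt}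
    (hz : ev φ z = 0) (h0 : 0 < ev (gate 𝔇 (c 0)) z) (h1 : 0 < ev (gate 𝔇 (c (n + 1))) z) :
    Good 𝔇 z := by
  obtain ⟨T, t1, t2, t3⟩ := h.exists_param
  have s0 := h.sep 0 (by omega)
  have s1 := h.sep (n + 1) le_rfl
  obtain ⟨σ, rfl⟩ := exists_dir_smul (c 1).ε s0.gsq_ne s0.ev_Yc hz
  have e0 := (h.gate_dir (Yc 𝔇 φ (c 0)) σ).1
  have e1 := (h.gate_dir (Yc 𝔇 φ (c 0)) σ).2
  have e2 := (h.gate_dir (Yc 𝔇 φ (c 0)) T).2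
  rw [← t2, s1.onEdge.gate_eq] at e2
  rw [e0, s0.onEdge.gate_eq, zero_add] at h0
  rw [e1] at h1
  refine t3 σ (pos_of_mul_pos_left h0 s0.aa_pos.le) ?_
  by_contra hcon
  nlinarith [mul_le_mul_of_nonneg_right (not_lt.1 hcon) s1.aa_pos.le]

/-! ### Chords of planar polygons -/

lemma SChain.start_eq {φ φ' : Fn} {c c' : ℕ → CState V} {n n' : ℕ} (h : SChain 𝔇 φ c (n + 1))
    (h' : SChain 𝔇 φ' c' (n' + 1)) (he : (c 0).edge = (c' 0).edge) (hε : (c 1).ε = (c' 1).ε) :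
    c 0 = c' 0 := by
  have v := h.chain.inv 0 (by omega)
  have v' := h'.chain.inv 0 (by omega)
  refine v.eq_of_orient v' he (face_eq_of_bd v v' he h.bd) ?_
  have e := ((h.chain.step 0 (by omega)).bd h.bd).2
  have e' := ((h'.chain.step 0 (by omega)).bd h'.bd).2
  rw [zero_add] at e e'
  rw [e, e'] at hε
  simpa using hε

lemma SChain.end_eq {φ φ' : Fn} {c c' : ℕ → CState V} {n n' : ℕ} (h : SChain 𝔇 φ c (n + 1))
    (h' : SChain 𝔇 φ' c' (n' + 1)) (hb : P.IsBoundaryEdge (c (n + 1)).edge)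
    (he : (c (n + 1)).edge = (c' (n' + 1)).edge) (hε : (c 1).ε = (c' 1).ε) :
    c (n + 1) = c' (n' + 1) := by
  have v := h.chain.inv _ le_rfl
  have v' := h'.chain.inv _ le_rfl
  refine v.eq_of_orient v' he (face_eq_of_bd v v' he hb) ?_
  rw [h.orient n le_rfl, h'.orient n' le_rfl, hε]

/-- A point of the line through the exit edge lies in the open edge if it is between two lines
that cross the edge. -/
lemma Sep.onEdge_of_between {x x' : Fn} {s : CState V} (hx : Sep 𝔇 x s) (hx' : Sep 𝔇 x' s)
    {W : Pt} (h0 : ev (gate 𝔇 s) W = 0) (h1 : ev x W ≤ 0) (h2 : 0 ≤ ev x' W) : OnEdge 𝔇 s W := by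
  have ha := hx.aa_pos
  rw [ev_gate, neg_eq_zero, mul_eq_zero] at h0
  have hc := h0.resolve_left (sg_ne _)
  unfold OnEdge
  unfold aa at ha
  obtain ⟨hl, -⟩ := hx
  obtain ⟨hl', hr'⟩ := hx'
  set L := 𝔇.D s.face s.l
  set R := 𝔇.D s.face s.r
  set σ := (ev x L - ev x W) / (ev x L - ev x R) with hσ
  have hW : W = (1 - σ) • L + σ • R := by
    have e : σ * (ev x L - ev x R) = ev x L - ev x W := div_mul_cancel₀ _ ha.ne'
    unfold cr at hc
    unfold ev at e ha
    ext
    · simp only [Prod.fst_add, Prod.smul_fst, smul_eq_mul]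
      refine mul_left_cancel₀ ha.ne' ?_
      linear_combination (R.1 - L.1) * (-e) + x.2.1 * hc
    · simp only [Prod.snd_add, Prod.smul_snd, smul_eq_mul]
      refine mul_left_cancel₀ ha.ne' ?_
      linear_combination (R.2 - L.2) * (-e) - x.1 * hc
  have s0 : 0 < σ := div_pos (by linarith) ha
  refine ⟨1 - σ, σ, ?_, s0, by ring, hW⟩
  rw [hW, ev_combo _ _ _ (by ring)] at h2
  by_contra hcon
  nlinarith [mul_neg_of_pos_of_neg s0 hr', mul_nonneg (neg_nonneg.2 (not_lt.1 hcon)) hl'.le]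

lemma Sep.wr_mono {x z : Fn} {s : CState V} (hx : Sep 𝔇 x s) (hz : Sep 𝔇 z s)
    (hl : ev x (𝔇.D s.face s.l) ≤ ev z (𝔇.D s.face s.l))
    (hr : ev x (𝔇.D s.face s.r) ≤ ev z (𝔇.D s.face s.r)) : wr 𝔇 x s ≤ wr 𝔇 z s := by
  unfold wr
  rw [div_le_div_iff₀ hx.aa_pos hz.aa_pos]
  unfold aa
  have := mul_le_mul hl (neg_le_neg hr) (neg_nonneg.2 hz.2.le) hz.1.le
  linarith

/-- A half plane that contains two points of an edge contains the points between. -/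
lemma Sep.pos_of_between {x z x' : Fn} {s : CState V} (hs : VInv 𝔇 s) (hx : Sep 𝔇 x s)
    (hz : Sep 𝔇 z s) (hx' : Sep 𝔇 x' s) (h1 : BelowEq 𝔇 x z) (h2 : BelowEq 𝔇 z x') {g : Fn}
    (g1 : 0 < ev g (Yc 𝔇 x s)) (g2 : 0 < ev g (Yc 𝔇 x' s)) : 0 < ev g (Yc 𝔇 z s) := by
  have w1 := hx.wr_mono hz (h1 _ hs.face_mem _ hs.l_mem) (h1 _ hs.face_mem _ hs.r_mem)
  have w2 := hz.wr_mono hx' (h2 _ hs.face_mem _ hs.l_mem) (h2 _ hs.face_mem _ hs.r_mem)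
  rw [hx.Yc_eq, ev_combo _ _ _ (by ring)] at g1
  rw [hx'.Yc_eq, ev_combo _ _ _ (by ring)] at g2
  rw [hz.Yc_eq, ev_combo _ _ _ (by ring)]
  rcases le_total (ev g (𝔇.D s.face s.l)) (ev g (𝔇.D s.face s.r)) with h | h
  · nlinarith [mul_nonneg (sub_nonneg.2 w1) (sub_nonneg.2 h)]
  · nlinarith [mul_nonneg (sub_nonneg.2 w2) (sub_nonneg.2 h)]

lemma BelowEq.ev_Yc_nonpos {x z : Fn} {s : CState V} (hs : VInv 𝔇 s) (h : BelowEq 𝔇 x z)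
    (hz : Sep 𝔇 z s) : ev x (Yc 𝔇 z s) ≤ 0 := by
  rw [← hz.ev_Yc, hz.Yc_eq, ev_combo _ _ _ (by ring), ev_combo _ _ _ (by ring)]
  exact add_le_add
    (mul_le_mul_of_nonneg_left (h _ hs.face_mem _ hs.l_mem) (by linarith [hz.wr_lt]))
    (mul_le_mul_of_nonneg_left (h _ hs.face_mem _ hs.r_mem) hz.wr_pos.le)

lemma BelowEq.ev_Yc_nonneg {x z : Fn} {s : CState V} (hs : VInv 𝔇 s) (h : BelowEq 𝔇 z x)
    (hz : Sep 𝔇 z s) : 0 ≤ ev x (Yc 𝔇 z s) := by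
  rw [← hz.ev_Yc, hz.Yc_eq, ev_combo _ _ _ (by ring), ev_combo _ _ _ (by ring)]
  exact add_le_add
    (mul_le_mul_of_nonneg_left (h _ hs.face_mem _ hs.l_mem) (by linarith [hz.wr_lt]))
    (mul_le_mul_of_nonneg_left (h _ hs.face_mem _ hs.r_mem) hz.wr_pos.le)

lemma exists_combo_eq_zero {g : Fn} {A B : Pt} (hA : ev g A ≤ 0) (hB : 0 ≤ ev g B) :
    ∃ s t : ℝ, 0 ≤ s ∧ 0 ≤ t ∧ s + t = 1 ∧ ev g (s • A + t • B) = 0 := by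
  by_cases h : ev g B - ev g A = 0
  · exact ⟨1, 0, zero_le_one, le_rfl, by ring, by rw [ev_combo _ _ _ (by ring)]; linarith⟩
  · have h' : 0 < ev g B - ev g A := lt_of_le_of_ne (by linarith) (Ne.symm h)
    have e : ev g B / (ev g B - ev g A) + -ev g A / (ev g B - ev g A) = 1 := by
      field_simp; ring
    refine ⟨_, _, div_nonneg hB h'.le, div_nonneg (neg_nonneg.2 hA) h'.le, e, ?_⟩
    rw [ev_combo _ _ _ e]
    field_simp
    ring

/-- A chord does not cross a boundary edge between two lines that cross this edge. -/
lemma SChain.gate_nonneg (hpl : 𝔇.Planar) {ζ x x' : Fn} {c : ℕ → CState V} {n : ℕ}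
    (h : SChain 𝔇 ζ c (n + 1)) {s : CState V} (hs : VInv 𝔇 s) (hb : P.IsBoundaryEdge s.edge)
    (hx : Sep 𝔇 x s) (hx' : Sep 𝔇 x' s) (hg : 0 < ev (gate 𝔇 s) (Yc 𝔇 ζ (c 0)))
    (h1 : BelowEq 𝔇 x ζ) (h2 : BelowEq 𝔇 ζ x') :
    0 ≤ ev (gate 𝔇 s) (Yc 𝔇 ζ (c (n + 1))) := by
  by_contra hcon
  have hcon := not_le.1 hcon
  obtain ⟨a, b, ha, hb', hab, h0⟩ := exists_combo_eq_zero hcon.le hg.le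
  have v0 := h.chain.inv 0 (by omega)
  have v1 := h.chain.inv _ le_rfl
  have s0 := h.sep 0 (by omega)
  have s1 := h.sep _ le_rfl
  have hapos : 0 < a := by
    refine lt_of_le_of_ne ha fun h => ?_
    obtain rfl : b = 1 := by linarith
    rw [ev_combo _ _ _ hab, ← h] at h0
    linarith
  have hbpos : 0 < b := by
    refine lt_of_le_of_ne hb' fun h => ?_
    obtain rfl : a = 1 := by linarith
    rw [ev_combo _ _ _ hab, ← h] at h0
    linarith
  refine hpl.not_good hs hb (hx.onEdge_of_between hx' h0 ?_ ?_) (h.good ?_ ?_ ?_)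
  · rw [ev_combo _ _ _ hab]
    nlinarith [mul_nonneg ha (neg_nonneg.2 (h1.ev_Yc_nonpos v1 s1)),
      mul_nonneg hb' (neg_nonneg.2 (h1.ev_Yc_nonpos v0 s0))]
  · rw [ev_combo _ _ _ hab]
    exact add_nonneg (mul_nonneg ha (h2.ev_Yc_nonneg v1 s1)) (mul_nonneg hb' (h2.ev_Yc_nonneg v0 s0))
  · rw [ev_combo _ _ _ hab, s0.ev_Yc, s1.ev_Yc]; ring
  · rw [ev_combo _ _ _ hab, s0.onEdge.gate_eq]
    nlinarith [mul_pos hapos h.gate_ends.2]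
  · rw [ev_combo _ _ _ hab, s1.onEdge.gate_eq]
    nlinarith [mul_pos hbpos h.gate_ends.1]

lemma OnEdge.combo {s : CState V} {A B : Pt} (hA : OnEdge 𝔇 s A) (hB : OnEdge 𝔇 s B) {a b : ℝ}
    (ha : 0 ≤ a) (hb : 0 ≤ b) (hab : a + b = 1) : OnEdge 𝔇 s (a • A + b • B) := by
  obtain ⟨p, q, hp, hq, hpq, rfl⟩ := hA
  obtain ⟨p', q', hp', hq', hpq', rfl⟩ := hB
  have key : ∀ {u v : ℝ}, 0 < u → 0 < v → 0 < a * u + b * v := fun {u v} hu hv => by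
    rcases ha.eq_or_lt with h | h
    · obtain rfl : b = 1 := by linarith
      rw [← h]; linarith
    · exact add_pos_of_pos_of_nonneg (mul_pos h hu) (mul_nonneg hb hv.le)
  refine ⟨a * p + b * p', a * q + b * q', key hp hp', key hq hq', ?_, by module⟩
  linear_combination a * hpq + b * hpq' + hab

/-- The chords `z` and `z₁` cannot run through the boundary edges at each other's end. So each ends
on the front side of the other's last edge, and this makes the two last edges share a point with a
common front side. -/
theorem Dev.Planar.stag (hpl : 𝔇.Planar) : Stag 𝔇 := by
  rintro ε a b d x x' z y y' z₁ ⟨cx, nx, hx, x1, x2, x3⟩ ⟨cx', nx', hx', x1', x2', x3'⟩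
    ⟨cz, nz, hz, z1, z2, z3⟩ ⟨cy, ny, hy, y1, y2, y3⟩ ⟨cy', ny', hy', y1', y2', y3'⟩
    ⟨cw, nw, hw, w1, w2, w3⟩ l1 l2 l3 l4 l5 l6
  have ex := hx.start_eq hz (x1.trans z1.symm) (x3.trans z3.symm)
  have ex' := hx'.start_eq hz (x1'.trans z1.symm) (x3'.trans z3.symm)
  have ey := hy.start_eq hz (y1.trans z1.symm) (y3.trans z3.symm)
  have ey' := hy'.start_eq hz (y1'.trans z1.symm) (y3'.trans z3.symm)
  have ew := hw.start_eq hz (w1.trans z1.symm) (w3.trans z3.symm)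
  have fx := hx.end_eq hz (x2 ▸ b.2) (x2.trans z2.symm) (x3.trans z3.symm)
  have fx' := hx'.end_eq hz (x2' ▸ b.2) (x2'.trans z2.symm) (x3'.trans z3.symm)
  have fy := hy.end_eq hw (y2 ▸ d.2) (y2.trans w2.symm) (y3.trans w3.symm)
  have fy' := hy'.end_eq hw (y2' ▸ d.2) (y2'.trans w2.symm) (y3'.trans w3.symm)
  have gx := hx.gate_ends.1
  have gx' := hx'.gate_ends.1
  have gz := hz.gate_ends.1
  have gy := hy.gate_ends.1
  have gy' := hy'.gate_ends.1
  have gw := hw.gate_ends.1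
  have vA := hz.chain.inv 0 (by omega)
  have vB := hz.chain.inv _ le_rfl
  have vC := hw.chain.inv _ le_rfl
  have Ax := hx.sep 0 (by omega)
  have Ax' := hx'.sep 0 (by omega)
  have Az := hz.sep 0 (by omega)
  have Ay := hy.sep 0 (by omega)
  have Ay' := hy'.sep 0 (by omega)
  have Aw := hw.sep 0 (by omega)
  have Bx := hx.sep _ le_rfl
  have Bx' := hx'.sep _ le_rfl
  have Bz := hz.sep _ le_rfl
  have Cy := hy.sep _ le_rfl
  have Cy' := hy'.sep _ le_rfl
  have Cw := hw.sep _ le_rfl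
  have oB : (cz (nz + 1)).ε = ε := (hz.orient nz le_rfl).trans z3
  have oC : (cw (nw + 1)).ε = ε := (hw.orient nw le_rfl).trans w3
  have bB : P.IsBoundaryEdge (cz (nz + 1)).edge := z2 ▸ b.2
  have bC : P.IsBoundaryEdge (cw (nw + 1)).edge := w2 ▸ d.2
  -- On the starting edge `z₁` begins between `x` and `x'`, which both begin in front of the last
  -- edge of `z`.
  have nB : 0 < ev (gate 𝔇 (cz (nz + 1))) (Yc 𝔇 z₁ (cw 0)) := by
    rw [ex, fx] at gx
    rw [ex', fx'] at gx'
    rw [ex] at Ax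
    rw [ex'] at Ax'
    rw [ew] at Aw ⊢
    exact Ax.pos_of_between vA Aw Ax' l1.le l2.le gx gx'
  have nC : 0 < ev (gate 𝔇 (cw (nw + 1))) (Yc 𝔇 z (cz 0)) := by
    rw [ey, fy] at gy
    rw [ey', fy'] at gy'
    rw [ey] at Ay
    rw [ey'] at Ay'
    exact Ay.pos_of_between vA Az Ay' l3.le l4.le gy gy'
  rw [fx] at Bx
  rw [fx'] at Bx'
  rw [fy] at Cy
  rw [fy'] at Cy'
  have pB := hw.gate_nonneg hpl vB bB Bx Bx' nB l1.le l2.le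
  have pC := hz.gate_nonneg hpl vC bC Cy Cy' nC l3.le l4.le
  set B := cz (nz + 1)
  set C := cw (nw + 1)
  -- The prolonged line `z` also crosses the last edge of `z₁`, because it lies between `y` and
  -- `y'`.
  have Cz : Sep 𝔇 z C := ⟨Cy.1.trans (l3 _ vC.face_mem _ vC.l_mem),
    (l4 _ vC.face_mem _ vC.r_mem).trans Cy'.2⟩
  obtain ⟨T, hT⟩ := exists_dir_smul ε Bz.gsq_ne Bz.ev_Yc Cz.ev_Yc
  have eB := gate_add_dir (𝔇 := 𝔇) B z (Yc 𝔇 z B) T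
  have eC := gate_add_dir (𝔇 := 𝔇) C z (Yc 𝔇 z C) (-T)
  rw [oB, ← hT, Bz.onEdge.gate_eq] at eB
  rw [oC, hT, add_assoc, ← add_smul, add_neg_cancel, zero_smul, add_zero, ← hT,
    Cz.onEdge.gate_eq] at eC
  have aB := Bz.aa_pos
  have aC := Cz.aa_pos
  unfold aa at aB aC
  -- By `pC` the chord `z` has not yet passed the line of `C` when it ends, so it meets `C` at or
  -- after `B`, hence not in front of `B`.
  have hT0 : 0 ≤ T := by
    by_contra hcon
    nlinarith [mul_pos (neg_pos.2 (not_le.1 hcon)) aC]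
  -- On the edge `C` the crossing with `z` is not in front of `B`, while the crossing with `z₁` is
  -- not behind it. A point between them is on the line of `B`, and being between `x` and `x'` it is
  -- on the open edge.
  obtain ⟨p, q, hp, hq, hpq, h0⟩ := exists_combo_eq_zero (g := gate 𝔇 B) (A := Yc 𝔇 z C)
    (by rw [eB]; nlinarith [mul_nonneg hT0 aB.le]) pB
  have hWB := Bx.onEdge_of_between Bx' h0
    (by
      rw [ev_combo _ _ _ hpq]
      nlinarith [mul_nonneg hp (neg_nonneg.2 (l5.ev_Yc_nonpos vC Cz)),
        mul_nonneg hq (neg_nonneg.2 (l1.le.ev_Yc_nonpos vC Cw))])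
    (by
      rw [ev_combo _ _ _ hpq]
      exact add_nonneg (mul_nonneg hp (l6.ev_Yc_nonneg vC Cz))
        (mul_nonneg hq (l2.le.ev_Yc_nonneg vC Cw)))
  have := hpl.edge_eq vB vC hWB (Cz.onEdge.combo Cw.onEdge hp hq hpq) nB gw
  exact Subtype.ext (z2.symm.trans (this.trans w2))

/-! ### Planar chords that pass on both sides of a vertex -/

lemma exists_orientation {t : Finset V} (ht : t ∈ P.faces) {a b : V} (ha : a ∈ t) (hb : b ∈ t)
    (hab : a ≠ b) : ∃ ε, VInv 𝔇 ⟨t, a, b, ε⟩ := by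
  obtain ⟨c, c1, c2, c3⟩ := exists_apex ht ha hb hab
  have hc : c ∈ t := by rw [c3]; simp
  have hn := 𝔇.nondeg ht ha hb hc hab c2.symm c1.symm
  have huniq : ∀ d ∈ t, d ≠ a → d ≠ b → d = c := fun d hd d1 d2 => by
    rw [c3] at hd
    simp only [Finset.mem_insert, Finset.mem_singleton] at hd
    tauto
  rcases lt_or_gt_of_ne hn with h | h
  · refine ⟨true, ht, ha, hb, hab, fun d hd d1 d2 => ?_⟩
    rw [huniq d hd d1 d2]
    simpa [sg] using h
  · refine ⟨false, ht, ha, hb, hab, fun d hd d1 d2 => ?_⟩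
    rw [huniq d hd d1 d2]
    simpa [sg] using h

lemma ev_add_const (φ : Fn) (η : ℝ) (z : Pt) : ev (φ + (0, 0, η)) z = ev φ z + η := by
  rw [ev_add]; simp [ev]

/-- If a chord that passes close to the apex `v` of its last triangle starts at an edge which sees
`v` from the front, then it does not pass on the side of the boundary edge at `v`. -/
lemma Dev.Planar.exists_pos_not_gate (hpl : 𝔇.Planar) {s : CState V} {v : V} {φ : Fn}
    (hs : VInv 𝔇 s) (hv : v ∈ s.face) (hl : v ≠ s.l) (hr : v ≠ s.r)
    (h0 : ev φ (𝔇.D s.face v) = 0) {w : V} (hwv : w ≠ v) (hb : P.IsBoundaryEdge {v, w})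
    (hw : ev φ (𝔇.D s.face w) ≠ 0) :
    ∃ η₀ : ℝ, 0 < η₀ ∧ ∀ θ, |θ| < η₀ → θ * ev φ (𝔇.D s.face w) < 0 → ∀ c m,
      SChain 𝔇 (φ + (0, 0, θ)) c (m + 1) → c (m + 1) = s →
      ¬ 0 < ev (gate 𝔇 (c 0)) (𝔇.D s.face v) := by
  obtain ⟨t, ⟨ht, hsub⟩, -⟩ := hb.2
  obtain ⟨ε, hvi⟩ := exists_orientation (𝔇 := 𝔇) ht (hsub (by simp : v ∈ _))
    (hsub (by simp : w ∈ _)) hwv.symm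
  set A := 𝔇.D s.face v
  set B := 𝔇.D s.face w
  set k := ev φ B
  have hg : ∀ u : CState V, 0 < ev (gate 𝔇 u) A →
      ∀ᶠ τ in 𝓝[>] (0 : ℝ), 0 < ev (gate 𝔇 u) ((1 - τ) • A + τ • B) := fun u hu => by
    filter_upwards [eventually_add_pos (x := ev (gate 𝔇 u) B - ev (gate 𝔇 u) A) hu] with τ hτ
    rw [ev_combo _ _ _ (by ring)]; linarith
  have hall : ∀ᶠ τ in 𝓝[>] (0 : ℝ), ∀ u : CState V, 0 < ev (gate 𝔇 u) A →
      0 < ev (gate 𝔇 u) ((1 - τ) • A + τ • B) :=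
    Filter.eventually_all.2 fun u => Filter.eventually_imp_distrib_left.2 (hg u)
  obtain ⟨δ, hδ, hδ'⟩ := (mem_nhdsGT_iff_exists_Ioo_subset).1 hall
  have hδ : 0 < δ := hδ
  have hk := abs_pos.2 hw
  refine ⟨min δ 1 * |k|, mul_pos (lt_min hδ one_pos) hk, fun θ t1 t2 c m hc hcs hpos => ?_⟩
  have hτ : -θ / k = |θ| / |k| := by
    rw [← abs_div, abs_of_neg, neg_div]
    rw [show θ / k = θ * k / k ^ 2 by field_simp]
    exact div_neg_of_neg_of_pos t2 (by positivity)
  have hθ : θ ≠ 0 := by rintro rfl; simp at t2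
  have τ0 : 0 < -θ / k := by rw [hτ]; exact div_pos (abs_pos.2 hθ) hk
  have τ1 : -θ / k < min δ 1 := by rw [hτ, div_lt_iff₀ hk]; exact t1
  have hh := hδ' ⟨τ0, τ1.trans_le (min_le_left _ _)⟩
  have τ2 := τ1.trans_le (min_le_right _ _)
  refine hpl.not_good hvi hb (z := (1 - -θ / k) • A + (-θ / k) • B) ?_ (hc.good ?_ (hh _ hpos) ?_)
  · refine ⟨1 - -θ / k, -θ / k, by linarith, τ0, by ring, ?_⟩
    rw [hpl.const t s.face, hpl.const t s.face]
  · rw [ev_add_const, ev_combo _ _ _ (by ring), h0]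
    change (1 - -θ / k) * 0 + -θ / k * k + θ = 0
    rw [div_mul_cancel₀ _ hw]; ring
  · rw [hcs]
    exact hh _ (hs.gate_pos hv hl hr)

/-- One of the two chords passes `v` on the side of a boundary edge `{v, w}` and would cross this
edge close to `v`, unless `v` is not in front of the starting edge. With a common starting edge,
that edge would then have to cut into the triangle of `s`. -/
theorem Dev.Planar.noFold (hpl : 𝔇.Planar) : NoFold 𝔇 := by
  intro s v φ hs hv hl hr hS h0 huniq
  obtain ⟨w, hwv, hb⟩ := exists_boundaryEdge_at P v
  obtain ⟨t, ⟨ht, hsub⟩, -⟩ := hb.2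
  have hw : ev φ (𝔇.D s.face w) ≠ 0 := fun h => by
    rw [hpl.const s.face t] at h
    have := huniq t ht w (hsub (by simp)) h
    rw [hpl.const s.face t] at this
    exact 𝔇.D_ne ht (hsub (by simp)) (hsub (by simp)) hwv this
  obtain ⟨η₀, e0, e1⟩ := hpl.exists_pos_not_gate hs hv hl hr h0 hwv hb hw
  refine ⟨η₀, e0, fun η η' p1 p2 p3 p4 c m c' m' h c1 _ _ h' c1' _ _ he => ?_⟩
  have hε : (c 1).ε = (c' 1).ε := by
    rw [← h.orient m le_rfl, ← h'.orient m' le_rfl, c1, c1']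
  have es := h.start_eq h' he hε
  -- The shifts `η` and `η'` have opposite signs, so one of them moves the line to the side of `w`.
  have hneg : ¬ 0 < ev (gate 𝔇 (c 0)) (𝔇.D s.face v) := by
    rcases lt_or_gt_of_ne hw with hlt | hlt
    · exact e1 η (by rw [abs_of_pos p1]; exact p2) (mul_neg_of_pos_of_neg p1 hlt) c m h c1
    · rw [es]
      exact e1 η' (by rw [abs_of_neg p4]; linarith) (mul_neg_of_neg_of_pos p4 hlt) c' m' h' c1'
  have v0 := h.chain.inv 0 (by omega)
  have s0 := h.sep 0 (by omega)
  have s0' := h'.sep 0 (by omega)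
  have s1 := h.sep _ le_rfl
  have s1' := h'.sep _ le_rfl
  have g1 := h.gate_ends.2
  have g1' := h'.gate_ends.2
  rw [← es] at s0' g1'
  rw [c1] at s1 g1
  rw [c1'] at s1' g1'
  have hS0 : Sep 𝔇 φ (c 0) := by
    obtain ⟨-, q1⟩ := s0
    obtain ⟨q2, -⟩ := s0'
    rw [ev_add_const] at q1 q2
    exact ⟨by linarith, by linarith⟩
  have hK : 0 < ev (gate 𝔇 (c 0)) (Yc 𝔇 φ s) :=
    s1'.pos_of_between hs hS s1 (fun t _ u _ => by rw [ev_add_const]; linarith)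
      (fun t _ u _ => by rw [ev_add_const]; linarith) g1' g1
  -- `v` is not in front of the starting edge, but the point where `φ` leaves the triangle is.
  -- Between them the line `φ` meets the line of the starting edge, in fact the open edge by `hS0`.
  obtain ⟨a, b, ha, hb', hab, hW⟩ := exists_combo_eq_zero (not_lt.1 hneg) hK.le
  have hapos : 0 < a := by
    refine lt_of_le_of_ne ha fun h => ?_
    obtain rfl : b = 1 := by linarith
    rw [ev_combo _ _ _ hab, ← h] at hW
    linarith
  have hφW : ev φ (a • 𝔇.D s.face v + b • Yc 𝔇 φ s) = 0 := by
    rw [ev_combo _ _ _ hab, h0, hS.ev_Yc]; ring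
  have hedge := hS0.onEdge_of_between hS0 hW hφW.le hφW.ge
  have hface : s.face = {s.l, s.r, v} := by
    obtain ⟨d, d1, d2, d3⟩ := hs.exists_apex
    have hv' := hv
    rw [d3] at hv'
    simp only [Finset.mem_insert, Finset.mem_singleton] at hv'
    obtain rfl : v = d := by tauto
    exact d3
  have hin : ∀ α β : ℝ, 0 < α → 0 < β → α + β = 1 →
      InT (𝔇.D s.face) s.face (α • 𝔇.D s.face v + β • Yc 𝔇 φ s) := fun α β hα hβ hαβ => by
    have := InT.of_bary (𝔇.nondeg hs.face_mem hs.l_mem hs.r_mem hv hs.ne hr.symm hl.symm)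
      (α := β * (1 - wr 𝔇 φ s)) (β := β * wr 𝔇 φ s) (mul_pos hβ (by linarith [hS.wr_lt]))
      (mul_pos hβ hS.wr_pos) hα (by linear_combination hαβ)
    rw [← hface] at this
    rw [hS.Yc_eq]
    convert this using 1
    module
  -- If the meeting point is `v`, the starting edge belongs to the same triangle and would contain
  -- its vertex `v` as an inner point. Otherwise the meeting point is inside the open triangle
  -- although it is on a boundary edge.
  rcases hb'.eq_or_lt with hb0 | hb0
  · obtain rfl : a = 1 := by linarith
    rw [← hb0, one_smul, zero_smul, add_zero] at hedge
    obtain ⟨β, b1, b2, b3⟩ := ((hedge.eventually v0 hK).and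
      (Ioo_mem_nhdsGT (zero_lt_one' ℝ))).exists
    have ef := hpl.disjoint _ v0.face_mem _ hs.face_mem _ b1 (hin _ _ (by linarith) b2 (by ring))
    have g0 := hedge.gate_eq
    rw [← ef] at g0 hv h0
    have n1 : v ≠ (c 0).l := fun h => by rw [h] at h0; exact hS0.1.ne' h0
    have n2 : v ≠ (c 0).r := fun h => by rw [h] at h0; exact hS0.2.ne h0
    exact (v0.gate_pos hv n1 n2).ne' g0
  · exact hpl.not_good v0 h.bd hedge (Or.inl ⟨_, hs.face_mem, hin a b hapos hb0 hab⟩)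

end Billiard

theorem mainTheorem7 {V : Type*} [Fintype V] [DecidableEq V]
    (P : Billiard.GeneralizedPolygon V) (hP : P.IsPlanar ∨ P.IsSimplyConnected)
    (E : ℕ → P.BoundaryEdge) (hE : E ∈ closure P.forwardBounceSpectrum) :
    (P.HasUniquePrefixes E → E ∈ P.forwardBounceSpectrum) ∧
    ((¬ ∃ k : ℕ, 0 < k ∧ Function.Periodic E k) →
      (E ∈ P.forwardBounceSpectrum ↔ P.HasUniquePrefixes E)) := by
  obtain ⟨𝔇, hNF, hS⟩ : ∃ 𝔇 : Billiard.Dev P, Billiard.NoFold 𝔇 ∧ Billiard.Stag 𝔇 := by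
    rcases hP with hP | hP
    · obtain ⟨𝔇, hpl⟩ := Billiard.exists_dev_of_isPlanar hP
      exact ⟨𝔇, hpl.noFold, hpl.stag⟩
    · obtain ⟨𝔇⟩ := Billiard.exists_dev_of_isSimplyConnected hP
      exact ⟨𝔇, Billiard.noFold_of_isSimplyConnected hP, Billiard.stag_of_isSimplyConnected hP⟩
  exact ⟨Billiard.realizable_of_unique hNF hE, fun hap =>
    ⟨fun h => Billiard.hasUniquePrefixes hS h hap, Billiard.realizable_of_unique hNF hE⟩⟩
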